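/- **Setting.** Let $u^i$ ($i=1,2,3$) be even and $\theta_{ia}$ ($i=1,2,3$, $a=1,2$) odd coordinates, $\partial_i=\partial/\partial u^i$, $d^{ia}=\partial/\partial\theta_{ia}$, $D^{ia}=d^{ia}+\epsilon^{ijk}\theta^a_j\partial_k$, where $\theta^a_j=\epsilon^{ab}\theta_{jb}$, $\epsilon^{12}=\epsilon_{21}=1$, and $sl(2)$ indices are raised and lowered with $\epsilon$. A homogeneous polynomial vector field $X=Q^i\partial_i+P_{ia}d^{ia}=\widetilde Q^i\partial_i+P_{ia}D^{ia}$ belongs to $\mathfrak{vle}(3|6)$ iff $[X,D^{ia}]=-(-)^X(D^{ia}P_{jb})D^{jb}$; $\mathfrak g_0=sl(3)\oplus sl(2)\oplus gl(1)$ is its part of degree $0$ for $\deg\theta=1$, $\deg u=2$. For $p,q,r\in\mathbb N$, $z\in\mathbb Z$ the tensor module $T(p,q;r;z)$ consists of components $\omega^{j_1..j_q}_{i_1..i_p|a_1..a_r}(\theta,u)$, polynomial in $(\theta,u)$, symmetric in each group of indices and traceless, with the Lie derivative $L_X$ obtained from the rules $L_X\alpha^i=\partial_j\widetilde Q^i\alpha^j$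 for $\alpha^i\in T(1,0;0;2)$, $L_X\gamma^{ia}=-(-)^X D^{ia}P_{jb}\gamma^{jb}$ for $\gamma^{ia}\in T(1,0;1;-1)$, and $L_Xv=\partial_i\widetilde Q^i v$ for $v\in T(0,0;0;6)$. For $p,q,r\ge0$ put $$\Omega_A(p,r)=T(p,0;r;2p-3r),\quad \Omega_B(p,r)=T(p,0;r;2p+3r+6),$$ $$\Omega_C(q,r)=T(0,q;r;-2q-3r-6),\quad \Omega_D(q,r)=T(0,q;r;-2q+3r).$$ An operator of order $k$ is one given by a constant-coefficient matrix of homogeneous polynomials of degree $k$ in the $D^{ia}$; it is invariant under $X$ if it maps the source module to the target module and $L_X\nabla=(-)^{kX}\nabla L_X$ there. **Statement.** 1. $L_X$ ($X\in\mathfrak{vle}(3|6)$) preserves every $T(p,q;r;z)$. All modules $\Omega_A(p,r)$, $\Omega_B(p,r)$, $\Omega_C(q,r)$, $\Omega_D(q,r)$ are reducible: each contains a proper nonzero parity-graded subspace invariant under $\mathfrak{vle}(3|6)$. 2. The following operators $\nabla_1$ of order $1$ are nonzero and $\mathfrak{vle}(3|6)$-invariant ($\mathbf S$ denotes the sum over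 the choices of the indices $j$, $b$ among the symmetrised free indices of the result): - $\Omega_A(p,r)\to\Omega_A(p-1,r-1)$, $\ D^{jb}\omega_{i_1..i_{p-1}j|a_1..a_{r-1}b}$, for $p,r\neq0$; - $\Omega_B(p,r)\to\Omega_B(p-1,r+1)$, $\ \mathbf S(D^{jb}\omega_{i_1..i_{p-1}j}^{a_1..a_r})$, for $p\ne0$; - $\Omega_C(q,r)\to\Omega_C(q+1,r-1)$, $\ \mathbf S(D^{jb}\omega^{i_1..i_q}_{a_1..a_{r-1}b})$, for $r\ne0$; - $\Omega_D(q,r)\to\Omega_D(q+1,r+1)$, $\ \mathbf S(D^{jb}\omega^{i_1..i_q|a_1..a_r})$. Moreover the $gl(1)$ weights are forced: if the same formula is $\mathfrak{vle}(3|6)$-invariant when the weights $z$ of the source and $z'$ of the target are changed to other integers, then $z$ and $z'$ are the weights listed above. 3. The following operators of order $2,3,4,6$ are nonzero and $\mathfrak g_0$-invariant: - $\nabla_2$: $\epsilon_{ab}D^{ia}D^{jb}\omega_{i_1..i_{p-2}ij}$, $\ \Omega_A(p,0)\to\Omega_B(p-2,0)$ ($p\ge2$); $\ \mathbf S(\epsilon_{ab}D^{ia}D^{jb}\omega^{i_1..i_q})$,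 $\ \Omega_C(q,0)\to\Omega_D(q+2,0)$; - $\nabla_3$: $\epsilon_{ijk}D^{ia}D^{jb}D^{kc}\omega_{a_1..a_{r-3}abc}$, $\ \Omega_A(0,r)\to\Omega_C(0,r-3)$ ($r\ge3$); $\ \mathbf S(\epsilon_{ijk}D^{ia}D^{jb}D^{kc}\omega^{a_1..a_r})$, $\ \Omega_B(0,r)\to\Omega_D(0,r+3)$; - $\nabla_4$: $\epsilon_{ijk}\epsilon_{cd}D^{ia}D^{jb}D^{kc}D^{ld}\omega_{ab}$, $\ \Omega_A(0,2)\to\Omega_D(1,0)$; $\ \mathbf S(\epsilon_{ijk}\epsilon_{cd}D^{ia}D^{jb}D^{kc}D^{ld}\omega_l)$ (symmetrised in $a,b$), $\ \Omega_A(1,0)\to\Omega_D(0,2)$; - $\nabla_6$: $(K^{ad}+K^{da})\omega_a$ with $K^{ad}=\epsilon_{ijk}\epsilon_{lmn}\epsilon_{be}\epsilon_{cf}D^{ia}D^{jb}D^{kc}D^{ld}D^{me}D^{nf}$, $\ \Omega_A(0,1)\to\Omega_D(0,1)$. 4. These arrows form complexes. Any two consecutive operators among $\nabla_1,\nabla_2,\nabla_3$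 above have composite zero: $\nabla_1\nabla_1=0$ in each sector, $\nabla_2\nabla_1=0$, $\nabla_1\nabla_2=0$, $\nabla_3\nabla_1=0$, $\nabla_1\nabla_3=0$, and also $\nabla_3\nabla_2=0$ on $\Omega_A(2,0)\to\Omega_B(0,0)\to\Omega_D(0,3)$ and $\nabla_2\nabla_3=0$ on $\Omega_A(0,3)\to\Omega_C(0,0)\to\Omega_D(2,0)$. There are nonzero $\mathfrak g_0$-invariant operators $\Omega_A(0,2)\to\Omega_D(1,0)$ and $\Omega_A(1,0)\to\Omega_D(0,2)$ of order $4$ and $\Omega_A(0,1)\to\Omega_D(0,1)$ of order $6$ whose composites with the preceding and the following $\nabla_1$ vanish. 5. $\Omega_A(0,0)=\Omega_D(0,0)=T(0,0;0;0)$. On smooth superfunctions $\omega(\theta,u)$, $u\in\mathbb R^3$, with compact support, the Berezin integral $\omega\mapsto\int d^3u\,d^6\theta\,\omega(\theta,u)$, regarded as a map $\Omega_A(0,0)\to\Omega_D(0,0)$ to constant superfunctions, is nonzero, is $\mathfrak{vle}(3|6)$-invariant, is not a local operator (it enlarges supports), vanishes on $D^{ia}\omega_{ia}$ for all compactly supported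 $\omega_{ia}$, and its values are annihilated by all $D^{ia}$. -/

import Mathlib

open scoped TensorProduct

noncomputable section

namespace VLE36

/-! ### Superfunctions on the superspace with three even coordinates `u^i` and
six odd coordinates `θ_{ia}` -/

/-- The Grassmann algebra on the odd coordinates `θ_{ia}`, `i = 1,2,3`, `a = 1,2`. -/
abbrev Grass := ExteriorAlgebra ℂ (Fin 3 × Fin 2 → ℂ)

/-- Polynomials in the even coordinates `u^1, u^2, u^3`. -/
abbrev Poly := MvPolynomial (Fin 3) ℂ

/-- Superfunctions whose coefficients lie in a commutative algebra `C` of functions of `u`. -/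
abbrev SF (C : Type) [CommRing C] [Algebra ℂ C] := C ⊗[ℂ] Grass

/-- The totally antisymmetric symbol `ε^{ijk} = ε_{ijk}`, with `ε^{123} = 1`. -/
def eps3 (i j k : Fin 3) : ℂ :=
  ((j : ℂ) - (i : ℂ)) * ((k : ℂ) - (i : ℂ)) * ((k : ℂ) - (j : ℂ)) / 2

/-- `ε^{ab}`, with `ε^{12} = 1`. -/
def epsUp (a b : Fin 2) : ℂ := (b : ℂ) - (a : ℂ)

/-- The inverse symbol `ε_{ab}`, with `ε_{21} = 1`. -/
def epsLow (a b : Fin 2) : ℂ := (a : ℂ) - (b : ℂ)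

section generic

variable {C : Type} [CommRing C] [Algebra ℂ C]

/-- The odd coordinate `θ_{ia}`. -/
def theta (i : Fin 3) (a : Fin 2) : SF C :=
  (1 : C) ⊗ₜ[ℂ] ExteriorAlgebra.ι ℂ (Pi.single (i, a) 1)

/-- `θ^a_j = ε^{ab} θ_{jb}`. -/
def thetaUp (j : Fin 3) (a : Fin 2) : SF C := ∑ b, epsUp a b • theta j b

/-- The left derivative `d^{ia} = ∂/∂θ_{ia}`. -/
def dTheta (i : Fin 3) (a : Fin 2) : SF C →ₗ[ℂ] SF C :=
  LinearMap.lTensor C (CliffordAlgebra.contractLeft (LinearMap.proj (i, a)))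

/-- Multiplication by `+1` on even superfunctions and by `-1` on odd ones. -/
def parity : SF C →ₗ[ℂ] SF C :=
  LinearMap.lTensor C (CliffordAlgebra.involute (Q := (0 : QuadraticForm ℂ _))).toLinearMap

/-- The extension to superfunctions of a linear operator on the coefficients. -/
def onCoeff (δ : C →ₗ[ℂ] C) : SF C →ₗ[ℂ] SF C := LinearMap.rTensor Grass δ

/-- `D^{ia} = d^{ia} + ε^{ijk} θ^a_j ∂_k`, for given partial derivatives `∂_k` of coefficients. -/
def covD (pd : Fin 3 → C →ₗ[ℂ] C) (i : Fin 3) (a : Fin 2) : SF C →ₗ[ℂ] SF C :=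
  dTheta i a +
    ∑ j, ∑ k, eps3 i j k • (LinearMap.mulLeft ℂ (thetaUp j a) ∘ₗ onCoeff (pd k))

end generic

/-! ### Polynomial superfunctions and vector fields -/

/-- Polynomial superfunctions `f(θ,u)`. -/
abbrev PSF := SF Poly

/-- The even coordinate `u^i`. -/
def u (i : Fin 3) : PSF := (MvPolynomial.X i) ⊗ₜ[ℂ] 1

/-- `∂_i = ∂/∂u^i` on polynomials. -/
def polyPd (i : Fin 3) : Poly →ₗ[ℂ] Poly := (MvPolynomial.pderiv i).toLinearMap

/-- `∂_i = ∂/∂u^i` on superfunctions. -/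
def dU (i : Fin 3) : PSF →ₗ[ℂ] PSF := onCoeff (polyPd i)

/-- The fermionic derivative `D^{ia}` on polynomial superfunctions. -/
def D (i : Fin 3) (a : Fin 2) : PSF →ₗ[ℂ] PSF := covD polyPd i a

/-- `D^i_a = ε_{ab} D^{ib}`. -/
def Dlow (i : Fin 3) (a : Fin 2) : PSF →ₗ[ℂ] PSF := ∑ b, epsLow a b • D i b

/-- The polynomial vector field `Q^i ∂_i + P_{ia} d^{ia}`. -/
structure VField where
  Q : Fin 3 → PSF
  P : Fin 3 → Fin 2 → PSF

namespace VField

/-- The action of a vector field on superfunctions. -/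
def act (X : VField) : PSF →ₗ[ℂ] PSF :=
  ∑ i, LinearMap.mulLeft ℂ (X.Q i) ∘ₗ dU i +
    ∑ i, ∑ a, LinearMap.mulLeft ℂ (X.P i a) ∘ₗ dTheta i a

/-- The coefficients `Q̃^i` in `X = Q̃^i ∂_i + P_{ia} D^{ia}`. -/
def Qt (X : VField) (i : Fin 3) : PSF :=
  X.Q i - ∑ j, ∑ k, ∑ a, eps3 j k i • (X.P j a * thetaUp k a)

/-- `X` is homogeneous of parity sign `σ = (-)^X`: the `Q^i` have the parity of `X`, the
`P_{ia}` the opposite one. -/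
def IsHomog (σ : ℤˣ) (X : VField) : Prop :=
  (∀ i, parity (X.Q i) = (σ : ℤ) • X.Q i) ∧ ∀ i a, parity (X.P i a) = -((σ : ℤ) • X.P i a)

/-- The homogeneous elements of `vle(3|6)`: the vector fields that preserve the dual Pfaff
equation `D^{ia} = 0`, i.e. `[X, D^{ia}] = -(-)^X (D^{ia} P_{jb}) D^{jb}`. -/
def IsVLE (σ : ℤˣ) (X : VField) : Prop :=
  X.IsHomog σ ∧ ∀ i a f,
    X.act (D i a f) - (σ : ℤ) • D i a (X.act f) =
      -((σ : ℤ) • ∑ j, ∑ b, D i a (X.P j b) * D j b f)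

/-- The grading operator `2 u^i ∂_i + θ_{ia} d^{ia}`. -/
def euler : VField where
  Q i := (2 : ℂ) • u i
  P i a := theta i a

/-- The homogeneous elements of the degree zero subalgebra
`𝔤₀ = sl(3) ⊕ sl(2) ⊕ gl(1)` of `vle(3|6)`. -/
def IsG0 (σ : ℤˣ) (X : VField) : Prop :=
  X.IsVLE σ ∧ ∀ f, euler.act (X.act f) = X.act (euler.act f)

/-- The `gl(1)` part `∂_i Q̃^i` of the derivative of `X`. -/
def dv (X : VField) : PSF := ∑ i, dU i (X.Qt i)

/-- The `sl(3)` part `∂_j Q̃^l - (1/3) δ_j^l ∂_i Q̃^i`. -/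
def sl3 (X : VField) (j l : Fin 3) : PSF :=
  dU j (X.Qt l) - if j = l then (1 / 3 : ℂ) • X.dv else 0

/-- The `sl(2)` part `-(1/3) ((-)^X D^{ic} P_{ib} - (1/2) δ^c_b ∂_i Q̃^i)`. -/
def sl2 (σ : ℤˣ) (X : VField) (b c : Fin 2) : PSF :=
  -((1 / 3 : ℂ) • ((σ : ℤ) • ∑ i, D i c (X.P i b) - if b = c then (1 / 2 : ℂ) • X.dv else 0))

end VField

/-! ### Tensor modules -/

/-- The label `(p,q;r;z)` of a tensor module. -/
structure Label where
  p : ℕ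
  q : ℕ
  r : ℕ
  z : ℤ

/-- Systems of components `ω_{i_1..i_p|a_1..a_r}^{j_1..j_q}(θ,u)`. -/
abbrev Comp (p q r : ℕ) := (Fin p → Fin 3) → (Fin q → Fin 3) → (Fin r → Fin 2) → PSF

/-- The underlying space of the tensor module `T(p,q;r;z)`: components
`ω_{i_1..i_p|a_1..a_r}^{j_1..j_q}` that are symmetric in each group of indices, and traceless.
The `sl(2)` indices are always lowered, by means of `ε_{ab}`. -/
def T (τ : Label) : Submodule ℂ (Comp τ.p τ.q τ.r) where
  carrier := {ω |
    (∀ (π : Equiv.Perm (Fin τ.p)) I J B, ω (I ∘ π) J B = ω I J B) ∧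
    (∀ (π : Equiv.Perm (Fin τ.q)) I J B, ω I (J ∘ π) B = ω I J B) ∧
    (∀ (π : Equiv.Perm (Fin τ.r)) I J B, ω I J (B ∘ π) = ω I J B) ∧
    ∀ (k : Fin τ.p) (k' : Fin τ.q) I J B,
      ∑ l, ω (Function.update I k l) (Function.update J k' l) B = 0}
  zero_mem' := by simp
  add_mem' := by
    rintro x y ⟨h1, h2, h3, h4⟩ ⟨g1, g2, g3, g4⟩
    refine ⟨?_, ?_, ?_, ?_⟩ <;> intros <;>
      simp [h1, h2, h3, h4, g1, g2, g3, g4, Finset.sum_add_distrib]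
  smul_mem' := by
    rintro c x ⟨h1, h2, h3, h4⟩
    refine ⟨?_, ?_, ?_, ?_⟩ <;> intros <;>
      simp [h1, h2, h3, h4, ← Finset.smul_sum]

/-- The Lie derivative `L_X` along a homogeneous `X ∈ vle(3|6)` in the tensor module with label
`τ = (p,q;r;z)`, in components. The normalisation is fixed by
`L_X α^i = ∂_j Q̃^i α^j`, `L_X γ^{ia} = -(-)^X D^{ia} P_{jb} γ^{jb}` and
`L_X v = ∂_i Q̃^i v`, for `α^i ∈ T(1,0;0;2)`, `γ^{ia} ∈ T(1,0;1;-1)`, `v ∈ T(0,0;0;6)`. -/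
def lie (τ : Label) (σ : ℤˣ) (X : VField) (ω : Comp τ.p τ.q τ.r) : Comp τ.p τ.q τ.r :=
  fun I J B =>
    X.act (ω I J B)
      + ∑ k, ∑ l, X.sl3 (I k) l * ω (Function.update I k l) J B
      - ∑ k, ∑ l, X.sl3 l (J k) * ω I (Function.update J k l) B
      + ∑ k, ∑ c, X.sl2 σ (B k) c * ω I J (Function.update B k c)
      + ((τ.z : ℂ) / 6) • (X.dv * ω I J B)

/-- `T(p,q;r;z)` is reducible: it has a proper nonzero (parity-graded) invariant subspace. -/
def IsReducible (τ : Label) : Prop :=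
  ∃ W : Submodule ℂ (Comp τ.p τ.q τ.r), W < T τ ∧ W ≠ ⊥ ∧
    (∀ ω ∈ W, (fun I J B => parity (ω I J B)) ∈ W) ∧
    ∀ σ X, VField.IsVLE σ X → ∀ ω ∈ W, lie τ σ X ω ∈ W

/-- The sector `Ω_A(p,r) = T(p,0;r;2p-3r)`. -/
abbrev OmegaA (p r : ℕ) : Label := ⟨p, 0, r, 2 * p - 3 * r⟩

/-- The sector `Ω_B(p,r) = T(p,0;r;2p+3r+6)`. -/
abbrev OmegaB (p r : ℕ) : Label := ⟨p, 0, r, 2 * p + 3 * r + 6⟩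

/-- The sector `Ω_C(q,r) = T(0,q;r;-2q-3r-6)`. -/
abbrev OmegaC (q r : ℕ) : Label := ⟨0, q, r, -2 * q - 3 * r - 6⟩

/-- The sector `Ω_D(q,r) = T(0,q;r;-2q+3r)`. -/
abbrev OmegaD (q r : ℕ) : Label := ⟨0, q, r, -2 * q + 3 * r⟩

/-! ### Morphisms -/

/-- The product `D^{i_1 a_1} ⋯ D^{i_k a_k}`. -/
def dWord {k : ℕ} (w : Fin k → Fin 3 × Fin 2) (f : PSF) : PSF :=
  (List.ofFn w).foldr (fun x g => D x.1 x.2 g) f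

/-- `f` is a differential operator with constant coefficients, homogeneous of order `k` in the
fermionic derivatives `D^{ia}`. -/
def IsDOperator {p q r p' q' r' : ℕ} (k : ℕ) (f : Comp p q r → Comp p' q' r') : Prop :=
  ∃ c : (Fin p' → Fin 3) → (Fin q' → Fin 3) → (Fin r' → Fin 2) →
      (Fin p → Fin 3) → (Fin q → Fin 3) → (Fin r → Fin 2) → (Fin k → Fin 3 × Fin 2) → ℂ,
    ∀ ω I' J' B', f ω I' J' B' =
      ∑ I, ∑ J, ∑ B, ∑ w, c I' J' B' I J B w • dWord w (ω I J B)

/-- `f` is a nonzero operator `T(τ) → T(τ')`, of order `k` in the `D^{ia}` (hence of the parity of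
`k`), that is invariant under the homogeneous vector fields singled out by `V`:
`L_X f = (-)^{kX} f L_X`. -/
structure IsMorphism (V : ℤˣ → VField → Prop) (k : ℕ) (τ τ' : Label)
    (f : Comp τ.p τ.q τ.r → Comp τ'.p τ'.q τ'.r) : Prop where
  dOperator : IsDOperator k f
  mapsTo : ∀ ω ∈ T τ, f ω ∈ T τ'
  ne_zero : ∃ ω ∈ T τ, f ω ≠ 0
  invariant : ∀ σ X, V σ X → ∀ ω ∈ T τ,
    lie τ' σ X (f ω) = ((σ ^ k : ℤˣ) : ℤ) • f (lie τ σ X ω)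

/-- The composite `T(τ) → T(τ') → T(τ'')` of `f` and `g` vanishes. -/
def IsComplex (τ τ' τ'' : Label) (f : Comp τ.p τ.q τ.r → Comp τ'.p τ'.q τ'.r)
    (g : Comp τ'.p τ'.q τ'.r → Comp τ''.p τ''.q τ''.r) : Prop :=
  ∀ ω ∈ T τ, g (f ω) = 0

open Fin (snoc removeNth)

/-- `∇_1` in sector A: `D^{jb} ω_{i_1..i_p j|a_1..a_r b}`. -/
def nabla1A {p r : ℕ} (ω : Comp (p + 1) 0 (r + 1)) : Comp p 0 r := fun I J B =>
  ∑ j, ∑ b, D j b (ω (snoc I j) J (snoc B b))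

/-- `∇_1` in sector B: `D^{jb} ω_{i_1..i_p j}^{a_1..a_r}`, symmetrised over the `sl(2)` indices. -/
def nabla1B {p r : ℕ} (ω : Comp (p + 1) 0 r) : Comp p 0 (r + 1) := fun I J B =>
  ∑ m, ∑ j, Dlow j (B m) (ω (snoc I j) J (removeNth m B))

/-- `∇_1` in sector C: `D^{jb} ω^{i_1..i_q}_{a_1..a_r b}`, symmetrised over the `sl(3)` indices. -/
def nabla1C {q r : ℕ} (ω : Comp 0 q (r + 1)) : Comp 0 (q + 1) r := fun I J B =>
  ∑ k, ∑ b, D (J k) b (ω I (removeNth k J) (snoc B b))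

/-- `∇_1` in sector D: `D^{jb} ω^{i_1..i_q|a_1..a_r}`, symmetrised over both kinds of indices. -/
def nabla1D {q r : ℕ} (ω : Comp 0 q r) : Comp 0 (q + 1) (r + 1) := fun I J B =>
  ∑ k, ∑ m, Dlow (J k) (B m) (ω I (removeNth k J) (removeNth m B))

/-- `∇_2` on `Ω_A(p+2,0)`: `ε_{ab} D^{ia} D^{jb} ω_{i_1..i_p i j}`. -/
def nabla2A {p : ℕ} (ω : Comp (p + 2) 0 0) : Comp p 0 0 := fun I J B =>
  ∑ i, ∑ j, ∑ a, ∑ b, epsLow a b • D i a (D j b (ω (snoc (snoc I i : Fin (p + 1) → Fin 3) j) J B))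

/-- `∇_2` on `Ω_C(q,0)`: `ε_{ab} D^{ia} D^{jb} ω^{i_1..i_q}`, symmetrised. -/
def nabla2C {q : ℕ} (ω : Comp 0 q 0) : Comp 0 (q + 2) 0 := fun I J B =>
  ∑ k : Fin (q + 2), ∑ l : Fin (q + 1), ∑ a, ∑ b,
    epsLow a b • D (J k) a (D (removeNth k J l) b (ω I (removeNth l (removeNth k J)) B))

/-- `∇_3` on `Ω_A(0,r+3)`: `ε_{ijk} D^{ia} D^{jb} D^{kc} ω_{a_1..a_r a b c}`. -/
def nabla3A {r : ℕ} (ω : Comp 0 0 (r + 3)) : Comp 0 0 r := fun I J B =>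
  ∑ i, ∑ j, ∑ k, ∑ a, ∑ b, ∑ c, eps3 i j k • D i a (D j b (D k c
    (ω I J (snoc (snoc (snoc B a : Fin (r + 1) → Fin 2) b : Fin (r + 2) → Fin 2) c))))

/-- `∇_3` on `Ω_B(0,r)`: `ε_{ijk} D^{ia} D^{jb} D^{kc} ω^{a_1..a_r}`, symmetrised. -/
def nabla3B {r : ℕ} (ω : Comp 0 0 r) : Comp 0 0 (r + 3) := fun I J B =>
  ∑ l : Fin (r + 3), ∑ m : Fin (r + 2), ∑ n : Fin (r + 1), ∑ i, ∑ j, ∑ k,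
    eps3 i j k • Dlow i (B l) (Dlow j (removeNth l B m) (Dlow k (removeNth m (removeNth l B) n)
      (ω I J (removeNth n (removeNth m (removeNth l B))))))

/-- `∇_4` on `Ω_A(0,2)`: `ε_{ijk} ε_{cd} D^{ia} D^{jb} D^{kc} D^{ld} ω_{ab}`. -/
def nabla4A2 (ω : Comp 0 0 2) : Comp 0 1 0 := fun I J _ =>
  ∑ i, ∑ j, ∑ k, ∑ a, ∑ b, ∑ c, ∑ d, (eps3 i j k * epsLow c d) •
    D i a (D j b (D k c (D (J 0) d (ω I ![] ![a, b]))))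

/-- `∇_4` on `Ω_A(1,0)`: `ε_{ijk} ε_{cd} D^{ia} D^{jb} D^{kc} D^{ld} ω_l`, symmetrised in `a, b`. -/
def nabla4A1 (ω : Comp 1 0 0) : Comp 0 0 2 := fun _ J B =>
  ∑ m : Fin 2, ∑ i, ∑ j, ∑ k, ∑ l, ∑ c, ∑ d, (eps3 i j k * epsLow c d) •
    Dlow i (B m) (Dlow j (removeNth m B 0) (D k c (D l d (ω ![l] J ![]))))

/-- `∇_6` on `Ω_A(0,1)`: `(K^{ad} + K^{da}) ω_a`, where
`K^{ad} = ε_{ijk} ε_{lmn} ε_{be} ε_{cf} D^{ia} D^{jb} D^{kc} D^{ld} D^{me} D^{nf}`. -/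
def nabla6 (ω : Comp 0 0 1) : Comp 0 0 1 := fun I J B =>
  ∑ i, ∑ j, ∑ k, ∑ l, ∑ m, ∑ n, ∑ a, ∑ b, ∑ c, ∑ e, ∑ f,
    (eps3 i j k * eps3 l m n * epsLow b e * epsLow c f) •
      (D i a (D j b (D k c (Dlow l (B 0) (D m e (D n f (ω I J ![a])))))) +
        Dlow i (B 0) (D j b (D k c (D l a (D m e (D n f (ω I J ![a])))))))

/-! ### Smooth superfunctions and the Berezin integral -/

/-- Smooth complex functions of `u ∈ ℝ³`. -/
def Smooth : Subalgebra ℂ ((Fin 3 → ℝ) → ℂ) where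
  carrier := {f | ContDiff ℝ ((⊤ : ℕ∞) : WithTop ℕ∞) f}
  mul_mem' {f g} hf hg := by
    change ContDiff ℝ ((⊤ : ℕ∞) : WithTop ℕ∞) f at hf
    change ContDiff ℝ ((⊤ : ℕ∞) : WithTop ℕ∞) g at hg
    exact hf.mul hg
  add_mem' {f g} hf hg := by
    change ContDiff ℝ ((⊤ : ℕ∞) : WithTop ℕ∞) f at hf
    change ContDiff ℝ ((⊤ : ℕ∞) : WithTop ℕ∞) g at hg
    exact hf.add hg
  algebraMap_mem' c := by
    change ContDiff ℝ ((⊤ : ℕ∞) : WithTop ℕ∞) fun _ : Fin 3 → ℝ => c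
    exact contDiff_const

/-- `∂_i` on smooth functions. -/
def smoothPd (i : Fin 3) : Smooth →ₗ[ℂ] Smooth where
  toFun f := ⟨fun x => fderiv ℝ f.1 x (Pi.single i 1), by
    have h : ContDiff ℝ ((⊤ : ℕ∞) : WithTop ℕ∞) f.1 := f.2
    exact (h.fderiv_right (m := ((⊤ : ℕ∞) : WithTop ℕ∞)) (by simp)).clm_apply contDiff_const⟩
  map_add' f g := by
    have hf : Differentiable ℝ f.1 := (show ContDiff ℝ ((⊤ : ℕ∞) : WithTop ℕ∞) f.1 from f.2).differentiable (by simp)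
    have hg : Differentiable ℝ g.1 := (show ContDiff ℝ ((⊤ : ℕ∞) : WithTop ℕ∞) g.1 from g.2).differentiable (by simp)
    ext x
    change fderiv ℝ (f.1 + g.1) x _ = _
    rw [fderiv_add (hf x) (hg x)]
    rfl
  map_smul' c f := by
    have hf : Differentiable ℝ f.1 := (show ContDiff ℝ ((⊤ : ℕ∞) : WithTop ℕ∞) f.1 from f.2).differentiable (by simp)
    ext x
    change fderiv ℝ (c • f.1) x _ = _
    rw [fderiv_const_smul (hf x)]
    rfl

/-- Restriction of polynomials to `ℝ³`. -/
def polyToSmooth : Poly →ₐ[ℂ] Smooth :=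
  MvPolynomial.aeval fun i => ⟨fun x => (x i : ℂ),
    by
    change ContDiff ℝ ((⊤ : ℕ∞) : WithTop ℕ∞) fun x : Fin 3 → ℝ => (x i : ℂ)
    exact Complex.ofRealCLM.contDiff.comp (contDiff_apply ℝ ℝ i)⟩

/-- Smooth superfunctions. -/
abbrev SSF := SF Smooth

/-- Polynomial superfunctions as smooth superfunctions. -/
def toSSF : PSF →ₐ[ℂ] SSF := Algebra.TensorProduct.map polyToSmooth (AlgHom.id ℂ Grass)

/-- The action of a polynomial vector field on smooth superfunctions, i.e. the Lie derivative in
the smooth version of `T(0,0;0;0)`. -/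
def VField.actSmooth (X : VField) : SSF →ₗ[ℂ] SSF :=
  ∑ i, LinearMap.mulLeft ℂ (toSSF (X.Q i)) ∘ₗ onCoeff (smoothPd i) +
    ∑ i, ∑ a, LinearMap.mulLeft ℂ (toSSF (X.P i a)) ∘ₗ dTheta i a

/-- The coefficient function of a smooth superfunction selected by a functional on the
Grassmann algebra. -/
def coeff (φ : Grass →ₗ[ℂ] ℂ) : SSF →ₗ[ℂ] Smooth :=
  (TensorProduct.rid ℂ Smooth).toLinearMap ∘ₗ LinearMap.lTensor Smooth φ

/-- Smooth superfunctions all of whose coefficients have compact support. -/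
def CSF : Submodule ℂ SSF where
  carrier := {f | ∀ φ, HasCompactSupport (coeff φ f : (Fin 3 → ℝ) → ℂ)}
  zero_mem' φ := by
    rw [map_zero]
    exact HasCompactSupport.zero
  add_mem' hf hg φ := by
    rw [map_add]
    exact (hf φ).add (hg φ)
  smul_mem' c f hf φ := by
    rw [map_smul]
    exact (hf φ).smul_left (f := fun _ => c)

/-- `∂/∂θ_{ia}` on the Grassmann algebra. -/
def grassD (i : Fin 3) (a : Fin 2) : Grass →ₗ[ℂ] Grass :=
  CliffordAlgebra.contractLeft (LinearMap.proj (i, a))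

/-- The Berezin integral `∫ d^6θ` on the Grassmann algebra: all six derivatives `∂/∂θ_{ia}` are
applied, and the constant term is taken. -/
def berezinTheta : Grass →ₗ[ℂ] ℂ :=
  ExteriorAlgebra.algebraMapInv.toLinearMap ∘ₗ
    grassD 0 0 ∘ₗ grassD 0 1 ∘ₗ grassD 1 0 ∘ₗ grassD 1 1 ∘ₗ grassD 2 0 ∘ₗ grassD 2 1

/-- The integral `ω ↦ ∫ d^3u d^6θ ω(θ,u)`, as a map from compactly supported superfunctions to
constant superfunctions. -/
def berezin : CSF →ₗ[ℂ] SSF where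
  toFun ω := algebraMap ℂ SSF (∫ x : Fin 3 → ℝ, (coeff berezinTheta ω.1).1 x)
  map_add' f g := by
    have h (f : CSF) : MeasureTheory.Integrable (coeff berezinTheta f.1).1 :=
      (show ContDiff ℝ ((⊤ : ℕ∞) : WithTop ℕ∞) _ from (coeff berezinTheta f.1).2).continuous.integrable_of_hasCompactSupport
        (f.2 _)
    rw [← map_add, ← MeasureTheory.integral_add (h f) (h g)]
    simp
  map_smul' c f := by
    simp [MeasureTheory.integral_const_mul, Algebra.algebraMap_eq_smul_one, mul_smul]

/-- A smooth superfunction vanishes on a set of points `u`. -/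
def VanishesOn (U : Set (Fin 3 → ℝ)) (f : SSF) : Prop :=
  ∀ φ, ∀ x ∈ U, (coeff φ f).1 x = 0

/-- An operator is local if it does not enlarge supports, as every differential operator. -/
def IsLocal (F : CSF →ₗ[ℂ] SSF) : Prop :=
  ∀ (ω : CSF) (U : Set (Fin 3 → ℝ)), IsOpen U → VanishesOn U ω → VanishesOn U (F ω)

end VLE36

end

/-!
Every element `X` of `vle(3|6)` is governed by few structure functions. The bracket of `X` with
`D^{ia}`, evaluated on the coordinates `u^k`, expresses `D^{ia} Q̃^k` through the `P_{jb}` (`D_Qt`); the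
relation `{D^{ia}, D^{jb}} = 2 ε^{ijk} ε^{ab} ∂_k` (`covD_anticomm`) then forces the matrix
`(-)^X D^{lc} P_{jb}` into `sl(3) ⊕ sl(2) ⊕ gl(1)` (`D_P`, `act_D`). Applying the same relation once more
shows that the derivatives of the structure functions `sl3`, `sl2` and `dv` depend, after contraction
with symmetric tensors, on the single spinor `ρ^{ia} = ½ D^{ia} ∂_j Q̃^j` (`D_sl2`, `D_sl3`).

Invariance of `∇_1`. Commuting the Lie derivative with a first-order operator on tensors of weight `z`
leaves the defect `(z' - z - 1)/6 ∂_i Q̃^i ∇_1 ω - (-)^X (z - z₀)/3 ρ·ω`, where `ρ·ω` is formed as `∇_1 ω`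
with `ρ^{ia}` in the place of `D^{ia}`, and `z₀` is a number that depends on the index structure
(`lie_opA`, `lie_opB`, `lie_opC`, `lie_opD`). Hence `∇_1` is invariant if `z' = z + 1` and `z = z₀`.
Conversely the Euler field forces the first equation, and an odd field of degree one for which `ρ` does
not vanish (`exists_rho_eq_one`) the second.

Invariance of the higher operators. On `𝔤₀` the structure functions are of degree zero, hence constant,
and they vanish for odd fields (`exists_g0Data`). So `D^{ia}` is a tensor operator for the even part of
`𝔤₀`, and it anticommutes with the odd part, which acts trivially on indices (`invariant_of_even`). All
operators formed from the `D^{ia}` by contraction with invariant tensors are therefore invariant, with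
the weights fixed by the order. That they do not vanish is seen on explicit test functions.

Complexes. The anticommutator of the `D^{ia}` is antisymmetric in each kind of indices, so that
symmetrising a product `D D` in the `sl(3)` indices antisymmetrises it in the `sl(2)` indices and vice
versa (`D_D_symm`). A product of three operators symmetrised in `sl(3)` indices, or of four symmetrised
in `sl(2)` indices, vanishes by `antisymm_three` and `antisymm_four`. This settles the composites in
which each index that matters is symmetrised. In the remaining cases let `D_t^i = D^{i1} + t D^{i2}`.
For fixed `t` these three operators anticommute and have vanishing squares, so that
`N_t = D_t^1 D_t^2 D_t^3` satisfies `D_t^i N_t = N_t D_t^i = 0` (`D_N`, `N_D`). The four coefficients of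
`N_t` are the part of `ε_{ijk} D^{ia} D^{jb} D^{kc}` symmetric in the `sl(2)` indices (`W_symm`), which is
all that enters `∇_3`. The members of order four and six of the last three complexes are built from the
coefficients of `N_t` and one more `D^{ia}` (`Y42`, `Y41`) or from those of two factors `N_t` (`Y6`).

Reducibility. The kernel of an invariant operator is an invariant subspace (`isReducible_of_ker`), and
so is its image, which is a proper one if some nonzero operator follows in a complex
(`isReducible_of_complex`); that operator need not be invariant. This leaves `Ω_B(0,0)` and `Ω_C(0,0)`,
where `∇_1` is not available. There `∇_2` is invariant even under `vle(3|6)`: it is a product of two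
first-order operators, whose defects cancel (`lie_nabla2A_two`, `lie_nabla2C_zero`).

The integral. The superdivergence of an element of `vle(3|6)` is a combination of traces of structure
functions and vanishes (`divergence_eq_zero`), so that `X f` is a total derivative, as is `D^{ia} f`. The
integral annihilates total derivatives of compactly supported functions, and the operators `X` and
`D^{ia}` annihilate its constant values. A bump function times the product of all `θ_{ia}` shows that
the integral is neither zero nor local.
-/

open scoped TensorProduct

noncomputable section

namespace VLE36

/-! ### Calculus on superfunctions -/

section generic

variable {C : Type} [CommRing C] [Algebra ℂ C]

/-- Induction on superfunctions: they are generated from the coefficients by addition and by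
multiplication with the odd coordinates. -/
theorem sf_induction {p : SF C → Prop} (hc : ∀ c : C, p (c ⊗ₜ 1))
    (hadd : ∀ f g, p f → p g → p (f + g)) (hθ : ∀ i a f, p f → p (theta i a * f)) (f : SF C) :
    p f := by
  induction f using TensorProduct.induction_on with
  | zero => simpa using hc 0
  | add x y hx hy => exact hadd _ _ hx hy
  | tmul c g =>
    induction g using CliffordAlgebra.left_induction generalizing c with
    | algebraMap r =>
      have : c ⊗ₜ[ℂ] (algebraMap ℂ Grass r) = (r • c) ⊗ₜ[ℂ] (1 : Grass) := by
        rw [Algebra.algebraMap_eq_smul_one, TensorProduct.smul_tmul]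
      exact this ▸ hc _
    | add x y hx hy => rw [TensorProduct.tmul_add]; exact hadd _ _ (hx c) (hy c)
    | ι_mul x m hx =>
      have hm : m = ∑ ia : Fin 3 × Fin 2, m ia • (Pi.single ia 1 : Fin 3 × Fin 2 → ℂ) := by
        ext j; simp [Finset.sum_apply, Pi.single_apply]
      have key : ∀ s : Finset (Fin 3 × Fin 2),
          p (c ⊗ₜ[ℂ] (CliffordAlgebra.ι _ (∑ ia ∈ s, m ia • (Pi.single ia 1 : _ → ℂ)) * x)) := by
        intro s
        induction s using Finset.induction_on with
        | empty => simpa using hc 0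
        | insert ia s his ih =>
          rw [Finset.sum_insert his, map_add, add_mul, TensorProduct.tmul_add]
          refine hadd _ _ ?_ ih
          have := hθ ia.1 ia.2 _ (hx (m ia • c))
          rw [theta, Algebra.TensorProduct.tmul_mul_tmul, one_mul] at this
          rw [map_smul, smul_mul_assoc, ← TensorProduct.smul_tmul]
          exact this
      rw [hm]
      exact key Finset.univ

/-- The parity automorphism as a homomorphism of algebras. -/
def parityHom : SF C →ₐ[ℂ] SF C :=
  Algebra.TensorProduct.map (AlgHom.id ℂ C)
    (CliffordAlgebra.involute (Q := (0 : QuadraticForm ℂ (Fin 3 × Fin 2 → ℂ))))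

@[simp] theorem parity_tmul (c : C) (g : Grass) :
    parity (c ⊗ₜ[ℂ] g) = c ⊗ₜ[ℂ] (CliffordAlgebra.involute g) := rfl

@[simp] theorem parity_mul (f g : SF C) : parity (f * g) = parity f * parity g :=
  map_mul parityHom f g

@[simp] theorem parity_one : parity (1 : SF C) = 1 := map_one (parityHom (C := C))

@[simp] theorem parity_theta (i : Fin 3) (a : Fin 2) : parity (theta (C := C) i a) = -theta i a := by
  simp [theta, ExteriorAlgebra.ι, TensorProduct.tmul_neg]

@[simp] theorem parity_parity (f : SF C) : parity (parity f) = f := by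
  induction f using TensorProduct.induction_on with
  | zero => simp
  | add x y hx hy => simp [hx, hy]
  | tmul c g => simp

theorem theta_mul_theta (i j : Fin 3) (a b : Fin 2) :
    theta (C := C) i a * theta j b = -(theta j b * theta i a) := by
  rw [theta, theta, Algebra.TensorProduct.tmul_mul_tmul, Algebra.TensorProduct.tmul_mul_tmul,
    ← TensorProduct.tmul_neg, eq_neg_of_add_eq_zero_left (ExteriorAlgebra.ι_add_mul_swap _ _)]

theorem theta_sq (i : Fin 3) (a : Fin 2) : theta (C := C) i a * theta i a = 0 := by
  rw [theta, Algebra.TensorProduct.tmul_mul_tmul, ExteriorAlgebra.ι_sq_zero, TensorProduct.tmul_zero]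

theorem coe_comm (c : C) (f : SF C) : (c ⊗ₜ[ℂ] (1 : Grass)) * f = f * (c ⊗ₜ[ℂ] (1 : Grass)) := by
  induction f using TensorProduct.induction_on with
  | zero => simp
  | add x y hx hy => rw [mul_add, add_mul, hx, hy]
  | tmul d g => simp [mul_comm]

/-- Odd coordinates commute with superfunctions up to the sign rule. -/
theorem mul_theta (i : Fin 3) (a : Fin 2) (f : SF C) : f * theta i a = theta i a * parity f := by
  induction f using sf_induction with
  | hc c => simpa using coe_comm c _
  | hadd f g hf hg => rw [add_mul, map_add, mul_add, hf, hg]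
  | hθ j b f hf =>
    rw [mul_assoc, hf, parity_mul, parity_theta, ← mul_assoc, ← mul_assoc, theta_mul_theta j i]
    simp

/-- Contraction with a covector is an odd derivation of the Grassmann algebra. -/
theorem contractLeft_mul (d : Module.Dual ℂ (Fin 3 × Fin 2 → ℂ)) (x y : Grass) :
    CliffordAlgebra.contractLeft d (x * y) = CliffordAlgebra.contractLeft d x * y +
      CliffordAlgebra.involute x * CliffordAlgebra.contractLeft d y := by
  induction x using CliffordAlgebra.left_induction with
  | algebraMap r => simp [Algebra.algebraMap_eq_smul_one, CliffordAlgebra.contractLeft_one]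
  | add x z hx hz => simp only [add_mul, map_add, hx, hz]; abel
  | ι_mul x m hx =>
    rw [mul_assoc, CliffordAlgebra.contractLeft_ι_mul, hx, CliffordAlgebra.contractLeft_ι_mul,
      map_mul, CliffordAlgebra.involute_ι]
    simp only [mul_add, sub_mul, smul_mul_assoc, neg_mul, mul_assoc]
    abel

theorem dTheta_tmul (i : Fin 3) (a : Fin 2) (c : C) (g : Grass) :
    dTheta i a (c ⊗ₜ[ℂ] g) = c ⊗ₜ[ℂ] grassD i a g := rfl

theorem dTheta_mul (i : Fin 3) (a : Fin 2) (f g : SF C) :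
    dTheta i a (f * g) = dTheta i a f * g + parity f * dTheta i a g := by
  induction f using TensorProduct.induction_on with
  | zero => simp
  | add x y hx hy => simp only [add_mul, map_add, hx, hy]; abel
  | tmul c x =>
    induction g using TensorProduct.induction_on with
    | zero => simp
    | add x y hx hy => simp only [mul_add, map_add, hx, hy]; abel
    | tmul d y =>
      simp only [dTheta_tmul, parity_tmul, Algebra.TensorProduct.tmul_mul_tmul, grassD,
        contractLeft_mul, TensorProduct.tmul_add]

@[simp] theorem dTheta_coe (i : Fin 3) (a : Fin 2) (c : C) : dTheta i a (c ⊗ₜ[ℂ] (1 : Grass)) = 0 := by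
  rw [dTheta_tmul, grassD, CliffordAlgebra.contractLeft_one, TensorProduct.tmul_zero]

theorem dTheta_theta (i j : Fin 3) (a b : Fin 2) :
    dTheta i a (theta (C := C) j b) = if i = j ∧ a = b then 1 else 0 := by
  rw [theta, dTheta_tmul, grassD, ExteriorAlgebra.ι, CliffordAlgebra.contractLeft_ι]
  simp only [LinearMap.proj_apply, Pi.single_apply, Prod.mk.injEq]
  split_ifs <;> simp_all [Algebra.TensorProduct.one_def]

@[simp] theorem onCoeff_tmul (δ : C →ₗ[ℂ] C) (c : C) (g : Grass) :
    onCoeff δ (c ⊗ₜ[ℂ] g) = δ c ⊗ₜ[ℂ] g := rfl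

theorem onCoeff_mul {δ : C →ₗ[ℂ] C} (hδ : ∀ x y, δ (x * y) = δ x * y + x * δ y) (f g : SF C) :
    onCoeff δ (f * g) = onCoeff δ f * g + f * onCoeff δ g := by
  induction f using TensorProduct.induction_on with
  | zero => simp
  | add x y hx hy => simp only [add_mul, map_add, hx, hy]; abel
  | tmul c x =>
    induction g using TensorProduct.induction_on with
    | zero => simp
    | add x y hx hy => simp only [mul_add, map_add, hx, hy]; abel
    | tmul d y =>
      simp [hδ, TensorProduct.add_tmul]

theorem onCoeff_theta_mul (δ : C →ₗ[ℂ] C) (i : Fin 3) (a : Fin 2) (f : SF C) :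
    onCoeff δ (theta i a * f) = theta i a * onCoeff δ f := by
  induction f using TensorProduct.induction_on with
  | zero => simp
  | add x y hx hy => simp only [mul_add, map_add, hx, hy]
  | tmul c x => simp [theta]

theorem onCoeff_parity (δ : C →ₗ[ℂ] C) (f : SF C) :
    onCoeff δ (parity f) = parity (onCoeff δ f) := by
  induction f using TensorProduct.induction_on with
  | zero => simp
  | add x y hx hy => simp only [map_add, hx, hy]
  | tmul c x => simp

theorem onCoeff_dTheta (δ : C →ₗ[ℂ] C) (i : Fin 3) (a : Fin 2) (f : SF C) :
    onCoeff δ (dTheta i a f) = dTheta i a (onCoeff δ f) := by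
  induction f using TensorProduct.induction_on with
  | zero => simp
  | add x y hx hy => simp only [map_add, hx, hy]
  | tmul c x => simp [dTheta_tmul]

theorem onCoeff_comm {δ δ' : C →ₗ[ℂ] C} (h : ∀ c, δ (δ' c) = δ' (δ c)) (f : SF C) :
    onCoeff δ (onCoeff δ' f) = onCoeff δ' (onCoeff δ f) := by
  induction f using TensorProduct.induction_on with
  | zero => simp
  | add x y hx hy => simp only [map_add, hx, hy]
  | tmul c x => simp [h]

theorem dTheta_parity (i : Fin 3) (a : Fin 2) (f : SF C) :
    dTheta i a (parity f) = -parity (dTheta i a f) := by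
  induction f using sf_induction with
  | hc c => simp
  | hadd f g hf hg => simp only [map_add, hf, hg]; abel
  | hθ j b f hf =>
    rw [parity_mul, dTheta_mul, dTheta_mul, hf, parity_theta, map_neg, map_neg, dTheta_theta]
    split_ifs <;> simp [parity_theta, add_comm]

theorem thetaUp_zero (j : Fin 3) : thetaUp (C := C) j 0 = theta j 1 := by
  simp [thetaUp, epsUp]

theorem thetaUp_one (j : Fin 3) : thetaUp (C := C) j 1 = -theta j 0 := by
  simp [thetaUp, epsUp]

theorem mul_thetaUp (i : Fin 3) (a : Fin 2) (f : SF C) :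
    f * thetaUp i a = thetaUp i a * parity f := by
  simp only [thetaUp, Finset.mul_sum, Finset.sum_mul, mul_smul_comm, smul_mul_assoc, mul_theta]

@[simp] theorem parity_thetaUp (i : Fin 3) (a : Fin 2) :
    parity (thetaUp (C := C) i a) = -thetaUp i a := by
  simp [thetaUp, add_comm]

theorem onCoeff_thetaUp_mul (δ : C →ₗ[ℂ] C) (i : Fin 3) (a : Fin 2) (f : SF C) :
    onCoeff δ (thetaUp i a * f) = thetaUp i a * onCoeff δ f := by
  simp only [thetaUp, Finset.sum_mul, smul_mul_assoc, map_sum, map_smul, onCoeff_theta_mul]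

theorem dTheta_thetaUp (i j : Fin 3) (a b : Fin 2) :
    dTheta i a (thetaUp (C := C) j b) = if i = j then epsUp b a • 1 else 0 := by
  simp only [thetaUp, map_sum, map_smul, dTheta_theta]
  by_cases h : i = j <;> simp [h]

theorem covD_apply (pd : Fin 3 → C →ₗ[ℂ] C) (i : Fin 3) (a : Fin 2) (f : SF C) :
    covD pd i a f = dTheta i a f +
      ∑ j, ∑ k, eps3 i j k • (thetaUp j a * onCoeff (pd k) f) := by
  simp [covD, LinearMap.sum_apply]

theorem covD_mul {pd : Fin 3 → C →ₗ[ℂ] C} (hpd : ∀ k x y, pd k (x * y) = pd k x * y + x * pd k y)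
    (i : Fin 3) (a : Fin 2) (f g : SF C) :
    covD pd i a (f * g) = covD pd i a f * g + parity f * covD pd i a g := by
  simp only [covD_apply, dTheta_mul, onCoeff_mul (hpd _), mul_add, add_mul, Finset.sum_mul,
    Finset.mul_sum, smul_add, Finset.sum_add_distrib, smul_mul_assoc, mul_smul_comm, ← mul_assoc]
  simp only [mul_thetaUp, parity_parity]
  abel

theorem covD_parity (pd : Fin 3 → C →ₗ[ℂ] C) (i : Fin 3) (a : Fin 2) (f : SF C) :
    covD pd i a (parity f) = -parity (covD pd i a f) := by
  simp only [covD_apply, dTheta_parity, onCoeff_parity, map_add, map_sum, map_smul, parity_mul,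
    parity_thetaUp, neg_mul, smul_neg, Finset.sum_neg_distrib, neg_add, neg_neg]

theorem covD_theta {pd : Fin 3 → C →ₗ[ℂ] C} (hpd : ∀ k, pd k 1 = 0) (i j : Fin 3) (a b : Fin 2) :
    covD pd i a (theta j b) = if i = j ∧ a = b then 1 else 0 := by
  rw [covD_apply, dTheta_theta]
  simp [theta, hpd]

theorem covD_theta_mul (pd : Fin 3 → C →ₗ[ℂ] C) (i j : Fin 3) (a b : Fin 2) (f : SF C) :
    covD pd i a (theta j b * f) =
      (if i = j ∧ a = b then f else 0) - theta j b * covD pd i a f := by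
  simp only [covD_apply, dTheta_mul, dTheta_theta, onCoeff_theta_mul, parity_theta, mul_add,
    Finset.mul_sum, mul_smul_comm, ← mul_assoc, mul_theta, parity_thetaUp, ite_mul, one_mul,
    zero_mul, mul_neg, neg_mul, smul_neg, Finset.sum_neg_distrib]
  abel

theorem dTheta_anticomm (i j : Fin 3) (a b : Fin 2) (f : SF C) :
    dTheta i a (dTheta j b f) = -dTheta j b (dTheta i a f) := by
  induction f using TensorProduct.induction_on with
  | zero => simp
  | add x y hx hy => simp only [map_add, hx, hy]; abel
  | tmul c x =>
    rw [dTheta_tmul, dTheta_tmul, dTheta_tmul, dTheta_tmul, grassD, grassD,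
      CliffordAlgebra.contractLeft_comm, TensorProduct.tmul_neg]

theorem thetaUp_mul_thetaUp (i j : Fin 3) (a b : Fin 2) :
    thetaUp (C := C) i a * thetaUp j b = -(thetaUp j b * thetaUp i a) := by
  rw [mul_thetaUp, parity_thetaUp, mul_neg]

theorem eps3_swap (i j k : Fin 3) : eps3 j i k = -eps3 i j k := by
  unfold eps3; ring

theorem epsUp_swap (a b : Fin 2) : epsUp b a = -epsUp a b := by
  unfold epsUp; ring

/-- The fundamental relation `{D^{ia}, D^{jb}} = 2 ε^{ijk} ε^{ab} ∂_k`. -/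
theorem covD_anticomm {pd : Fin 3 → C →ₗ[ℂ] C} (hpd : ∀ k l c, pd k (pd l c) = pd l (pd k c))
    (i j : Fin 3) (a b : Fin 2) (f : SF C) :
    covD pd i a (covD pd j b f) + covD pd j b (covD pd i a f) =
      ∑ k, (2 * eps3 i j k * epsUp a b) • onCoeff (pd k) f := by
  -- `D = d + T`, where `d` anticommutes with `d`, and `T` with `T`
  set T : Fin 3 → Fin 2 → SF C → SF C := fun i a f =>
    ∑ j, ∑ k, eps3 i j k • (thetaUp j a * onCoeff (pd k) f) with hT
  have h1 : ∀ i a f, covD pd i a f = dTheta i a f + T i a f := covD_apply pd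
  have hTadd : ∀ i a f g, T i a (f + g) = T i a f + T i a g := by
    intro i a f g; simp only [hT, map_add, mul_add, smul_add, Finset.sum_add_distrib]
  have h2 : ∀ i j a b f, dTheta i a (T j b f) + T j b (dTheta i a f) =
      ∑ k, (eps3 i j k * epsUp a b) • onCoeff (pd k) f := by
    intro i j a b f
    simp only [hT, map_sum, map_smul, dTheta_mul, dTheta_thetaUp, parity_thetaUp, onCoeff_dTheta,
      neg_mul, smul_add, smul_neg, ite_mul, zero_mul, smul_ite, smul_zero, Finset.sum_add_distrib,
      Finset.sum_neg_distrib, neg_add_cancel_right, smul_mul_assoc, one_mul, smul_smul]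
    rw [Finset.sum_comm]
    refine Finset.sum_congr rfl fun k _ => ?_
    rw [Finset.sum_ite_eq Finset.univ i, if_pos (Finset.mem_univ _), eps3_swap i j, epsUp_swap a b,
      neg_mul_neg]
  have h3 : T i a (T j b f) + T j b (T i a f) = 0 := by
    have e : ∀ i a j b, T i a (T j b f) = ∑ x : Fin 3 × Fin 3, ∑ y : Fin 3 × Fin 3,
        (eps3 i x.1 x.2 * eps3 j y.1 y.2) •
          (thetaUp x.1 a * thetaUp y.1 b * onCoeff (pd x.2) (onCoeff (pd y.2) f)) := by
      intro i a j b
      simp only [hT, map_sum, map_smul, Finset.mul_sum, mul_smul_comm, Finset.smul_sum,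
        onCoeff_thetaUp_mul, Fintype.sum_prod_type, smul_smul, mul_assoc]
    rw [e, e, Finset.sum_comm (γ := Fin 3 × Fin 3), ← Finset.sum_add_distrib]
    refine Finset.sum_eq_zero fun x _ => ?_
    rw [← Finset.sum_add_distrib]
    refine Finset.sum_eq_zero fun y _ => ?_
    rw [thetaUp_mul_thetaUp, onCoeff_comm (hpd _ _), mul_comm, neg_mul, smul_neg,
      neg_add_cancel]
  have h4 := h2 i j a b f
  have h5 := h2 j i b a f
  have h6 := dTheta_anticomm i j a b f
  simp only [h1, map_add, hTadd]
  have h7 : ∑ k, (2 * eps3 i j k * epsUp a b) • onCoeff (pd k) f =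
      ∑ k, (eps3 i j k * epsUp a b) • onCoeff (pd k) f +
        ∑ k, (eps3 j i k * epsUp b a) • onCoeff (pd k) f := by
    rw [← Finset.sum_add_distrib]
    refine Finset.sum_congr rfl fun k _ => ?_
    rw [eps3_swap i j, epsUp_swap a b, ← add_smul]
    congr 1; ring
  rw [h7, ← h4, ← h5, h6]
  rw [← sub_eq_zero, ← h3]
  abel

end generic

/-! ### Polynomial superfunctions and the vector fields of `vle(3|6)` -/

theorem polyPd_mul (k : Fin 3) (x y : Poly) :
    polyPd k (x * y) = polyPd k x * y + x * polyPd k y := by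
  have h := (MvPolynomial.pderiv k : Derivation ℂ Poly Poly).leibniz x y
  rw [smul_eq_mul, smul_eq_mul, add_comm, mul_comm y] at h
  exact h

theorem polyPd_comm (k l : Fin 3) (x : Poly) :
    polyPd k (polyPd l x) = polyPd l (polyPd k x) := by
  have h : ⁅(MvPolynomial.pderiv k : Derivation ℂ Poly Poly),
      (MvPolynomial.pderiv l : Derivation ℂ Poly Poly)⁆ = 0 := by
    refine MvPolynomial.derivation_ext fun i => ?_
    simp [Derivation.commutator_apply, MvPolynomial.pderiv_X, Pi.single_apply, apply_ite]
  have h2 := congrArg (fun d : Derivation ℂ Poly Poly => d x) h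
  simp only [Derivation.commutator_apply, Derivation.coe_zero, Pi.zero_apply] at h2
  exact sub_eq_zero.mp h2

theorem polyPd_one (k : Fin 3) : polyPd k 1 = 0 :=
  (MvPolynomial.pderiv k : Derivation ℂ Poly Poly).map_one_eq_zero

theorem polyPd_X (k i : Fin 3) : polyPd k (MvPolynomial.X i) = if k = i then 1 else 0 := by
  simp [polyPd, MvPolynomial.pderiv_X, Pi.single_apply, eq_comm]

theorem psf_induction {p : PSF → Prop} (hc : ∀ c : ℂ, p (algebraMap ℂ PSF c))
    (hadd : ∀ f g, p f → p g → p (f + g)) (hu : ∀ i f, p f → p (u i * f))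
    (hθ : ∀ i a f, p f → p (theta i a * f)) (f : PSF) : p f := by
  refine sf_induction (fun c => ?_) hadd hθ f
  induction c using MvPolynomial.induction_on with
  | C a => exact hc a
  | add x y hx hy => rw [TensorProduct.add_tmul]; exact hadd _ _ hx hy
  | mul_X x i hx =>
    have := hu i _ hx
    rwa [u, Algebra.TensorProduct.tmul_mul_tmul, one_mul, mul_comm] at this

theorem algebraMap_eq (c : ℂ) : algebraMap ℂ PSF c = c • 1 := Algebra.algebraMap_eq_smul_one c

theorem dU_mul (k : Fin 3) (f g : PSF) : dU k (f * g) = dU k f * g + f * dU k g :=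
  onCoeff_mul (polyPd_mul k) f g

@[simp] theorem dU_one (k : Fin 3) : dU k 1 = 0 := by
  rw [Algebra.TensorProduct.one_def, dU, onCoeff_tmul, polyPd_one, TensorProduct.zero_tmul]

theorem dU_u (k i : Fin 3) : dU k (u i) = if k = i then 1 else 0 := by
  rw [u, dU, onCoeff_tmul, polyPd_X]
  split_ifs <;> simp [Algebra.TensorProduct.one_def]

theorem dU_theta_mul (k i : Fin 3) (a : Fin 2) (f : PSF) :
    dU k (theta i a * f) = theta i a * dU k f := onCoeff_theta_mul _ _ _ _

@[simp] theorem dU_theta (k i : Fin 3) (a : Fin 2) : dU k (theta i a) = 0 := by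
  simpa using dU_theta_mul k i a 1

theorem dU_u_mul (k i : Fin 3) (f : PSF) :
    dU k (u i * f) = (if k = i then f else 0) + u i * dU k f := by
  rw [dU_mul, dU_u]; split_ifs <;> simp

theorem dU_parity (k : Fin 3) (f : PSF) : dU k (parity f) = parity (dU k f) := onCoeff_parity _ _

theorem dU_dU (k l : Fin 3) (f : PSF) : dU k (dU l f) = dU l (dU k f) :=
  onCoeff_comm (polyPd_comm k l) f

@[simp] theorem dTheta_one (i : Fin 3) (a : Fin 2) : dTheta i a (1 : PSF) = 0 := dTheta_coe i a 1

theorem dTheta_u_mul (i k : Fin 3) (a : Fin 2) (f : PSF) :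
    dTheta i a (u k * f) = u k * dTheta i a f := by
  rw [dTheta_mul, u, dTheta_coe]; simp

@[simp] theorem parity_u (k : Fin 3) : parity (u k) = u k := by simp [u]

theorem u_mul (k : Fin 3) (f : PSF) : u k * f = f * u k := coe_comm _ f

theorem D_apply (i : Fin 3) (a : Fin 2) (f : PSF) :
    D i a f = dTheta i a f + ∑ j, ∑ k, eps3 i j k • (thetaUp j a * dU k f) := covD_apply _ _ _ _

theorem D_mul (i : Fin 3) (a : Fin 2) (f g : PSF) :
    D i a (f * g) = D i a f * g + parity f * D i a g := covD_mul polyPd_mul i a f g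

theorem D_parity (i : Fin 3) (a : Fin 2) (f : PSF) : D i a (parity f) = -parity (D i a f) :=
  covD_parity _ i a f

theorem D_theta (i j : Fin 3) (a b : Fin 2) :
    D i a (theta j b) = if i = j ∧ a = b then 1 else 0 := covD_theta polyPd_one i j a b

theorem D_theta_mul (i j : Fin 3) (a b : Fin 2) (f : PSF) :
    D i a (theta j b * f) = (if i = j ∧ a = b then f else 0) - theta j b * D i a f :=
  covD_theta_mul _ i j a b f

theorem D_anticomm (i j : Fin 3) (a b : Fin 2) (f : PSF) :
    D i a (D j b f) + D j b (D i a f) = ∑ k, (2 * eps3 i j k * epsUp a b) • dU k f :=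
  covD_anticomm polyPd_comm i j a b f

@[simp] theorem D_one (i : Fin 3) (a : Fin 2) : D i a 1 = 0 := by
  simp [D_apply]

theorem D_u (i k : Fin 3) (a : Fin 2) : D i a (u k) = ∑ j, eps3 i j k • thetaUp j a := by
  rw [D_apply, u, dTheta_coe, ← u]
  simp [dU_u]

theorem D_thetaUp (i j : Fin 3) (a b : Fin 2) :
    D i a (thetaUp j b) = if i = j then epsUp b a • 1 else 0 := by
  simp only [thetaUp, map_sum, map_smul, D_theta]
  by_cases h : i = j <;> simp [h]

theorem dU_D (k i : Fin 3) (a : Fin 2) (f : PSF) : dU k (D i a f) = D i a (dU k f) := by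
  simp only [D_apply, map_add, map_sum, map_smul]
  congr 1
  · exact onCoeff_dTheta _ _ _ _
  · refine Finset.sum_congr rfl fun j _ => Finset.sum_congr rfl fun l _ => ?_
    rw [dU_dU l k]
    exact congrArg _ (onCoeff_thetaUp_mul _ _ _ _)

/-- Two tensors with values in a complex vector space agree as soon as all their scalar
components do. -/
theorem eq_of_dual {V : Type*} [AddCommGroup V] [Module ℂ V] {x y : V}
    (h : ∀ φ : Module.Dual ℂ V, φ x = φ y) : x = y := by
  rw [← sub_eq_zero, ← Module.forall_dual_apply_eq_zero_iff ℂ]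
  intro φ
  rw [map_sub, h, sub_self]

theorem eps3_val (i j k : Fin 3) : eps3 i j k =
    if (i, j, k) ∈ [((0 : Fin 3), (1 : Fin 3), (2 : Fin 3)), (1, 2, 0), (2, 0, 1)] then 1 else
    if (i, j, k) ∈ [((0 : Fin 3), (2 : Fin 3), (1 : Fin 3)), (1, 0, 2), (2, 1, 0)] then -1 else 0 := by
  fin_cases i <;> fin_cases j <;> fin_cases k <;> simp [eps3] <;> norm_num

namespace VField

variable {σ : ℤˣ} {X : VField}

theorem act_apply (X : VField) (f : PSF) : X.act f =
    ∑ i, X.Q i * dU i f + ∑ i, ∑ a, X.P i a * dTheta i a f := by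
  simp [act, LinearMap.sum_apply]

@[simp] theorem act_one (X : VField) : X.act 1 = 0 := by simp [act_apply]

@[simp] theorem act_algebraMap (X : VField) (c : ℂ) : X.act (algebraMap ℂ PSF c) = 0 := by
  rw [algebraMap_eq, map_smul, act_one, smul_zero]

theorem act_u (X : VField) (k : Fin 3) : X.act (u k) = X.Q k := by
  have : ∀ i a, dTheta i a (u k) = 0 := fun i a => dTheta_coe i a _
  simp [act_apply, dU_u, this]

theorem act_theta (X : VField) (i : Fin 3) (a : Fin 2) : X.act (theta i a) = X.P i a := by
  simp only [act_apply, dU_theta, dTheta_theta, mul_zero, Finset.sum_const_zero, zero_add]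
  rw [Finset.sum_eq_single i (by intro b _ hb; simp [hb]) (by simp),
    Finset.sum_eq_single a (by intro b _ hb; simp [hb]) (by simp)]
  simp

theorem act_u_mul (X : VField) (k : Fin 3) (f : PSF) :
    X.act (u k * f) = X.Q k * f + u k * X.act f := by
  have h1 : ∀ x : PSF, ∀ g : PSF, x * (u k * g) = u k * (x * g) := by
    intro x g; rw [← mul_assoc, ← u_mul, mul_assoc]
  simp only [act_apply, dU_u_mul, dTheta_u_mul, mul_add, Finset.sum_add_distrib, Finset.mul_sum, h1]
  simp [add_assoc]

theorem act_theta_mul (h : X.IsHomog σ) (i : Fin 3) (a : Fin 2) (f : PSF) :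
    X.act (theta i a * f) = X.P i a * f + (σ : ℤ) • (theta i a * X.act f) := by
  have h1 : ∀ k, X.Q k * theta i a = (σ : ℤ) • (theta i a * X.Q k) := by
    intro k; rw [mul_theta, h.1, mul_smul_comm]
  have h2 : ∀ j b, X.P j b * theta i a = -((σ : ℤ) • (theta i a * X.P j b)) := by
    intro j b; rw [mul_theta, h.2, mul_neg, mul_smul_comm]
  have e1 : ∀ j b, X.P j b * dTheta j b (theta i a * f) = X.P j b * (if j = i ∧ b = a then f else 0)
      + (σ : ℤ) • (theta i a * (X.P j b * dTheta j b f)) := by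
    intro j b
    rw [dTheta_mul, dTheta_theta, parity_theta, mul_add, neg_mul, mul_neg, ← mul_assoc _ (theta i a), h2,
      neg_mul, neg_neg, smul_mul_assoc, mul_assoc]
    congr 2
    split_ifs <;> simp
  have e2 : ∀ k, X.Q k * dU k (theta i a * f) = (σ : ℤ) • (theta i a * (X.Q k * dU k f)) := by
    intro k; rw [dU_theta_mul, ← mul_assoc, h1, smul_mul_assoc, mul_assoc]
  rw [act_apply, act_apply]
  simp only [e1, e2, Finset.sum_add_distrib, mul_add, smul_add, Finset.mul_sum, Finset.smul_sum]
  have e3 : ∑ x, ∑ y, X.P x y * (if x = i ∧ y = a then f else 0) = X.P i a * f := by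
    rw [Finset.sum_eq_single i (by intro b _ hb; simp [hb]) (by simp),
      Finset.sum_eq_single a (by intro b _ hb; simp [hb]) (by simp)]
    simp
  rw [e3]
  abel

theorem act_thetaUp (X : VField) (j : Fin 3) (a : Fin 2) :
    X.act (thetaUp j a) = ∑ b, epsUp a b • X.P j b := by
  simp only [thetaUp, map_sum, map_smul, act_theta]

theorem parity_Qt (h : X.IsHomog σ) (k : Fin 3) : parity (X.Qt k) = (σ : ℤ) • X.Qt k := by
  simp only [Qt, map_sub, map_sum, map_smul, parity_mul, h.1, h.2, parity_thetaUp, neg_mul_neg,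
    smul_sub, Finset.smul_sum, smul_mul_assoc, smul_comm (_ : ℂ) (_ : ℤ)]

theorem parity_dv (h : X.IsHomog σ) : parity X.dv = (σ : ℤ) • X.dv := by
  simp only [dv, map_sum, ← dU_parity, parity_Qt h, map_zsmul, Finset.smul_sum]

theorem parity_sl3 (h : X.IsHomog σ) (j l : Fin 3) :
    parity (X.sl3 j l) = (σ : ℤ) • X.sl3 j l := by
  simp only [sl3, map_sub, ← dU_parity, parity_Qt h, map_zsmul, smul_sub]
  split_ifs
  · rw [map_smul, parity_dv h, smul_comm]
  · simp

theorem parity_D_P (h : X.IsHomog σ) (i j : Fin 3) (a b : Fin 2) :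
    parity (D i a (X.P j b)) = (σ : ℤ) • D i a (X.P j b) := by
  rw [← neg_inj, ← D_parity, h.2, map_neg, map_zsmul]

theorem parity_sl2 (h : X.IsHomog σ) (b c : Fin 2) :
    parity (X.sl2 σ b c) = (σ : ℤ) • X.sl2 σ b c := by
  simp only [sl2, map_neg, map_smul, map_sub, map_zsmul, map_sum, parity_D_P h]
  split_ifs
  · rw [map_smul, parity_dv h, ← Finset.smul_sum]; module
  · rw [map_zero, ← Finset.smul_sum]; module

/-- The coefficients `P_{ia}` of an element of `vle(3|6)` are determined by the `Q̃^i`. -/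
theorem D_Qt (h : X.IsVLE σ) (i k : Fin 3) (a : Fin 2) :
    D i a (X.Qt k) = (σ : ℤ) • ∑ j, ∑ b, (2 * eps3 i j k * epsUp a b) • X.P j b := by
  have h1 := h.2 i a (u k)
  simp only [act_u, D_u, map_sum, map_smul, act_thetaUp] at h1
  have h2 : D i a (X.Qt k) = D i a (X.Q k) -
      (∑ j, ∑ l, ∑ b, eps3 j l k • (D i a (X.P j b) * thetaUp l b)) +
        (σ : ℤ) • ∑ j, ∑ b, (eps3 j i k * epsUp b a) • X.P j b := by
    have e : ∀ j l b, D i a (X.P j b * thetaUp l b) = D i a (X.P j b) * thetaUp l b -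
        (σ : ℤ) • (if i = l then epsUp b a • X.P j b else 0) := by
      intro j l b
      rw [D_mul, h.1.2, D_thetaUp, neg_mul, smul_mul_assoc, sub_eq_add_neg]
      split_ifs <;> simp
    simp only [Qt, map_sub, map_sum, map_smul, e, smul_sub, Finset.sum_sub_distrib, Finset.smul_sum]
    rw [sub_add]
    congr 2
    refine Finset.sum_congr rfl fun j _ => ?_
    rw [Finset.sum_eq_single i (by intro b _ hb; simp [hb.symm]) (by simp)]
    refine Finset.sum_congr rfl fun b _ => ?_
    rw [if_pos rfl, smul_comm, smul_smul]
  set A : PSF := ∑ j, ∑ b, (eps3 i j k * epsUp a b) • X.P j b with hA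
  set B : PSF := ∑ j, ∑ l, ∑ b, eps3 j l k • (D i a (X.P j b) * thetaUp l b) with hB
  have e1 : ∑ j, eps3 i j k • ∑ b, epsUp a b • X.P j b = A := by
    simp only [hA, Finset.smul_sum, smul_smul]
  have e2 : ∑ j, ∑ b, D i a (X.P j b) * ∑ l, eps3 j l k • thetaUp l b = B := by
    simp only [hB, Finset.mul_sum, mul_smul_comm]
    exact Finset.sum_congr rfl fun j _ => Finset.sum_comm
  have e3 : ∑ j, ∑ b, (eps3 j i k * epsUp b a) • X.P j b = A := by
    simp only [hA, eps3_swap i, epsUp_swap a, neg_mul_neg]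
  have e4 : ∑ j, ∑ b, (2 * eps3 i j k * epsUp a b) • X.P j b = (2 : ℂ) • A := by
    simp only [hA, Finset.smul_sum, smul_smul, mul_assoc]
  rw [e1, e2] at h1
  rw [h2, e3, e4]
  rcases Int.units_eq_one_or σ with rfl | rfl
  · simp only [Units.val_one, one_smul] at h1 ⊢
    linear_combination (norm := module) (-1 : ℂ) • h1
  · simp only [Units.val_neg, Units.val_one, neg_smul, one_smul] at h1 ⊢
    linear_combination (norm := module) (1 : ℂ) • h1

/-- The linear algebra behind `D_P`, with `M l c j b` in the place of `(-)^X D^{lc} P_{jb}` and `U j l`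
in the place of `∂_j Q̃^l`. The system has more equations than unknowns; it determines `M` by `U` and
the `sl(2)` part of its partial trace. -/
theorem solve_first (M : Fin 3 → Fin 2 → Fin 3 → Fin 2 → ℂ) (U : Fin 3 → Fin 3 → ℂ)
    (h : ∀ l c i a k, ∑ j, ∑ b, (eps3 i j k * epsUp a b) * M l c j b +
      ∑ j, ∑ b, (eps3 l j k * epsUp c b) * M i a j b = ∑ m, (eps3 l i m * epsUp c a) * U m k)
    (l : Fin 3) (c : Fin 2) (j : Fin 3) (b : Fin 2) :
    M l c j b = -(if c = b then U j l - (if j = l then (1 / 3) * ∑ m, U m m else 0) else 0) +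
      (if l = j ∧ c = b then (1 / 6) * ∑ m, U m m else 0) +
      (if l = j then (1 / 3) * (∑ i, M i c i b - (if b = c then (1 / 2) * ∑ m, U m m else 0))
        else 0) := by
  simp only [eps3_val, epsUp, Fin.sum_univ_three, Fin.sum_univ_two] at h ⊢
  simp at h
  simp only [Fin.forall_fin_succ, Fin.forall_fin_zero] at h
  simp at h
  fin_cases l <;> fin_cases c <;> fin_cases j <;> fin_cases b <;> simp <;> grind

/-- The anticommutator of `D^{lc}` and `D^{ia}` applied to `Q̃^k`, with `D Q̃` expressed through the
`P_{jb}`. -/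
theorem D_P_rel (h : X.IsVLE σ) (l i k : Fin 3) (c a : Fin 2) :
    ∑ j, ∑ b, (eps3 i j k * epsUp a b) • ((σ : ℤ) • D l c (X.P j b)) +
      ∑ j, ∑ b, (eps3 l j k * epsUp c b) • ((σ : ℤ) • D i a (X.P j b)) =
        ∑ m, (eps3 l i m * epsUp c a) • dU m (X.Qt k) := by
  have h1 := D_anticomm l i c a (X.Qt k)
  rw [D_Qt h, D_Qt h] at h1
  simp only [map_zsmul, map_sum, map_smul, mul_assoc] at h1
  simp only [mul_smul, ← Finset.smul_sum] at h1 ⊢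
  simp only [smul_comm _ (σ : ℤ), ← Finset.smul_sum] at h1 ⊢
  linear_combination (norm := module) (1 / 2 : ℂ) • h1

/-- `(-)^X D^{lc} P_{jb}` is a `gl(3) ⊕ gl(2)` matrix. -/
theorem D_P (h : X.IsVLE σ) (l : Fin 3) (c : Fin 2) (j : Fin 3) (b : Fin 2) :
    (σ : ℤ) • D l c (X.P j b) = -(if c = b then X.sl3 j l else 0) +
      (if l = j ∧ c = b then (1 / 6 : ℂ) • X.dv else 0) - (if l = j then X.sl2 σ b c else 0) := by
  refine eq_of_dual fun φ => ?_
  have := solve_first (fun l c j b => φ ((σ : ℤ) • D l c (X.P j b))) (fun j l => φ (dU j (X.Qt l)))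
    (fun l c i a k => by
      have h1 := congrArg φ (D_P_rel h l i k c a)
      simpa only [map_add, map_sum, map_smul, smul_eq_mul] using h1) l c j b
  rw [this]
  simp only [sl3, sl2, dv, map_add, map_sub, map_neg, apply_ite φ, map_smul, map_sum, map_zero,
    Finset.smul_sum, smul_eq_mul, ← Finset.mul_sum]
  split_ifs <;> ring

/-- The bracket of `X ∈ vle(3|6)` with the fermionic derivatives. -/
theorem act_D (h : X.IsVLE σ) (i : Fin 3) (a : Fin 2) (f : PSF) :
    X.act (D i a f) = (σ : ℤ) • D i a (X.act f) + ∑ j, X.sl3 j i * D j a f +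
      ∑ b, X.sl2 σ b a * D i b f - (1 / 6 : ℂ) • (X.dv * D i a f) := by
  have h1 := h.2 i a f
  have e : (σ : ℤ) • ∑ j, ∑ b, D i a (X.P j b) * D j b f = -∑ j, X.sl3 j i * D j a f -
      ∑ b, X.sl2 σ b a * D i b f + (1 / 6 : ℂ) • (X.dv * D i a f) := by
    simp only [Finset.smul_sum, ← smul_mul_assoc, D_P h]
    simp only [sub_mul, add_mul, neg_mul, Finset.sum_add_distrib, Finset.sum_sub_distrib, ite_mul,
      zero_mul, Finset.sum_neg_distrib, Finset.sum_ite_eq, Finset.mem_univ, if_true]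
    have e1 : ∑ x, ∑ y, (if i = x ∧ a = y then (1 / 6 : ℂ) • X.dv * D x y f else 0) =
        (1 / 6 : ℂ) • X.dv * D i a f := by
      rw [Finset.sum_eq_single i (by intro b _ hb; simp [hb.symm]) (by simp),
        Finset.sum_eq_single a (by intro b _ hb; simp [hb.symm]) (by simp)]
      simp
    have e2 : ∑ x, ∑ y, (if i = x then X.sl2 σ y a * D x y f else 0) =
        ∑ y, X.sl2 σ y a * D i y f := by
      rw [Finset.sum_eq_single i (by intro b _ hb; simp [hb.symm]) (by simp)]
      simp
    rw [e1, e2]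
    abel
  rw [e] at h1
  linear_combination (norm := module) h1

theorem sl3_trace (X : VField) : ∑ j, X.sl3 j j = 0 := by
  simp only [sl3, if_true, Finset.sum_sub_distrib, ← dv.eq_1, Finset.sum_const, Finset.card_univ,
    Fintype.card_fin]
  module

/-- The linear system of `solve_first` also determines the full trace of `M`, which remains free in the
formula given there. -/
theorem solve_trace (M : Fin 3 → Fin 2 → Fin 3 → Fin 2 → ℂ) (U : Fin 3 → Fin 3 → ℂ)
    (h : ∀ l c i a k, ∑ j, ∑ b, (eps3 i j k * epsUp a b) * M l c j b +
      ∑ j, ∑ b, (eps3 l j k * epsUp c b) * M i a j b = ∑ m, (eps3 l i m * epsUp c a) * U m k) :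
    ∑ i, ∑ b, M i b i b = ∑ m, U m m := by
  simp only [eps3_val, epsUp, Fin.sum_univ_three, Fin.sum_univ_two] at h ⊢
  simp at h
  simp only [Fin.forall_fin_succ, Fin.forall_fin_zero] at h
  simp at h
  grind

/-- The function `sl2` is traceless, because `(-)^X D^{ia} P_{ia} = ∂_i Q̃^i` on `vle(3|6)`. -/
theorem sl2_trace (h : X.IsVLE σ) : ∑ b, X.sl2 σ b b = 0 := by
  have h1 : ∑ i, ∑ b, (σ : ℤ) • D i b (X.P i b) = X.dv := by
    refine eq_of_dual fun φ => ?_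
    have := solve_trace (fun l c j b => φ ((σ : ℤ) • D l c (X.P j b)))
      (fun j l => φ (dU j (X.Qt l))) (fun l c i a k => by
        have h1 := congrArg φ (D_P_rel h l i k c a)
        simpa only [map_add, map_sum, map_smul, smul_eq_mul] using h1)
    simpa only [dv, map_sum] using this
  rw [Finset.sum_comm] at h1
  simp only [sl2, if_true, Finset.sum_neg_distrib, ← Finset.smul_sum, Finset.sum_sub_distrib,
    Finset.sum_const, Finset.card_univ, Fintype.card_fin]
  simp only [← Finset.smul_sum] at h1
  rw [h1]
  module

/-- The spinor `ρ^{ia} = ½ D^{ia} ∂_j Q̃^j`, which carries the part of the derivative of the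
structure functions of `X` that obstructs invariance. -/
def rho (X : VField) (i : Fin 3) (a : Fin 2) : PSF := (1 / 2 : ℂ) • D i a X.dv

theorem D_dv (X : VField) (i : Fin 3) (a : Fin 2) : D i a X.dv = (2 : ℂ) • X.rho i a := by
  rw [rho, smul_smul]; norm_num

/-- The linear algebra behind `D_sl2`. In it `R k j b` stands for `±∂_k P_{jb}`, `E`, `V` and `G` for
the derivatives `D^{ia}` of `sl3`, `dv` and `sl2`, and `M` for `±D^{ia} D^{lc} P_{jb}`; the hypotheses
are the relation of `R` with `E`, `V`, the shape of `D P`, and the anticommutator of the `D^{ia}`. -/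
theorem solve_second (R : Fin 3 → Fin 3 → Fin 2 → ℂ) (E : Fin 3 → Fin 2 → Fin 3 → Fin 3 → ℂ)
    (V : Fin 3 → Fin 2 → ℂ) (G : Fin 3 → Fin 2 → Fin 2 → Fin 2 → ℂ)
    (M : Fin 3 → Fin 2 → Fin 3 → Fin 2 → Fin 3 → Fin 2 → ℂ)
    (hE : ∀ i a j l, E i a j l = ∑ k, ∑ b, (2 * eps3 i k l * epsUp a b) * R j k b -
      if j = l then (1 / 3) * V i a else 0)
    (hV : ∀ i a, V i a = ∑ l, ∑ k, ∑ b, (2 * eps3 i k l * epsUp a b) * R l k b)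
    (hM : ∀ i a l c j b, M i a l c j b = -(if c = b then E i a j l else 0) +
      (if l = j ∧ c = b then (1 / 6) * V i a else 0) - (if l = j then G i a b c else 0))
    (h : ∀ i a l c j b, M i a l c j b + M l c i a j b = ∑ k, (2 * eps3 i l k * epsUp a c) * R k j b)
    (i : Fin 3) (a b c : Fin 2) :
    G i a b c = (if a = b then V i c else 0) - if c = b then (1 / 2) * V i a else 0 := by
  have h1 := h i a (i + 1) c (i + 1) b
  rw [hM, hM, hE, hE, hV, hV] at h1
  rw [hV, hV]
  simp only [eps3_val, epsUp, Fin.sum_univ_three, Fin.sum_univ_two] at h1 ⊢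
  fin_cases i <;> fin_cases a <;> fin_cases b <;> fin_cases c <;> simp at h1 ⊢ <;> grind

theorem D_dU_Qt (h : X.IsVLE σ) (i : Fin 3) (a : Fin 2) (j l : Fin 3) :
    D i a (dU j (X.Qt l)) =
      ∑ k, ∑ b, (2 * eps3 i k l * epsUp a b) • ((σ : ℤ) • dU j (X.P k b)) := by
  rw [← dU_D, D_Qt h]
  simp only [map_zsmul, map_sum, map_smul, Finset.smul_sum, smul_comm (σ : ℤ)]

theorem D_dv_eq (h : X.IsVLE σ) (i : Fin 3) (a : Fin 2) :
    D i a X.dv = ∑ l, ∑ k, ∑ b, (2 * eps3 i k l * epsUp a b) • ((σ : ℤ) • dU l (X.P k b)) := by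
  simp only [dv, map_sum, D_dU_Qt h]

theorem D_sl3_eq (h : X.IsVLE σ) (i : Fin 3) (a : Fin 2) (j l : Fin 3) :
    D i a (X.sl3 j l) =
      ∑ k, ∑ b, (2 * eps3 i k l * epsUp a b) • ((σ : ℤ) • dU j (X.P k b)) -
        if j = l then (1 / 3 : ℂ) • D i a X.dv else 0 := by
  rw [sl3, map_sub, D_dU_Qt h]
  split_ifs <;> simp

/-- The derivatives of the `sl(2)` part of `X` are expressed through the spinor `ρ`. -/
theorem D_sl2 (h : X.IsVLE σ) (i : Fin 3) (a b c : Fin 2) :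
    D i a (X.sl2 σ b c) =
      (if a = b then (2 : ℂ) • X.rho i c else 0) - if c = b then X.rho i a else 0 := by
  refine eq_of_dual fun φ => ?_
  have := solve_second (fun k j b => φ ((σ : ℤ) • dU k (X.P j b)))
    (fun i a j l => φ (D i a (X.sl3 j l))) (fun i a => φ (D i a X.dv))
    (fun i a b c => φ (D i a (X.sl2 σ b c))) (fun i a l c j b => φ (D i a ((σ : ℤ) • D l c (X.P j b))))
    (fun i a j l => by
      rw [D_sl3_eq h]
      split_ifs <;> simp only [map_sub, map_sum, map_smul, map_zero, smul_eq_mul])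
    (fun i a => by rw [D_dv_eq h]; simp only [map_sum, map_smul, smul_eq_mul])
    (fun i a l c j b => by
      rw [D_P h]
      split_ifs <;> simp only [map_sub, map_add, map_neg, map_smul, map_zero, smul_eq_mul])
    (fun i a l c j b => by
      rw [map_zsmul (D i a), map_zsmul (D l c), ← map_add, ← smul_add, D_anticomm,
        Finset.smul_sum, map_sum]
      simp only [smul_comm (σ : ℤ), map_smul, smul_eq_mul]) i a b c
  rw [this]
  simp only [rho]
  split_ifs <;> simp only [map_sub, map_smul, map_zero, smul_eq_mul] <;> ring

/-- The derivatives of the `sl(3)` part of `X` are expressed through the spinor `ρ` and a tensor that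
is symmetric in two `sl(3)` indices. The latter drops out of all contractions with symmetric
tensors. -/
theorem D_sl3 (h : X.IsVLE σ) : ∃ S : Fin 2 → Fin 3 → Fin 3 → PSF, (∀ a j k, S a j k = S a k j) ∧
    ∀ i a j l, D i a (X.sl3 j l) = ∑ k, eps3 i k l • S a j k +
      (if j = l then (1 / 3 : ℂ) • X.rho i a else 0) - if i = j then X.rho l a else 0 := by
  refine ⟨fun a j k => ∑ b, epsUp a b • ((σ : ℤ) • dU j (X.P k b) + (σ : ℤ) • dU k (X.P j b)),
    fun a j k => Finset.sum_congr rfl fun b _ => by rw [add_comm], fun i a j l => ?_⟩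
  rw [D_sl3_eq h, rho, rho, D_dv_eq h, D_dv_eq h]
  generalize hT : (fun k j => ∑ b, epsUp a b • ((σ : ℤ) • dU k (X.P j b))) = T
  have hT' : ∀ k j, ∑ b, epsUp a b • ((σ : ℤ) • dU k (X.P j b)) = T k j := fun k j => by rw [← hT]
  simp only [smul_add, Finset.sum_add_distrib, mul_smul, ← Finset.smul_sum, hT']
  simp only [eps3_val, Fin.sum_univ_three]
  fin_cases i <;> fin_cases j <;> fin_cases l <;> simp <;> module

/-- The second derivatives `D^{ia} D^{jb} ∂_k Q̃^k`, antisymmetrised in `a, b` and symmetrised in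
`i, j`, vanish. -/
theorem D_rho (h : X.IsVLE σ) (i j : Fin 3) {a b : Fin 2} (hab : a ≠ b) :
    D i a (X.rho j b) + D j a (X.rho i b) = 0 := by
  have h1 := D_anticomm i j a a (X.sl2 σ a b)
  rw [D_sl2 h, D_sl2 h] at h1
  have h2 : epsUp a a = 0 := sub_self _
  simp only [h2, mul_zero, zero_smul, Finset.sum_const_zero, if_true, if_neg hab.symm, sub_zero,
    map_smul, ← smul_add] at h1
  exact (smul_eq_zero.mp h1).resolve_left two_ne_zero

theorem parity_rho (h : X.IsHomog σ) (i : Fin 3) (a : Fin 2) :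
    parity (X.rho i a) = -((σ : ℤ) • X.rho i a) := by
  rw [rho, map_smul, ← neg_eq_iff_eq_neg, ← smul_neg, ← D_parity, parity_dv h, map_zsmul, smul_comm]

theorem D_mul_of_parity {m : PSF} (hm : parity m = (σ : ℤ) • m) (i : Fin 3) (a : Fin 2) (f : PSF) :
    D i a (m * f) = D i a m * f + (σ : ℤ) • (m * D i a f) := by
  rw [D_mul, hm, smul_mul_assoc]

end VField

/-! ### Symmetric functions of index tuples -/

open Fin (snoc removeNth)

section tuples

variable {α V : Type*} {n : ℕ}

/-- A function of an index tuple that does not depend on the order of the indices. -/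
def IsSymm (g : (Fin n → α) → V) : Prop := ∀ (π : Equiv.Perm (Fin n)) I, g (I ∘ π) = g I

theorem IsSymm.insertNth {g : (Fin (n + 1) → α) → V} (hg : IsSymm g) (k k' : Fin (n + 1)) (x : α)
    (I : Fin n → α) :
    g (Fin.insertNth (α := fun _ => α) k x I) = g (Fin.insertNth (α := fun _ => α) k' x I) := by
  rw [← hg ((finSuccEquiv' k).trans (finSuccEquiv' k').symm)
    (Fin.insertNth (α := fun _ => α) k' x I)]
  congr 1
  ext i
  refine Fin.succAboveCases k ?_ (fun j => ?_) i <;> simp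

theorem IsSymm.update {g : (Fin (n + 1) → α) → V} (hg : IsSymm g) (k : Fin (n + 1)) (x : α)
    (I : Fin (n + 1) → α) :
    g (Function.update I k x) = g (snoc (α := fun _ => α) (removeNth k I) x) := by
  rw [← Fin.insertNth_removeNth, hg.insertNth k (Fin.last n), Fin.insertNth_last]
  rfl

theorem IsSymm.removeNth {g : (Fin (n + 1) → α) → V} (hg : IsSymm g) (k : Fin (n + 1))
    (I : Fin (n + 1) → α) :
    g (snoc (α := fun _ => α) (removeNth k I) (I k)) = g I := by
  rw [← hg.update, Function.update_eq_self]

theorem IsSymm.snoc_left {g : (Fin (n + 1) → α) → V} (hg : IsSymm g) (x : α) :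
    IsSymm fun I : Fin n → α => g (snoc (α := fun _ => α) I x) := by
  intro π I
  change g (snoc (α := fun _ => α) (I ∘ π) x) = g (snoc (α := fun _ => α) I x)
  rw [← hg ((finSuccEquivLast.trans (Equiv.optionCongr π)).trans finSuccEquivLast.symm)
    (snoc (α := fun _ => α) I x)]
  congr 1
  ext i
  refine Fin.lastCases ?_ (fun j => ?_) i <;> simp

theorem IsSymm.snoc_snoc {g : (Fin (n + 2) → α) → V} (hg : IsSymm g) (x y : α)
    (I : Fin n → α) :
    g (snoc (α := fun _ => α) (snoc (α := fun _ => α) I x : Fin (n + 1) → α) y) =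
      g (snoc (α := fun _ => α) (snoc (α := fun _ => α) I y : Fin (n + 1) → α) x) := by
  rw [← hg (Equiv.swap (Fin.last n).castSucc (Fin.last (n + 1)))]
  congr 1
  ext i
  refine Fin.lastCases ?_ (fun j => ?_) i
  · simp
  · refine Fin.lastCases ?_ (fun j => ?_) j
    · simp
    · have h1 : j.castSucc.castSucc ≠ (Fin.last n).castSucc := by
        rw [Ne, Fin.castSucc_inj]; exact (Fin.castSucc_lt_last j).ne
      have h2 : j.castSucc.castSucc ≠ Fin.last (n + 1) := (Fin.castSucc_lt_last _).ne
      simp [Equiv.swap_apply_of_ne_of_ne h1 h2]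

theorem IsSymm.snoc_update {g : (Fin (n + 1) → α) → V} (hg : IsSymm g) (k : Fin n) (x y : α)
    (I : Fin n → α) :
    g (snoc (α := fun _ => α) (Function.update I k x) y) =
      g (snoc (α := fun _ => α) (Function.update I k y) x) := by
  cases n with
  | zero => exact k.elim0
  | succ n =>
    rw [(hg.snoc_left y).update, (hg.snoc_left x).update, hg.snoc_snoc]

/-- Splitting off one index in all possible ways symmetrises over it. -/
theorem isSymm_removeNth_sum [AddCommMonoid V] {F : α → (Fin n → α) → V}
    (hF : ∀ x, IsSymm (F x)) : IsSymm fun J : Fin (n + 1) → α => ∑ k, F (J k) (removeNth k J) := by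
  intro π J
  refine Fintype.sum_equiv π _ _ fun k => ?_
  have h1 : ∀ i, ∃ j, (π k).succAbove j = π (k.succAbove i) := fun i =>
    Fin.exists_succAbove_eq fun h => Fin.succAbove_ne k i (π.injective h)
  choose f hf using h1
  have hinj : Function.Injective f := by
    intro i j hij
    have := hf i
    rw [hij, hf] at this
    exact (Fin.succAbove_right_injective (π.injective this)).symm
  have h2 : removeNth k (J ∘ π) = removeNth (π k) J ∘
      (Equiv.ofBijective f (Finite.injective_iff_bijective.mp hinj)) := by
    ext i
    simp [Fin.removeNth, hf]
  simp only [h2, hF _ _ _, Function.comp_apply]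

/-- Exchanging the first two of the indices that are split off an index tuple. -/
theorem sum_removeNth_swap [AddCommMonoid V] (Φ : α → α → (Fin n → α) → V) (J : Fin (n + 2) → α) :
    ∑ k : Fin (n + 2), ∑ l : Fin (n + 1),
        Φ (J k) (removeNth k J l) (removeNth l (removeNth k J)) =
      ∑ k : Fin (n + 2), ∑ l : Fin (n + 1),
        Φ (removeNth k J l) (J k) (removeNth l (removeNth k J)) := by
  rw [← Fintype.sum_prod_type', ← Fintype.sum_prod_type']
  refine Finset.sum_bij' (fun x _ => (x.1.succAbove x.2, x.2.predAbove x.1))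
    (fun x _ => (x.1.succAbove x.2, x.2.predAbove x.1)) (by simp) (by simp) ?_ ?_ ?_
  · rintro ⟨k, l⟩ -
    simp [Fin.succAbove_succAbove_predAbove, Fin.predAbove_predAbove_succAbove]
  · rintro ⟨k, l⟩ -
    simp [Fin.succAbove_succAbove_predAbove, Fin.predAbove_predAbove_succAbove]
  · rintro ⟨k, l⟩ -
    dsimp only
    rw [← Fin.removeNth_removeNth_eq_swap]
    simp only [Fin.removeNth, Fin.succAbove_succAbove_predAbove]

/-- Symmetrisation over two indices annihilates what is antisymmetric in them. -/
theorem sum_removeNth_antisymm [AddCommGroup V] [Module ℂ V] {Φ : α → α → (Fin n → α) → V}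
    (hΦ : ∀ x y r, Φ x y r = -Φ y x r) (J : Fin (n + 2) → α) :
    ∑ k : Fin (n + 2), ∑ l : Fin (n + 1),
        Φ (J k) (removeNth k J l) (removeNth l (removeNth k J)) = 0 := by
  have h1 := sum_removeNth_swap Φ J
  simp only [hΦ (removeNth _ J _), Finset.sum_neg_distrib] at h1
  have h2 := add_eq_zero_iff_eq_neg.mpr h1
  rw [← two_smul ℂ] at h2
  exact (smul_eq_zero.mp h2).resolve_left two_ne_zero

end tuples

/-! ### The action of matrix-valued functions on index tuples -/

section rot

variable {α : Type*} [Fintype α] {n : ℕ}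

/-- The derivation-like action of a matrix `m` of superfunctions on a tensor. -/
def rot (m : α → α → PSF) (g : (Fin n → α) → PSF) (I : Fin n → α) : PSF :=
  ∑ k, ∑ l, m (I k) l * g (Function.update I k l)

variable {m : α → α → PSF} {σ : ℤˣ} {T : α → PSF →ₗ[ℂ] PSF}

/-- Contraction of a tensor of operators with the last index is equivariant up to derivatives
of the matrix `m`. -/
theorem contract_rot (hT : ∀ j x y f, T j (m x y * f) = T j (m x y) * f + (σ : ℤ) • (m x y * T j f))
    (g : (Fin (n + 1) → α) → PSF) (I : Fin n → α) :
    ∑ j, T j (rot m g (snoc (α := fun _ => α) I j)) =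
      (σ : ℤ) • (∑ j, ∑ l, m l j * T l (g (snoc (α := fun _ => α) I j)) +
        rot m (fun I => ∑ j, T j (g (snoc (α := fun _ => α) I j))) I) +
      (∑ k, ∑ j, ∑ l, T j (m (I k) l) * g (snoc (α := fun _ => α) (Function.update I k l) j) +
        ∑ j, ∑ l, T j (m j l) * g (snoc (α := fun _ => α) I l)) := by
  have e : ∀ j, rot m g (snoc (α := fun _ => α) I j) =
      ∑ k, ∑ l, m (I k) l * g (snoc (α := fun _ => α) (Function.update I k l) j) +
        ∑ l, m j l * g (snoc (α := fun _ => α) I l) := by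
    intro j
    simp only [rot, Fin.sum_univ_castSucc, Fin.snoc_castSucc, Fin.snoc_last, ← Fin.snoc_update,
      Fin.update_snoc_last]
  have e1 : rot m (fun I => ∑ j, T j (g (snoc (α := fun _ => α) I j))) I =
      ∑ j, ∑ k, ∑ l, m (I k) l * T j (g (snoc (α := fun _ => α) (Function.update I k l) j)) := by
    simp only [rot, Finset.mul_sum]
    rw [Finset.sum_comm]
    refine (Finset.sum_congr rfl fun k _ => Finset.sum_comm).trans ?_
    rw [Finset.sum_comm]
    exact Finset.sum_congr rfl fun k _ => Finset.sum_comm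
  have e2 : ∑ j, ∑ l, m l j * T l (g (snoc (α := fun _ => α) I j)) =
      ∑ j, ∑ l, m j l * T j (g (snoc (α := fun _ => α) I l)) := Finset.sum_comm
  have e3 : ∑ k, ∑ j, ∑ l, T j (m (I k) l) * g (snoc (α := fun _ => α) (Function.update I k l) j) =
      ∑ j, ∑ k, ∑ l, T j (m (I k) l) * g (snoc (α := fun _ => α) (Function.update I k l) j) :=
    Finset.sum_comm
  rw [e1, e2, e3]
  simp only [e, map_add, map_sum, hT, Finset.sum_add_distrib, smul_add, Finset.smul_sum]
  abel

/-- Adjoining the index of a tensor of operators, with symmetrisation, is equivariant up to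
derivatives of the matrix `m`. -/
theorem adjoin_rot (hT : ∀ j x y f, T j (m x y * f) = T j (m x y) * f + (σ : ℤ) • (m x y * T j f))
    (g : (Fin n → α) → PSF) (J : Fin (n + 1) → α) :
    (σ : ℤ) • rot m (fun J => ∑ k, T (J k) (g (removeNth k J))) J +
        ∑ k, ∑ i, ∑ l, T (J k) (m (removeNth k J i) l) * g (Function.update (removeNth k J) i l) =
      ∑ k, T (J k) (rot m g (removeNth k J)) +
        (σ : ℤ) • ∑ k, ∑ l, m (J k) l * T l (g (removeNth k J)) := by
  have e : rot m (fun J => ∑ k, T (J k) (g (removeNth k J))) J =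
      ∑ k, (∑ l, m (J k) l * T l (g (removeNth k J)) +
        ∑ i, ∑ l, m (removeNth k J i) l * T (J k) (g (Function.update (removeNth k J) i l))) := by
    simp only [rot, Finset.mul_sum]
    have e1 : ∀ i, ∑ l, ∑ k, m (J i) l * T (Function.update J i l k)
        (g (removeNth k (Function.update J i l))) = ∑ k, ∑ l, m (J i) l *
        T (Function.update J i l k) (g (removeNth k (Function.update J i l))) :=
      fun i => Finset.sum_comm
    simp only [e1]
    rw [Finset.sum_comm]
    refine Finset.sum_congr rfl fun k _ => ?_
    rw [Fin.sum_univ_succAbove _ k]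
    congr 1
    · simp
    · refine Finset.sum_congr rfl fun i _ => Finset.sum_congr rfl fun l _ => ?_
      rw [Fin.removeNth_update_succAbove, Function.update_of_ne (Fin.succAbove_ne k i).symm]
      rfl
  rw [e]
  simp only [rot, map_sum, hT, Finset.sum_add_distrib, smul_add, Finset.smul_sum]
  abel

end rot

theorem sign_smul_smul {V : Type*} [AddCommGroup V] (σ : ℤˣ) (x : V) :
    (σ : ℤ) • (σ : ℤ) • x = x := by
  rcases Int.units_eq_one_or σ with rfl | rfl <;> simp

/-! ### Derivatives of the structure functions, contracted with symmetric tensors -/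

section residual

variable {σ : ℤˣ} {X : VField} {n : ℕ}

/-- The trace over `j` of the derivative of `sl3`, contracted with a symmetric tensor. The symmetric
tensor in `D_sl3` occurs in the combination `ε^{jkl} S_{xk} H_{jl} = 0`. -/
theorem sum_D_sl3_symm (h : X.IsVLE σ) (b : Fin 2) (x : Fin 3) {H : Fin 3 → Fin 3 → PSF}
    (hH : ∀ j l, H j l = H l j) :
    ∑ j, ∑ l, D j b (X.sl3 x l) * H j l = -((2 / 3 : ℂ) • ∑ j, X.rho j b * H j x) := by
  obtain ⟨S, hS, hD⟩ := X.D_sl3 h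
  simp only [hD, hH 1 0, hH 2 0, hH 2 1, eps3_val, Fin.sum_univ_three]
  fin_cases x <;> simp [sub_mul, add_mul, hH 1 0, hH 2 0, hH 2 1] <;> module

/-- The contribution of the contracted index. The symmetric tensor in `D_sl3` occurs in the
combination `ε^{jkl} S_{jk} = 0`. -/
theorem sum_D_sl3_diag (h : X.IsVLE σ) (b : Fin 2) (H : Fin 3 → PSF) :
    ∑ j, ∑ l, D j b (X.sl3 j l) * H l = -((8 / 3 : ℂ) • ∑ j, X.rho j b * H j) := by
  obtain ⟨S, hS, hD⟩ := X.D_sl3 h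
  simp only [hD, hS b 1 0, hS b 2 0, hS b 2 1, eps3_val, Fin.sum_univ_three]
  simp [sub_mul]
  module

theorem sum_D_sl2_symm (h : X.IsVLE σ) (j : Fin 3) (x : Fin 2) {H : Fin 2 → Fin 2 → PSF}
    (hH : ∀ b c, H b c = H c b) :
    ∑ b, ∑ c, D j b (X.sl2 σ x c) * H b c = ∑ b, X.rho j b * H b x := by
  simp only [X.D_sl2 h, hH 1 0, Fin.sum_univ_two]
  fin_cases x <;> simp [sub_mul, hH 1 0] <;> module

theorem sum_D_sl2_diag (h : X.IsVLE σ) (j : Fin 3) (H : Fin 2 → PSF) :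
    ∑ b, ∑ c, D j b (X.sl2 σ b c) * H c = (3 : ℂ) • ∑ b, X.rho j b * H b := by
  simp only [X.D_sl2 h, Fin.sum_univ_two]
  simp [sub_mul]
  module

/-- `D^j_a = ε_{ab} D^{jb}` for a general tensor of operators. -/
def lowerOp (T : Fin 3 → Fin 2 → PSF →ₗ[ℂ] PSF) (i : Fin 3) (a : Fin 2) : PSF →ₗ[ℂ] PSF :=
  ∑ b, epsLow a b • T i b

theorem lowerOp_apply (T : Fin 3 → Fin 2 → PSF →ₗ[ℂ] PSF) (i : Fin 3) (a : Fin 2) (f : PSF) :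
    lowerOp T i a f = ∑ b, epsLow a b • T i b f := by
  simp [lowerOp]

theorem Dlow_eq (i : Fin 3) (a : Fin 2) : Dlow i a = lowerOp D i a := rfl

/-- Multiplication by the spinor `ρ^{ia}`. -/
def rhoOp (X : VField) (i : Fin 3) (a : Fin 2) : PSF →ₗ[ℂ] PSF := LinearMap.mulLeft ℂ (X.rho i a)

@[simp] theorem rhoOp_apply (X : VField) (i : Fin 3) (a : Fin 2) (f : PSF) :
    rhoOp X i a f = X.rho i a * f := rfl

theorem D_sl3_mul (h : X.IsVLE σ) (i j l : Fin 3) (a : Fin 2) (f : PSF) :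
    D i a (X.sl3 j l * f) = D i a (X.sl3 j l) * f + (σ : ℤ) • (X.sl3 j l * D i a f) :=
  VField.D_mul_of_parity (X.parity_sl3 h.1 j l) i a f

theorem D_sl2_mul (h : X.IsVLE σ) (i : Fin 3) (a b c : Fin 2) (f : PSF) :
    D i a (X.sl2 σ b c * f) = D i a (X.sl2 σ b c) * f + (σ : ℤ) • (X.sl2 σ b c * D i a f) :=
  VField.D_mul_of_parity (X.parity_sl2 h.1 b c) i a f

theorem D_dv_mul (h : X.IsVLE σ) (i : Fin 3) (a : Fin 2) (f : PSF) :
    D i a (X.dv * f) = (2 : ℂ) • (X.rho i a * f) + (σ : ℤ) • (X.dv * D i a f) := by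
  rw [VField.D_mul_of_parity (X.parity_dv h.1), X.D_dv, smul_mul_assoc]

theorem Dlow_mul_of_parity {m : PSF} (hm : parity m = (σ : ℤ) • m) (i : Fin 3) (a : Fin 2)
    (f : PSF) : Dlow i a (m * f) = Dlow i a m * f + (σ : ℤ) • (m * Dlow i a f) := by
  simp only [Dlow_eq, lowerOp_apply, VField.D_mul_of_parity hm, smul_add, Finset.sum_add_distrib,
    Finset.sum_mul, smul_mul_assoc, Finset.mul_sum, mul_smul_comm, Finset.smul_sum,
    smul_comm (σ : ℤ)]

/-- The bracket of `X` with `D^i_a`. -/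
theorem act_Dlow (h : X.IsVLE σ) (i : Fin 3) (a : Fin 2) (f : PSF) :
    X.act (Dlow i a f) = (σ : ℤ) • Dlow i a (X.act f) + ∑ j, X.sl3 j i * Dlow j a f -
      ∑ c, X.sl2 σ a c * Dlow i c f - (1 / 6 : ℂ) • (X.dv * Dlow i a f) := by
  have htr := X.sl2_trace h
  simp only [Fin.sum_univ_two] at htr
  have h1 : X.sl2 σ 1 1 = -X.sl2 σ 0 0 := (neg_eq_of_add_eq_zero_right htr).symm
  simp only [Dlow_eq, lowerOp_apply, epsLow, Fin.sum_univ_two, Fin.sum_univ_three]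
  fin_cases a <;> simp [h1, X.act_D h, Fin.sum_univ_three, -zsmul_eq_mul] <;> module

/-- Contraction with an `sl(3)` index commutes with the action of the `sl(3)` part of `X`, up to a
multiple of the contraction with the spinor `ρ` that depends on the number of indices. -/
theorem contract_sl3 (h : X.IsVLE σ) (b : Fin 2) {g : (Fin (n + 1) → Fin 3) → PSF} (hg : IsSymm g)
    (I : Fin n → Fin 3) :
    (σ : ℤ) • ∑ j, D j b (rot X.sl3 g (snoc (α := fun _ => Fin 3) I j)) =
      ∑ j, ∑ l, X.sl3 l j * D l b (g (snoc (α := fun _ => Fin 3) I j)) +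
        rot X.sl3 (fun I => ∑ j, D j b (g (snoc (α := fun _ => Fin 3) I j))) I -
      (σ : ℤ) • ((2 / 3 * (n + 1 : ℂ) + 2) • ∑ j, X.rho j b * g (snoc (α := fun _ => Fin 3) I j)) := by
  rw [contract_rot (T := fun j => D j b) fun j x y f => D_sl3_mul h j x y b f, smul_add,
    sign_smul_smul, sub_eq_add_neg, ← smul_neg]
  congr 2
  rw [sum_D_sl3_diag h]
  have e : ∀ k, ∑ j, ∑ l, D j b (X.sl3 (I k) l) *
      g (snoc (α := fun _ => Fin 3) (Function.update I k l) j) =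
        -((2 / 3 : ℂ) • ∑ j, X.rho j b * g (snoc (α := fun _ => Fin 3) I j)) := by
    intro k
    rw [sum_D_sl3_symm h b (I k) (H := fun j l =>
      g (snoc (α := fun _ => Fin 3) (Function.update I k l) j)) fun j l => hg.snoc_update k l j I]
    simp only [Function.update_eq_self]
  simp only [e, Finset.sum_const, Finset.card_univ, Fintype.card_fin]
  module

/-- Contraction with an `sl(2)` index commutes with the action of the `sl(2)` part of `X`, up to a
multiple of the contraction with the spinor `ρ` that depends on the number of indices. -/
theorem contract_sl2 (h : X.IsVLE σ) (j : Fin 3) {g : (Fin (n + 1) → Fin 2) → PSF} (hg : IsSymm g)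
    (B : Fin n → Fin 2) :
    (σ : ℤ) • ∑ b, D j b (rot (X.sl2 σ) g (snoc (α := fun _ => Fin 2) B b)) =
      ∑ b, ∑ c, X.sl2 σ c b * D j c (g (snoc (α := fun _ => Fin 2) B b)) +
        rot (X.sl2 σ) (fun B => ∑ b, D j b (g (snoc (α := fun _ => Fin 2) B b))) B +
      (σ : ℤ) • ((n + 3 : ℂ) • ∑ b, X.rho j b * g (snoc (α := fun _ => Fin 2) B b)) := by
  rw [contract_rot (T := fun b => D j b) fun b x y f => D_sl2_mul h j b x y f, smul_add,
    sign_smul_smul]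
  congr 2
  rw [sum_D_sl2_diag h]
  have e : ∀ k, ∑ b, ∑ c, D j b (X.sl2 σ (B k) c) *
      g (snoc (α := fun _ => Fin 2) (Function.update B k c) b) =
        ∑ b, X.rho j b * g (snoc (α := fun _ => Fin 2) B b) := by
    intro k
    rw [sum_D_sl2_symm h j (B k) (H := fun b c =>
      g (snoc (α := fun _ => Fin 2) (Function.update B k c) b)) fun b c => hg.snoc_update k c b B]
    simp only [Function.update_eq_self]
  simp only [e, Finset.sum_const, Finset.card_univ, Fintype.card_fin]
  module

/-- Adjoining an upper `sl(3)` index commutes with the action of the `sl(3)` part of `X`, up to a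
multiple of the product with the spinor `ρ` that depends on the number of indices. -/
theorem adjoin_sl3 (h : X.IsVLE σ) (b : Fin 2) {g : (Fin n → Fin 3) → PSF} (hg : IsSymm g)
    (J : Fin (n + 1) → Fin 3) :
    (σ : ℤ) • ∑ k, D (J k) b (rot (fun j l => X.sl3 l j) g (removeNth k J)) =
      rot (fun j l => X.sl3 l j) (fun J => ∑ k, D (J k) b (g (removeNth k J))) J -
        ∑ k, ∑ l, X.sl3 l (J k) * D l b (g (removeNth k J)) -
      (σ : ℤ) • ((2 / 3 * n : ℂ) • ∑ k, X.rho (J k) b * g (removeNth k J)) := by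
  have h1 := adjoin_rot (m := fun j l => X.sl3 l j) (T := fun j => D j b)
    (fun j x y f => D_sl3_mul h j y x b f) g J
  have h2 : ∑ k, ∑ i, ∑ l, D (J k) b (X.sl3 l (removeNth k J i)) *
      g (Function.update (removeNth k J) i l) =
        -((2 / 3 * n : ℂ) • ∑ k, X.rho (J k) b * g (removeNth k J)) := by
    cases n with
    | zero => simp
    | succ n =>
      obtain ⟨S, hS, hD⟩ := X.D_sl3 h
      have e1 : ∀ x y (r : Fin n → Fin 3), ∑ l, D x b (X.sl3 l y) * g (snoc (α := fun _ => Fin 3) r l) =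
          ∑ l, ∑ k, eps3 x k y • (S b l k * g (snoc (α := fun _ => Fin 3) r l)) +
          ((1 / 3 : ℂ) • (X.rho x b * g (snoc (α := fun _ => Fin 3) r y)) -
          X.rho y b * g (snoc (α := fun _ => Fin 3) r x)) := by
        intro x y r
        simp only [hD, add_mul, sub_mul, ite_mul, zero_mul, Finset.sum_add_distrib,
          Finset.sum_sub_distrib, Finset.sum_ite_eq, Finset.sum_ite_eq', Finset.mem_univ, if_true,
          Finset.sum_mul, smul_mul_assoc]
        abel
      simp only [hg.update, e1, Finset.sum_add_distrib, Finset.sum_sub_distrib]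
      rw [sum_removeNth_antisymm (Φ := fun x y r =>
        ∑ l, ∑ k, eps3 x k y • (S b l k * g (snoc (α := fun _ => Fin 3) r l)))
        (fun x y r => by
          simp only [← Finset.sum_neg_distrib, ← neg_smul]
          refine Finset.sum_congr rfl fun l _ => Finset.sum_congr rfl fun k _ => ?_
          congr 1; unfold eps3; ring),
        sum_removeNth_swap (fun x y r => X.rho y b * g (snoc (α := fun _ => Fin 3) r x))]
      simp only [hg.removeNth, Finset.sum_const, Finset.card_univ, Fintype.card_fin,
        ← Finset.smul_sum, Nat.cast_add, Nat.cast_one]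
      module
  rw [h2] at h1
  have h3 := congrArg (fun x => (σ : ℤ) • x) h1
  simp only [smul_add, sign_smul_smul, smul_neg] at h3
  rw [eq_sub_iff_add_eq, eq_sub_iff_add_eq, ← sub_eq_zero, ← sub_eq_zero.mpr h3.symm]
  abel

/-- Adjoining an `sl(2)` index commutes with the action of the `sl(2)` part of `X`, up to a multiple
of the product with the spinor `ρ` that depends on the number of indices. -/
theorem adjoin_sl2 (h : X.IsVLE σ) (j : Fin 3) {g : (Fin n → Fin 2) → PSF} (hg : IsSymm g)
    (B : Fin (n + 1) → Fin 2) :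
    (σ : ℤ) • ∑ k, Dlow j (B k) (rot (X.sl2 σ) g (removeNth k B)) =
      rot (X.sl2 σ) (fun B => ∑ k, Dlow j (B k) (g (removeNth k B))) B -
        ∑ k, ∑ c, X.sl2 σ (B k) c * Dlow j c (g (removeNth k B)) -
      (σ : ℤ) • ((n : ℂ) • ∑ k, lowerOp (rhoOp X) j (B k) (g (removeNth k B))) := by
  have h1 := adjoin_rot (m := X.sl2 σ) (T := fun b => Dlow j b)
    (fun a x y f => Dlow_mul_of_parity (X.parity_sl2 h.1 x y) j a f) g B
  have h2 : ∑ k, ∑ i, ∑ c, Dlow j (B k) (X.sl2 σ (removeNth k B i) c) *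
      g (Function.update (removeNth k B) i c) =
        -((n : ℂ) • ∑ k, lowerOp (rhoOp X) j (B k) (g (removeNth k B))) := by
    cases n with
    | zero => simp
    | succ n =>
      have e1 : ∀ x y (r : Fin n → Fin 2),
          ∑ c, Dlow j x (X.sl2 σ y c) * g (snoc (α := fun _ => Fin 2) r c) =
          ∑ c, (2 * epsLow x y) • (X.rho j c * g (snoc (α := fun _ => Fin 2) r c)) -
            lowerOp (rhoOp X) j x (g (snoc (α := fun _ => Fin 2) r y)) := by
        intro x y r
        simp only [Dlow_eq, lowerOp_apply, X.D_sl2 h, Fin.sum_univ_two, epsLow, rhoOp_apply]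
        fin_cases x <;> fin_cases y <;> simp [sub_mul] <;> module
      simp only [hg.update, e1, Finset.sum_sub_distrib]
      rw [sum_removeNth_antisymm (Φ := fun x y r =>
        ∑ c, (2 * epsLow x y) • (X.rho j c * g (snoc (α := fun _ => Fin 2) r c)))
        (fun x y r => by
          simp only [← Finset.sum_neg_distrib, ← neg_smul]
          refine Finset.sum_congr rfl fun l _ => ?_
          congr 1; unfold epsLow; ring)]
      simp only [hg.removeNth, Finset.sum_const, Finset.card_univ, Fintype.card_fin,
        ← Finset.smul_sum, Nat.cast_add, Nat.cast_one]
      module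
  rw [h2] at h1
  have h3 := congrArg (fun x => (σ : ℤ) • x) h1
  simp only [smul_add, sign_smul_smul, smul_neg] at h3
  rw [eq_sub_iff_add_eq, eq_sub_iff_add_eq, ← sub_eq_zero, ← sub_eq_zero.mpr h3.symm]
  abel

end residual

/-! ### The first-order operators and the Lie derivative -/

section firstOrder

variable {σ : ℤˣ} {X : VField} {p q r : ℕ}

/-- `T^{jb} ω_{i_1..i_p j|a_1..a_r b}` for a tensor of operators `T^{jb}`. -/
def opA (T : Fin 3 → Fin 2 → PSF →ₗ[ℂ] PSF) (ω : Comp (p + 1) 0 (r + 1)) : Comp p 0 r :=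
  fun I J B => ∑ j, ∑ b, T j b (ω (snoc I j) J (snoc B b))

/-- `T^{jb} ω_{i_1..i_p j}^{a_1..a_r}`, symmetrised, for a tensor of operators `T^{jb}`. -/
def opB (T : Fin 3 → Fin 2 → PSF →ₗ[ℂ] PSF) (ω : Comp (p + 1) 0 r) : Comp p 0 (r + 1) :=
  fun I J B => ∑ m, ∑ j, lowerOp T j (B m) (ω (snoc I j) J (removeNth m B))

/-- `T^{jb} ω^{i_1..i_q}_{a_1..a_r b}`, symmetrised, for a tensor of operators `T^{jb}`. -/
def opC (T : Fin 3 → Fin 2 → PSF →ₗ[ℂ] PSF) (ω : Comp 0 q (r + 1)) : Comp 0 (q + 1) r :=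
  fun I J B => ∑ k, ∑ b, T (J k) b (ω I (removeNth k J) (snoc B b))

/-- `T^{jb} ω^{i_1..i_q|a_1..a_r}`, symmetrised, for a tensor of operators `T^{jb}`. -/
def opD (T : Fin 3 → Fin 2 → PSF →ₗ[ℂ] PSF) (ω : Comp 0 q r) : Comp 0 (q + 1) (r + 1) :=
  fun I J B => ∑ k, ∑ m, lowerOp T (J k) (B m) (ω I (removeNth k J) (removeNth m B))

theorem rot_sum {α ι : Type*} [Fintype α] [Fintype ι] {n : ℕ} (m : α → α → PSF)
    (g : ι → (Fin n → α) → PSF) (I : Fin n → α) :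
    rot m (fun I => ∑ x, g x I) I = ∑ x, rot m (g x) I := by
  simp only [rot, Finset.mul_sum]
  rw [Finset.sum_comm]
  rw [Finset.sum_comm (s := Finset.univ (α := ι))]
  exact Finset.sum_comm.trans (Finset.sum_congr rfl fun k _ => Finset.sum_comm)

theorem lie_lower (z : ℤ) (ω : Comp p 0 r) (I : Fin p → Fin 3) (J : Fin 0 → Fin 3)
    (B : Fin r → Fin 2) : lie ⟨p, 0, r, z⟩ σ X ω I J B =
      X.act (ω I J B) + rot X.sl3 (fun I => ω I J B) I + rot (X.sl2 σ) (fun B => ω I J B) B +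
        ((z : ℂ) / 6) • (X.dv * ω I J B) := by
  simp [lie, rot]

theorem lie_upper (z : ℤ) (ω : Comp 0 q r) (I : Fin 0 → Fin 3) (J : Fin q → Fin 3)
    (B : Fin r → Fin 2) : lie ⟨0, q, r, z⟩ σ X ω I J B =
      X.act (ω I J B) - rot (fun j l => X.sl3 l j) (fun J => ω I J B) J +
        rot (X.sl2 σ) (fun B => ω I J B) B + ((z : ℂ) / 6) • (X.dv * ω I J B) := by
  simp [lie, rot]

theorem isSymm_I {τ : Label} {ω : Comp τ.p τ.q τ.r} (hω : ω ∈ T τ) (J : Fin τ.q → Fin 3)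
    (B : Fin τ.r → Fin 2) : IsSymm fun I => ω I J B := fun π I => hω.1 π I J B

theorem isSymm_J {τ : Label} {ω : Comp τ.p τ.q τ.r} (hω : ω ∈ T τ) (I : Fin τ.p → Fin 3)
    (B : Fin τ.r → Fin 2) : IsSymm fun J => ω I J B := fun π J => hω.2.1 π I J B

theorem isSymm_B {τ : Label} {ω : Comp τ.p τ.q τ.r} (hω : ω ∈ T τ) (I : Fin τ.p → Fin 3)
    (J : Fin τ.q → Fin 3) : IsSymm fun B => ω I J B := fun π B => hω.2.2.1 π I J B

/-- The defect of invariance of the first-order operator of sector `A` for arbitrary weights. -/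
theorem lie_opA (h : X.IsVLE σ) (z z' : ℤ) {ω : Comp (p + 1) 0 (r + 1)}
    (hω : ω ∈ T ⟨p + 1, 0, r + 1, z⟩) :
    lie ⟨p, 0, r, z'⟩ σ X (opA D ω) = (σ : ℤ) • opA D (lie ⟨p + 1, 0, r + 1, z⟩ σ X ω) +
      (((z' - z - 1 : ℤ) : ℂ) / 6) • (fun I J B => X.dv * opA D ω I J B) -
      (σ : ℤ) • (((z - (2 * (p + 1) - 3 * (r + 1)) : ℤ) : ℂ) / 3) • opA (rhoOp X) ω := by
  funext I J B
  simp only [Pi.sub_apply, Pi.add_apply, Pi.smul_apply, lie_lower, opA, rhoOp_apply]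
  have h3 : (σ : ℤ) • ∑ j, ∑ b, D j b (rot X.sl3 (fun I => ω I J (snoc B b)) (snoc I j)) =
      ∑ j, ∑ b, ∑ l, X.sl3 l j * D l b (ω (snoc I j) J (snoc B b)) +
      rot X.sl3 (fun I => ∑ j, ∑ b, D j b (ω (snoc I j) J (snoc B b))) I -
      (σ : ℤ) • ((2 / 3 * (p + 1 : ℂ) + 2) •
        ∑ j, ∑ b, X.rho j b * ω (snoc I j) J (snoc B b)) := by
    have e1 : rot X.sl3 (fun I => ∑ j, ∑ b, D j b (ω (snoc I j) J (snoc B b))) I =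
        ∑ b, rot X.sl3 (fun I => ∑ j, D j b (ω (snoc I j) J (snoc B b))) I := by
      rw [← rot_sum]
      exact congrArg (fun g => rot X.sl3 g I) (funext fun I => Finset.sum_comm)
    rw [e1, Finset.sum_comm, Finset.sum_comm (f := fun j b => ∑ l, X.sl3 l j * _),
      Finset.sum_comm (f := fun j b => X.rho j b * _), Finset.smul_sum, Finset.smul_sum,
      Finset.smul_sum, ← Finset.sum_add_distrib, ← Finset.sum_sub_distrib]
    exact Finset.sum_congr rfl fun b _ => contract_sl3 h b (isSymm_I hω J (snoc B b)) I
  have h2 : (σ : ℤ) • ∑ j, ∑ b, D j b (rot (X.sl2 σ) (fun B => ω (snoc I j) J B) (snoc B b)) =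
      ∑ j, ∑ b, ∑ c, X.sl2 σ c b * D j c (ω (snoc I j) J (snoc B b)) +
      rot (X.sl2 σ) (fun B => ∑ j, ∑ b, D j b (ω (snoc I j) J (snoc B b))) B +
      (σ : ℤ) • ((r + 3 : ℂ) •
        ∑ j, ∑ b, X.rho j b * ω (snoc I j) J (snoc B b)) := by
    rw [rot_sum, Finset.smul_sum, Finset.smul_sum, Finset.smul_sum, ← Finset.sum_add_distrib,
      ← Finset.sum_add_distrib]
    exact Finset.sum_congr rfl fun j _ => contract_sl2 h j (isSymm_B hω (snoc I j) J) B
  have h1 : X.act (∑ j, ∑ b, D j b (ω (snoc I j) J (snoc B b))) =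
      (σ : ℤ) • ∑ j, ∑ b, D j b (X.act (ω (snoc I j) J (snoc B b))) +
      ∑ j, ∑ b, ∑ l, X.sl3 l j * D l b (ω (snoc I j) J (snoc B b)) +
      ∑ j, ∑ b, ∑ c, X.sl2 σ c b * D j c (ω (snoc I j) J (snoc B b)) -
      (1 / 6 : ℂ) • (X.dv * ∑ j, ∑ b, D j b (ω (snoc I j) J (snoc B b))) := by
    simp only [map_sum, X.act_D h, Finset.sum_add_distrib, Finset.sum_sub_distrib,
      ← Finset.smul_sum, ← Finset.mul_sum]
  have h4 : ∑ j, ∑ b, D j b (X.dv * ω (snoc I j) J (snoc B b)) =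
      (2 : ℂ) • ∑ j, ∑ b, X.rho j b * ω (snoc I j) J (snoc B b) +
        (σ : ℤ) • (X.dv * ∑ j, ∑ b, D j b (ω (snoc I j) J (snoc B b))) := by
    simp only [D_dv_mul h, Finset.sum_add_distrib, ← Finset.smul_sum, ← Finset.mul_sum]
  simp only [map_add, map_smul, Finset.sum_add_distrib, smul_add, h1, h2, h3, ← Finset.smul_sum, h4]
  push_cast
  rw [smul_comm ((z : ℂ) / 6) (σ : ℤ), sign_smul_smul]
  module

theorem rot_lin {α : Type*} [Fintype α] {n : ℕ} (m : α → α → PSF) (g g' : (Fin n → α) → PSF)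
    (c c' : ℂ) (I : Fin n → α) :
    rot m (fun I => c • g I + c' • g' I) I = c • rot m g I + c' • rot m g' I := by
  simp only [rot, mul_add, mul_smul_comm, Finset.sum_add_distrib, Finset.smul_sum]

theorem lowerOp_apply_two (T : Fin 3 → Fin 2 → PSF →ₗ[ℂ] PSF) (i : Fin 3) (a : Fin 2) (f : PSF) :
    lowerOp T i a f = epsLow a 0 • T i 0 f + epsLow a 1 • T i 1 f := by
  rw [lowerOp_apply, Fin.sum_univ_two]

theorem contract_sl3_low {n : ℕ} (h : X.IsVLE σ) (a : Fin 2) {g : (Fin (n + 1) → Fin 3) → PSF}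
    (hg : IsSymm g) (I : Fin n → Fin 3) :
    (σ : ℤ) • ∑ j, Dlow j a (rot X.sl3 g (snoc (α := fun _ => Fin 3) I j)) =
      ∑ j, ∑ l, X.sl3 l j * Dlow l a (g (snoc (α := fun _ => Fin 3) I j)) +
        rot X.sl3 (fun I => ∑ j, Dlow j a (g (snoc (α := fun _ => Fin 3) I j))) I -
      (σ : ℤ) • ((2 / 3 * (n + 1 : ℂ) + 2) •
        ∑ j, lowerOp (rhoOp X) j a (g (snoc (α := fun _ => Fin 3) I j))) := by
  have e0 := contract_sl3 h 0 hg I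
  have e1 := contract_sl3 h 1 hg I
  simp only [Dlow_eq, lowerOp_apply_two, Finset.sum_add_distrib, mul_add, mul_smul_comm,
    ← Finset.smul_sum, rot_lin, rhoOp_apply]
  linear_combination (norm := module) epsLow a 0 • e0 + epsLow a 1 • e1

theorem adjoin_sl3_low {n : ℕ} (h : X.IsVLE σ) (a : Fin 2) {g : (Fin n → Fin 3) → PSF}
    (hg : IsSymm g) (J : Fin (n + 1) → Fin 3) :
    (σ : ℤ) • ∑ k, Dlow (J k) a (rot (fun j l => X.sl3 l j) g (removeNth k J)) =
      rot (fun j l => X.sl3 l j) (fun J => ∑ k, Dlow (J k) a (g (removeNth k J))) J -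
        ∑ k, ∑ l, X.sl3 l (J k) * Dlow l a (g (removeNth k J)) -
      (σ : ℤ) • ((2 / 3 * n : ℂ) • ∑ k, lowerOp (rhoOp X) (J k) a (g (removeNth k J))) := by
  have e0 := adjoin_sl3 h 0 hg J
  have e1 := adjoin_sl3 h 1 hg J
  simp only [Dlow_eq, lowerOp_apply_two, Finset.sum_add_distrib, mul_add, mul_smul_comm,
    ← Finset.smul_sum, rot_lin, rhoOp_apply]
  linear_combination (norm := module) epsLow a 0 • e0 + epsLow a 1 • e1

theorem Dlow_dv_mul (h : X.IsVLE σ) (i : Fin 3) (a : Fin 2) (f : PSF) :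
    Dlow i a (X.dv * f) = (2 : ℂ) • lowerOp (rhoOp X) i a f + (σ : ℤ) • (X.dv * Dlow i a f) := by
  simp only [Dlow_eq, lowerOp_apply_two, D_dv_mul h, mul_add, mul_smul_comm, rhoOp_apply]
  module

/-- The defect of invariance of the first-order operator of sector `B` for arbitrary weights. -/
theorem lie_opB (h : X.IsVLE σ) (z z' : ℤ) {ω : Comp (p + 1) 0 r}
    (hω : ω ∈ T ⟨p + 1, 0, r, z⟩) :
    lie ⟨p, 0, r + 1, z'⟩ σ X (opB D ω) = (σ : ℤ) • opB D (lie ⟨p + 1, 0, r, z⟩ σ X ω) +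
      (((z' - z - 1 : ℤ) : ℂ) / 6) • (fun I J B => X.dv * opB D ω I J B) -
      (σ : ℤ) • (((z - (2 * (p + 1) + 3 * r + 6) : ℤ) : ℂ) / 3) • opB (rhoOp X) ω := by
  funext I J B
  simp only [Pi.sub_apply, Pi.add_apply, Pi.smul_apply, lie_lower, opB, ← Dlow_eq]
  have h3 : (σ : ℤ) • ∑ m, ∑ j,
        Dlow j (B m) (rot X.sl3 (fun I => ω I J (removeNth m B)) (snoc I j)) =
      ∑ m, ∑ j, ∑ l, X.sl3 l j * Dlow l (B m) (ω (snoc I j) J (removeNth m B)) +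
      rot X.sl3 (fun I => ∑ m, ∑ j, Dlow j (B m) (ω (snoc I j) J (removeNth m B))) I -
      (σ : ℤ) • ((2 / 3 * (p + 1 : ℂ) + 2) •
        ∑ m, ∑ j, lowerOp (rhoOp X) j (B m) (ω (snoc I j) J (removeNth m B))) := by
    rw [rot_sum, Finset.smul_sum, Finset.smul_sum, Finset.smul_sum, ← Finset.sum_add_distrib,
      ← Finset.sum_sub_distrib]
    exact Finset.sum_congr rfl fun m _ => contract_sl3_low h (B m) (isSymm_I hω J (removeNth m B)) I
  have h2 : (σ : ℤ) • ∑ m, ∑ j,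
        Dlow j (B m) (rot (X.sl2 σ) (fun B => ω (snoc I j) J B) (removeNth m B)) =
      rot (X.sl2 σ) (fun B => ∑ m, ∑ j, Dlow j (B m) (ω (snoc I j) J (removeNth m B))) B -
      ∑ m, ∑ j, ∑ c, X.sl2 σ (B m) c * Dlow j c (ω (snoc I j) J (removeNth m B)) -
      (σ : ℤ) • ((r : ℂ) •
        ∑ m, ∑ j, lowerOp (rhoOp X) j (B m) (ω (snoc I j) J (removeNth m B))) := by
    have e1 : rot (X.sl2 σ) (fun B => ∑ m, ∑ j,
        Dlow j (B m) (ω (snoc I j) J (removeNth m B))) B =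
        ∑ j, rot (X.sl2 σ) (fun B => ∑ m, Dlow j (B m) (ω (snoc I j) J (removeNth m B))) B := by
      rw [← rot_sum]
      exact congrArg (fun g => rot (X.sl2 σ) g B) (funext fun B => Finset.sum_comm)
    rw [e1, Finset.sum_comm, Finset.sum_comm (f := fun m j => ∑ c, X.sl2 σ (B m) c * _),
      Finset.sum_comm (f := fun m j => lowerOp (rhoOp X) j (B m) _), Finset.smul_sum,
      Finset.smul_sum, Finset.smul_sum, ← Finset.sum_sub_distrib, ← Finset.sum_sub_distrib]
    exact Finset.sum_congr rfl fun j _ => adjoin_sl2 h j (isSymm_B hω (snoc I j) J) B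
  have h1 : X.act (∑ m, ∑ j, Dlow j (B m) (ω (snoc I j) J (removeNth m B))) =
      (σ : ℤ) • ∑ m, ∑ j, Dlow j (B m) (X.act (ω (snoc I j) J (removeNth m B))) +
      ∑ m, ∑ j, ∑ l, X.sl3 l j * Dlow l (B m) (ω (snoc I j) J (removeNth m B)) -
      ∑ m, ∑ j, ∑ c, X.sl2 σ (B m) c * Dlow j c (ω (snoc I j) J (removeNth m B)) -
      (1 / 6 : ℂ) • (X.dv * ∑ m, ∑ j, Dlow j (B m) (ω (snoc I j) J (removeNth m B))) := by
    simp only [map_sum, act_Dlow h, Finset.sum_add_distrib, Finset.sum_sub_distrib,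
      ← Finset.smul_sum, ← Finset.mul_sum]
  have h4 : ∑ m, ∑ j, Dlow j (B m) (X.dv * ω (snoc I j) J (removeNth m B)) =
      (2 : ℂ) • ∑ m, ∑ j, lowerOp (rhoOp X) j (B m) (ω (snoc I j) J (removeNth m B)) +
        (σ : ℤ) • (X.dv * ∑ m, ∑ j, Dlow j (B m) (ω (snoc I j) J (removeNth m B))) := by
    simp only [Dlow_dv_mul h, Finset.sum_add_distrib, ← Finset.smul_sum, ← Finset.mul_sum]
  simp only [map_add, map_smul, Finset.sum_add_distrib, smul_add, h1, h2, h3, ← Finset.smul_sum, h4]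
  push_cast
  rw [smul_comm ((z : ℂ) / 6) (σ : ℤ), sign_smul_smul]
  module

/-- The defect of invariance of the first-order operator of sector `C` for arbitrary weights. -/
theorem lie_opC (h : X.IsVLE σ) (z z' : ℤ) {ω : Comp 0 q (r + 1)}
    (hω : ω ∈ T ⟨0, q, r + 1, z⟩) :
    lie ⟨0, q + 1, r, z'⟩ σ X (opC D ω) = (σ : ℤ) • opC D (lie ⟨0, q, r + 1, z⟩ σ X ω) +
      (((z' - z - 1 : ℤ) : ℂ) / 6) • (fun I J B => X.dv * opC D ω I J B) -
      (σ : ℤ) • (((z - (-2 * q - 3 * (r + 1) - 6) : ℤ) : ℂ) / 3) • opC (rhoOp X) ω := by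
  funext I J B
  simp only [Pi.sub_apply, Pi.add_apply, Pi.smul_apply, lie_upper, opC, rhoOp_apply]
  have h3 : (σ : ℤ) • ∑ k, ∑ b, D (J k) b
        (rot (fun j l => X.sl3 l j) (fun J => ω I J (snoc B b)) (removeNth k J)) =
      rot (fun j l => X.sl3 l j) (fun J => ∑ k, ∑ b, D (J k) b (ω I (removeNth k J) (snoc B b))) J -
      ∑ k, ∑ b, ∑ l, X.sl3 l (J k) * D l b (ω I (removeNth k J) (snoc B b)) -
      (σ : ℤ) • ((2 / 3 * q : ℂ) •
        ∑ k, ∑ b, X.rho (J k) b * ω I (removeNth k J) (snoc B b)) := by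
    have e1 : rot (fun j l => X.sl3 l j)
        (fun J => ∑ k, ∑ b, D (J k) b (ω I (removeNth k J) (snoc B b))) J =
        ∑ b, rot (fun j l => X.sl3 l j)
          (fun J => ∑ k, D (J k) b (ω I (removeNth k J) (snoc B b))) J := by
      rw [← rot_sum]
      exact congrArg (fun g => rot (fun j l => X.sl3 l j) g J) (funext fun J => Finset.sum_comm)
    rw [e1, Finset.sum_comm, Finset.sum_comm (f := fun k b => ∑ l, X.sl3 l (J k) * _),
      Finset.sum_comm (f := fun k b => X.rho (J k) b * _), Finset.smul_sum, Finset.smul_sum,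
      Finset.smul_sum, ← Finset.sum_sub_distrib, ← Finset.sum_sub_distrib]
    exact Finset.sum_congr rfl fun b _ => adjoin_sl3 h b (isSymm_J hω I (snoc B b)) J
  have h2 : (σ : ℤ) • ∑ k, ∑ b, D (J k) b
        (rot (X.sl2 σ) (fun B => ω I (removeNth k J) B) (snoc B b)) =
      ∑ k, ∑ b, ∑ c, X.sl2 σ c b * D (J k) c (ω I (removeNth k J) (snoc B b)) +
      rot (X.sl2 σ) (fun B => ∑ k, ∑ b, D (J k) b (ω I (removeNth k J) (snoc B b))) B +
      (σ : ℤ) • ((r + 3 : ℂ) •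
        ∑ k, ∑ b, X.rho (J k) b * ω I (removeNth k J) (snoc B b)) := by
    rw [rot_sum, Finset.smul_sum, Finset.smul_sum, Finset.smul_sum, ← Finset.sum_add_distrib,
      ← Finset.sum_add_distrib]
    exact Finset.sum_congr rfl fun k _ => contract_sl2 h (J k) (isSymm_B hω I (removeNth k J)) B
  have h1 : X.act (∑ k, ∑ b, D (J k) b (ω I (removeNth k J) (snoc B b))) =
      (σ : ℤ) • ∑ k, ∑ b, D (J k) b (X.act (ω I (removeNth k J) (snoc B b))) +
      ∑ k, ∑ b, ∑ l, X.sl3 l (J k) * D l b (ω I (removeNth k J) (snoc B b)) +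
      ∑ k, ∑ b, ∑ c, X.sl2 σ c b * D (J k) c (ω I (removeNth k J) (snoc B b)) -
      (1 / 6 : ℂ) • (X.dv * ∑ k, ∑ b, D (J k) b (ω I (removeNth k J) (snoc B b))) := by
    simp only [map_sum, X.act_D h, Finset.sum_add_distrib, Finset.sum_sub_distrib,
      ← Finset.smul_sum, ← Finset.mul_sum]
  have h4 : ∑ k, ∑ b, D (J k) b (X.dv * ω I (removeNth k J) (snoc B b)) =
      (2 : ℂ) • ∑ k, ∑ b, X.rho (J k) b * ω I (removeNth k J) (snoc B b) +
        (σ : ℤ) • (X.dv * ∑ k, ∑ b, D (J k) b (ω I (removeNth k J) (snoc B b))) := by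
    simp only [D_dv_mul h, Finset.sum_add_distrib, ← Finset.smul_sum, ← Finset.mul_sum]
  simp only [map_add, map_sub, map_smul, Finset.sum_add_distrib, Finset.sum_sub_distrib, smul_add,
    smul_sub, h1, h2, h3, ← Finset.smul_sum, h4]
  push_cast
  rw [smul_comm ((z : ℂ) / 6) (σ : ℤ), sign_smul_smul]
  module

/-- The defect of invariance of the first-order operator of sector `D` for arbitrary weights. -/
theorem lie_opD (h : X.IsVLE σ) (z z' : ℤ) {ω : Comp 0 q r} (hω : ω ∈ T ⟨0, q, r, z⟩) :
    lie ⟨0, q + 1, r + 1, z'⟩ σ X (opD D ω) = (σ : ℤ) • opD D (lie ⟨0, q, r, z⟩ σ X ω) +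
      (((z' - z - 1 : ℤ) : ℂ) / 6) • (fun I J B => X.dv * opD D ω I J B) -
      (σ : ℤ) • (((z - (-2 * q + 3 * r) : ℤ) : ℂ) / 3) • opD (rhoOp X) ω := by
  funext I J B
  simp only [Pi.sub_apply, Pi.add_apply, Pi.smul_apply, lie_upper, opD, ← Dlow_eq]
  have h3 : (σ : ℤ) • ∑ k, ∑ m, Dlow (J k) (B m)
        (rot (fun j l => X.sl3 l j) (fun J => ω I J (removeNth m B)) (removeNth k J)) =
      rot (fun j l => X.sl3 l j)
        (fun J => ∑ k, ∑ m, Dlow (J k) (B m) (ω I (removeNth k J) (removeNth m B))) J -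
      ∑ k, ∑ m, ∑ l, X.sl3 l (J k) * Dlow l (B m) (ω I (removeNth k J) (removeNth m B)) -
      (σ : ℤ) • ((2 / 3 * q : ℂ) •
        ∑ k, ∑ m, lowerOp (rhoOp X) (J k) (B m) (ω I (removeNth k J) (removeNth m B))) := by
    have e1 : rot (fun j l => X.sl3 l j)
        (fun J => ∑ k, ∑ m, Dlow (J k) (B m) (ω I (removeNth k J) (removeNth m B))) J =
        ∑ m, rot (fun j l => X.sl3 l j)
          (fun J => ∑ k, Dlow (J k) (B m) (ω I (removeNth k J) (removeNth m B))) J := by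
      rw [← rot_sum]
      exact congrArg (fun g => rot (fun j l => X.sl3 l j) g J) (funext fun J => Finset.sum_comm)
    rw [e1, Finset.sum_comm, Finset.sum_comm (f := fun k m => ∑ l, X.sl3 l (J k) * _),
      Finset.sum_comm (f := fun k m => lowerOp (rhoOp X) (J k) (B m) _), Finset.smul_sum,
      Finset.smul_sum, Finset.smul_sum, ← Finset.sum_sub_distrib, ← Finset.sum_sub_distrib]
    exact Finset.sum_congr rfl fun m _ => adjoin_sl3_low h (B m) (isSymm_J hω I (removeNth m B)) J
  have h2 : (σ : ℤ) • ∑ k, ∑ m, Dlow (J k) (B m)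
        (rot (X.sl2 σ) (fun B => ω I (removeNth k J) B) (removeNth m B)) =
      rot (X.sl2 σ)
        (fun B => ∑ k, ∑ m, Dlow (J k) (B m) (ω I (removeNth k J) (removeNth m B))) B -
      ∑ k, ∑ m, ∑ c, X.sl2 σ (B m) c * Dlow (J k) c (ω I (removeNth k J) (removeNth m B)) -
      (σ : ℤ) • ((r : ℂ) •
        ∑ k, ∑ m, lowerOp (rhoOp X) (J k) (B m) (ω I (removeNth k J) (removeNth m B))) := by
    rw [rot_sum, Finset.smul_sum, Finset.smul_sum, Finset.smul_sum, ← Finset.sum_sub_distrib,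
      ← Finset.sum_sub_distrib]
    exact Finset.sum_congr rfl fun k _ => adjoin_sl2 h (J k) (isSymm_B hω I (removeNth k J)) B
  have h1 : X.act (∑ k, ∑ m, Dlow (J k) (B m) (ω I (removeNth k J) (removeNth m B))) =
      (σ : ℤ) • ∑ k, ∑ m, Dlow (J k) (B m) (X.act (ω I (removeNth k J) (removeNth m B))) +
      ∑ k, ∑ m, ∑ l, X.sl3 l (J k) * Dlow l (B m) (ω I (removeNth k J) (removeNth m B)) -
      ∑ k, ∑ m, ∑ c, X.sl2 σ (B m) c * Dlow (J k) c (ω I (removeNth k J) (removeNth m B)) -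
      (1 / 6 : ℂ) • (X.dv *
        ∑ k, ∑ m, Dlow (J k) (B m) (ω I (removeNth k J) (removeNth m B))) := by
    simp only [map_sum, act_Dlow h, Finset.sum_add_distrib, Finset.sum_sub_distrib,
      ← Finset.smul_sum, ← Finset.mul_sum]
  have h4 : ∑ k, ∑ m, Dlow (J k) (B m) (X.dv * ω I (removeNth k J) (removeNth m B)) =
      (2 : ℂ) • ∑ k, ∑ m, lowerOp (rhoOp X) (J k) (B m) (ω I (removeNth k J) (removeNth m B)) +
        (σ : ℤ) • (X.dv *
          ∑ k, ∑ m, Dlow (J k) (B m) (ω I (removeNth k J) (removeNth m B))) := by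
    simp only [Dlow_dv_mul h, Finset.sum_add_distrib, ← Finset.smul_sum, ← Finset.mul_sum]
  simp only [map_add, map_sub, map_smul, Finset.sum_add_distrib, Finset.sum_sub_distrib, smul_add,
    smul_sub, h1, h2, h3, ← Finset.smul_sum, h4]
  push_cast
  rw [smul_comm ((z : ℂ) / 6) (σ : ℤ), sign_smul_smul]
  module

end firstOrder

/-! ### The tensor modules are stable under Lie derivatives -/

section stable

variable {σ : ℤˣ} {X : VField}

theorem IsSymm.rot {α : Type*} [Fintype α] {n : ℕ} {g : (Fin n → α) → PSF} (hg : IsSymm g)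
    (m : α → α → PSF) : IsSymm (rot m g) := by
  intro π I
  refine Fintype.sum_equiv π _ _ fun k => Finset.sum_congr rfl fun l _ => ?_
  rw [Function.comp_apply, ← hg π (Function.update I (π k) l)]
  congr 2
  ext i
  by_cases h : i = k
  · subst h; simp
  · simp [h]

theorem lie_eq (τ : Label) (ω : Comp τ.p τ.q τ.r) (I : Fin τ.p → Fin 3) (J : Fin τ.q → Fin 3)
    (B : Fin τ.r → Fin 2) : lie τ σ X ω I J B =
      X.act (ω I J B) + rot X.sl3 (fun I => ω I J B) I -
        rot (fun j l => X.sl3 l j) (fun J => ω I J B) J +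
        rot (X.sl2 σ) (fun B => ω I J B) B + ((τ.z : ℂ) / 6) • (X.dv * ω I J B) := rfl

/-- The Lie derivative preserves the symmetry of the components because the same matrix acts on each
index of a group, and tracelessness because it acts on upper and lower `sl(3)` indices dually. -/
theorem lie_mem (τ : Label) (σ : ℤˣ) (X : VField) {ω : Comp τ.p τ.q τ.r} (hω : ω ∈ T τ) :
    lie τ σ X ω ∈ T τ := by
  have h4 := hω.2.2.2
  refine ⟨fun π I J B => ?_, fun π I J B => ?_, fun π I J B => ?_, fun k k' I J B => ?_⟩
  · have h := (isSymm_I hω J B).rot X.sl3 π I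
    simp only [lie_eq, h, hω.1]
  · have h := (isSymm_J hω I B).rot (fun j l => X.sl3 l j) π J
    simp only [lie_eq, h, hω.2.1]
  · have h := (isSymm_B hω I J).rot (X.sl2 σ) π B
    simp only [lie_eq, h, hω.2.2.1]
  · simp only [lie_eq, Finset.sum_add_distrib, Finset.sum_sub_distrib, ← map_sum,
      ← Finset.smul_sum, ← Finset.mul_sum, h4]
    have e1 : ∑ l, rot (X.sl2 σ) (fun B => ω (Function.update I k l) (Function.update J k' l) B) B
        = 0 := by
      rw [← rot_sum]
      simp [h4, rot]
    have e2 : ∑ l, rot X.sl3 (fun I => ω I (Function.update J k' l) B) (Function.update I k l) =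
        ∑ l, ∑ l', X.sl3 l l' * ω (Function.update I k l') (Function.update J k' l) B := by
      simp only [rot]
      rw [Finset.sum_comm, Finset.sum_eq_single k]
      · simp
      · intro i _ hi
        rw [Finset.sum_comm]
        refine Finset.sum_eq_zero fun l' _ => ?_
        simp only [Function.update_of_ne hi, ← Finset.mul_sum, Function.update_comm hi.symm, h4,
          mul_zero]
      · simp
    have e3 : ∑ l, rot (fun j l => X.sl3 l j) (fun J => ω (Function.update I k l) J B)
        (Function.update J k' l) =
        ∑ l, ∑ l', X.sl3 l' l * ω (Function.update I k l) (Function.update J k' l') B := by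
      simp only [rot]
      rw [Finset.sum_comm, Finset.sum_eq_single k']
      · simp
      · intro i _ hi
        rw [Finset.sum_comm]
        refine Finset.sum_eq_zero fun l' _ => ?_
        simp only [Function.update_of_ne hi, ← Finset.mul_sum, Function.update_comm hi.symm, h4,
          mul_zero]
      · simp
    rw [e1, e2, e3, Finset.sum_comm]
    simp

end stable

/-! ### Operators with constant coefficients -/

section dcomp

variable {p q r p' q' r' k : ℕ}

/-- `g` is a single component of a differential operator with constant coefficients, homogeneous
of order `k` in the `D^{ia}`. -/
def IsDComp (k : ℕ) (g : Comp p q r → PSF) : Prop :=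
  ∃ c : (Fin p → Fin 3) → (Fin q → Fin 3) → (Fin r → Fin 2) → (Fin k → Fin 3 × Fin 2) → ℂ,
    ∀ ω, g ω = ∑ I, ∑ J, ∑ B, ∑ w, c I J B w • dWord w (ω I J B)

theorem isDOperator_of_comp {f : Comp p q r → Comp p' q' r'}
    (h : ∀ I J B, IsDComp k fun ω => f ω I J B) : IsDOperator k f := by
  choose c hc using h
  exact ⟨c, fun ω I J B => hc I J B ω⟩

theorem dWord_zero (w : Fin 0 → Fin 3 × Fin 2) (f : PSF) : dWord w f = f := by simp [dWord]

theorem dWord_cons (x : Fin 3 × Fin 2) (w : Fin k → Fin 3 × Fin 2) (f : PSF) :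
    dWord (Fin.cons x w : Fin (k + 1) → Fin 3 × Fin 2) f = D x.1 x.2 (dWord w f) := by
  simp [dWord, List.ofFn_succ]

/-- `D^{i_1 a_1} ⋯ D^{i_k a_k}` as a linear operator. -/
def dWordHom (w : Fin k → Fin 3 × Fin 2) : PSF →ₗ[ℂ] PSF where
  toFun := dWord w
  map_add' f g := by
    induction k with
    | zero => simp [dWord_zero]
    | succ k ih =>
      rw [← Fin.cons_self_tail w]
      simp only [dWord_cons, ih, map_add]
  map_smul' c f := by
    induction k with
    | zero => simp [dWord_zero]
    | succ k ih =>
      rw [← Fin.cons_self_tail w]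
      simp only [dWord_cons, ih, map_smul, RingHom.id_apply]

theorem dWordHom_apply (w : Fin k → Fin 3 × Fin 2) (f : PSF) : dWordHom w f = dWord w f := rfl

theorem IsDComp.base (I : Fin p → Fin 3) (J : Fin q → Fin 3) (B : Fin r → Fin 2) :
    IsDComp 0 fun ω => ω I J B := by
  refine ⟨fun I' J' B' _ => if I' = I ∧ J' = J ∧ B' = B then 1 else 0, fun ω => ?_⟩
  simp only [dWord_zero, Finset.sum_const, Finset.card_univ, Fintype.card_unique, one_smul]
  rw [Finset.sum_eq_single I, Finset.sum_eq_single J, Finset.sum_eq_single B] <;>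
    simp +contextual

theorem IsDComp.sum {ι : Type*} {s : Finset ι} {g : ι → Comp p q r → PSF}
    (h : ∀ i, IsDComp k (g i)) : IsDComp k fun ω => ∑ i ∈ s, g i ω := by
  choose c hc using h
  refine ⟨fun I J B w => ∑ i ∈ s, c i I J B w, fun ω => ?_⟩
  simp only [hc, Finset.sum_smul]
  rw [Finset.sum_comm]
  refine Finset.sum_congr rfl fun I _ => ?_
  rw [Finset.sum_comm]
  refine Finset.sum_congr rfl fun J _ => ?_
  rw [Finset.sum_comm]
  exact Finset.sum_congr rfl fun B _ => Finset.sum_comm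

theorem IsDComp.smul {g : Comp p q r → PSF} (a : ℂ) (h : IsDComp k g) :
    IsDComp k fun ω => a • g ω := by
  obtain ⟨c, hc⟩ := h
  exact ⟨fun I J B w => a * c I J B w, fun ω => by simp only [hc, Finset.smul_sum, mul_smul]⟩

theorem IsDComp.add {g g' : Comp p q r → PSF} (h : IsDComp k g) (h' : IsDComp k g') :
    IsDComp k fun ω => g ω + g' ω := by
  obtain ⟨c, hc⟩ := h
  obtain ⟨c', hc'⟩ := h'
  exact ⟨fun I J B w => c I J B w + c' I J B w, fun ω => by
    simp only [hc, hc', Finset.sum_add_distrib, add_smul]⟩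

theorem IsDComp.D {g : Comp p q r → PSF} (h : IsDComp k g) (i : Fin 3) (a : Fin 2) :
    IsDComp (k + 1) fun ω => D i a (g ω) := by
  obtain ⟨c, hc⟩ := h
  refine ⟨fun I J B w => if w 0 = (i, a) then c I J B (Fin.tail w) else 0, fun ω => ?_⟩
  simp only [hc, map_sum, map_smul]
  refine Finset.sum_congr rfl fun I _ => Finset.sum_congr rfl fun J _ =>
    Finset.sum_congr rfl fun B _ => ?_
  rw [← (Fin.consEquiv fun _ => Fin 3 × Fin 2).sum_comp, Fintype.sum_prod_type,
    Finset.sum_eq_single (i, a)]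
  · simp [Fin.consEquiv, dWord_cons]
  · intro x _ hx
    simp [Fin.consEquiv, hx]
  · simp

theorem IsDComp.Dlow {g : Comp p q r → PSF} (h : IsDComp k g) (i : Fin 3) (a : Fin 2) :
    IsDComp (k + 1) fun ω => Dlow i a (g ω) := by
  simp only [Dlow_eq, lowerOp_apply]
  exact IsDComp.sum fun b => (h.D i b).smul _

/-- An operator of order `k` commutes up to the sign `σ^k` with an operator that commutes with
the `D^{ia}` up to the sign `σ`. -/
theorem dWord_comm {σ : ℤˣ} {Y : PSF →ₗ[ℂ] PSF} (hY : ∀ i a f, Y (D i a f) = (σ : ℤ) • D i a (Y f))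
    (w : Fin k → Fin 3 × Fin 2) (f : PSF) :
    Y (dWord w f) = ((σ ^ k : ℤˣ) : ℤ) • dWord w (Y f) := by
  induction k with
  | zero => simp [dWord_zero]
  | succ k ih =>
    rw [← Fin.cons_self_tail w]
    simp only [dWord_cons, hY, ih, map_zsmul, smul_smul, pow_succ', Units.val_mul]

theorem IsDOperator.comm {f : Comp p q r → Comp p' q' r'} (hf : IsDOperator k f) {σ : ℤˣ}
    {Y : PSF →ₗ[ℂ] PSF} (hY : ∀ i a g, Y (VLE36.D i a g) = (σ : ℤ) • VLE36.D i a (Y g))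
    (ω : Comp p q r) :
    (fun I J B => Y (f ω I J B)) = ((σ ^ k : ℤˣ) : ℤ) • f fun I J B => Y (ω I J B) := by
  obtain ⟨c, hc⟩ := hf
  funext I J B
  simp only [Pi.smul_apply, hc, map_sum, map_smul, dWord_comm hY, Finset.smul_sum,
    smul_comm (_ : ℂ) (_ : ℤ)]

theorem IsDOperator.parity {f : Comp p q r → Comp p' q' r'} (hf : IsDOperator k f)
    (ω : Comp p q r) : (fun I J B => parity (f ω I J B)) =
      (((-1) ^ k : ℤˣ) : ℤ) • f fun I J B => VLE36.parity (ω I J B) :=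
  hf.comm (Y := VLE36.parity) (fun i a g => by rw [← neg_eq_iff_eq_neg.mpr (D_parity i a g)]; simp) ω

theorem IsDOperator.map_add {f : Comp p q r → Comp p' q' r'} (hf : IsDOperator k f)
    (ω ω' : Comp p q r) : f (ω + ω') = f ω + f ω' := by
  obtain ⟨c, hc⟩ := hf
  funext I J B
  simp only [Pi.add_apply, hc, ← dWordHom_apply, _root_.map_add, smul_add, Finset.sum_add_distrib]

theorem IsDOperator.map_smul {f : Comp p q r → Comp p' q' r'} (hf : IsDOperator k f)
    (a : ℂ) (ω : Comp p q r) : f (a • ω) = a • f ω := by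
  obtain ⟨c, hc⟩ := hf
  funext I J B
  simp only [Pi.smul_apply, hc, ← dWordHom_apply, _root_.map_smul, Finset.smul_sum, smul_comm a]

/-- An operator with constant coefficients, as a linear map. -/
def IsDOperator.toLin {f : Comp p q r → Comp p' q' r'} (hf : IsDOperator k f) :
    Comp p q r →ₗ[ℂ] Comp p' q' r' where
  toFun := f
  map_add' := hf.map_add
  map_smul' := hf.map_smul

@[simp] theorem IsDOperator.toLin_apply {f : Comp p q r → Comp p' q' r'} (hf : IsDOperator k f)
    (ω : Comp p q r) : hf.toLin ω = f ω := rfl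

end dcomp

/-! ### Order and target of the operators -/

section targets

variable {p q r : ℕ}

theorem nabla1A_dOperator : IsDOperator 1 (nabla1A (p := p) (r := r)) :=
  isDOperator_of_comp fun _ _ _ => IsDComp.sum fun _ => IsDComp.sum fun _ => (IsDComp.base _ _ _).D _ _

theorem nabla1B_dOperator : IsDOperator 1 (nabla1B (p := p) (r := r)) :=
  isDOperator_of_comp fun _ _ _ => IsDComp.sum fun _ => IsDComp.sum fun _ =>
    (IsDComp.base _ _ _).Dlow _ _

theorem nabla1C_dOperator : IsDOperator 1 (nabla1C (q := q) (r := r)) :=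
  isDOperator_of_comp fun _ _ _ => IsDComp.sum fun _ => IsDComp.sum fun _ => (IsDComp.base _ _ _).D _ _

theorem nabla1D_dOperator : IsDOperator 1 (nabla1D (q := q) (r := r)) :=
  isDOperator_of_comp fun _ _ _ => IsDComp.sum fun _ => IsDComp.sum fun _ =>
    (IsDComp.base _ _ _).Dlow _ _

theorem nabla2A_dOperator : IsDOperator 2 (nabla2A (p := p)) :=
  isDOperator_of_comp fun _ _ _ => IsDComp.sum fun _ => IsDComp.sum fun _ =>
    IsDComp.sum fun _ => IsDComp.sum fun _ => (((IsDComp.base _ _ _).D _ _).D _ _).smul _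

theorem nabla2C_dOperator : IsDOperator 2 (nabla2C (q := q)) :=
  isDOperator_of_comp fun _ _ _ => IsDComp.sum fun _ => IsDComp.sum fun _ =>
    IsDComp.sum fun _ => IsDComp.sum fun _ => (((IsDComp.base _ _ _).D _ _).D _ _).smul _

theorem nabla3A_dOperator : IsDOperator 3 (nabla3A (r := r)) :=
  isDOperator_of_comp fun _ _ _ => IsDComp.sum fun _ => IsDComp.sum fun _ =>
    IsDComp.sum fun _ => IsDComp.sum fun _ => IsDComp.sum fun _ => IsDComp.sum fun _ =>
      ((((IsDComp.base _ _ _).D _ _).D _ _).D _ _).smul _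

theorem nabla3B_dOperator : IsDOperator 3 (nabla3B (r := r)) :=
  isDOperator_of_comp fun _ _ _ => IsDComp.sum fun _ => IsDComp.sum fun _ =>
    IsDComp.sum fun _ => IsDComp.sum fun _ => IsDComp.sum fun _ => IsDComp.sum fun _ =>
      ((((IsDComp.base _ _ _).Dlow _ _).Dlow _ _).Dlow _ _).smul _

theorem nabla4A2_dOperator : IsDOperator 4 nabla4A2 :=
  isDOperator_of_comp fun _ _ _ => IsDComp.sum fun _ => IsDComp.sum fun _ =>
    IsDComp.sum fun _ => IsDComp.sum fun _ => IsDComp.sum fun _ => IsDComp.sum fun _ =>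
      IsDComp.sum fun _ => (((((IsDComp.base _ _ _).D _ _).D _ _).D _ _).D _ _).smul _

theorem nabla4A1_dOperator : IsDOperator 4 nabla4A1 :=
  isDOperator_of_comp fun _ _ _ => IsDComp.sum fun _ => IsDComp.sum fun _ =>
    IsDComp.sum fun _ => IsDComp.sum fun _ => IsDComp.sum fun _ => IsDComp.sum fun _ =>
      IsDComp.sum fun _ => (((((IsDComp.base _ _ _).D _ _).D _ _).Dlow _ _).Dlow _ _).smul _

theorem nabla6_dOperator : IsDOperator 6 nabla6 :=
  isDOperator_of_comp fun _ _ _ => IsDComp.sum fun _ => IsDComp.sum fun _ =>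
    IsDComp.sum fun _ => IsDComp.sum fun _ => IsDComp.sum fun _ => IsDComp.sum fun _ =>
      IsDComp.sum fun _ => IsDComp.sum fun _ => IsDComp.sum fun _ => IsDComp.sum fun _ =>
      IsDComp.sum fun _ => IsDComp.smul _ (IsDComp.add
        (((((((IsDComp.base _ _ _).D _ _).D _ _).Dlow _ _).D _ _).D _ _).D _ _)
        (((((((IsDComp.base _ _ _).D _ _).D _ _).D _ _).D _ _).D _ _).Dlow _ _))

/-- Membership in a tensor module without upper `sl(3)` indices is symmetry. -/
theorem mem_T_lower {z : ℤ} {ω : Comp p 0 r} (h1 : ∀ J B, IsSymm fun I => ω I J B)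
    (h2 : ∀ I J, IsSymm (ω I J)) : ω ∈ T ⟨p, 0, r, z⟩ :=
  ⟨fun π I J B => h1 J B π I, fun _ I J B => by rw [Subsingleton.elim (J ∘ _) J],
    fun π I J B => h2 I J π B, fun _ k => k.elim0⟩

/-- Membership in a tensor module without lower `sl(3)` indices is symmetry. -/
theorem mem_T_upper {z : ℤ} {ω : Comp 0 q r} (h1 : ∀ I B, IsSymm fun J => ω I J B)
    (h2 : ∀ I J, IsSymm (ω I J)) : ω ∈ T ⟨0, q, r, z⟩ :=
  ⟨fun _ I J B => by rw [Subsingleton.elim (I ∘ _) I], fun π I J B => h1 I B π J,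
    fun π I J B => h2 I J π B, fun k => k.elim0⟩

theorem nabla1A_mem {z z' : ℤ} {ω : Comp (p + 1) 0 (r + 1)} (hω : ω ∈ T ⟨p + 1, 0, r + 1, z⟩) :
    nabla1A ω ∈ T ⟨p, 0, r, z'⟩ := by
  refine mem_T_lower (fun J B π I => ?_) fun I J π B => ?_
  · exact Finset.sum_congr rfl fun j _ => Finset.sum_congr rfl fun b _ => congrArg _ <|
      (isSymm_I hω J (snoc B b)).snoc_left j π I
  · exact Finset.sum_congr rfl fun j _ => Finset.sum_congr rfl fun b _ => congrArg _ <|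
      (isSymm_B hω (snoc I j) J).snoc_left b π B

theorem nabla1B_mem {z z' : ℤ} {ω : Comp (p + 1) 0 r} (hω : ω ∈ T ⟨p + 1, 0, r, z⟩) :
    nabla1B ω ∈ T ⟨p, 0, r + 1, z'⟩ := by
  refine mem_T_lower (fun J B π I => ?_) fun I J => ?_
  · exact Finset.sum_congr rfl fun m _ => Finset.sum_congr rfl fun j _ => congrArg _ <|
      (isSymm_I hω J (removeNth m B)).snoc_left j π I
  · exact isSymm_removeNth_sum (F := fun b B => ∑ j, Dlow j b (ω (snoc I j) J B)) fun b π B =>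
      Finset.sum_congr rfl fun j _ => congrArg _ <| isSymm_B hω (snoc I j) J π B

theorem nabla1C_mem {z z' : ℤ} {ω : Comp 0 q (r + 1)} (hω : ω ∈ T ⟨0, q, r + 1, z⟩) :
    nabla1C ω ∈ T ⟨0, q + 1, r, z'⟩ := by
  refine mem_T_upper (fun I B => ?_) fun I J π B => ?_
  · exact isSymm_removeNth_sum (F := fun j J => ∑ b, D j b (ω I J (snoc B b))) fun j π J =>
      Finset.sum_congr rfl fun b _ => congrArg _ <| isSymm_J hω I (snoc B b) π J
  · exact Finset.sum_congr rfl fun k _ => Finset.sum_congr rfl fun b _ => congrArg _ <|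
      (isSymm_B hω I (removeNth k J)).snoc_left b π B

theorem nabla1D_mem {z z' : ℤ} {ω : Comp 0 q r} (hω : ω ∈ T ⟨0, q, r, z⟩) :
    nabla1D ω ∈ T ⟨0, q + 1, r + 1, z'⟩ := by
  refine mem_T_upper (fun I B => ?_) fun I J => ?_
  · exact isSymm_removeNth_sum (F := fun j J => ∑ m, Dlow j (B m) (ω I J (removeNth m B)))
      fun j π J => Finset.sum_congr rfl fun m _ => congrArg _ <| isSymm_J hω I (removeNth m B) π J
  · have h : nabla1D ω I J = fun B => ∑ m, ∑ k, Dlow (J k) (B m) (ω I (removeNth k J) (removeNth m B)) :=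
      funext fun B => Finset.sum_comm
    rw [h]
    exact isSymm_removeNth_sum (F := fun b B => ∑ k, Dlow (J k) b (ω I (removeNth k J) B))
      fun b π B => Finset.sum_congr rfl fun k _ => congrArg _ <| isSymm_B hω I (removeNth k J) π B

theorem nabla1B_zero (ω : Comp (p + 1) 0 0) (I : Fin p → Fin 3) (J : Fin 0 → Fin 3)
    (B : Fin 1 → Fin 2) (B' : Fin 0 → Fin 2) :
    nabla1B ω I J B = ∑ j, Dlow j (B 0) (ω (snoc I j) J B') := by
  unfold nabla1B
  refine (Fin.sum_univ_succ _).trans ?_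
  rw [Fin.sum_univ_zero, add_zero]
  exact Finset.sum_congr rfl fun j _ => by congr 2; exact Subsingleton.elim _ _

theorem nabla1D_zero (ω : Comp 0 q 0) (I : Fin 0 → Fin 3) (J : Fin (q + 1) → Fin 3)
    (B : Fin 1 → Fin 2) (B' : Fin 0 → Fin 2) :
    nabla1D ω I J B = ∑ k, Dlow (J k) (B 0) (ω I (removeNth k J) B') := by
  unfold nabla1D
  refine Finset.sum_congr rfl fun j _ => (Fin.sum_univ_succ _).trans ?_
  rw [Fin.sum_univ_zero, add_zero]
  congr 2; exact Subsingleton.elim _ _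

/-- The second-order operator is the composite of two first-order operators. -/
theorem nabla2A_eq (ω : Comp (p + 2) 0 0) : nabla2A ω = nabla1A (nabla1B ω) := by
  funext I J B
  simp only [nabla2A, nabla1A, nabla1B_zero (B' := B), Dlow_eq, lowerOp_apply, map_sum, map_smul]
  refine Finset.sum_congr rfl fun i _ => ?_
  rw [Finset.sum_comm]
  refine Finset.sum_congr rfl fun a _ => Finset.sum_congr rfl fun j _ =>
    Finset.sum_congr rfl fun b _ => ?_
  rfl

/-- The second-order operator is the composite of two first-order operators. -/
theorem nabla2C_eq (ω : Comp 0 q 0) : nabla2C ω = nabla1C (nabla1D ω) := by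
  funext I J B
  simp only [nabla2C, nabla1C, nabla1D_zero (B' := B), Dlow_eq, lowerOp_apply, map_sum, map_smul]
  refine Finset.sum_congr rfl fun k _ => ?_
  rw [Finset.sum_comm]
  refine Finset.sum_congr rfl fun a _ => Finset.sum_congr rfl fun j _ =>
    Finset.sum_congr rfl fun b _ => ?_
  rfl

theorem nabla2A_mem {z z' : ℤ} {ω : Comp (p + 2) 0 0} (hω : ω ∈ T ⟨p + 2, 0, 0, z⟩) :
    nabla2A ω ∈ T ⟨p, 0, 0, z'⟩ := by
  rw [nabla2A_eq]
  exact nabla1A_mem (z := 0) (nabla1B_mem hω)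

theorem nabla2C_mem {z z' : ℤ} {ω : Comp 0 q 0} (hω : ω ∈ T ⟨0, q, 0, z⟩) :
    nabla2C ω ∈ T ⟨0, q + 2, 0, z'⟩ := by
  rw [nabla2C_eq]
  exact nabla1C_mem (z := 0) (nabla1D_mem hω)

theorem nabla3A_mem {z z' : ℤ} {ω : Comp 0 0 (r + 3)} (hω : ω ∈ T ⟨0, 0, r + 3, z⟩) :
    nabla3A ω ∈ T ⟨0, 0, r, z'⟩ := by
  refine mem_T_lower (fun J B π I => by rw [Subsingleton.elim (I ∘ _) I]) fun I J π B => ?_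
  exact Finset.sum_congr rfl fun i _ => Finset.sum_congr rfl fun j _ =>
    Finset.sum_congr rfl fun k _ => Finset.sum_congr rfl fun a _ => Finset.sum_congr rfl fun b _ =>
    Finset.sum_congr rfl fun c _ => by
      congr 4
      exact (((isSymm_B hω I J).snoc_left c).snoc_left b).snoc_left a π B

end targets

/-! ### Membership in `vle(3|6)` -/

namespace VField

variable {σ : ℤˣ} {X : VField}

theorem act_thetaUp_mul (h : X.IsHomog σ) (j : Fin 3) (a : Fin 2) (f : PSF) :
    X.act (thetaUp j a * f) = X.act (thetaUp j a) * f + (σ : ℤ) • (thetaUp j a * X.act f) := by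
  simp only [thetaUp, Finset.sum_mul, smul_mul_assoc, map_sum, map_smul, act_theta_mul h, act_theta,
    smul_add, Finset.sum_add_distrib, Finset.smul_sum, smul_comm (_ : ℂ) (_ : ℤ)]

/-- A criterion for membership in `vle(3|6)`: it suffices to check the bracket with the `D^{ia}` on
the coordinates `u^k`. -/
theorem isVLE_of_D_Qt (h : X.IsHomog σ) (hQ : ∀ i k a, D i a (X.Qt k) =
    (σ : ℤ) • ∑ j, ∑ b, (2 * eps3 i j k * epsUp a b) • X.P j b) : X.IsVLE σ := by
  have hu : ∀ i a k, X.act (D i a (u k)) - (σ : ℤ) • D i a (X.act (u k)) +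
      (σ : ℤ) • ∑ j, ∑ b, D i a (X.P j b) * D j b (u k) = 0 := by
    intro i a k
    have h1 := hQ i k a
    have h2 : D i a (X.Qt k) = D i a (X.Q k) - ∑ j, ∑ l, ∑ b, eps3 j l k •
        (D i a (X.P j b) * thetaUp l b - (σ : ℤ) • (X.P j b * D i a (thetaUp l b))) := by
      have e : ∀ j l b, D i a (X.P j b * thetaUp l b) = D i a (X.P j b) * thetaUp l b -
          (σ : ℤ) • (X.P j b * D i a (thetaUp l b)) := by
        intro j l b
        rw [D_mul, h.2, neg_mul, smul_mul_assoc, sub_eq_add_neg]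
      simp only [Qt, map_sub, map_sum, map_smul, e]
    have h3 : X.act (D i a (u k)) = ∑ j, ∑ b, (eps3 i j k * epsUp a b) • X.P j b := by
      simp only [D_u, map_sum, map_smul, act_thetaUp, Finset.smul_sum, smul_smul]
    have h4 : ∑ j, ∑ l, ∑ b, eps3 j l k • ((σ : ℤ) • (X.P j b * D i a (thetaUp l b))) =
        (σ : ℤ) • ∑ j, ∑ b, (eps3 i j k * epsUp a b) • X.P j b := by
      simp only [D_thetaUp, Finset.smul_sum]
      refine Finset.sum_congr rfl fun j _ => ?_
      rw [Finset.sum_comm]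
      refine Finset.sum_congr rfl fun b _ => ?_
      rw [Finset.sum_eq_single i (by intro l _ hl; simp [hl.symm]) (by simp)]
      have e1 : eps3 i j k = -eps3 j i k := by unfold eps3; ring
      have e2 : epsUp a b = -epsUp b a := by unfold epsUp; ring
      rw [if_pos rfl, mul_smul_comm, mul_one, e1, e2]
      module
    have h5 : ∑ j, ∑ b, D i a (X.P j b) * D j b (u k) =
        ∑ j, ∑ l, ∑ b, eps3 j l k • (D i a (X.P j b) * thetaUp l b) := by
      simp only [D_u, Finset.mul_sum, mul_smul_comm]
      exact Finset.sum_congr rfl fun j _ => Finset.sum_comm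
    have h6 : ∑ j, ∑ b, (2 * eps3 i j k * epsUp a b) • X.P j b =
        (2 : ℂ) • ∑ j, ∑ b, (eps3 i j k * epsUp a b) • X.P j b := by
      simp only [Finset.smul_sum, smul_smul, mul_assoc]
    rw [h2] at h1
    simp only [smul_sub, Finset.sum_sub_distrib, h4, ← h5, h6] at h1
    have h7 : D i a (X.Q k) = (σ : ℤ) • (∑ j, ∑ b, (eps3 i j k * epsUp a b) • X.P j b) +
        ∑ j, ∑ b, D i a (X.P j b) * D j b (u k) := by
      linear_combination (norm := module) h1
    rw [h3, act_u, h7, smul_add, sign_smul_smul]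
    abel
  refine ⟨h, fun i a f => ?_⟩
  -- Both sides of the equation are derivations in `f` of the same parity, so that it propagates from
  -- the generators; on the `θ_{ia}` it holds because the `D^{ia}` act on them by constants.
  suffices h0 : X.act (D i a f) - (σ : ℤ) • D i a (X.act f) +
      (σ : ℤ) • ∑ j, ∑ b, D i a (X.P j b) * D j b f = 0 from eq_neg_of_add_eq_zero_left h0
  induction f using psf_induction with
  | hc c => simp only [algebraMap_eq, map_smul, act_one, D_one, map_zero, smul_zero, mul_zero,
      Finset.sum_const_zero, sub_self, add_zero]
  | hadd f g hf hg =>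
    simp only [map_add, mul_add, Finset.sum_add_distrib, smul_add]
    linear_combination (norm := module) hf + hg
  | hu k f hf =>
    have e1 : X.act (D i a (u k) * f) = X.act (D i a (u k)) * f + (σ : ℤ) • (D i a (u k) * X.act f) := by
      simp only [D_u, Finset.sum_mul, smul_mul_assoc, map_sum, map_smul, act_thetaUp_mul h, smul_add,
        Finset.sum_add_distrib, Finset.smul_sum, smul_comm (_ : ℂ) (_ : ℤ)]
    have e2 : ∑ j, ∑ b, D i a (X.P j b) * D j b (u k * f) =
        (∑ j, ∑ b, D i a (X.P j b) * D j b (u k)) * f +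
          u k * ∑ j, ∑ b, D i a (X.P j b) * D j b f := by
      simp only [D_mul, parity_u, mul_add, Finset.sum_add_distrib, Finset.sum_mul, Finset.mul_sum,
        ← mul_assoc]
      simp only [u_mul k (D _ _ (X.P _ _))]
    rw [e2, act_u_mul, map_add, D_mul (f := X.Q k), D_mul (f := u k), D_mul (f := u k), map_add, e1,
      parity_u, act_u_mul, h.1]
    have h8 := congrArg (· * f) (hu i a k)
    have h9 := congrArg (u k * ·) hf
    simp only [add_mul, sub_mul, mul_add, mul_sub, zero_mul, mul_zero, act_u, mul_smul_comm,
      smul_mul_assoc, smul_add, sign_smul_smul] at h8 h9 ⊢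
    linear_combination (norm := module) h8 + h9
  | hθ k c f hf =>
    have e2 : ∑ j, ∑ b, D i a (X.P j b) * D j b (theta k c * f) =
        D i a (X.P k c) * f - (σ : ℤ) • (theta k c * ∑ j, ∑ b, D i a (X.P j b) * D j b f) := by
      simp only [D_theta_mul, mul_sub, Finset.sum_sub_distrib, Finset.mul_sum, Finset.smul_sum]
      congr 1
      · rw [Finset.sum_eq_single k, Finset.sum_eq_single c] <;> simp +contextual
      · refine Finset.sum_congr rfl fun j _ => Finset.sum_congr rfl fun b _ => ?_
        rw [← mul_assoc, mul_theta, parity_D_P h, ← mul_assoc, mul_smul_comm, smul_mul_assoc]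
    rw [e2, act_theta_mul h, D_theta_mul, map_add, map_sub, D_mul, h.2, act_theta_mul h, map_zsmul,
      D_theta_mul]
    have h9 := congrArg (theta k c * ·) hf
    have e3 : X.act (if i = k ∧ a = c then f else 0) = if i = k ∧ a = c then X.act f else 0 := by
      split_ifs <;> simp
    simp only [mul_add, mul_sub, mul_zero, mul_smul_comm, neg_mul, smul_mul_assoc, smul_add,
      smul_sub, smul_neg, sign_smul_smul, e3] at h9 ⊢
    rcases Int.units_eq_one_or σ with rfl | rfl
    · simp only [Units.val_one, one_smul] at h9 ⊢
      linear_combination (norm := module) -h9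
    · simp only [Units.val_neg, Units.val_one, neg_smul, one_smul] at h9 ⊢
      linear_combination (norm := module) h9

theorem isHomog_euler : euler.IsHomog 1 := by
  refine ⟨fun i => ?_, fun i a => ?_⟩
  · simp [euler]
  · simp [euler]

theorem euler_Qt (k : Fin 3) : euler.Qt k =
    (2 : ℂ) • u k - ∑ j, ∑ l, ∑ a, eps3 j l k • (theta j a * thetaUp l a) := rfl

theorem D_euler_Qt (i k : Fin 3) (a : Fin 2) : D i a (euler.Qt k) =
    ((1 : ℤˣ) : ℤ) • ∑ j, ∑ b, (2 * eps3 i j k * epsUp a b) • euler.P j b := by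
  simp only [euler_Qt, map_sub, map_smul, map_sum, D_u, D_theta_mul, D_thetaUp, Units.val_one, one_smul]
  simp only [eps3_val, euler, thetaUp, epsUp, Fin.sum_univ_three, Fin.sum_univ_two]
  fin_cases i <;> fin_cases k <;> fin_cases a <;> simp

theorem isVLE_euler : euler.IsVLE 1 := isVLE_of_D_Qt isHomog_euler D_euler_Qt

theorem euler_D (i : Fin 3) (a : Fin 2) (f : PSF) :
    euler.act (D i a f) = D i a (euler.act f) - D i a f := by
  have h := isVLE_euler.2 i a f
  have e : ∑ j, ∑ b, D i a (euler.P j b) * D j b f = D i a f := by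
    simp only [euler, D_theta]
    rw [Finset.sum_eq_single i, Finset.sum_eq_single a] <;> simp +contextual [eq_comm]
  rw [e] at h
  simp only [Units.val_one, one_smul] at h
  rw [sub_eq_iff_eq_add] at h
  rw [h]; abel

theorem dv_euler : euler.dv = (6 : ℂ) • 1 := by
  have e : ∀ i j l a, dU i (theta j a * thetaUp l a) = 0 := by
    intro i j l a
    simp only [dU_theta_mul, thetaUp, map_sum, map_smul, dU_theta, smul_zero, Finset.sum_const_zero,
      mul_zero]
  have e' : ∀ i, dU i (euler.Qt i) = (2 : ℂ) • 1 := by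
    intro i
    simp only [euler_Qt, map_sub, map_smul, dU_u, map_sum, e, smul_zero, Finset.sum_const_zero,
      sub_zero, if_true]
  rw [dv, Fin.sum_univ_three, e', e', e']
  module

/-! ### The structure of the degree zero subalgebra -/

theorem act_euler_u_mul (k : Fin 3) (f : PSF) :
    euler.act (u k * f) = u k * (euler.act f + (2 : ℂ) • f) := by
  rw [act_u_mul, mul_add, mul_smul_comm, add_comm]
  simp [euler]

theorem act_euler_theta_mul (i : Fin 3) (a : Fin 2) (f : PSF) :
    euler.act (theta i a * f) = theta i a * (euler.act f + f) := by
  rw [act_theta_mul isHomog_euler, mul_add, add_comm, Units.val_one, one_smul]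
  rfl

/-- Superfunctions of degree zero are constant. -/
theorem eq_const_of_euler_eq_zero {f : PSF} (hf : euler.act f = 0) :
    ∃ c : ℂ, f = algebraMap ℂ PSF c := by
  -- The augmentation ideal is spanned by eigenvectors of positive degree.
  have hpos : ∀ f : PSF, ∃ c : ℂ, ∃ g ∈ ⨆ (n : ℕ) (_ : n ≠ 0),
      Module.End.eigenspace euler.act (n : ℂ), f = algebraMap ℂ PSF c + g := by
    intro f
    induction f using psf_induction with
    | hc c => exact ⟨c, 0, zero_mem _, by simp⟩
    | hadd f g hf hg =>
      obtain ⟨c, x, hx, rfl⟩ := hf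
      obtain ⟨d, y, hy, rfl⟩ := hg
      exact ⟨c + d, x + y, add_mem hx hy, by rw [map_add]; abel⟩
    | hu k f hf =>
      obtain ⟨c, x, hx, rfl⟩ := hf
      refine ⟨0, _, ?_, by rw [map_zero, zero_add]⟩
      rw [mul_add]
      refine add_mem ?_ ?_
      · refine Submodule.mem_iSup_of_mem 2 (Submodule.mem_iSup_of_mem two_ne_zero ?_)
        rw [Module.End.mem_eigenspace_iff, act_euler_u_mul, act_algebraMap, zero_add, mul_smul_comm]
        norm_num
      · induction hx using Submodule.iSup_induction' with
        | mem n x hx =>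
          by_cases hn : n = 0
          · simp [hn] at hx
            simp [hx]
          · simp only [ne_eq, hn, not_false_eq_true, iSup_pos, Module.End.mem_eigenspace_iff] at hx
            refine Submodule.mem_iSup_of_mem (n + 2) (Submodule.mem_iSup_of_mem (by omega) ?_)
            rw [Module.End.mem_eigenspace_iff, act_euler_u_mul, hx, ← add_smul, mul_smul_comm]
            push_cast; rfl
        | zero => rw [mul_zero]; exact zero_mem _
        | add x y _ _ hx hy => rw [mul_add]; exact add_mem hx hy
    | hθ k a f hf =>
      obtain ⟨c, x, hx, rfl⟩ := hf
      refine ⟨0, _, ?_, by rw [map_zero, zero_add]⟩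
      rw [mul_add]
      refine add_mem ?_ ?_
      · refine Submodule.mem_iSup_of_mem 1 (Submodule.mem_iSup_of_mem one_ne_zero ?_)
        rw [Module.End.mem_eigenspace_iff, act_euler_theta_mul, act_algebraMap, zero_add]
        norm_num
      · induction hx using Submodule.iSup_induction' with
        | mem n x hx =>
          by_cases hn : n = 0
          · simp [hn] at hx
            simp [hx]
          · simp only [ne_eq, hn, not_false_eq_true, iSup_pos, Module.End.mem_eigenspace_iff] at hx
            refine Submodule.mem_iSup_of_mem (n + 1) (Submodule.mem_iSup_of_mem (by omega) ?_)
            rw [Module.End.mem_eigenspace_iff, act_euler_theta_mul, hx, ← mul_smul_comm]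
            congr 1
            push_cast; module
        | zero => rw [mul_zero]; exact zero_mem _
        | add x y _ _ hx hy => rw [mul_add]; exact add_mem hx hy
  obtain ⟨c, g, hg, rfl⟩ := hpos f
  refine ⟨c, ?_⟩
  rw [map_add, act_algebraMap, zero_add] at hf
  have h1 : iSupIndep fun n : ℕ => Module.End.eigenspace euler.act (n : ℂ) :=
    (Module.End.eigenspaces_iSupIndep euler.act).comp Nat.cast_injective
  have h2 := (Submodule.disjoint_def.mp (h1 0)) g
    (by rw [Module.End.mem_eigenspace_iff, hf]; simp) hg
  rw [h2, add_zero]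

theorem euler_dU (k : Fin 3) (f : PSF) :
    euler.act (dU k f) = dU k (euler.act f) - (2 : ℂ) • dU k f := by
  induction f using psf_induction with
  | hc c => simp only [algebraMap_eq, map_smul, act_one, dU_one, map_zero, smul_zero, sub_self]
  | hadd f g hf hg => simp only [map_add, hf, hg, smul_add]; abel
  | hu i f hf =>
    rw [dU_u_mul, map_add, act_euler_u_mul, act_euler_u_mul, dU_u_mul, hf, map_add, map_smul]
    split_ifs
    · rw [sub_add_cancel, mul_add, mul_smul_comm]
      module
    · rw [map_zero, sub_add_cancel, mul_add, mul_smul_comm]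
      module
  | hθ i a f hf =>
    rw [dU_theta_mul, act_euler_theta_mul, act_euler_theta_mul, dU_theta_mul, hf, map_add, mul_add,
      mul_sub, mul_add, mul_smul_comm]
    module

/-- The data of an element of `𝔤₀`: the constant matrices `A ∈ sl(3)`, `S ∈ sl(2)` and the number
`w ∈ gl(1)`. -/
structure G0Data (σ : ℤˣ) (X : VField) (A : Fin 3 → Fin 3 → ℂ) (S : Fin 2 → Fin 2 → ℂ) (w : ℂ) :
    Prop where
  isVLE : X.IsVLE σ
  sl3_eq : ∀ j l, X.sl3 j l = A j l • 1
  sl2_eq : ∀ b c, X.sl2 σ b c = S b c • 1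
  dv_eq : X.dv = (6 * w) • 1
  trA : A 0 0 + A 1 1 + A 2 2 = 0
  trS : S 0 0 + S 1 1 = 0

theorem smul_one_injective {c d : ℂ} (h : c • (1 : PSF) = d • 1) : c = d := by
  rw [← algebraMap_eq, ← algebraMap_eq] at h
  exact FaithfulSMul.algebraMap_injective ℂ PSF h

theorem euler_Q {X : VField} (h : X.IsG0 σ) (k : Fin 3) : euler.act (X.Q k) = (2 : ℂ) • X.Q k := by
  have := h.2 (u k)
  rw [act_u] at this
  rw [this, act_u]
  simp [euler, act_u]

theorem euler_P {X : VField} (h : X.IsG0 σ) (i : Fin 3) (a : Fin 2) :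
    euler.act (X.P i a) = X.P i a := by
  have := h.2 (theta i a)
  rw [act_theta] at this
  rw [this, act_theta]
  simp [euler, act_theta]

theorem euler_Qt_of_isG0 {X : VField} (h : X.IsG0 σ) (k : Fin 3) :
    euler.act (X.Qt k) = (2 : ℂ) • X.Qt k := by
  have e : ∀ j l a, euler.act (X.P j a * thetaUp l a) = (2 : ℂ) • (X.P j a * thetaUp l a) := by
    intro j l a
    have h1 : X.P j a * thetaUp l a = ∑ b, -((σ : ℤ) • (epsUp a b • (theta l b * X.P j a))) := by
      simp only [thetaUp, Finset.mul_sum, mul_smul_comm, mul_theta, h.1.1.2, mul_neg, smul_neg,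
        smul_comm (_ : ℂ) (_ : ℤ)]
    simp only [h1, map_sum, map_neg, map_zsmul, map_smul, act_euler_theta_mul, euler_P h, mul_add,
      Finset.smul_sum]
    exact Finset.sum_congr rfl fun b _ => by module
  simp only [Qt, map_sub, map_sum, map_smul, e, euler_Q h, smul_sub, Finset.smul_sum,
    smul_comm (_ : ℂ) (2 : ℂ)]

/-- An element of `𝔤₀` has structure functions of degree zero, hence constant ones. They have the
parity of `X`, so that they vanish for odd `X`. -/
theorem exists_g0Data {X : VField} (h : X.IsG0 σ) : ∃ A S w, G0Data σ X A S w ∧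
    (σ = -1 → A = 0 ∧ S = 0 ∧ w = 0) := by
  have c1 : ∀ j l, ∃ c : ℂ, dU j (X.Qt l) = c • 1 := fun j l => by
    obtain ⟨c, hc⟩ := eq_const_of_euler_eq_zero (f := dU j (X.Qt l))
      (by rw [euler_dU, euler_Qt_of_isG0 h, map_smul, sub_self])
    exact ⟨c, by rw [hc, algebraMap_eq]⟩
  have c2 : ∀ i a j b, ∃ c : ℂ, D i a (X.P j b) = c • 1 := fun i a j b => by
    obtain ⟨c, hc⟩ := eq_const_of_euler_eq_zero (f := D i a (X.P j b))
      (by rw [euler_D, euler_P h, sub_self])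
    exact ⟨c, by rw [hc, algebraMap_eq]⟩
  choose U hU using c1
  choose M hM using c2
  have hdv : X.dv = (6 * (1 / 6 * ∑ i, U i i)) • (1 : PSF) := by
    simp only [dv, hU, ← Finset.sum_smul]
    congr 1; ring
  have hA : ∀ j l, ∃ c : ℂ, X.sl3 j l = c • (1 : PSF) := by
    intro j l
    refine ⟨U j l - if j = l then (1 / 3) * ∑ i, U i i else 0, ?_⟩
    rw [sl3, hU, hdv]
    split_ifs <;> module
  have hS : ∀ b c, ∃ d : ℂ, X.sl2 σ b c = d • (1 : PSF) := by
    intro b c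
    refine ⟨-((1 / 3) * ((σ : ℤ) * ∑ i, M i c i b - if b = c then (1 / 2) * ∑ i, U i i else 0)), ?_⟩
    simp only [sl2, hM, hdv, ← Finset.sum_smul]
    split_ifs <;> module
  choose A hA using hA
  choose S hS using hS
  refine ⟨_, _, _, ⟨h.1, hA, hS, hdv, ?_, ?_⟩, ?_⟩
  · refine smul_one_injective ?_
    have := X.sl3_trace
    simp only [Fin.sum_univ_three, hA, ← add_smul] at this
    rw [this, zero_smul]
  · refine smul_one_injective ?_
    have := X.sl2_trace h.1
    simp only [Fin.sum_univ_two, hS, ← add_smul] at this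
    rw [this, zero_smul]
  · rintro rfl
    have hz : ∀ {f : PSF} {c : ℂ}, f = c • (1 : PSF) → parity f = ((-1 : ℤˣ) : ℤ) • f → c = 0 := by
      rintro f c rfl hf
      simp only [map_smul, parity_one, Units.val_neg, Units.val_one, neg_smul, one_smul] at hf
      have h2 : (c + c) • (1 : PSF) = (0 : ℂ) • 1 := by
        rw [add_smul, zero_smul]; nth_rw 1 [hf]; exact neg_add_cancel _
      have := smul_one_injective h2
      linear_combination this / 2
    refine ⟨funext fun j => funext fun l => hz (hA j l) (X.parity_sl3 h.1.1 j l),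
      funext fun b => funext fun c => hz (hS b c) (X.parity_sl2 h.1.1 b c), ?_⟩
    have := hz hdv (X.parity_dv h.1.1)
    linear_combination this / 6

/-- The bracket of an element of `𝔤₀` with `D^{ia}`. -/
theorem G0Data.act_D {X : VField} {A : Fin 3 → Fin 3 → ℂ} {S : Fin 2 → Fin 2 → ℂ} {w : ℂ}
    (h : G0Data σ X A S w) (i : Fin 3) (a : Fin 2) (f : PSF) :
    X.act (D i a f) = (σ : ℤ) • D i a (X.act f) + ∑ j, A j i • D j a f + ∑ b, S b a • D i b f -
      w • D i a f := by
  rw [X.act_D h.isVLE]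
  simp only [h.sl3_eq, h.sl2_eq, h.dv_eq, smul_mul_assoc, one_mul, smul_smul]
  congr 2
  ring

theorem G0Data.rho_eq {X : VField} {A : Fin 3 → Fin 3 → ℂ} {S : Fin 2 → Fin 2 → ℂ} {w : ℂ}
    (h : G0Data σ X A S w) (i : Fin 3) (a : Fin 2) : X.rho i a = 0 := by
  simp [rho, h.dv_eq]

end VField

/-! ### Invariance of the operators of order one and two -/

section invariance

variable {σ : ℤˣ} {X : VField} {p q r : ℕ}

theorem opA_zero (ω : Comp (p + 1) 0 (r + 1)) : opA 0 ω = 0 := by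
  funext I J B; simp [opA]

theorem opB_zero (ω : Comp (p + 1) 0 r) : opB 0 ω = 0 := by
  funext I J B; simp [opB, lowerOp]

theorem opC_zero (ω : Comp 0 q (r + 1)) : opC 0 ω = 0 := by
  funext I J B; simp [opC]

theorem opD_zero (ω : Comp 0 q r) : opD 0 ω = 0 := by
  funext I J B; simp [opD, lowerOp]

theorem lie_nabla1A {z z' : ℤ} (h : X.IsVLE σ) (hz' : z' = z + 1)
    (hz : z = 2 * (p + 1) - 3 * (r + 1) ∨ rhoOp X = 0) {ω : Comp (p + 1) 0 (r + 1)}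
    (hω : ω ∈ T ⟨p + 1, 0, r + 1, z⟩) :
    lie ⟨p, 0, r, z'⟩ σ X (nabla1A ω) = (σ : ℤ) • nabla1A (lie ⟨p + 1, 0, r + 1, z⟩ σ X ω) := by
  refine (lie_opA h z z' hω).trans ?_
  have e : (((z - (2 * (p + 1) - 3 * (r + 1)) : ℤ) : ℂ) / 3) • opA (rhoOp X) ω = 0 := by
    rcases hz with hz | hz
    · simp [hz]
    · rw [hz, opA_zero, smul_zero]
  rw [e, hz']
  simp [show nabla1A = opA (p := p) (r := r) D from rfl]

theorem lie_nabla1B {z z' : ℤ} (h : X.IsVLE σ) (hz' : z' = z + 1)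
    (hz : z = 2 * (p + 1) + 3 * r + 6 ∨ rhoOp X = 0) {ω : Comp (p + 1) 0 r}
    (hω : ω ∈ T ⟨p + 1, 0, r, z⟩) :
    lie ⟨p, 0, r + 1, z'⟩ σ X (nabla1B ω) = (σ : ℤ) • nabla1B (lie ⟨p + 1, 0, r, z⟩ σ X ω) := by
  refine (lie_opB h z z' hω).trans ?_
  have e : (((z - (2 * (p + 1) + 3 * r + 6) : ℤ) : ℂ) / 3) • opB (rhoOp X) ω = 0 := by
    rcases hz with hz | hz
    · simp [hz]
    · rw [hz, opB_zero, smul_zero]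
  rw [e, hz']
  simp [show nabla1B = opB (p := p) (r := r) D from rfl]

theorem lie_nabla1C {z z' : ℤ} (h : X.IsVLE σ) (hz' : z' = z + 1)
    (hz : z = -2 * q - 3 * (r + 1) - 6 ∨ rhoOp X = 0) {ω : Comp 0 q (r + 1)}
    (hω : ω ∈ T ⟨0, q, r + 1, z⟩) :
    lie ⟨0, q + 1, r, z'⟩ σ X (nabla1C ω) = (σ : ℤ) • nabla1C (lie ⟨0, q, r + 1, z⟩ σ X ω) := by
  refine (lie_opC h z z' hω).trans ?_
  have e : (((z - (-2 * q - 3 * (r + 1) - 6) : ℤ) : ℂ) / 3) • opC (rhoOp X) ω = 0 := by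
    rcases hz with hz | hz
    · simp [hz]
    · rw [hz, opC_zero, smul_zero]
  rw [e, hz']
  simp [show nabla1C = opC (q := q) (r := r) D from rfl]

theorem lie_nabla1D {z z' : ℤ} (h : X.IsVLE σ) (hz' : z' = z + 1)
    (hz : z = -2 * q + 3 * r ∨ rhoOp X = 0) {ω : Comp 0 q r} (hω : ω ∈ T ⟨0, q, r, z⟩) :
    lie ⟨0, q + 1, r + 1, z'⟩ σ X (nabla1D ω) = (σ : ℤ) • nabla1D (lie ⟨0, q, r, z⟩ σ X ω) := by
  refine (lie_opD h z z' hω).trans ?_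
  have e : (((z - (-2 * q + 3 * r) : ℤ) : ℂ) / 3) • opD (rhoOp X) ω = 0 := by
    rcases hz with hz | hz
    · simp [hz]
    · rw [hz, opD_zero, smul_zero]
  rw [e, hz']
  simp [show nabla1D = opD (q := q) (r := r) D from rfl]

theorem rhoOp_eq_zero (h : X.IsG0 σ) : rhoOp X = 0 := by
  obtain ⟨A, S, w, hX, -⟩ := VField.exists_g0Data h
  funext i a
  ext f
  simp [hX.rho_eq]

theorem sign_sq (σ : ℤˣ) : ((σ ^ 2 : ℤˣ) : ℤ) = 1 := by
  rw [Int.units_sq]; rfl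

theorem lie_nabla2A_of_isG0 {z z' : ℤ} (h : X.IsG0 σ) (hz' : z' = z + 2) {ω : Comp (p + 2) 0 0}
    (hω : ω ∈ T ⟨p + 2, 0, 0, z⟩) :
    lie ⟨p, 0, 0, z'⟩ σ X (nabla2A ω) =
      ((σ ^ 2 : ℤˣ) : ℤ) • nabla2A (lie ⟨p + 2, 0, 0, z⟩ σ X ω) := by
  have e : lie ⟨p, 0, 0, z'⟩ σ X (nabla1A (nabla1B ω)) =
      (σ : ℤ) • nabla1A (lie ⟨p + 1, 0, 1, z + 1⟩ σ X (nabla1B ω)) :=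
    lie_nabla1A h.1 (by omega) (Or.inr (rhoOp_eq_zero h)) (nabla1B_mem hω)
  have e' : lie ⟨p + 1, 0, 1, z + 1⟩ σ X (nabla1B ω) =
      (σ : ℤ) • nabla1B (lie ⟨p + 2, 0, 0, z⟩ σ X ω) :=
    lie_nabla1B (p := p + 1) h.1 rfl (Or.inr (rhoOp_eq_zero h)) hω
  rw [nabla2A_eq, nabla2A_eq, e, e', ← nabla1A_dOperator.toLin_apply, map_zsmul, sign_smul_smul,
    sign_sq, one_smul]
  rfl

theorem lie_nabla2C_of_isG0 {z z' : ℤ} (h : X.IsG0 σ) (hz' : z' = z + 2) {ω : Comp 0 q 0}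
    (hω : ω ∈ T ⟨0, q, 0, z⟩) :
    lie ⟨0, q + 2, 0, z'⟩ σ X (nabla2C ω) =
      ((σ ^ 2 : ℤˣ) : ℤ) • nabla2C (lie ⟨0, q, 0, z⟩ σ X ω) := by
  have e : lie ⟨0, q + 2, 0, z'⟩ σ X (nabla1C (nabla1D ω)) =
      (σ : ℤ) • nabla1C (lie ⟨0, q + 1, 1, z + 1⟩ σ X (nabla1D ω)) :=
    lie_nabla1C h.1 (by omega) (Or.inr (rhoOp_eq_zero h)) (nabla1D_mem hω)
  have e' : lie ⟨0, q + 1, 1, z + 1⟩ σ X (nabla1D ω) =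
      (σ : ℤ) • nabla1D (lie ⟨0, q, 0, z⟩ σ X ω) :=
    lie_nabla1D (r := 0) h.1 rfl (Or.inr (rhoOp_eq_zero h)) hω
  rw [nabla2C_eq, nabla2C_eq, e, e', ← nabla1C_dOperator.toLin_apply, map_zsmul, sign_smul_smul,
    sign_sq, one_smul]
  rfl

theorem rho_mul_D (h : X.IsVLE σ) (i j : Fin 3) (a b : Fin 2) (f : PSF) :
    D i a (X.rho j b * f) = D i a (X.rho j b) * f - (σ : ℤ) • (X.rho j b * D i a f) := by
  rw [D_mul, VField.parity_rho h.1, neg_mul, smul_mul_assoc, sub_eq_add_neg]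

theorem D_rho_antisymm (h : X.IsVLE σ) (i j : Fin 3) :
    D i 0 (X.rho j 1) + D j 0 (X.rho i 1) = 0 ∧ D i 1 (X.rho j 0) + D j 1 (X.rho i 0) = 0 :=
  ⟨X.D_rho h i j (by decide), X.D_rho h i j (by decide)⟩

/-- On symmetric tensors of rank two the second-order operator is invariant under all of
`vle(3|6)`: the defects of invariance of its two first-order factors cancel. -/
theorem lie_nabla2A_two {z' : ℤ} (h : X.IsVLE σ) (hz' : z' = 6) {ω : Comp 2 0 0}
    (hω : ω ∈ T ⟨2, 0, 0, 4⟩) :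
    lie ⟨0, 0, 0, z'⟩ σ X (nabla2A ω) = nabla2A (lie ⟨2, 0, 0, 4⟩ σ X ω) := by
  subst hz'
  -- The weights of the sources of `∇_1 : T(1,0;1;5) → T(0,0;0;6)` and `∇_1 : T(2,0;0;4) → T(1,0;1;5)`
  -- differ by `6` and `-6` from those that make these operators invariant.
  have e : lie ⟨0, 0, 0, 6⟩ σ X (nabla1A (nabla1B ω)) =
      (σ : ℤ) • nabla1A (lie ⟨1, 0, 1, 5⟩ σ X (nabla1B ω)) -
        (σ : ℤ) • (2 : ℂ) • opA (rhoOp X) (nabla1B ω) := by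
    refine (lie_opA (p := 0) (r := 0) h 5 6 (nabla1B_mem hω)).trans ?_
    norm_num
    rfl
  have e' : lie ⟨1, 0, 1, 5⟩ σ X (nabla1B ω) =
      (σ : ℤ) • nabla1B (lie ⟨2, 0, 0, 4⟩ σ X ω) + (σ : ℤ) • (2 : ℂ) • opB (rhoOp X) ω := by
    refine (lie_opB (p := 1) (r := 0) h 4 5 hω).trans ?_
    norm_num
    rfl
  have key : opA (rhoOp X) (nabla1B ω) = (σ : ℤ) • nabla1A (opB (rhoOp X) ω) := by
    have hs : ∀ i j, ω ![i, j] ![] ![] = ω ![j, i] ![] ![] := by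
      intro i j
      rw [← hω.1 (Equiv.swap 0 1)]
      congr 1
      ext k; fin_cases k <;> rfl
    funext I J B
    have hI : I = ![] := Subsingleton.elim _ _
    have hJ : J = ![] := Subsingleton.elim _ _
    have hB : B = ![] := Subsingleton.elim _ _
    subst hI hJ hB
    have hsn : ∀ i j : Fin 3, snoc (α := fun _ => Fin 3) (snoc (α := fun _ => Fin 3) ![] i :
        Fin 1 → Fin 3) j = ![i, j] := by
      intro i j; ext k; fin_cases k <;> rfl
    have hoB : ∀ (T : Fin 3 → Fin 2 → PSF →ₗ[ℂ] PSF) (I : Fin 1 → Fin 3) (B : Fin 1 → Fin 2),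
        opB (p := 1) (r := 0) T ω I ![] B = ∑ j, lowerOp T j (B 0) (ω (snoc I j) ![] ![]) := by
      intro T I B
      unfold opB
      refine (Fin.sum_univ_succ _).trans ?_
      rw [Fin.sum_univ_zero, add_zero]
      exact Finset.sum_congr rfl fun j _ => by congr 2; exact Subsingleton.elim _ _
    have hl : ∀ b, (snoc (α := fun _ => Fin 2) ![] b : Fin 1 → Fin 2) 0 = b := fun b => rfl
    have c := fun i j => eq_neg_of_add_eq_zero_left (D_rho_antisymm h i j).1
    have c' := fun i j => eq_neg_of_add_eq_zero_left (D_rho_antisymm h i j).2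
    have d : ∀ i, D i 0 (X.rho i 1) = 0 ∧ D i 1 (X.rho i 0) = 0 := fun i => by
      have := D_rho_antisymm h i i
      simp only [← two_smul ℂ, smul_eq_zero, OfNat.ofNat_ne_zero, false_or] at this
      exact this
    -- The terms with a derivative of `ρ` cancel: they contain `D^{ia} ρ^{jb}` with `a ≠ b` only, which
    -- is antisymmetric in `i, j`, contracted with the symmetric `ω_{ij}`.
    simp only [show nabla1B ω = opB D ω from rfl, show nabla1A (opB (rhoOp X) ω) =
      opA D (opB (rhoOp X) ω) from rfl, Pi.smul_apply, opA, hoB, hsn, hl, lowerOp_apply,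
      rhoOp_apply, map_sum, map_smul, rho_mul_D h]
    simp only [Fin.sum_univ_three, Fin.sum_univ_two, hs 1 0,
      hs 2 0, hs 2 1, (d _).1, (d _).2, c 1 0, c 2 0, c 2 1, c' 1 0, c' 2 0, c' 2 1, epsLow]
    rcases Int.units_eq_one_or σ with rfl | rfl
    · simp [-zsmul_eq_mul]
      module
    · simp [-zsmul_eq_mul]
      module
  rw [nabla2A_eq, nabla2A_eq, e, e', key]
  have h1 : ∀ ω₁ ω₂ : Comp 1 0 1, nabla1A ((σ : ℤ) • ω₁ + (σ : ℤ) • (2 : ℂ) • ω₂) =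
      (σ : ℤ) • nabla1A (p := 0) (r := 0) ω₁ +
        (σ : ℤ) • (2 : ℂ) • nabla1A (p := 0) (r := 0) ω₂ := fun ω₁ ω₂ => by
    simp only [← nabla1A_dOperator.toLin_apply, map_add, map_zsmul, map_smul]
  rw [h1]
  simp only [smul_add, sign_smul_smul, smul_comm (2 : ℂ) (σ : ℤ)]
  rw [add_sub_cancel_right]

/-- On scalars the second-order operator is invariant under all of `vle(3|6)`. -/
theorem lie_nabla2C_zero {z' : ℤ} (h : X.IsVLE σ) (hz' : z' = -4) {ω : Comp 0 0 0}
    (hω : ω ∈ T ⟨0, 0, 0, -6⟩) :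
    lie ⟨0, 2, 0, z'⟩ σ X (nabla2C ω) = nabla2C (lie ⟨0, 0, 0, -6⟩ σ X ω) := by
  subst hz'
  -- The weights of the sources of `∇_1 : T(0,1;1;-5) → T(0,2;0;-4)` and
  -- `∇_1 : T(0,0;0;-6) → T(0,1;1;-5)` differ by `6` and `-6` from those that make these operators
  -- invariant.
  have e : lie ⟨0, 2, 0, -4⟩ σ X (nabla1C (nabla1D ω)) =
      (σ : ℤ) • nabla1C (lie ⟨0, 1, 1, -5⟩ σ X (nabla1D ω)) -
        (σ : ℤ) • (2 : ℂ) • opC (rhoOp X) (nabla1D ω) := by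
    refine (lie_opC (q := 1) (r := 0) h (-5) (-4) (nabla1D_mem hω)).trans ?_
    norm_num
    rfl
  have e' : lie ⟨0, 1, 1, -5⟩ σ X (nabla1D ω) =
      (σ : ℤ) • nabla1D (lie ⟨0, 0, 0, -6⟩ σ X ω) + (σ : ℤ) • (2 : ℂ) • opD (rhoOp X) ω := by
    refine (lie_opD (q := 0) (r := 0) h (-6) (-5) hω).trans ?_
    norm_num
    rfl
  have key : opC (rhoOp X) (nabla1D ω) = (σ : ℤ) • nabla1C (opD (rhoOp X) ω) := by
    funext I J B
    have hI : I = ![] := Subsingleton.elim _ _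
    have hB : B = ![] := Subsingleton.elim _ _
    subst hI hB
    have hoD : ∀ (T : Fin 3 → Fin 2 → PSF →ₗ[ℂ] PSF) (J : Fin 1 → Fin 3) (B : Fin 1 → Fin 2),
        opD (q := 0) (r := 0) T ω ![] J B = lowerOp T (J 0) (B 0) (ω ![] ![] ![]) := by
      intro T J B
      unfold opD
      refine (Fin.sum_univ_succ _).trans ?_
      rw [Fin.sum_univ_zero, add_zero]
      refine (Fin.sum_univ_succ _).trans ?_
      rw [Fin.sum_univ_zero, add_zero]
      congr 2 <;> exact Subsingleton.elim _ _
    have hl : ∀ b, (snoc (α := fun _ => Fin 2) ![] b : Fin 1 → Fin 2) 0 = b := fun b => rfl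
    have hoC : ∀ (T : Fin 3 → Fin 2 → PSF →ₗ[ℂ] PSF) (ω' : Comp 0 1 1),
        opC (q := 1) (r := 0) T ω' ![] J ![] =
          ∑ b, T (J 0) b (ω' ![] (fun _ => J 1) (snoc ![] b)) +
            ∑ b, T (J 1) b (ω' ![] (fun _ => J 0) (snoc ![] b)) := by
      intro T ω'
      have e0 : removeNth (α := fun _ => Fin 3) 0 J = fun _ => J 1 := by
        ext k; fin_cases k; rfl
      have e1 : removeNth (α := fun _ => Fin 3) 1 J = fun _ => J 0 := by
        ext k; fin_cases k; rfl
      refine (Fin.sum_univ_two _).trans ?_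
      rw [← e0, ← e1]
    have c := eq_neg_of_add_eq_zero_left (D_rho_antisymm h (J 1) (J 0)).1
    have c' := eq_neg_of_add_eq_zero_left (D_rho_antisymm h (J 1) (J 0)).2
    simp only [show nabla1D ω = opD D ω from rfl, show nabla1C (opD (rhoOp X) ω) =
      opC D (opD (rhoOp X) ω) from rfl, Pi.smul_apply, hoC, hoD, hl, lowerOp_apply,
      rhoOp_apply, map_sum, map_smul, rho_mul_D h]
    simp only [Fin.sum_univ_two, c, c', epsLow]
    rcases Int.units_eq_one_or σ with rfl | rfl
    · simp [-zsmul_eq_mul]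
      module
    · simp [-zsmul_eq_mul]
      module
  rw [nabla2C_eq, nabla2C_eq, e, e', key]
  have h1 : ∀ ω₁ ω₂ : Comp 0 1 1, nabla1C ((σ : ℤ) • ω₁ + (σ : ℤ) • (2 : ℂ) • ω₂) =
      (σ : ℤ) • nabla1C (q := 1) (r := 0) ω₁ +
        (σ : ℤ) • (2 : ℂ) • nabla1C (q := 1) (r := 0) ω₂ := fun ω₁ ω₂ => by
    simp only [← nabla1C_dOperator.toLin_apply, map_add, map_zsmul, map_smul]
  rw [h1]
  simp only [smul_add, sign_smul_smul, smul_comm (2 : ℂ) (σ : ℤ)]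
  rw [add_sub_cancel_right]

end invariance

/-! ### Covariant families of operators -/

section covariant

variable {α : Type*} [Fintype α] {n : ℕ}

/-- The action of `m` before a contraction is its action after the contraction, and a term in which
`m` acts on the contracted index. -/
theorem rot_snoc_sum (m : α → α → PSF) (G : α → (Fin (n + 1) → α) → PSF) (I : Fin n → α) :
    ∑ j, rot m (G j) (snoc (α := fun _ => α) I j) =
      ∑ j, ∑ l, m j l * G j (snoc (α := fun _ => α) I l) +
        rot m (fun I => ∑ j, G j (snoc (α := fun _ => α) I j)) I := by
  rw [rot_sum, ← Finset.sum_add_distrib]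
  refine Finset.sum_congr rfl fun j _ => ?_
  simp only [rot, Fin.sum_univ_castSucc, Fin.snoc_castSucc, Fin.snoc_last, ← Fin.snoc_update,
      Fin.update_snoc_last]
  abel

/-- The action of `m` after adjoining an index with symmetrisation is its action before, and a term in
which `m` acts on the adjoined index. -/
theorem rot_removeNth_sum (m : α → α → PSF) (G : α → (Fin n → α) → PSF) (J : Fin (n + 1) → α) :
    rot m (fun J => ∑ k, G (J k) (removeNth k J)) J =
      ∑ k, (∑ l, m (J k) l * G l (removeNth k J) + rot m (G (J k)) (removeNth k J)) := by
  have e1 : ∀ i, ∑ l, ∑ k, m (J i) l * G (Function.update J i l k)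
      (removeNth k (Function.update J i l)) = ∑ k, ∑ l, m (J i) l *
      G (Function.update J i l k) (removeNth k (Function.update J i l)) :=
    fun i => Finset.sum_comm
  simp only [rot, Finset.mul_sum, e1]
  rw [Finset.sum_comm]
  refine Finset.sum_congr rfl fun k _ => ?_
  rw [Fin.sum_univ_succAbove _ k]
  congr 1
  · simp
  · refine Finset.sum_congr rfl fun i _ => Finset.sum_congr rfl fun l _ => ?_
    rw [Fin.removeNth_update_succAbove, Function.update_of_ne (Fin.succAbove_ne k i).symm]
    rfl

theorem map_rot {m : α → α → PSF} {L : PSF →ₗ[ℂ] PSF} (hL : ∀ x y f, L (m x y * f) = m x y * L f)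
    (g : (Fin n → α) → PSF) (I : Fin n → α) : L (rot m g I) = rot m (fun I => L (g I)) I := by
  simp only [rot, map_sum, hL]

/-- `ε_{ijk} E_1^i E_2^j E_3^k` for `sl(3)` vectors of operators. -/
def triple (E₁ E₂ E₃ : Fin 3 → PSF →ₗ[ℂ] PSF) : PSF →ₗ[ℂ] PSF :=
  ∑ i, ∑ j, ∑ k, eps3 i j k • (E₁ i ∘ₗ E₂ j ∘ₗ E₃ k)

theorem triple_apply (E₁ E₂ E₃ : Fin 3 → PSF →ₗ[ℂ] PSF) (f : PSF) :
    triple E₁ E₂ E₃ f = ∑ i, ∑ j, ∑ k, eps3 i j k • E₁ i (E₂ j (E₃ k f)) := by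
  simp [triple]

theorem triple_expand (E₁ E₂ E₃ : Fin 3 → PSF →ₗ[ℂ] PSF) (f : PSF) :
    triple E₁ E₂ E₃ f = E₁ 0 (E₂ 1 (E₃ 2 f)) - E₁ 0 (E₂ 2 (E₃ 1 f)) - E₁ 1 (E₂ 0 (E₃ 2 f)) +
      E₁ 1 (E₂ 2 (E₃ 0 f)) + E₁ 2 (E₂ 0 (E₃ 1 f)) - E₁ 2 (E₂ 1 (E₃ 0 f)) := by
  simp only [triple_apply, Fin.sum_univ_three, eps3_val]
  simp
  abel

variable {X : VField} {A : Fin 3 → Fin 3 → ℂ} {S : Fin 2 → Fin 2 → ℂ} {w : ℂ}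

/-- `E` is a vector of operators under the `sl(3)` part of `X`, of weight `-w`, and is mapped to
`E'` by the rest of `X`. -/
def IsVec (X : VField) (A : Fin 3 → Fin 3 → ℂ) (w : ℂ) (E E' : Fin 3 → PSF →ₗ[ℂ] PSF) : Prop :=
  ∀ i f, X.act (E i f) =
    E i (X.act f) + (A 0 i • E 0 f + A 1 i • E 1 f + A 2 i • E 2 f) + E' i f - w • E i f

/-- Since `ε_{ijk}` is `sl(3)`-invariant, only the weight and the remaining parts of the derivative
survive. -/
theorem act_triple (hA : A 0 0 + A 1 1 + A 2 2 = 0) {E₁ E₂ E₃ E₁' E₂' E₃' : Fin 3 → PSF →ₗ[ℂ] PSF}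
    (h₁ : IsVec X A w E₁ E₁') (h₂ : IsVec X A w E₂ E₂') (h₃ : IsVec X A w E₃ E₃') (f : PSF) :
    X.act (triple E₁ E₂ E₃ f) = triple E₁ E₂ E₃ (X.act f) + triple E₁' E₂ E₃ f +
      triple E₁ E₂' E₃ f + triple E₁ E₂ E₃' f - (3 * w) • triple E₁ E₂ E₃ f := by
  have hA' : A 2 2 = -A 0 0 - A 1 1 := by linear_combination hA
  simp only [triple_expand, map_add, map_sub, map_smul, h₁ _ _, h₂ _ _, h₃ _ _, hA']
  module

/-- `W^{abc} = ε_{ijk} D^{ia} D^{jb} D^{kc}`. -/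
def W (a b c : Fin 2) : PSF →ₗ[ℂ] PSF := triple (fun i => D i a) (fun i => D i b) (fun i => D i c)

/-- `W_{abc} = ε_{ijk} D^i_a D^j_b D^k_c`. -/
def Wlow (a b c : Fin 2) : PSF →ₗ[ℂ] PSF :=
  triple (fun i => Dlow i a) (fun i => Dlow i b) (fun i => Dlow i c)

theorem triple_lin (E₁ E₂ E₃ F G : Fin 3 → PSF →ₗ[ℂ] PSF) (c d : ℂ) (f : PSF) :
    triple (fun i => c • F i + d • G i) E₂ E₃ f = c • triple F E₂ E₃ f + d • triple G E₂ E₃ f ∧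
    triple E₁ (fun i => c • F i + d • G i) E₃ f = c • triple E₁ F E₃ f + d • triple E₁ G E₃ f ∧
    triple E₁ E₂ (fun i => c • F i + d • G i) f = c • triple E₁ E₂ F f + d • triple E₁ E₂ G f := by
  simp only [triple_expand, LinearMap.add_apply, LinearMap.smul_apply, map_add, map_smul]
  refine ⟨?_, ?_, ?_⟩ <;> module

theorem isVec_D (h : VField.G0Data 1 X A S w) (a : Fin 2) :
    IsVec X A w (fun i => D i a) fun i => S 0 a • D i 0 + S 1 a • D i 1 := by
  intro i f
  rw [h.act_D, Fin.sum_univ_three, Fin.sum_univ_two, Units.val_one, one_smul]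
  rfl

theorem isVec_Dlow (h : VField.G0Data 1 X A S w) (a : Fin 2) :
    IsVec X A w (fun i => Dlow i a) fun i => -S a 0 • Dlow i 0 + -S a 1 • Dlow i 1 := by
  intro i f
  have hS : S 1 1 = -S 0 0 := by linear_combination h.trS
  simp only [Dlow_eq, lowerOp_apply, Fin.sum_univ_two, map_add, map_smul, h.act_D, LinearMap.add_apply,
    LinearMap.smul_apply, Fin.sum_univ_three, Units.val_one, one_smul, epsLow]
  fin_cases a <;> simp [hS] <;> module

/-- `W^{abc}` is a tensor of weight `-3w` under `𝔤₀`. -/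
theorem act_W (h : VField.G0Data 1 X A S w) (a b c : Fin 2) (f : PSF) :
    X.act (W a b c f) = W a b c (X.act f) + (S 0 a • W 0 b c f + S 1 a • W 1 b c f) +
      (S 0 b • W a 0 c f + S 1 b • W a 1 c f) + (S 0 c • W a b 0 f + S 1 c • W a b 1 f) -
      (3 * w) • W a b c f := by
  rw [W, act_triple h.trA (isVec_D h a) (isVec_D h b) (isVec_D h c),
    (triple_lin 0 _ _ _ _ _ _ _).1, (triple_lin _ 0 _ _ _ _ _ _).2.1,
    (triple_lin _ _ 0 _ _ _ _ _).2.2]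
  rfl

theorem act_Wlow (h : VField.G0Data 1 X A S w) (a b c : Fin 2) (f : PSF) :
    X.act (Wlow a b c f) = Wlow a b c (X.act f) - (S a 0 • Wlow 0 b c f + S a 1 • Wlow 1 b c f) -
      (S b 0 • Wlow a 0 c f + S b 1 • Wlow a 1 c f) - (S c 0 • Wlow a b 0 f + S c 1 • Wlow a b 1 f) -
      (3 * w) • Wlow a b c f := by
  rw [Wlow, act_triple h.trA (isVec_Dlow h a) (isVec_Dlow h b) (isVec_Dlow h c),
    (triple_lin 0 _ _ _ _ _ _ _).1, (triple_lin _ 0 _ _ _ _ _ _).2.1,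
    (triple_lin _ _ 0 _ _ _ _ _).2.2]
  simp only [Wlow]
  module

theorem act_Dlow_G0 (h : VField.G0Data 1 X A S w) (i : Fin 3) (a : Fin 2) (f : PSF) :
    X.act (Dlow i a f) = Dlow i a (X.act f) +
      (A 0 i • Dlow 0 a f + A 1 i • Dlow 1 a f + A 2 i • Dlow 2 a f) -
      (S a 0 • Dlow i 0 f + S a 1 • Dlow i 1 f) - w • Dlow i a f := by
  rw [isVec_Dlow h a i f]
  simp only [LinearMap.add_apply, LinearMap.smul_apply]
  module

variable {r : ℕ}

theorem sum_three_comm (F : Fin 3 → Fin 3 → Fin 3 → Fin 2 → Fin 2 → Fin 2 → PSF) :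
    ∑ i, ∑ j, ∑ k, ∑ a, ∑ b, ∑ c, F i j k a b c = ∑ a, ∑ b, ∑ c, ∑ i, ∑ j, ∑ k, F i j k a b c := by
  simp only [Finset.sum_comm (s := (Finset.univ : Finset (Fin 3))) (t := (Finset.univ : Finset (Fin 2)))]

theorem nabla3A_eq (ω : Comp 0 0 (r + 3)) (I : Fin 0 → Fin 3) (J : Fin 0 → Fin 3)
    (B : Fin r → Fin 2) : nabla3A ω I J B = ∑ a, ∑ b, ∑ c, W a b c
      (ω I J (snoc (snoc (snoc B a : Fin (r + 1) → Fin 2) b : Fin (r + 2) → Fin 2) c)) := by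
  simp only [nabla3A, W, triple_apply]
  exact sum_three_comm fun i j k a b c => eps3 i j k • D i a (D j b (D k c
    (ω I J (snoc (snoc (snoc B a : Fin (r + 1) → Fin 2) b : Fin (r + 2) → Fin 2) c))))

theorem nabla3B_eq (ω : Comp 0 0 r) (I : Fin 0 → Fin 3) (J : Fin 0 → Fin 3)
    (B : Fin (r + 3) → Fin 2) : nabla3B ω I J B =
      ∑ l : Fin (r + 3), ∑ m : Fin (r + 2), ∑ n : Fin (r + 1),
        Wlow (B l) (removeNth l B m) (removeNth m (removeNth l B) n)
          (ω I J (removeNth n (removeNth m (removeNth l B)))) := by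
  simp only [nabla3B, Wlow, triple_apply]

theorem nabla3B_mem {z z' : ℤ} {ω : Comp 0 0 r} (hω : ω ∈ T ⟨0, 0, r, z⟩) :
    nabla3B ω ∈ T ⟨0, 0, r + 3, z'⟩ := by
  refine mem_T_lower (fun J B π I => by rw [Subsingleton.elim (I ∘ _) I]) fun I J => ?_
  have e : nabla3B ω I J = _ := funext fun B => nabla3B_eq ω I J B
  rw [e]
  exact isSymm_removeNth_sum (n := r + 2) (F := fun a B => ∑ m : Fin (r + 2), ∑ n : Fin (r + 1), Wlow a (B m) (removeNth m B n)
    (ω I J (removeNth n (removeNth m B)))) fun a =>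
    isSymm_removeNth_sum (n := r + 1) (F := fun b B => ∑ n : Fin (r + 1), Wlow a b (B n) (ω I J (removeNth n B))) fun b =>
    isSymm_removeNth_sum (F := fun c B => Wlow a b c (ω I J B)) fun c π B =>
    congrArg _ (isSymm_B hω I J π B)

theorem smul_one_mul_map (c : ℂ) (L : PSF →ₗ[ℂ] PSF) (f : PSF) :
    L (c • (1 : PSF) * f) = c • (1 : PSF) * L f := by
  rw [smul_one_mul, map_smul, smul_one_mul]

theorem lie_nabla3A_even {z z' : ℤ} (h : VField.G0Data 1 X A S w) (hz' : z' = z + 3)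
    (ω : Comp 0 0 (r + 3)) :
    lie ⟨0, 0, r, z'⟩ 1 X (nabla3A ω) = nabla3A (lie ⟨0, 0, r + 3, z⟩ 1 X ω) := by
  subst hz'
  funext I J B
  have h2 : X.sl2 1 = fun b c => S b c • (1 : PSF) := funext fun b => funext fun c => h.sl2_eq b c
  simp only [nabla3A_eq, lie_lower]
  have e0 : ∀ (g : (Fin 0 → Fin 3) → PSF), rot X.sl3 g I = 0 := fun g => by simp [rot]
  simp only [e0, add_zero, h2, h.dv_eq, map_add, map_smul, smul_one_mul,
    Finset.sum_add_distrib, map_sum, act_W h]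
  have e1 : ∀ a b c, W a b c (rot (fun b c => S b c • (1 : PSF)) (fun B => ω I J B)
      (snoc (snoc (snoc B a : Fin (r + 1) → Fin 2) b : Fin (r + 2) → Fin 2) c)) =
      rot (fun b c => S b c • (1 : PSF)) (fun B => W a b c (ω I J B))
      (snoc (snoc (snoc B a : Fin (r + 1) → Fin 2) b : Fin (r + 2) → Fin 2) c) :=
    fun a b c => map_rot (fun x y f => smul_one_mul_map _ _ f) _ _
  simp only [e1]
  have e2 : ∀ a b, ∑ c, rot (fun b c => S b c • (1 : PSF)) (fun B => W a b c (ω I J B))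
      (snoc (snoc (snoc B a : Fin (r + 1) → Fin 2) b : Fin (r + 2) → Fin 2) c) = _ := fun a b =>
    rot_snoc_sum (fun b c => S b c • (1 : PSF)) (fun c B => W a b c (ω I J B)) _
  have e3 : ∀ a, ∑ b, rot (fun b c => S b c • (1 : PSF))
      (fun B => ∑ c, W a b c (ω I J (snoc B c)))
      (snoc (snoc B a : Fin (r + 1) → Fin 2) b : Fin (r + 2) → Fin 2) = _ := fun a =>
    rot_snoc_sum (fun b c => S b c • (1 : PSF)) (fun b B => ∑ c, W a b c (ω I J (snoc B c))) _
  have e4 : ∑ a, rot (fun b c => S b c • (1 : PSF))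
      (fun B => ∑ b, ∑ c, W a b c (ω I J (snoc (snoc B b : Fin (r + 2) → Fin 2) c)))
      (snoc B a : Fin (r + 1) → Fin 2) = _ :=
    rot_snoc_sum (fun b c => S b c • (1 : PSF))
      (fun a B => ∑ b, ∑ c, W a b c (ω I J (snoc (snoc B b : Fin (r + 2) → Fin 2) c))) _
  simp only [e2, e3, e4, Finset.sum_add_distrib]
  simp only [Fin.sum_univ_two, smul_one_mul]
  push_cast
  module

theorem lie_nabla3B_even {z z' : ℤ} (h : VField.G0Data 1 X A S w) (hz' : z' = z + 3)
    (ω : Comp 0 0 r) :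
    lie ⟨0, 0, r + 3, z'⟩ 1 X (nabla3B ω) = nabla3B (lie ⟨0, 0, r, z⟩ 1 X ω) := by
  subst hz'
  funext I J B
  have h2 : X.sl2 1 = fun b c => S b c • (1 : PSF) := funext fun b => funext fun c => h.sl2_eq b c
  simp only [nabla3B_eq, lie_lower]
  have e0 : ∀ (g : (Fin 0 → Fin 3) → PSF), rot X.sl3 g I = 0 := fun g => by simp [rot]
  have e1 : ∀ a b c B, Wlow a b c (rot (fun b c => S b c • (1 : PSF)) (fun B => ω I J B) B) =
      rot (fun b c => S b c • (1 : PSF)) (fun B => Wlow a b c (ω I J B)) B :=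
    fun a b c B => map_rot (fun x y f => smul_one_mul_map _ _ f) _ _
  have e2 : rot (fun b c => S b c • (1 : PSF)) (fun B => ∑ l : Fin (r + 3), ∑ m : Fin (r + 2),
      ∑ n : Fin (r + 1), Wlow (B l) (removeNth l B m) (removeNth m (removeNth l B) n)
        (ω I J (removeNth n (removeNth m (removeNth l B))))) B = _ :=
    rot_removeNth_sum (fun b c => S b c • (1 : PSF)) (n := r + 2) (fun a B => ∑ m : Fin (r + 2), ∑ n : Fin (r + 1), Wlow a (B m)
      (removeNth m B n) (ω I J (removeNth n (removeNth m B)))) B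
  have e3 : ∀ a (B : Fin (r + 2) → Fin 2), rot (fun b c => S b c • (1 : PSF))
      (fun B => ∑ m : Fin (r + 2), ∑ n : Fin (r + 1), Wlow a (B m)
      (removeNth m B n) (ω I J (removeNth n (removeNth m B)))) B = _ := fun a B =>
    rot_removeNth_sum (fun b c => S b c • (1 : PSF)) (n := r + 1) (fun b B => ∑ n : Fin (r + 1), Wlow a b
      (B n) (ω I J (removeNth n B))) B
  have e4 : ∀ a b (B : Fin (r + 1) → Fin 2), rot (fun b c => S b c • (1 : PSF))
      (fun B => ∑ n : Fin (r + 1), Wlow a b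
      (B n) (ω I J (removeNth n B))) B = _ := fun a b B =>
    rot_removeNth_sum (fun b c => S b c • (1 : PSF)) (fun c B => Wlow a b c (ω I J B)) B
  simp only [h2, e2]
  simp only [e0, add_zero, h.dv_eq, map_add, map_smul, smul_one_mul, e1,
    Finset.sum_add_distrib, map_sum, act_Wlow h, e3, e4, Finset.sum_sub_distrib, Fin.sum_univ_two,
    ← Finset.smul_sum]
  push_cast
  module

end covariant

/-! ### The algebra of the operators `D^{ia}` -/

section algebra

/-- Rewriting rules that put products of the `D^{ia}` into the order
`D^{11}, D^{21}, D^{31}, D^{12}, D^{22}, D^{32}, ∂_1, ∂_2, ∂_3`. -/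
theorem normal_order (f : PSF) :
    D 0 0 (D 0 0 f) = 0 ∧ D 1 0 (D 1 0 f) = 0 ∧ D 2 0 (D 2 0 f) = 0 ∧
    D 0 1 (D 0 1 f) = 0 ∧ D 1 1 (D 1 1 f) = 0 ∧ D 2 1 (D 2 1 f) = 0 ∧
    D 1 0 (D 0 0 f) = -D 0 0 (D 1 0 f) ∧ D 2 0 (D 0 0 f) = -D 0 0 (D 2 0 f) ∧
    D 2 0 (D 1 0 f) = -D 1 0 (D 2 0 f) ∧ D 1 1 (D 0 1 f) = -D 0 1 (D 1 1 f) ∧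
    D 2 1 (D 0 1 f) = -D 0 1 (D 2 1 f) ∧ D 2 1 (D 1 1 f) = -D 1 1 (D 2 1 f) ∧
    D 0 1 (D 0 0 f) = -D 0 0 (D 0 1 f) ∧ D 1 1 (D 1 0 f) = -D 1 0 (D 1 1 f) ∧
    D 2 1 (D 2 0 f) = -D 2 0 (D 2 1 f) ∧
    D 0 1 (D 1 0 f) = -D 1 0 (D 0 1 f) - (2 : ℂ) • dU 2 f ∧
    D 0 1 (D 2 0 f) = -D 2 0 (D 0 1 f) + (2 : ℂ) • dU 1 f ∧
    D 1 1 (D 0 0 f) = -D 0 0 (D 1 1 f) + (2 : ℂ) • dU 2 f ∧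
    D 1 1 (D 2 0 f) = -D 2 0 (D 1 1 f) - (2 : ℂ) • dU 0 f ∧
    D 2 1 (D 0 0 f) = -D 0 0 (D 2 1 f) - (2 : ℂ) • dU 1 f ∧
    D 2 1 (D 1 0 f) = -D 1 0 (D 2 1 f) + (2 : ℂ) • dU 0 f ∧
    dU 1 (dU 0 f) = dU 0 (dU 1 f) ∧ dU 2 (dU 0 f) = dU 0 (dU 2 f) ∧
    dU 2 (dU 1 f) = dU 1 (dU 2 f) := by
  have h := fun i j a b => D_anticomm i j a b f
  have h0 : ∀ i a, D i a (D i a f) = 0 := fun i a => by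
    have := h i i a a
    simp only [epsUp, sub_self, mul_zero, zero_smul, Finset.sum_const_zero] at this
    rw [← two_smul ℂ] at this
    exact (smul_eq_zero.mp this).resolve_left two_ne_zero
  have h1 : ∀ i j a b, D i a (D j b f) = -D j b (D i a f) + ∑ k, (2 * eps3 i j k * epsUp a b) • dU k f :=
    fun i j a b => by rw [← h i j a b]; abel
  refine ⟨h0 _ _, h0 _ _, h0 _ _, h0 _ _, h0 _ _, h0 _ _, ?_, ?_, ?_, ?_, ?_, ?_, ?_, ?_, ?_, ?_, ?_,
    ?_, ?_, ?_, ?_, dU_dU _ _ _, dU_dU _ _ _, dU_dU _ _ _⟩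
  all_goals
    rw [h1]
    simp [eps3_val, epsUp, Fin.sum_univ_three, sub_eq_add_neg]

/-- The coefficients of `t^s` in `D_t^1 D_t^2 D_t^3`, where `D_t^i = D^{i1} + t D^{i2}`. Up to
normalisation these are the components of the part of `ε_{ijk} D^{ia} D^{jb} D^{kc}` that is
symmetric in `a, b, c`. -/
def N : Fin 4 → PSF →ₗ[ℂ] PSF
  | 0 => D 0 0 ∘ₗ D 1 0 ∘ₗ D 2 0
  | 1 => D 0 1 ∘ₗ D 1 0 ∘ₗ D 2 0 + D 0 0 ∘ₗ D 1 1 ∘ₗ D 2 0 + D 0 0 ∘ₗ D 1 0 ∘ₗ D 2 1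
  | 2 => D 0 0 ∘ₗ D 1 1 ∘ₗ D 2 1 + D 0 1 ∘ₗ D 1 0 ∘ₗ D 2 1 + D 0 1 ∘ₗ D 1 1 ∘ₗ D 2 0
  | 3 => D 0 1 ∘ₗ D 1 1 ∘ₗ D 2 1

theorem N_zero (f : PSF) : N 0 f = D 0 0 (D 1 0 (D 2 0 f)) := rfl

theorem N_one (f : PSF) : N 1 f =
    D 0 1 (D 1 0 (D 2 0 f)) + D 0 0 (D 1 1 (D 2 0 f)) + D 0 0 (D 1 0 (D 2 1 f)) := rfl

theorem N_two (f : PSF) : N 2 f =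
    D 0 0 (D 1 1 (D 2 1 f)) + D 0 1 (D 1 0 (D 2 1 f)) + D 0 1 (D 1 1 (D 2 0 f)) := rfl

theorem N_three (f : PSF) : N 3 f = D 0 1 (D 1 1 (D 2 1 f)) := rfl

/-- `E^a = D^{ia} ∂_i`. -/
def E (a : Fin 2) : PSF →ₗ[ℂ] PSF := ∑ i, D i a ∘ₗ dU i

theorem E_apply (a : Fin 2) (f : PSF) :
    E a f = D 0 a (dU 0 f) + D 1 a (dU 1 f) + D 2 a (dU 2 f) := by
  simp [E, Fin.sum_univ_three]

/-- The vanishing of `D_t^j D_t^1 D_t^2 D_t^3`, in each order in `t`. -/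
theorem D_N (j : Fin 3) (f : PSF) : D j 0 (N 0 f) = 0 ∧ D j 0 (N 1 f) = -D j 1 (N 0 f) ∧
    D j 0 (N 2 f) = -D j 1 (N 1 f) ∧ D j 0 (N 3 f) = -D j 1 (N 2 f) ∧ D j 1 (N 3 f) = 0 := by
  fin_cases j <;> refine ⟨?_, ?_, ?_, ?_, ?_⟩ <;>
  simp only [N_zero, N_one, N_two, N_three, Fin.zero_eta, Fin.mk_one, Fin.reduceFinMk, map_add, map_sub, map_neg, map_zero,
    map_smul, normal_order, dU_D, neg_zero] <;> module

/-- The vanishing of `D_t^1 D_t^2 D_t^3 D_t^j`, in each order in `t`. -/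
theorem N_D (j : Fin 3) (f : PSF) : N 0 (D j 0 f) = 0 ∧ N 1 (D j 0 f) = -N 0 (D j 1 f) ∧
    N 2 (D j 0 f) = -N 1 (D j 1 f) ∧ N 3 (D j 0 f) = -N 2 (D j 1 f) ∧ N 3 (D j 1 f) = 0 := by
  fin_cases j <;> refine ⟨?_, ?_, ?_, ?_, ?_⟩ <;>
  simp only [N_zero, N_one, N_two, N_three, Fin.zero_eta, Fin.mk_one, Fin.reduceFinMk, map_add, map_sub, map_neg, map_zero,
    map_smul, normal_order, dU_D, neg_zero] <;> module

/-- The anticommutators of the `D^{ja}` with the extreme components of `N`. -/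
theorem N_D_comm (j : Fin 3) (f : PSF) :
    N 3 (D j 0 f) = -D j 0 (N 3 f) + (2 : ℂ) • E 1 (D j 1 f) ∧
    N 0 (D j 1 f) = -D j 1 (N 0 f) - (2 : ℂ) • E 0 (D j 0 f) := by
  fin_cases j <;> refine ⟨?_, ?_⟩ <;>
  simp only [N_zero, N_three, E_apply, Fin.zero_eta, Fin.mk_one, Fin.reduceFinMk, map_add, map_sub, map_neg, map_zero,
    map_smul, normal_order, dU_D, neg_zero] <;> module

theorem E_D (j : Fin 3) (a b : Fin 2) (f : PSF) : E a (D j b f) = -D j b (E a f) := by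
  fin_cases j <;> fin_cases a <;> fin_cases b <;>
  simp only [E_apply, Fin.zero_eta, Fin.mk_one, Fin.reduceFinMk, map_add, map_sub, map_neg, map_zero,
    map_smul, normal_order, dU_D, neg_zero] <;> module

theorem E_N (a : Fin 2) (f : PSF) : E a (N 0 f) = -N 0 (E a f) ∧ E a (N 3 f) = -N 3 (E a f) := by
  simp only [N_zero, N_three, E_D, map_neg, neg_neg, and_self]

/-- Quadratic relations among the components of `N` and `E`. -/
theorem N_N (f : PSF) : N 2 (N 0 f) = (2 : ℂ) • E 1 (N 0 f) ∧ N 0 (N 2 f) = (2 : ℂ) • E 1 (N 0 f) ∧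
    N 3 (N 1 f) = (2 : ℂ) • N 3 (E 0 f) ∧ N 1 (N 3 f) = (2 : ℂ) • N 3 (E 0 f) ∧
    E 0 (N 0 f) = 0 ∧ N 3 (E 1 f) = 0 ∧ N 3 (N 0 f) + N 0 (N 3 f) = (2 : ℂ) • E 1 (N 1 f) ∧
    N 3 (N 0 f) + N 0 (N 3 f) = (2 : ℂ) • N 2 (E 0 f) := by
  refine ⟨?_, ?_, ?_, ?_, ?_, ?_, ?_, ?_⟩ <;>
  simp only [N_zero, N_one, N_two, N_three, E_apply, map_add, map_sub, map_neg, map_zero,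
    map_smul, normal_order, dU_D, neg_zero] <;> module

/-- The symmetric part of `W^{abc}`. -/
theorem W_symm (f : PSF) : W 0 0 0 f = (6 : ℂ) • N 0 f ∧ W 1 1 1 f = (6 : ℂ) • N 3 f ∧
    W 0 0 1 f + W 0 1 0 f + W 1 0 0 f = (6 : ℂ) • N 1 f ∧
    W 0 1 1 f + W 1 0 1 f + W 1 1 0 f = (6 : ℂ) • N 2 f := by
  refine ⟨?_, ?_, ?_, ?_⟩ <;>
  simp only [W, triple_expand, N_zero, N_one, N_two, N_three, map_add, map_sub, map_neg, map_zero,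
    map_smul, normal_order, dU_D, neg_zero] <;> module

variable {X : VField} {A : Fin 3 → Fin 3 → ℂ} {S : Fin 2 → Fin 2 → ℂ} {w : ℂ}

/-- The components of `N` span an `sl(2)` quadruplet, that is, the third symmetric power of the
two-dimensional representation. -/
theorem act_N (h : VField.G0Data 1 X A S w) (f : PSF) :
    X.act (N 0 f) = N 0 (X.act f) + (3 * S 0 0) • N 0 f + S 1 0 • N 1 f - (3 * w) • N 0 f ∧
    X.act (N 1 f) = N 1 (X.act f) + S 0 0 • N 1 f + (3 * S 0 1) • N 0 f + (2 * S 1 0) • N 2 f -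
      (3 * w) • N 1 f ∧
    X.act (N 2 f) = N 2 (X.act f) - S 0 0 • N 2 f + (3 * S 1 0) • N 3 f + (2 * S 0 1) • N 1 f -
      (3 * w) • N 2 f ∧
    X.act (N 3 f) = N 3 (X.act f) - (3 * S 0 0) • N 3 f + S 0 1 • N 2 f - (3 * w) • N 3 f := by
  have hS : S 1 1 = -S 0 0 := by linear_combination h.trS
  have e0 : ∀ f, N 0 f = (1 / 6 : ℂ) • W 0 0 0 f := fun f => by rw [(W_symm f).1]; module
  have e3 : ∀ f, N 3 f = (1 / 6 : ℂ) • W 1 1 1 f := fun f => by rw [(W_symm f).2.1]; module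
  have e1 : ∀ f, N 1 f = (1 / 6 : ℂ) • (W 0 0 1 f + W 0 1 0 f + W 1 0 0 f) := fun f => by
    rw [(W_symm f).2.2.1]; module
  have e2 : ∀ f, N 2 f = (1 / 6 : ℂ) • (W 0 1 1 f + W 1 0 1 f + W 1 1 0 f) := fun f => by
    rw [(W_symm f).2.2.2]; module
  simp only [e0, e1, e2, e3, map_smul, map_add, act_W h, hS]
  refine ⟨?_, ?_, ?_, ?_⟩ <;> module

/-- The `∂_k` are anticommutators of the `D^{ia}`, so that their transformation follows from `act_D`. -/
theorem act_dU (h : VField.G0Data 1 X A S w) (k : Fin 3) (f : PSF) :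
    X.act (dU k f) = dU k (X.act f) - (A k 0 • dU 0 f + A k 1 • dU 1 f + A k 2 • dU 2 f) -
      (2 * w) • dU k f := by
  have hA : A 2 2 = -A 0 0 - A 1 1 := by linear_combination h.trA
  have hS : S 1 1 = -S 0 0 := by linear_combination h.trS
  have e : ∀ f, dU 0 f = (1 / 2 : ℂ) • (D 1 0 (D 2 1 f) + D 2 1 (D 1 0 f)) ∧
      dU 1 f = (1 / 2 : ℂ) • (D 2 0 (D 0 1 f) + D 0 1 (D 2 0 f)) ∧
      dU 2 f = (1 / 2 : ℂ) • (D 0 0 (D 1 1 f) + D 1 1 (D 0 0 f)) := fun f => by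
    simp only [normal_order]
    refine ⟨?_, ?_, ?_⟩ <;> module
  fin_cases k
  · simp only [Fin.zero_eta]
    rw [(e f).1, (e (X.act f)).1]
    simp only [map_smul, map_add, map_sub, h.act_D, Fin.sum_univ_three, Fin.sum_univ_two, Units.val_one,
      one_smul]
    simp only [normal_order, hA, hS]
    module
  · simp only [Fin.mk_one]
    rw [(e f).2.1, (e (X.act f)).2.1]
    simp only [map_smul, map_add, map_sub, h.act_D, Fin.sum_univ_three, Fin.sum_univ_two, Units.val_one,
      one_smul]
    simp only [normal_order, hA, hS]
    module
  · simp only [Fin.reduceFinMk]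
    rw [(e f).2.2, (e (X.act f)).2.2]
    simp only [map_smul, map_add, map_sub, h.act_D, Fin.sum_univ_three, Fin.sum_univ_two, Units.val_one,
      one_smul]
    simp only [normal_order, hA, hS]
    module

theorem act_E (h : VField.G0Data 1 X A S w) (a : Fin 2) (f : PSF) :
    X.act (E a f) = E a (X.act f) + (S 0 a • E 0 f + S 1 a • E 1 f) - (3 * w) • E a f := by
  simp only [E_apply, map_add, h.act_D, act_dU h, Fin.sum_univ_three, Fin.sum_univ_two, Units.val_one,
      one_smul, map_sub, map_smul]
  module

end algebra

/-! ### Invariant operators of order four and six -/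

section higher

variable {X : VField} {A : Fin 3 → Fin 3 → ℂ} {S : Fin 2 → Fin 2 → ℂ} {w : ℂ}

/-- A family `Y^{j|ab}` of operators that transforms under `𝔤₀` like `D^{ia} D^{jb} D^{kc} D^{ld}`
with three `sl(3)` and two `sl(2)` indices contracted. -/
def IsCovariant4 (Y : Fin 3 → Fin 2 → Fin 2 → PSF →ₗ[ℂ] PSF) : Prop :=
  ∀ X A S w, VField.G0Data 1 X A S w → ∀ j a b f, X.act (Y j a b f) =
    Y j a b (X.act f) + (A 0 j • Y 0 a b f + A 1 j • Y 1 a b f + A 2 j • Y 2 a b f) +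
      (S 0 a • Y j 0 b f + S 1 a • Y j 1 b f) + (S 0 b • Y j a 0 f + S 1 b • Y j a 1 f) -
      (4 * w) • Y j a b f

/-- A family `Y^{ab}` of operators that transforms under `𝔤₀` like a product of six `D^{ia}` with
all the `sl(3)` and all but two of the `sl(2)` indices contracted. -/
def IsCovariant6 (Y : Fin 2 → Fin 2 → PSF →ₗ[ℂ] PSF) : Prop :=
  ∀ X A S w, VField.G0Data 1 X A S w → ∀ a b f, X.act (Y a b f) =
    Y a b (X.act f) + (S 0 a • Y 0 b f + S 1 a • Y 1 b f) + (S 0 b • Y a 0 f + S 1 b • Y a 1 f) -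
      (6 * w) • Y a b f

/-- The operator `Y^{j|ab} ω_{ab}` from `Ω_A(0,2)` to `Ω_D(1,0)`. -/
def opA2 (Y : Fin 3 → Fin 2 → Fin 2 → PSF →ₗ[ℂ] PSF) (ω : Comp 0 0 2) : Comp 0 1 0 := fun _ J _ =>
  ∑ a, ∑ b, Y (J 0) a b (ω ![] ![] ![a, b])

/-- The operator `Y^l_{ab} ω_l`, symmetrised, from `Ω_A(1,0)` to `Ω_D(0,2)`. -/
def opA1 (Y : Fin 3 → Fin 2 → Fin 2 → PSF →ₗ[ℂ] PSF) (ω : Comp 1 0 0) : Comp 0 0 2 := fun _ _ B =>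
  ∑ l, ∑ a, ∑ b, (epsLow (B 0) a * epsLow (B 1) b) • (Y l a b (ω ![l] ![] ![]) +
    Y l b a (ω ![l] ![] ![]))

/-- The operator `ε_{bd} Y^{ad} ω_a` from `Ω_A(0,1)` to `Ω_D(0,1)`. -/
def opA01 (Y : Fin 2 → Fin 2 → PSF →ₗ[ℂ] PSF) (ω : Comp 0 0 1) : Comp 0 0 1 := fun _ _ B =>
  ∑ a, ∑ d, epsLow (B 0) d • Y a d (ω ![] ![] ![a])

theorem rot_two (m : Fin 2 → Fin 2 → PSF) (g : (Fin 2 → Fin 2) → PSF) (B : Fin 2 → Fin 2) :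
    rot m g B = m (B 0) 0 * g ![0, B 1] + m (B 0) 1 * g ![1, B 1] +
      (m (B 1) 0 * g ![B 0, 0] + m (B 1) 1 * g ![B 0, 1]) := by
  have e0 : ∀ x, Function.update B 0 x = ![x, B 1] := by
    intro x; ext k; fin_cases k <;> simp
  have e1 : ∀ x, Function.update B 1 x = ![B 0, x] := by
    intro x; ext k; fin_cases k <;> simp
  simp only [rot, Fin.sum_univ_two, e0, e1]

theorem rot_one {n : ℕ} (m : Fin n → Fin n → PSF) (g : (Fin 1 → Fin n) → PSF) (B : Fin 1 → Fin n) :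
    rot m g B = ∑ x, m (B 0) x * g ![x] := by
  have e0 : ∀ x, Function.update B 0 x = ![x] := by
    intro x; ext k; fin_cases k; simp
  simp only [rot, Finset.univ_unique, Finset.sum_singleton, Fin.default_eq_zero, e0]

theorem rot_zero {α : Type*} [Fintype α] (m : α → α → PSF) (g : (Fin 0 → α) → PSF) (B : Fin 0 → α) :
    rot m g B = 0 := by simp [rot]

theorem lie_opA2_even {Y : Fin 3 → Fin 2 → Fin 2 → PSF →ₗ[ℂ] PSF} (hY : IsCovariant4 Y)
    (h : VField.G0Data 1 X A S w) {z z' : ℤ} (hz' : z' = z + 4) (ω : Comp 0 0 2) :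
    lie ⟨0, 1, 0, z'⟩ 1 X (opA2 Y ω) = opA2 Y (lie ⟨0, 0, 2, z⟩ 1 X ω) := by
  subst hz'
  funext I J B
  rw [lie_upper]
  simp only [opA2, lie_lower, rot_zero, add_zero, rot_one, rot_two, h.sl2_eq, h.sl3_eq, h.dv_eq,
    smul_one_mul, Fin.sum_univ_two, Fin.sum_univ_three, map_add, map_smul, hY X A S w h]
  simp only [Matrix.cons_val_zero, Matrix.cons_val_one]
  push_cast
  module

set_option maxHeartbeats 1000000 in
theorem lie_opA1_even {Y : Fin 3 → Fin 2 → Fin 2 → PSF →ₗ[ℂ] PSF} (hY : IsCovariant4 Y)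
    (h : VField.G0Data 1 X A S w) {z z' : ℤ} (hz' : z' = z + 4) (ω : Comp 1 0 0) :
    lie ⟨0, 0, 2, z'⟩ 1 X (opA1 Y ω) = opA1 Y (lie ⟨1, 0, 0, z⟩ 1 X ω) := by
  subst hz'
  have hS : S 1 1 = -S 0 0 := by linear_combination h.trS
  funext I J B
  rw [lie_lower]
  simp only [opA1, lie_lower, rot_zero, add_zero, rot_one, rot_two, h.sl2_eq, h.sl3_eq, h.dv_eq,
    smul_one_mul, Fin.sum_univ_two, Fin.sum_univ_three, map_add, map_smul, hY X A S w h]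
  have hB : ∀ x : Fin 2, x = 0 ∨ x = 1 := by decide
  simp only [Matrix.cons_val_zero, Matrix.cons_val_one]
  rcases hB (B 0) with h0 | h0 <;> rcases hB (B 1) with h1 | h1 <;>
  simp only [h0, h1, epsLow, hS, Fin.isValue, Fin.val_zero, Fin.val_one, Nat.cast_zero, Nat.cast_one] <;>
  push_cast <;> module

theorem lie_opA01_even {Y : Fin 2 → Fin 2 → PSF →ₗ[ℂ] PSF} (hY : IsCovariant6 Y)
    (h : VField.G0Data 1 X A S w) {z z' : ℤ} (hz' : z' = z + 6) (ω : Comp 0 0 1) :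
    lie ⟨0, 0, 1, z'⟩ 1 X (opA01 Y ω) = opA01 Y (lie ⟨0, 0, 1, z⟩ 1 X ω) := by
  subst hz'
  have hS : S 1 1 = -S 0 0 := by linear_combination h.trS
  funext I J B
  rw [lie_lower]
  simp only [opA01, lie_lower, rot_zero, add_zero, rot_one, h.sl2_eq, h.dv_eq,
    smul_one_mul, Fin.sum_univ_two, map_add, map_smul, hY X A S w h]
  have hB : ∀ x : Fin 2, x = 0 ∨ x = 1 := by decide
  simp only [Matrix.cons_val_zero]
  rcases hB (B 0) with h0 | h0 <;>
  simp only [h0, epsLow, hS, Fin.isValue, Fin.val_zero, Fin.val_one, Nat.cast_zero, Nat.cast_one] <;>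
  push_cast <;> module

theorem opA2_mem (Y : Fin 3 → Fin 2 → Fin 2 → PSF →ₗ[ℂ] PSF) (z : ℤ) (ω : Comp 0 0 2) :
    opA2 Y ω ∈ T ⟨0, 1, 0, z⟩ :=
  mem_T_upper (fun I B π J => by rw [Subsingleton.elim π 1]; rfl)
    fun I J π B => by rw [Subsingleton.elim (B ∘ _) B]

theorem opA1_mem (Y : Fin 3 → Fin 2 → Fin 2 → PSF →ₗ[ℂ] PSF) (z : ℤ) (ω : Comp 1 0 0) :
    opA1 Y ω ∈ T ⟨0, 0, 2, z⟩ := by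
  refine mem_T_lower (fun J B π I => by rw [Subsingleton.elim (I ∘ _) I]) fun I J π B => ?_
  have hπ : π = 1 ∨ π = Equiv.swap 0 1 := by revert π; decide
  rcases hπ with rfl | rfl
  · rfl
  · simp only [opA1, Function.comp_apply, Equiv.swap_apply_left, Equiv.swap_apply_right]
    refine Finset.sum_congr rfl fun l _ => ?_
    rw [Finset.sum_comm]
    refine Finset.sum_congr rfl fun a _ => Finset.sum_congr rfl fun b _ => ?_
    rw [mul_comm, add_comm]

theorem opA01_mem (Y : Fin 2 → Fin 2 → PSF →ₗ[ℂ] PSF) (z : ℤ) (ω : Comp 0 0 1) :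
    opA01 Y ω ∈ T ⟨0, 0, 1, z⟩ :=
  mem_T_lower (fun J B π I => by rw [Subsingleton.elim (I ∘ _) I])
    fun I J π B => by rw [Subsingleton.elim π 1]; rfl

/-- Invariance under `𝔤₀` needs to be checked for even vector fields only: an odd one acts on
tensors as on scalars, and anticommutes with the `D^{ia}`. -/
theorem invariant_of_even {k : ℕ} {τ τ' : Label}
    {f : Comp τ.p τ.q τ.r → Comp τ'.p τ'.q τ'.r} (hf : IsDOperator k f)
    (h : ∀ X A S w, VField.G0Data 1 X A S w → ∀ ω ∈ T τ, lie τ' 1 X (f ω) = f (lie τ 1 X ω))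
    (σ : ℤˣ) (X : VField) (hX : X.IsG0 σ) (ω : Comp τ.p τ.q τ.r) (hω : ω ∈ T τ) :
    lie τ' σ X (f ω) = ((σ ^ k : ℤˣ) : ℤ) • f (lie τ σ X ω) := by
  obtain ⟨A, S, w, hd, hodd⟩ := VField.exists_g0Data hX
  rcases Int.units_eq_one_or σ with rfl | rfl
  · rw [one_pow, Units.val_one, one_smul]
    exact h X A S w hd ω hω
  · obtain ⟨rfl, rfl, rfl⟩ := hodd rfl
    have e : ∀ (τ : Label) (ω : Comp τ.p τ.q τ.r), lie τ (-1) X ω = fun I J B => X.act (ω I J B) := by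
      intro τ ω
      funext I J B
      simp [lie, hd.sl3_eq, hd.sl2_eq, hd.dv_eq]
    rw [e, e]
    refine hf.comm (fun i a g => ?_) ω
    rw [hd.act_D]
    simp

/-! ### Covariant families of order four and six -/

/-- The coefficients of the operator `Ω_A(0,2) → Ω_D(1,0)` that fits into a complex: the `sl(2)`
triplet in the product of `D^{ja}` and `N`. The quintuplet vanishes by `D_N`. -/
def Y42 (j : Fin 3) : Fin 2 → Fin 2 → PSF →ₗ[ℂ] PSF
  | 0, 0 => -(2 : ℂ) • D j 1 ∘ₗ N 0
  | 0, 1 => D j 0 ∘ₗ N 2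
  | 1, 0 => D j 0 ∘ₗ N 2
  | 1, 1 => (2 : ℂ) • D j 0 ∘ₗ N 3

/-- The coefficients of the operator `Ω_A(1,0) → Ω_D(0,2)` that fits into a complex: the `sl(2)`
triplet in the product of `N` and `D^{ja}`. The quintuplet vanishes by `N_D`. -/
def Y41 (j : Fin 3) : Fin 2 → Fin 2 → PSF →ₗ[ℂ] PSF
  | 0, 0 => -(2 : ℂ) • N 0 ∘ₗ D j 1
  | 0, 1 => N 2 ∘ₗ D j 0
  | 1, 0 => N 2 ∘ₗ D j 0
  | 1, 1 => (2 : ℂ) • N 3 ∘ₗ D j 0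

/-- The coefficients of the operator `Ω_A(0,1) → Ω_D(0,1)` that fits into a complex. Its off-diagonal
components are the products of the extreme components of `N`, in both orders; covariance then forces
the diagonal ones, which are `N_2 N_0` and `N_3 N_1` by `N_N`. -/
def Y6 : Fin 2 → Fin 2 → PSF →ₗ[ℂ] PSF
  | 0, 0 => (2 : ℂ) • E 1 ∘ₗ N 0
  | 0, 1 => N 3 ∘ₗ N 0
  | 1, 0 => N 0 ∘ₗ N 3
  | 1, 1 => (2 : ℂ) • N 3 ∘ₗ E 0

theorem Y42_apply (j : Fin 3) (f : PSF) : Y42 j 0 0 f = -(2 : ℂ) • D j 1 (N 0 f) ∧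
    Y42 j 0 1 f = D j 0 (N 2 f) ∧ Y42 j 1 0 f = D j 0 (N 2 f) ∧
    Y42 j 1 1 f = (2 : ℂ) • D j 0 (N 3 f) := ⟨rfl, rfl, rfl, rfl⟩

theorem Y41_apply (j : Fin 3) (f : PSF) : Y41 j 0 0 f = -(2 : ℂ) • N 0 (D j 1 f) ∧
    Y41 j 0 1 f = N 2 (D j 0 f) ∧ Y41 j 1 0 f = N 2 (D j 0 f) ∧
    Y41 j 1 1 f = (2 : ℂ) • N 3 (D j 0 f) := by
  refine ⟨?_, ?_, ?_, ?_⟩ <;> simp only [Y41, LinearMap.smul_apply, LinearMap.comp_apply]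

theorem Y6_apply (f : PSF) : Y6 0 0 f = (2 : ℂ) • E 1 (N 0 f) ∧ Y6 0 1 f = N 3 (N 0 f) ∧
    Y6 1 0 f = N 0 (N 3 f) ∧ Y6 1 1 f = (2 : ℂ) • N 3 (E 0 f) := by
  refine ⟨?_, ?_, ?_, ?_⟩ <;> simp only [Y6, LinearMap.smul_apply, LinearMap.comp_apply]

theorem isCovariant4_Y42 : IsCovariant4 Y42 := by
  intro X A S w h j a b f
  have hS : S 1 1 = -S 0 0 := by linear_combination h.trS
  fin_cases a <;> fin_cases b <;>
  simp only [Fin.zero_eta, Fin.mk_one, Y42_apply, map_smul, h.act_D, act_N h, map_add, map_sub,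
    Fin.sum_univ_three, Fin.sum_univ_two, Units.val_one, one_smul, hS, D_N, map_neg] <;> module

theorem isCovariant4_Y41 : IsCovariant4 Y41 := by
  intro X A S w h j a b f
  have hS : S 1 1 = -S 0 0 := by linear_combination h.trS
  fin_cases a <;> fin_cases b <;>
  simp only [Fin.zero_eta, Fin.mk_one, Y41_apply, map_smul, h.act_D, act_N h, map_add, map_sub,
    Fin.sum_univ_three, Fin.sum_univ_two, Units.val_one, one_smul, hS, N_D, map_neg] <;> module

theorem isCovariant6_Y6 : IsCovariant6 Y6 := by
  intro X A S w h a b f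
  have hS : S 1 1 = -S 0 0 := by linear_combination h.trS
  have e1 : E 1 (N 1 f) = (1 / 2 : ℂ) • (N 3 (N 0 f) + N 0 (N 3 f)) := by
    rw [(N_N f).2.2.2.2.2.2.1]; module
  have e2 : N 2 (E 0 f) = (1 / 2 : ℂ) • (N 3 (N 0 f) + N 0 (N 3 f)) := by
    rw [(N_N f).2.2.2.2.2.2.2]; module
  have e3 := (N_N f).1
  have e4 := (N_N f).2.1
  have e5 := (N_N f).2.2.1
  have e6 := (N_N f).2.2.2.1
  have e7 := (N_N f).2.2.2.2.1
  have e8 := (N_N f).2.2.2.2.2.1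
  fin_cases a <;> fin_cases b <;>
  simp only [Fin.zero_eta, Fin.mk_one, Y6_apply, map_smul, act_E h, act_N h, map_add, map_sub, hS,
    e1, e2, e3, e4, e5, e6, e7, e8, map_neg] <;> module

/-- The coefficients of the fourth-order operators `∇_4`. -/
def Y4 (j : Fin 3) (a b : Fin 2) : PSF →ₗ[ℂ] PSF := ∑ c, W a b c ∘ₗ Dlow j c

/-- The coefficients of the sixth-order operator `∇_6`. -/
def K (a d : Fin 2) : PSF →ₗ[ℂ] PSF :=
  ∑ b, ∑ c, ∑ e, ∑ f, (epsLow b e * epsLow c f) • (W a b c ∘ₗ W d e f)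

theorem Y4_apply (j : Fin 3) (a b : Fin 2) (f : PSF) :
    Y4 j a b f = W a b 0 (Dlow j 0 f) + W a b 1 (Dlow j 1 f) := by
  simp [Y4]

theorem K_apply (a d : Fin 2) (f : PSF) : K a d f =
    W a 0 0 (W d 1 1 f) - W a 0 1 (W d 1 0 f) - W a 1 0 (W d 0 1 f) + W a 1 1 (W d 0 0 f) := by
  simp [K, epsLow]
  abel

theorem isCovariant4_Y4 : IsCovariant4 Y4 := by
  intro X A S w h j a b f
  have hS : S 1 1 = -S 0 0 := by linear_combination h.trS
  simp only [Y4_apply, map_add, map_sub, map_smul, act_W h, act_Dlow_G0 h, hS]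
  module

theorem isCovariant6_K : IsCovariant6 K := by
  intro X A S w h a b f
  have hS : S 1 1 = -S 0 0 := by linear_combination h.trS
  simp only [K_apply, map_add, map_sub, map_smul, act_W h, hS]
  module

end higher

/-! ### Composites of consecutive operators -/

section complexes

theorem eq_zero_of_eq_neg {V : Type*} [AddCommGroup V] [Module ℂ V] {x : V} (h : x = -x) : x = 0 := by
  have h2 := add_eq_zero_iff_eq_neg.mpr h
  rw [← two_smul ℂ] at h2
  exact (smul_eq_zero.mp h2).resolve_left two_ne_zero

/-- An antisymmetric tensor of rank three in two dimensions vanishes. -/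
theorem antisymm_three {V : Type*} [AddCommGroup V] [Module ℂ V] {f : Fin 2 → Fin 2 → Fin 2 → V}
    (h1 : ∀ a b c, f a b c = -f b a c) (h2 : ∀ a b c, f a b c = -f a c b) (a b c : Fin 2) :
    f a b c = 0 := by
  have e1 : ∀ a c, f a a c = 0 := fun a c => eq_zero_of_eq_neg (h1 a a c)
  have e2 : ∀ a c, f a c c = 0 := fun a c => eq_zero_of_eq_neg (h2 a c c)
  have h : ∀ a b c : Fin 2, a = b ∨ b = c ∨ a = c := by decide
  rcases h a b c with rfl | rfl | rfl
  · exact e1 _ _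
  · exact e2 _ _
  · rw [h1, e2, neg_zero]

/-- An antisymmetric tensor of rank four in three dimensions vanishes. -/
theorem antisymm_four {V : Type*} [AddCommGroup V] [Module ℂ V]
    {f : Fin 3 → Fin 3 → Fin 3 → Fin 3 → V}
    (h1 : ∀ i j k l, f i j k l = -f j i k l) (h2 : ∀ i j k l, f i j k l = -f i k j l)
    (h3 : ∀ i j k l, f i j k l = -f i j l k) (i j k l : Fin 3) : f i j k l = 0 := by
  have e1 : ∀ i k l, f i i k l = 0 := fun i k l => eq_zero_of_eq_neg (h1 i i k l)
  have e2 : ∀ i j l, f i j j l = 0 := fun i j l => eq_zero_of_eq_neg (h2 i j j l)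
  have e3 : ∀ i j k, f i j k k = 0 := fun i j k => eq_zero_of_eq_neg (h3 i j k k)
  have h : ∀ i j k l : Fin 3, i = j ∨ j = k ∨ k = l ∨ i = k ∨ j = l ∨ i = l := by decide
  rcases h i j k l with rfl | rfl | rfl | rfl | rfl | rfl
  · exact e1 _ _ _
  · exact e2 _ _ _
  · exact e3 _ _ _
  · rw [h1, e2, neg_zero]
  · rw [h2, e3, neg_zero]
  · rw [h1, h2, e3, neg_zero, neg_zero]

/-- The anticommutators of the `D^{ia}` are antisymmetric in the `sl(3)` indices, so that the part of
`D^{ia} D^{jb}` that is symmetric in `i, j` is antisymmetric in `a, b`. -/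
theorem D_D_symm (i j : Fin 3) (a b : Fin 2) (f : PSF) :
    D i a (D j b f) + D j a (D i b f) = -(D i b (D j a f) + D j b (D i a f)) := by
  have h1 := D_anticomm i j a b f
  have h2 := D_anticomm j i a b f
  have h3 : ∑ k, (2 * eps3 j i k * epsUp a b) • dU k f = -∑ k, (2 * eps3 i j k * epsUp a b) • dU k f := by
    rw [← Finset.sum_neg_distrib]
    refine Finset.sum_congr rfl fun k _ => ?_
    rw [← neg_smul]; congr 1; unfold eps3; ring
  rw [h3] at h2
  linear_combination (norm := module) h1 + h2

theorem Dlow_anticomm (i j : Fin 3) (a b : Fin 2) (f : PSF) :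
    Dlow i a (Dlow j b f) + Dlow j b (Dlow i a f) = ∑ k, (2 * eps3 i j k * epsUp a b) • dU k f := by
  simp only [Dlow_eq, lowerOp_apply, Fin.sum_univ_two, map_add, map_smul, epsLow]
  have h := D_anticomm i j
  fin_cases a <;> fin_cases b <;> simp only [Fin.zero_eta, Fin.mk_one, Fin.isValue, Fin.val_zero,
    Fin.val_one, Nat.cast_zero, Nat.cast_one]
  · have e : epsUp 0 0 = epsUp 1 1 := by simp [epsUp]
    rw [e, ← h 1 1 f]; module
  · have e : ∀ k, 2 * eps3 i j k * epsUp 0 1 = -(2 * eps3 i j k * epsUp 1 0) := by simp [epsUp]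
    simp only [e, neg_smul, Finset.sum_neg_distrib]
    rw [← h 1 0 f]; module
  · have e : ∀ k, 2 * eps3 i j k * epsUp 1 0 = -(2 * eps3 i j k * epsUp 0 1) := by simp [epsUp]
    simp only [e, neg_smul, Finset.sum_neg_distrib]
    rw [← h 0 1 f]; module
  · have e : epsUp 1 1 = epsUp 0 0 := by simp [epsUp]
    rw [e, ← h 0 0 f]; module

theorem Dlow_Dlow_symm (i j : Fin 3) (a b : Fin 2) (f : PSF) :
    Dlow i a (Dlow j b f) + Dlow j a (Dlow i b f) = -(Dlow i b (Dlow j a f) + Dlow j b (Dlow i a f)) := by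
  have h1 := Dlow_anticomm i j a b f
  have h2 := Dlow_anticomm j i a b f
  have h3 : ∑ k, (2 * eps3 j i k * epsUp a b) • dU k f = -∑ k, (2 * eps3 i j k * epsUp a b) • dU k f := by
    rw [← Finset.sum_neg_distrib]
    refine Finset.sum_congr rfl fun k _ => ?_
    rw [← neg_smul]; congr 1; unfold eps3; ring
  rw [h3] at h2
  linear_combination (norm := module) h1 + h2

/-- Contraction of two `D^{ia}` with a symmetric `sl(3)` tensor is antisymmetric in the `sl(2)`
indices. -/
theorem contract_D_D {g : Fin 3 → Fin 3 → PSF} (hg : ∀ i j, g i j = g j i) (a b : Fin 2) :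
    ∑ i, ∑ j, D i a (D j b (g i j)) = -∑ i, ∑ j, D i b (D j a (g i j)) := by
  have h : ∑ i, ∑ j, (D i a (D j b (g i j)) + D j a (D i b (g i j))) =
      -∑ i, ∑ j, (D i b (D j a (g i j)) + D j b (D i a (g i j))) := by
    simp only [D_D_symm _ _ a b, Finset.sum_neg_distrib]
  have e : ∀ a b, ∑ i, ∑ j, D j a (D i b (g i j)) = ∑ i, ∑ j, D i a (D j b (g i j)) := by
    intro a b
    rw [Finset.sum_comm]
    exact Finset.sum_congr rfl fun i _ => Finset.sum_congr rfl fun j _ => by rw [hg]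
  simp only [Finset.sum_add_distrib, e] at h
  linear_combination (norm := module) (1 / 2 : ℂ) • h

/-- The contraction of three `D^{ia}` with a symmetric `sl(3)` tensor is antisymmetric in three
`sl(2)` indices, hence zero. -/
theorem contract_D_D_D {g : Fin 3 → Fin 3 → Fin 3 → PSF} (h1 : ∀ i j k, g i j k = g j i k)
    (h2 : ∀ i j k, g i j k = g i k j) (a b c : Fin 2) :
    ∑ i, ∑ j, ∑ k, D i a (D j b (D k c (g i j k))) = 0 := by
  refine antisymm_three (f := fun a b c => ∑ i, ∑ j, ∑ k, D i a (D j b (D k c (g i j k))))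
    (fun a b c => ?_) (fun a b c => ?_) a b c
  · have e : ∀ a b, ∑ i, ∑ j, ∑ k, D i a (D j b (D k c (g i j k))) =
        ∑ i, ∑ j, D i a (D j b (∑ k, D k c (g i j k))) := fun a b => by simp only [map_sum]
    rw [e, e, contract_D_D fun i j => by simp only [h1 i j]]
  · have e : ∀ b c, ∑ i, ∑ j, ∑ k, D i a (D j b (D k c (g i j k))) =
        ∑ i, D i a (∑ j, ∑ k, D j b (D k c (g i j k))) := fun b c => by simp only [map_sum]
    rw [e, e, ← Finset.sum_neg_distrib]
    refine Finset.sum_congr rfl fun i _ => ?_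
    rw [contract_D_D fun j k => h2 i j k, map_neg]

/-- Contraction of two `D^{ia}` with a symmetric `sl(2)` tensor is antisymmetric in the `sl(3)`
indices. -/
theorem contract_D_D' {g : Fin 2 → Fin 2 → PSF} (hg : ∀ a b, g a b = g b a) (i j : Fin 3) :
    ∑ a, ∑ b, D i a (D j b (g a b)) = -∑ a, ∑ b, D j a (D i b (g a b)) := by
  have h : ∑ a, ∑ b, (D i a (D j b (g a b)) + D j a (D i b (g a b))) =
      -∑ a, ∑ b, (D i b (D j a (g a b)) + D j b (D i a (g a b))) := by
    simp only [← Finset.sum_neg_distrib]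
    exact Finset.sum_congr rfl fun a _ => Finset.sum_congr rfl fun b _ => D_D_symm i j a b _
  have e : ∀ i j, ∑ a, ∑ b, D i b (D j a (g a b)) = ∑ a, ∑ b, D i a (D j b (g a b)) := by
    intro i j
    rw [Finset.sum_comm]
    exact Finset.sum_congr rfl fun i _ => Finset.sum_congr rfl fun j _ => by rw [hg]
  simp only [Finset.sum_add_distrib, e] at h
  linear_combination (norm := module) (1 / 2 : ℂ) • h

section adjoin

variable {κ α : Type*} {F : κ → α → PSF →ₗ[ℂ] PSF}

/-- Adjoining the second indices of two operators, with symmetrisation, is antisymmetric in the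
first ones if this is so for the symmetrised products. -/
theorem adjoin_two (hF : ∀ a b x y f,
      F a x (F b y f) + F b x (F a y f) = -(F a y (F b x f) + F b y (F a x f)))
    {n : ℕ} (h : (Fin n → α) → PSF) (J : Fin (n + 2) → α) (a b : κ) :
    ∑ k : Fin (n + 2), ∑ l : Fin (n + 1),
        F a (J k) (F b (removeNth k J l) (h (removeNth l (removeNth k J)))) =
      -∑ k : Fin (n + 2), ∑ l : Fin (n + 1),
        F b (J k) (F a (removeNth k J l) (h (removeNth l (removeNth k J)))) := by
  have := sum_removeNth_antisymm (Φ := fun x y r => F a x (F b y (h r)) + F b x (F a y (h r)))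
    (fun x y r => hF a b x y (h r)) J
  simp only [Finset.sum_add_distrib] at this
  exact eq_neg_of_add_eq_zero_left this

/-- The variant of `adjoin_two` for three operators: antisymmetry under both transpositions of
neighbours. -/
theorem adjoin_three (hF : ∀ a b x y f,
      F a x (F b y f) + F b x (F a y f) = -(F a y (F b x f) + F b y (F a x f)))
    {n : ℕ} (h : (Fin n → α) → PSF) (J : Fin (n + 3) → α) (a b c : κ) :
    ∑ k : Fin (n + 3), ∑ l : Fin (n + 2), ∑ m : Fin (n + 1),
        F a (J k) (F b (removeNth k J l) (F c (removeNth l (removeNth k J) m)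
          (h (removeNth m (removeNth l (removeNth k J)))))) =
      -∑ k : Fin (n + 3), ∑ l : Fin (n + 2), ∑ m : Fin (n + 1),
        F b (J k) (F a (removeNth k J l) (F c (removeNth l (removeNth k J) m)
          (h (removeNth m (removeNth l (removeNth k J)))))) ∧
    ∑ k : Fin (n + 3), ∑ l : Fin (n + 2), ∑ m : Fin (n + 1),
        F a (J k) (F b (removeNth k J l) (F c (removeNth l (removeNth k J) m)
          (h (removeNth m (removeNth l (removeNth k J)))))) =
      -∑ k : Fin (n + 3), ∑ l : Fin (n + 2), ∑ m : Fin (n + 1),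
        F a (J k) (F c (removeNth k J l) (F b (removeNth l (removeNth k J) m)
          (h (removeNth m (removeNth l (removeNth k J)))))) := by
  refine ⟨?_, ?_⟩
  · simpa only [map_sum] using
      adjoin_two hF (n := n + 1) (fun r => ∑ m, F c (r m) (h (removeNth m r))) J a b
  · rw [← Finset.sum_neg_distrib]
    refine Finset.sum_congr rfl fun k _ => ?_
    simpa only [map_sum, map_neg] using congrArg (F a (J k)) (adjoin_two hF h (removeNth k J) b c)

/-- The variant of `adjoin_two` for four operators: antisymmetry under the three transpositions of
neighbours. -/
theorem adjoin_four (hF : ∀ a b x y f,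
      F a x (F b y f) + F b x (F a y f) = -(F a y (F b x f) + F b y (F a x f)))
    {n : ℕ} (h : (Fin n → α) → PSF) (J : Fin (n + 4) → α) :
    ∀ a b c d : κ, ∑ k : Fin (n + 4), ∑ l : Fin (n + 3), ∑ m : Fin (n + 2), ∑ o : Fin (n + 1),
        F a (J k) (F b (removeNth k J l) (F c (removeNth l (removeNth k J) m)
          (F d (removeNth m (removeNth l (removeNth k J)) o)
            (h (removeNth o (removeNth m (removeNth l (removeNth k J)))))))) =
      -∑ k : Fin (n + 4), ∑ l : Fin (n + 3), ∑ m : Fin (n + 2), ∑ o : Fin (n + 1),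
        F b (J k) (F a (removeNth k J l) (F c (removeNth l (removeNth k J) m)
          (F d (removeNth m (removeNth l (removeNth k J)) o)
            (h (removeNth o (removeNth m (removeNth l (removeNth k J)))))))) ∧
    ∑ k : Fin (n + 4), ∑ l : Fin (n + 3), ∑ m : Fin (n + 2), ∑ o : Fin (n + 1),
        F a (J k) (F b (removeNth k J l) (F c (removeNth l (removeNth k J) m)
          (F d (removeNth m (removeNth l (removeNth k J)) o)
            (h (removeNth o (removeNth m (removeNth l (removeNth k J)))))))) =
      -∑ k : Fin (n + 4), ∑ l : Fin (n + 3), ∑ m : Fin (n + 2), ∑ o : Fin (n + 1),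
        F a (J k) (F c (removeNth k J l) (F b (removeNth l (removeNth k J) m)
          (F d (removeNth m (removeNth l (removeNth k J)) o)
            (h (removeNth o (removeNth m (removeNth l (removeNth k J)))))))) ∧
    ∑ k : Fin (n + 4), ∑ l : Fin (n + 3), ∑ m : Fin (n + 2), ∑ o : Fin (n + 1),
        F a (J k) (F b (removeNth k J l) (F c (removeNth l (removeNth k J) m)
          (F d (removeNth m (removeNth l (removeNth k J)) o)
            (h (removeNth o (removeNth m (removeNth l (removeNth k J)))))))) =
      -∑ k : Fin (n + 4), ∑ l : Fin (n + 3), ∑ m : Fin (n + 2), ∑ o : Fin (n + 1),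
        F a (J k) (F b (removeNth k J l) (F d (removeNth l (removeNth k J) m)
          (F c (removeNth m (removeNth l (removeNth k J)) o)
            (h (removeNth o (removeNth m (removeNth l (removeNth k J)))))))) := by
  intro a b c d
  refine ⟨?_, ?_, ?_⟩
  · simpa only [map_sum] using
      (adjoin_three hF (n := n + 1) (fun r => ∑ o, F d (r o) (h (removeNth o r))) J a b c).1
  · simpa only [map_sum] using
      (adjoin_three hF (n := n + 1) (fun r => ∑ o, F d (r o) (h (removeNth o r))) J a b c).2
  · rw [← Finset.sum_neg_distrib]
    refine Finset.sum_congr rfl fun k _ => ?_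
    simpa only [map_sum, map_neg] using
      congrArg (F a (J k)) (adjoin_three hF h (removeNth k J) b c d).2

end adjoin

/-- Adjoining three symmetrised `sl(3)` indices leaves antisymmetry in three `sl(2)` indices. -/
theorem adjoin_D_D_D {n : ℕ} (h : (Fin n → Fin 3) → PSF) (J : Fin (n + 3) → Fin 3) (a b c : Fin 2) :
    ∑ k : Fin (n + 3), ∑ l : Fin (n + 2), ∑ m : Fin (n + 1),
        D (J k) a (D (removeNth k J l) b (D (removeNth l (removeNth k J) m) c
          (h (removeNth m (removeNth l (removeNth k J)))))) = 0 :=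
  have hF := fun a b c => adjoin_three (F := fun a j => D j a)
    (fun a b x y f => by linear_combination (norm := module) D_D_symm x y a b f) h J a b c
  antisymm_three (fun a b c => (hF a b c).1) (fun a b c => (hF a b c).2) a b c

/-- Adjoining the `sl(2)` indices of two `D^{ia}`, with symmetrisation, is antisymmetric in the
`sl(3)` indices. -/
theorem adjoin_Dlow_Dlow {n : ℕ} (h : (Fin n → Fin 2) → PSF) (B : Fin (n + 2) → Fin 2)
    (i j : Fin 3) :
    ∑ k : Fin (n + 2), ∑ l : Fin (n + 1),
        Dlow i (B k) (Dlow j (removeNth k B l) (h (removeNth l (removeNth k B)))) =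
      -∑ k : Fin (n + 2), ∑ l : Fin (n + 1),
        Dlow j (B k) (Dlow i (removeNth k B l) (h (removeNth l (removeNth k B)))) :=
  adjoin_two (F := Dlow) Dlow_Dlow_symm h B i j

/-- Adjoining four symmetrised `sl(2)` indices leaves antisymmetry in four `sl(3)` indices. -/
theorem adjoin_Dlow_four {n : ℕ} (h : (Fin n → Fin 2) → PSF) (B : Fin (n + 4) → Fin 2)
    (i j k l : Fin 3) :
    ∑ x : Fin (n + 4), ∑ y : Fin (n + 3), ∑ z : Fin (n + 2), ∑ t : Fin (n + 1),
        Dlow i (B x) (Dlow j (removeNth x B y) (Dlow k (removeNth y (removeNth x B) z)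
          (Dlow l (removeNth z (removeNth y (removeNth x B)) t)
            (h (removeNth t (removeNth z (removeNth y (removeNth x B)))))))) = 0 :=
  have hF := fun i j k l => adjoin_four Dlow_Dlow_symm h B i j k l
  antisymm_four (fun i j k l => (hF i j k l).1) (fun i j k l => (hF i j k l).2.1)
    (fun i j k l => (hF i j k l).2.2) i j k l

variable {p q r : ℕ} {z : ℤ}

theorem sum_sum_comm_four {ι κ μ M R : Type*} [Fintype ι] [Fintype κ] [Fintype μ] [Semiring R]
    [AddCommMonoid M] [Module R M] (w : Fin 2 → Fin 2 → R) (F : ι → κ → Fin 2 → Fin 2 → μ → Fin 2 → M) :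
    ∑ i, ∑ j, ∑ a, ∑ b, w a b • ∑ k, ∑ c, F i j a b k c =
      ∑ a, ∑ b, w a b • ∑ c, ∑ i, ∑ j, ∑ k, F i j a b k c := by
  simp only [Finset.smul_sum,
    Finset.sum_comm (s := (Finset.univ : Finset ι)) (t := (Finset.univ : Finset (Fin 2))),
    Finset.sum_comm (s := (Finset.univ : Finset κ)) (t := (Finset.univ : Finset (Fin 2))),
    Finset.sum_comm (s := (Finset.univ : Finset μ)) (t := (Finset.univ : Finset (Fin 2)))]

theorem sum_sum_comm_five {ι κ μ M R : Type*} [Fintype ι] [Fintype κ] [Fintype μ] [Semiring R]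
    [AddCommMonoid M] [Module R M] (v : Fin 2 → R) (w : Fin 2 → Fin 2 → R)
    (F : ι → κ → μ → Fin 2 → Fin 2 → Fin 2 → M) :
    ∑ i, ∑ j, ∑ k, ∑ a, ∑ b, w a b • ∑ c, v c • F i j k c a b =
      ∑ a, ∑ b, ∑ c, (w a b * v c) • ∑ i, ∑ j, ∑ k, F i j k c a b := by
  simp only [Finset.smul_sum, smul_smul,
    Finset.sum_comm (s := (Finset.univ : Finset ι)) (t := (Finset.univ : Finset (Fin 2))),
    Finset.sum_comm (s := (Finset.univ : Finset κ)) (t := (Finset.univ : Finset (Fin 2))),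
    Finset.sum_comm (s := (Finset.univ : Finset μ)) (t := (Finset.univ : Finset (Fin 2)))]

theorem nabla1A_nabla1A {ω : Comp (p + 2) 0 (r + 2)} (hω : ω ∈ T ⟨p + 2, 0, r + 2, z⟩) :
    nabla1A (nabla1A ω) = 0 := by
  funext I J B
  have h := fun b b' => contract_D_D (g := fun j j' =>
    ω (snoc (snoc I j : Fin (p + 1) → Fin 3) j') J (snoc (snoc B b : Fin (r + 1) → Fin 2) b'))
    (fun j j' => (isSymm_I hω J _).snoc_snoc j j' I) b b'
  have hs : ∀ j j', ω (snoc (snoc I j : Fin (p + 1) → Fin 3) j') J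
      (snoc (snoc B 1 : Fin (r + 1) → Fin 2) 0) = ω (snoc (snoc I j : Fin (p + 1) → Fin 3) j') J
      (snoc (snoc B 0 : Fin (r + 1) → Fin 2) 1) := fun j j' =>
    (isSymm_B hω (snoc (snoc I j : Fin (p + 1) → Fin 3) j') J).snoc_snoc 1 0 B
  have h00 := eq_zero_of_eq_neg (h 0 0)
  have h11 := eq_zero_of_eq_neg (h 1 1)
  have h10 := h 1 0
  simp only [hs] at h10
  simp only [nabla1A, map_sum, Pi.zero_apply]
  have e : ∀ F : Fin 3 → Fin 2 → Fin 3 → Fin 2 → PSF,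
      ∑ i, ∑ a, ∑ j, ∑ b, F i a j b = ∑ a, ∑ b, ∑ i, ∑ j, F i a j b := by
    intro F
    simp only [
      Finset.sum_comm (s := (Finset.univ : Finset (Fin 3))) (t := (Finset.univ : Finset (Fin 2)))]
  refine (e _).trans ?_
  simp only [Fin.sum_univ_two, hs, h00, h11, h10]
  abel

theorem nabla1B_nabla1B {ω : Comp (p + 2) 0 r} (hω : ω ∈ T ⟨p + 2, 0, r, z⟩) :
    nabla1B (nabla1B ω) = 0 := by
  funext I J B
  have hΦ : ∀ (x y : Fin 2) (r' : Fin r → Fin 2),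
      ∑ j, ∑ j', Dlow j x (Dlow j' y (ω (snoc (snoc I j : Fin (p + 1) → Fin 3) j') J r')) =
        -∑ j, ∑ j', Dlow j y (Dlow j' x (ω (snoc (snoc I j : Fin (p + 1) → Fin 3) j') J r')) := by
    intro x y r'
    have h := fun b b' => contract_D_D (g := fun j j' =>
      ω (snoc (snoc I j : Fin (p + 1) → Fin 3) j') J r')
      (fun j j' => (isSymm_I hω J _).snoc_snoc j j' I) b b'
    simp only [Dlow_eq, lowerOp_apply, Fin.sum_univ_two, map_add, map_smul,
      Finset.sum_add_distrib, smul_add, ← Finset.smul_sum, eq_zero_of_eq_neg (h 0 0),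
      eq_zero_of_eq_neg (h 1 1), h 1 0]
    module
  have := sum_removeNth_antisymm hΦ B
  rw [Pi.zero_apply, Pi.zero_apply, Pi.zero_apply, ← this]
  simp only [nabla1B, map_sum]
  refine Finset.sum_congr rfl fun m _ => ?_
  rw [Finset.sum_comm]

theorem nabla1C_nabla1C {ω : Comp 0 q (r + 2)} (hω : ω ∈ T ⟨0, q, r + 2, z⟩) :
    nabla1C (nabla1C ω) = 0 := by
  funext I J B
  have hΦ : ∀ (x y : Fin 3) (r' : Fin q → Fin 3),
      ∑ b, ∑ b', D x b (D y b' (ω I r' (snoc (snoc B b : Fin (r + 1) → Fin 2) b'))) =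
        -∑ b, ∑ b', D y b (D x b' (ω I r' (snoc (snoc B b : Fin (r + 1) → Fin 2) b'))) :=
    fun x y r' => contract_D_D' (fun b b' => (isSymm_B hω I r').snoc_snoc b b' B) x y
  have := sum_removeNth_antisymm hΦ J
  rw [Pi.zero_apply, Pi.zero_apply, Pi.zero_apply, ← this]
  simp only [nabla1C, map_sum]
  refine Finset.sum_congr rfl fun m _ => ?_
  rw [Finset.sum_comm]

theorem nabla1D_nabla1D (ω : Comp 0 q r) : nabla1D (nabla1D ω) = 0 := by
  funext I J B
  have hΦ : ∀ (x y : Fin 3) (r' : Fin q → Fin 3), ∑ m : Fin (r + 2), ∑ n : Fin (r + 1),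
        Dlow x (B m) (Dlow y (removeNth m B n) (ω I r' (removeNth n (removeNth m B)))) =
      -∑ m : Fin (r + 2), ∑ n : Fin (r + 1),
        Dlow y (B m) (Dlow x (removeNth m B n) (ω I r' (removeNth n (removeNth m B)))) :=
    fun x y r' => adjoin_Dlow_Dlow (fun B => ω I r' B) B x y
  have := sum_removeNth_antisymm hΦ J
  rw [Pi.zero_apply, Pi.zero_apply, Pi.zero_apply, ← this]
  simp only [nabla1D, map_sum]
  refine Finset.sum_congr rfl fun m _ => ?_
  rw [Finset.sum_comm]

theorem nabla2A_nabla1A {ω : Comp (p + 3) 0 1} (hω : ω ∈ T ⟨p + 3, 0, 1, z⟩) :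
    nabla2A (nabla1A ω) = 0 := by
  funext I J B
  have h := fun c => contract_D_D_D (g := fun i j k => ω (snoc (snoc (snoc I i : Fin (p + 1) → Fin 3) j :
    Fin (p + 2) → Fin 3) k) J (snoc B c))
    (fun i j k => ((isSymm_I hω J (snoc B c)).snoc_left k).snoc_snoc i j I)
    (fun i j k => (isSymm_I hω J (snoc B c)).snoc_snoc j k _)
  simp only [nabla2A, nabla1A, map_sum]
  have e : ∀ F : Fin 3 → Fin 3 → Fin 2 → Fin 2 → Fin 3 → Fin 2 → PSF,
      ∑ i, ∑ j, ∑ a, ∑ b, epsLow a b • ∑ k, ∑ c, F i j a b k c =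
      ∑ a, ∑ b, epsLow a b • ∑ c, ∑ i, ∑ j, ∑ k, F i j a b k c := by
    intro F
    simp only [Finset.smul_sum,
      Finset.sum_comm (s := (Finset.univ : Finset (Fin 3))) (t := (Finset.univ : Finset (Fin 2)))]
  refine (e _).trans ?_
  simp only [h, Finset.sum_const_zero, smul_zero, Pi.zero_apply]

theorem nabla1B_nabla2A {ω : Comp (p + 3) 0 0} (hω : ω ∈ T ⟨p + 3, 0, 0, z⟩) :
    nabla1B (nabla2A ω) = 0 := by
  funext I J B
  have h := contract_D_D_D (g := fun i j k => ω (snoc (snoc (snoc I i : Fin (p + 1) → Fin 3) j :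
    Fin (p + 2) → Fin 3) k) J ![])
    (fun i j k => ((isSymm_I hω J ![]).snoc_left k).snoc_snoc i j I)
    (fun i j k => (isSymm_I hω J ![]).snoc_snoc j k _)
  rw [nabla1B_zero (B' := ![])]
  simp only [nabla2A, map_sum, map_smul]
  simp only [Dlow_eq, lowerOp_apply]
  refine (sum_sum_comm_five (fun c => epsLow (B 0) c) epsLow (fun i j k c a b =>
    D i c (D j a (D k b (ω (snoc (snoc (snoc I i : Fin (p + 1) → Fin 3) j :
    Fin (p + 2) → Fin 3) k) J ![]))))).trans ?_
  simp only [h, Finset.sum_const_zero, smul_zero, Pi.zero_apply]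

theorem nabla2C_nabla1C (ω : Comp 0 q 1) : nabla2C (nabla1C ω) = 0 := by
  funext I J B
  have h := fun a b c => adjoin_D_D_D (fun J => ω I J (snoc B c)) J a b c
  simp only [nabla2C, nabla1C, map_sum]
  refine (sum_sum_comm_four epsLow (fun (k : Fin (q + 3)) (l : Fin (q + 2)) a b (m : Fin (q + 1)) c =>
    D (J k) a (D (removeNth k J l) b (D (removeNth l (removeNth k J) m) c
      (ω I (removeNth m (removeNth l (removeNth k J))) (snoc B c)))))).trans ?_
  simp only [h, Finset.sum_const_zero, smul_zero, Pi.zero_apply]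

theorem nabla1D_nabla2C (ω : Comp 0 q 0) : nabla1D (nabla2C ω) = 0 := by
  funext I J B
  have h := fun a b c => adjoin_D_D_D (fun J => ω I J ![]) J a b c
  rw [nabla1D_zero (B' := ![])]
  simp only [nabla2C, map_sum, map_smul]
  simp only [Dlow_eq, lowerOp_apply]
  refine (sum_sum_comm_five (fun c => epsLow (B 0) c) epsLow
    (fun (k : Fin (q + 3)) (l : Fin (q + 2)) (m : Fin (q + 1)) c a b =>
    D (J k) c (D (removeNth k J l) a (D (removeNth l (removeNth k J) m) b
      (ω I (removeNth m (removeNth l (removeNth k J))) ![]))))).trans ?_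
  simp only [h, Finset.sum_const_zero, smul_zero, Pi.zero_apply]

end complexes

/-! ### Composites with the operators of order three -/

section complexes_higher

variable {r : ℕ} {z : ℤ}

/-- The contraction of `W^{abc}` with a symmetric tensor. -/
theorem contract_W {h : Fin 2 → Fin 2 → Fin 2 → PSF} (h1 : ∀ a b c, h a b c = h b a c)
    (h2 : ∀ a b c, h a b c = h a c b) : ∑ a, ∑ b, ∑ c, W a b c (h a b c) =
      (6 : ℂ) • (N 0 (h 0 0 0) + N 1 (h 0 0 1) + N 2 (h 0 1 1) + N 3 (h 1 1 1)) := by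
  have e1 : h 0 1 0 = h 0 0 1 := h2 _ _ _
  have e2 : h 1 0 0 = h 0 0 1 := (h1 _ _ _).trans e1
  have e3 : h 1 0 1 = h 0 1 1 := h1 _ _ _
  have e4 : h 1 1 0 = h 0 1 1 := (h2 _ _ _).trans e3
  have s0 := (W_symm (h 0 0 0)).1
  have s3 := (W_symm (h 1 1 1)).2.1
  have s1 := (W_symm (h 0 0 1)).2.2.1
  have s2 := (W_symm (h 0 1 1)).2.2.2
  simp only [Fin.sum_univ_two, e1, e2, e3, e4, smul_add, ← s0, ← s1, ← s2, ← s3]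
  abel

theorem nabla3A_eq_N {ω : Comp 0 0 (r + 3)} (hω : ω ∈ T ⟨0, 0, r + 3, z⟩) (I : Fin 0 → Fin 3)
    (J : Fin 0 → Fin 3) (B : Fin r → Fin 2) :
    nabla3A ω I J B = (6 : ℂ) •
      (N 0 (ω I J (snoc (snoc (snoc B 0 : Fin (r + 1) → Fin 2) 0 : Fin (r + 2) → Fin 2) 0)) +
      N 1 (ω I J (snoc (snoc (snoc B 0 : Fin (r + 1) → Fin 2) 0 : Fin (r + 2) → Fin 2) 1)) +
      N 2 (ω I J (snoc (snoc (snoc B 0 : Fin (r + 1) → Fin 2) 1 : Fin (r + 2) → Fin 2) 1)) +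
      N 3 (ω I J (snoc (snoc (snoc B 1 : Fin (r + 1) → Fin 2) 1 : Fin (r + 2) → Fin 2) 1))) := by
  rw [nabla3A_eq]
  exact contract_W (h := fun a b c =>
    ω I J (snoc (snoc (snoc B a : Fin (r + 1) → Fin 2) b : Fin (r + 2) → Fin 2) c))
    (fun a b c => ((isSymm_B hω I J).snoc_left c).snoc_snoc a b B)
    (fun a b c => (isSymm_B hω I J).snoc_snoc b c _)

theorem nabla3A_nabla1A {ω : Comp 1 0 (r + 4)} (hω : ω ∈ T ⟨1, 0, r + 4, z⟩) :
    nabla3A (nabla1A ω) = 0 := by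
  funext I J B
  rw [nabla3A_eq_N (z := z) (nabla1A_mem hω)]
  have e1 : ∀ j, ω (snoc I j) J (snoc (snoc (snoc (snoc B 0 : Fin (r + 1) → Fin 2) 0 :
      Fin (r + 2) → Fin 2) 1 : Fin (r + 3) → Fin 2) 0) = ω (snoc I j) J (snoc (snoc (snoc (snoc B 0 :
      Fin (r + 1) → Fin 2) 0 : Fin (r + 2) → Fin 2) 0 : Fin (r + 3) → Fin 2) 1) :=
    fun j => (isSymm_B hω _ J).snoc_snoc _ _ _
  have e2 : ∀ j, ω (snoc I j) J (snoc (snoc (snoc (snoc B 0 : Fin (r + 1) → Fin 2) 1 :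
      Fin (r + 2) → Fin 2) 1 : Fin (r + 3) → Fin 2) 0) = ω (snoc I j) J (snoc (snoc (snoc (snoc B 0 :
      Fin (r + 1) → Fin 2) 0 : Fin (r + 2) → Fin 2) 1 : Fin (r + 3) → Fin 2) 1) :=
    fun j => ((isSymm_B hω _ J).snoc_snoc _ _ _).trans
      (((isSymm_B hω _ J).snoc_left _).snoc_snoc _ _ _)
  have e3 : ∀ j, ω (snoc I j) J (snoc (snoc (snoc (snoc B 1 : Fin (r + 1) → Fin 2) 1 :
      Fin (r + 2) → Fin 2) 1 : Fin (r + 3) → Fin 2) 0) = ω (snoc I j) J (snoc (snoc (snoc (snoc B 0 :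
      Fin (r + 1) → Fin 2) 1 : Fin (r + 2) → Fin 2) 1 : Fin (r + 3) → Fin 2) 1) :=
    fun j => ((isSymm_B hω _ J).snoc_snoc _ _ _).trans
      ((((isSymm_B hω _ J).snoc_left _).snoc_snoc _ _ _).trans
      ((((isSymm_B hω _ J).snoc_left _).snoc_left _).snoc_snoc _ _ _))
  simp only [nabla1A, map_sum, ← Finset.sum_add_distrib, Fin.sum_univ_two, map_add, N_D, e1, e2, e3]
  simp only [Pi.zero_apply, smul_eq_zero]
  right
  refine Finset.sum_eq_zero fun x _ => ?_
  abel

theorem nabla1C_nabla3A {ω : Comp 0 0 (r + 4)} (hω : ω ∈ T ⟨0, 0, r + 4, z⟩) :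
    nabla1C (nabla3A ω) = 0 := by
  funext I J B
  simp only [nabla1C, nabla3A_eq_N hω, Fin.sum_univ_two, map_smul, map_add, D_N]
  have e1 : ∀ K, ω I K (snoc (snoc (snoc (snoc B 1 : Fin (r + 1) → Fin 2) 0 :
      Fin (r + 2) → Fin 2) 0 : Fin (r + 3) → Fin 2) 0) = ω I K (snoc (snoc (snoc (snoc B 0 :
      Fin (r + 1) → Fin 2) 0 : Fin (r + 2) → Fin 2) 0 : Fin (r + 3) → Fin 2) 1) :=
    fun K => ((((isSymm_B hω _ K).snoc_left _).snoc_left _).snoc_snoc _ _ _).trans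
      ((((isSymm_B hω _ K).snoc_left _).snoc_snoc _ _ _).trans
      (((isSymm_B hω _ K)).snoc_snoc _ _ _))
  have e2 : ∀ K, ω I K (snoc (snoc (snoc (snoc B 1 : Fin (r + 1) → Fin 2) 0 :
      Fin (r + 2) → Fin 2) 0 : Fin (r + 3) → Fin 2) 1) = ω I K (snoc (snoc (snoc (snoc B 0 :
      Fin (r + 1) → Fin 2) 0 : Fin (r + 2) → Fin 2) 1 : Fin (r + 3) → Fin 2) 1) :=
    fun K => ((((isSymm_B hω _ K).snoc_left _).snoc_left _).snoc_snoc _ _ _).trans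
      ((((isSymm_B hω _ K).snoc_left _).snoc_snoc _ _ _))
  have e3 : ∀ K, ω I K (snoc (snoc (snoc (snoc B 1 : Fin (r + 1) → Fin 2) 0 :
      Fin (r + 2) → Fin 2) 1 : Fin (r + 3) → Fin 2) 1) = ω I K (snoc (snoc (snoc (snoc B 0 :
      Fin (r + 1) → Fin 2) 1 : Fin (r + 2) → Fin 2) 1 : Fin (r + 3) → Fin 2) 1) :=
    fun K => ((((isSymm_B hω _ K).snoc_left _).snoc_left _).snoc_snoc _ _ _)
  simp only [e1, e2, e3]
  simp
  abel

theorem nabla3B_nabla1B (ω : Comp 1 0 r) : nabla3B (nabla1B ω) = 0 := by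
  funext I J B
  have h := fun x i j k => adjoin_Dlow_four (fun B => ω (snoc I x) J B) B i j k x
  rw [nabla3B_eq]
  simp only [nabla1B, Wlow, triple_expand, map_sum]
  simp only [Fin.sum_univ_three (M := PSF), Finset.sum_add_distrib, Finset.sum_sub_distrib, h]
  simp

theorem nabla1D_nabla3B (ω : Comp 0 0 r) : nabla1D (nabla3B ω) = 0 := by
  funext I J B
  have h := fun i j k l => adjoin_Dlow_four (fun B => ω I (removeNth 0 J) B) B i j k l
  simp only [nabla1D, nabla3B_eq, Wlow, triple_expand, map_sum, map_add, map_sub]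
  refine (Fin.sum_univ_one _).trans ?_
  simp only [Finset.sum_add_distrib, Finset.sum_sub_distrib, h]
  simp

/-- The part of `W_{abc}` that is symmetric in `a, b, c` vanishes where all components of `N` do. -/
theorem sum_Wlow_eq_zero {f : PSF} (hf : ∀ s, N s f = 0) (B : Fin 3 → Fin 2) :
    ∑ l : Fin 3, ∑ m : Fin 2, ∑ n : Fin 1,
      Wlow (B l) (removeNth l B m) (removeNth m (removeNth l B) n) f = 0 := by
  have e : ∑ l : Fin 3, ∑ m : Fin 2, ∑ n : Fin 1,
      Wlow (B l) (removeNth l B m) (removeNth m (removeNth l B) n) f =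
      Wlow (B 0) (B 1) (B 2) f + Wlow (B 0) (B 2) (B 1) f + (Wlow (B 1) (B 0) (B 2) f +
      Wlow (B 1) (B 2) (B 0) f) + (Wlow (B 2) (B 0) (B 1) f + Wlow (B 2) (B 1) (B 0) f) := by
    have h1 : ∀ g : Fin 1 → PSF, ∑ n, g n = g 0 := fun g => Fin.sum_univ_one g
    rw [Fin.sum_univ_three]
    have b0 : removeNth 0 B = ![B 1, B 2] := by ext k; fin_cases k <;> rfl
    have b1 : removeNth 1 B = ![B 0, B 2] := by ext k; fin_cases k <;> rfl
    have b2 : removeNth 2 B = ![B 0, B 1] := by ext k; fin_cases k <;> rfl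
    have c0 : ∀ x y : Fin 2, removeNth 0 ![x, y] 0 = y := fun _ _ => rfl
    have c1 : ∀ x y : Fin 2, removeNth 1 ![x, y] 0 = x := fun _ _ => rfl
    simp only [Fin.sum_univ_two, h1, b0, b1, b2, c0, c1, Matrix.cons_val_zero, Matrix.cons_val_one]
  obtain ⟨s0, s3, s1, s2⟩ := W_symm f
  have e0 : ∀ i f, Dlow i 0 f = -D i 1 f := fun i f => by simp [Dlow, epsLow]
  have e1 : ∀ i f, Dlow i 1 f = D i 0 f := fun i f => by simp [Dlow, epsLow]
  rw [e]
  generalize B 0 = a, B 1 = b, B 2 = c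
  simp only [hf, smul_zero, W, triple_expand] at s0 s1 s2 s3
  fin_cases a <;> fin_cases b <;> fin_cases c <;>
  simp only [Fin.zero_eta, Fin.mk_one, Wlow, triple_expand, e0, e1, map_neg]
  · linear_combination (norm := module) -(6 : ℂ) • s3
  · linear_combination (norm := module) (2 : ℂ) • s2
  · linear_combination (norm := module) (2 : ℂ) • s2
  · linear_combination (norm := module) -(2 : ℂ) • s1
  · linear_combination (norm := module) (2 : ℂ) • s2
  · linear_combination (norm := module) -(2 : ℂ) • s1
  · linear_combination (norm := module) -(2 : ℂ) • s1
  · linear_combination (norm := module) (6 : ℂ) • s0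

/-- All components of `N` annihilate the image of `∇_2`, because up to a factor `∇_2 ω` is
`D^{i1} D^{j2} ω_{ij} = -D^{i2} D^{j1} ω_{ij}`, to which `N_D` applies. -/
theorem nabla3B_nabla2A {ω : Comp 2 0 0} (hω : ω ∈ T ⟨2, 0, 0, z⟩) : nabla3B (nabla2A ω) = 0 := by
  funext I J B
  rw [nabla3B_eq]
  have hg := fun K i j => (isSymm_I hω J K).snoc_snoc i j I
  have hc := fun K a b => contract_D_D (hg K) a b
  have h00 := fun K => eq_zero_of_eq_neg (hc K 0 0)
  have h11 := fun K => eq_zero_of_eq_neg (hc K 1 1)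
  have e1 : ∀ K, nabla2A ω I J K = -(2 : ℂ) • ∑ i, ∑ j, D i 0 (D j 1
      (ω (snoc (snoc I i : Fin 1 → Fin 3) j) J K)) := by
    intro K
    have h10 := hc K 1 0
    simp only [nabla2A, Fin.sum_univ_two, epsLow, Finset.sum_add_distrib, ← Finset.smul_sum, h10]
    simp
    module
  have e2 : ∀ K, nabla2A ω I J K = (2 : ℂ) • ∑ i, ∑ j, D i 1 (D j 0
      (ω (snoc (snoc I i : Fin 1 → Fin 3) j) J K)) := by
    intro K
    rw [e1, hc K 0 1]; module
  have hN : ∀ K s, N s (nabla2A ω I J K) = 0 := by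
    intro K s
    have n0 := congrArg (N 0) (h11 K)
    have n1 := congrArg (N 1) (h11 K)
    simp only [map_sum, map_zero] at n0 n1
    fin_cases s
    · simp only [Fin.zero_eta, e1, map_smul, map_sum, N_D, Finset.sum_const_zero, smul_zero]
    · simp only [Fin.mk_one, e1, map_smul, map_sum, N_D, Finset.sum_neg_distrib, n0, neg_zero, smul_zero]
    · simp only [Fin.reduceFinMk, e1, map_smul, map_sum, N_D, Finset.sum_neg_distrib, n1, neg_zero, smul_zero]
    · simp only [Fin.reduceFinMk, e2, map_smul, map_sum, N_D, Finset.sum_const_zero, smul_zero]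
  refine (Finset.sum_congr rfl fun l _ => Finset.sum_congr rfl fun m _ => Finset.sum_congr rfl
    fun n _ => ?_).trans (sum_Wlow_eq_zero (hN ![]) B)
  rw [Subsingleton.elim (removeNth n _) ![]]

/-- The part of `D^{ia} D^{jb}` that is symmetric in `i, j` vanishes on the image of `∇_3`. -/
theorem D_D_N (i j : Fin 3) (s : Fin 4) (f : PSF) :
    D i 1 (D j 0 (N s f)) + D j 1 (D i 0 (N s f)) = 0 := by
  have h1 := D_D_symm i j 1 0 (N s f)
  have h : ∀ f, D i 1 (D j 1 f) + D j 1 (D i 1 f) = 0 := fun f => by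
    rw [D_anticomm]; simp [epsUp]
  fin_cases s <;> simp only [Fin.zero_eta, Fin.mk_one, Fin.reduceFinMk, D_N, map_neg, map_zero, add_zero] at *
  · rw [← neg_add, h, neg_zero]
  · rw [← neg_add, h, neg_zero]
  · rw [← neg_add, h, neg_zero]

theorem nabla2C_nabla3A {ω : Comp 0 0 3} (hω : ω ∈ T ⟨0, 0, 3, z⟩) : nabla2C (nabla3A ω) = 0 := by
  funext I J B
  have h : ∀ i j s f, D i 0 (D j 1 (N s f)) + D j 0 (D i 1 (N s f)) = 0 := fun i j s f => by
    rw [D_D_symm, D_D_N, neg_zero]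
  have h10 : ∀ i j K, D i 1 (D j 0 (nabla3A ω I K B)) + D j 1 (D i 0 (nabla3A ω I K B)) = 0 := by
    intro i j K
    simp only [nabla3A_eq_N hω, map_smul, map_add]
    linear_combination (norm := module) (6 : ℂ) • (D_D_N i j 0 _ + D_D_N i j 1 _ + D_D_N i j 2 _ +
      D_D_N i j 3 _)
  have h01 : ∀ i j K, D i 0 (D j 1 (nabla3A ω I K B)) + D j 0 (D i 1 (nabla3A ω I K B)) = 0 :=
    fun i j K => by rw [D_D_symm, h10, neg_zero]
  have hs : ∀ g : Fin 1 → PSF, ∑ n, g n = g 0 := fun g => Fin.sum_univ_one g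
  have h0 : removeNth 0 J 0 = J 1 := rfl
  have h1 : removeNth 1 J 0 = J 0 := rfl
  have h2 : removeNth 0 (removeNth 0 J) = ![] := Subsingleton.elim _ _
  have h3 : removeNth 0 (removeNth 1 J) = ![] := Subsingleton.elim _ _
  simp only [nabla2C]
  refine (Fin.sum_univ_two _).trans ?_
  simp only [hs, h0, h1, h2, h3, Fin.sum_univ_two, epsLow, Pi.zero_apply]
  simp only [Fin.val_zero, Fin.val_one, Nat.cast_zero, Nat.cast_one]
  linear_combination (norm := module) h10 (J 0) (J 1) ![] - h01 (J 0) (J 1) ![]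

/-! ### Composites with the operators of order four and six -/

theorem opA2_nabla1A {ω : Comp 1 0 3} (hω : ω ∈ T ⟨1, 0, 3, z⟩) : opA2 Y42 (nabla1A ω) = 0 := by
  funext I J B
  have h : ∀ a b c, snoc ![a, b] c = (![a, b, c] : Fin 3 → Fin 2) := fun a b c => by
    ext k; fin_cases k <;> rfl
  have hl : ∀ l, snoc ![] l = (![l] : Fin 1 → Fin 3) := fun l => by
    ext k; fin_cases k; rfl
  have e1 : ∀ l x y z, ω l ![] ![x, y, z] = ω l ![] ![y, x, z] := fun l x y z => by
    have := (isSymm_B hω l ![]) (Equiv.swap 0 1) ![x, y, z]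
    refine this.symm.trans ?_
    dsimp only
    congr 1; ext k; fin_cases k <;> rfl
  have e2 : ∀ l x y z, ω l ![] ![x, y, z] = ω l ![] ![x, z, y] := fun l x y z => by
    have := (isSymm_B hω l ![]) (Equiv.swap 1 2) ![x, y, z]
    refine this.symm.trans ?_
    dsimp only
    congr 1; ext k; fin_cases k <;> rfl
  have e3 := fun l => e2 l 0 1 0
  have e4 := fun l => (e1 l 1 0 0).trans (e3 l)
  have e5 := fun l => e1 l 1 0 1
  have e6 := fun l => (e2 l 1 1 0).trans (e5 l)
  simp only [opA2, nabla1A, Fin.sum_univ_two, map_sum, map_add, h, hl, e3, e4, e5, e6, Y42_apply,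
    N_D, D_N, ← Finset.sum_add_distrib, map_neg, map_zero]
  simp only [Pi.zero_apply]
  refine Finset.sum_eq_zero fun x _ => ?_
  module

theorem nabla1D_opA2 (ω : Comp 0 0 2) : nabla1D (opA2 Y42 ω) = 0 := by
  have h10 := fun i j s f => D_D_N i j s f
  have h01 : ∀ i j s f, D i 0 (D j 1 (N s f)) + D j 0 (D i 1 (N s f)) = 0 := fun i j s f => by
    rw [D_D_symm, D_D_N, neg_zero]
  have h00 : ∀ i j f, D i 0 (D j 0 f) + D j 0 (D i 0 f) = 0 := fun i j f => by
    rw [D_anticomm]; simp [epsUp]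
  have h11 : ∀ i j f, D i 1 (D j 1 f) + D j 1 (D i 1 f) = 0 := fun i j f => by
    rw [D_anticomm]; simp [epsUp]
  funext I J B
  have h0 : removeNth 0 J 0 = J 1 := rfl
  have h1 : removeNth 1 J 0 = J 0 := rfl
  rw [nabla1D_zero (B' := ![])]
  refine (Fin.sum_univ_two _).trans ?_
  simp only [opA2, h0, h1, Fin.sum_univ_two, map_add, Y42_apply, Pi.zero_apply]
  generalize ω ![] ![] ![0, 0] = f, ω ![] ![] ![0, 1] = g, ω ![] ![] ![1, 0] = h, ω ![] ![] ![1, 1] = k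
  generalize J 0 = i, J 1 = j, B 0 = b
  simp only [Dlow_eq, lowerOp_apply, Fin.sum_univ_two, map_smul]
  linear_combination (norm := module) epsLow b 0 • (-(2 : ℂ) • h01 i j 0 f + h00 i j (N 2 g) +
    h00 i j (N 2 h) + (2 : ℂ) • h00 i j (N 3 k)) + epsLow b 1 • (-(2 : ℂ) • h11 i j (N 0 f) +
    h10 i j 2 g + h10 i j 2 h + (2 : ℂ) • h10 i j 3 k)

theorem opA1_nabla1A {ω : Comp 2 0 1} (hω : ω ∈ T ⟨2, 0, 1, z⟩) : opA1 Y41 (nabla1A ω) = 0 := by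
  funext I J B
  have hl : ∀ l j, snoc ![l] j = (![l, j] : Fin 2 → Fin 3) := fun l j => by
    ext k; fin_cases k <;> rfl
  have hb : ∀ l, snoc ![] l = (![l] : Fin 1 → Fin 2) := fun l => by
    ext k; fin_cases k; rfl
  have hg : ∀ b i j, ω ![i, j] ![] b = ω ![j, i] ![] b := fun b i j => by
    refine ((isSymm_I hω ![] b) (Equiv.swap 0 1) ![i, j]).symm.trans ?_
    dsimp only
    congr 1; ext k; fin_cases k <;> rfl
  have hc := fun K a b => contract_D_D (hg K) a b
  have h00 := fun K => eq_zero_of_eq_neg (hc K 0 0)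
  have h11 := fun K => eq_zero_of_eq_neg (hc K 1 1)
  have e1 : ∀ K, ∑ l, ∑ j, N 0 (D l 1 (D j 1 (ω ![l, j] ![] K))) = 0 := fun K => by
    simpa only [map_sum, map_zero] using congrArg (N 0) (h11 K)
  have e2 : ∀ K, ∑ l, ∑ j, N 0 (D l 1 (D j 0 (ω ![l, j] ![] K))) = 0 := fun K => by
    have := congrArg (N 0) (hc K 1 0)
    simpa only [map_sum, map_neg, N_D, Finset.sum_const_zero, neg_zero] using this
  have e3 : ∀ K, ∑ l, ∑ j, N 1 (D l 1 (D j 1 (ω ![l, j] ![] K))) = 0 := fun K => by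
    simpa only [map_sum, map_zero] using congrArg (N 1) (h11 K)
  have e4 : ∀ K, ∑ l, ∑ j, N 1 (D l 1 (D j 0 (ω ![l, j] ![] K))) = 0 := fun K => by
    have := congrArg (N 1) (hc K 1 0)
    simp only [map_sum, map_neg, N_D] at this
    simpa only [Finset.sum_neg_distrib, e1, neg_zero] using this
  have e5 : ∀ K, ∑ l, ∑ j, N 2 (D l 1 (D j 1 (ω ![l, j] ![] K))) = 0 := fun K => by
    simpa only [map_sum, map_zero] using congrArg (N 2) (h11 K)
  have e6 : ∀ K, ∑ l, ∑ j, N 2 (D l 1 (D j 0 (ω ![l, j] ![] K))) = 0 := fun K => by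
    have := congrArg (N 2) (hc K 1 0)
    simp only [map_sum, map_neg, N_D] at this
    simpa only [Finset.sum_neg_distrib, e3, neg_zero] using this
  simp only [opA1, nabla1A, Fin.sum_univ_two, hl, hb]
  simp only [Y41_apply, map_sum, map_add, Finset.sum_add_distrib, smul_add, ← Finset.smul_sum,
    Finset.smul_sum, N_D]
  simp only [Finset.sum_add_distrib, ← Finset.smul_sum, Finset.sum_neg_distrib, smul_neg, e1, e2, e3, e4, e5, e6]
  simp

theorem removeNth_three {α : Type*} (B : Fin 3 → α) : removeNth 0 B = ![B 1, B 2] ∧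
    removeNth 1 B = ![B 0, B 2] ∧ removeNth 2 B = ![B 0, B 1] := by
  refine ⟨?_, ?_, ?_⟩ <;> ext k <;> fin_cases k <;> rfl

theorem nabla1D_opA1 (ω : Comp 1 0 0) : nabla1D (opA1 Y41 ω) = 0 := by
  funext I J B
  obtain ⟨b0, b1, b2⟩ := removeNth_three B
  simp only [nabla1D]
  refine (Fin.sum_univ_one _).trans ?_
  refine (Fin.sum_univ_three _).trans ?_
  simp only [opA1, b0, b1, b2, Matrix.cons_val_zero, Matrix.cons_val_one, map_sum, Pi.zero_apply,
    ← Finset.sum_add_distrib]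
  refine Finset.sum_eq_zero fun l _ => ?_
  generalize ω ![l] ![] ![] = f
  have h00 : D (J 0) 0 (N 0 (D l 1 f)) = 0 := (D_N _ _).1
  have h01 : D (J 0) 0 (N 2 (D l 0 f)) = D (J 0) 1 (N 0 (D l 1 f)) := by
    rw [(N_D l f).2.2.1, map_neg, (D_N _ _).2.1, neg_neg]
  have h11 : D (J 0) 0 (N 3 (D l 0 f)) = -D (J 0) 1 (N 2 (D l 0 f)) := (D_N _ _).2.2.2.1
  have h1 : D (J 0) 1 (N 3 (D l 0 f)) = 0 := (D_N _ _).2.2.2.2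
  generalize B 0 = a, B 1 = b, B 2 = c
  fin_cases a <;> fin_cases b <;> fin_cases c <;>
  simp [Fin.sum_univ_two, epsLow, Dlow_eq, lowerOp_apply, Y41_apply, h00, h01, h11, h1] <;> module

theorem opA01_nabla1A {ω : Comp 1 0 2} (hω : ω ∈ T ⟨1, 0, 2, z⟩) : opA01 Y6 (nabla1A ω) = 0 := by
  funext I J B
  have h : ∀ a b, snoc ![a] b = (![a, b] : Fin 2 → Fin 2) := fun a b => by
    ext k; fin_cases k <;> rfl
  have hl : ∀ l, snoc ![] l = (![l] : Fin 1 → Fin 3) := fun l => by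
    ext k; fin_cases k; rfl
  have e1 : ∀ l, ω l ![] ![1, 0] = ω l ![] ![0, 1] := fun l => by
    refine ((isSymm_B hω l ![]) (Equiv.swap 0 1) ![1, 0]).symm.trans ?_
    dsimp only
    congr 1; ext k; fin_cases k <;> rfl
  simp only [opA01, nabla1A, Fin.sum_univ_two, map_sum, map_add, h, hl, e1, Y6_apply,
    ← Finset.sum_add_distrib, Finset.smul_sum, Pi.zero_apply]
  refine Finset.sum_eq_zero fun x _ => ?_
  generalize ω ![x] ![] ![0, 0] = f, ω ![x] ![] ![0, 1] = g, ω ![x] ![] ![1, 1] = h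
  generalize B 0 = b
  have s1 : N 0 (N 3 (D x 0 g)) = (2 : ℂ) • N 0 (E 1 (D x 1 g)) := by
    rw [(N_D_comm x g).1, map_add, map_neg, (N_D x _).1, map_smul, neg_zero, zero_add]
  have s2 : N 3 (N 0 (D x 1 g)) = -(2 : ℂ) • N 3 (E 0 (D x 0 g)) := by
    rw [(N_D_comm x g).2, map_sub, map_neg, (N_D x _).2.2.2.2, map_smul]; module
  have s3 : N 3 (E 0 (D x 1 h)) = 0 := by rw [E_D, map_neg, (N_D x _).2.2.2.2, neg_zero]
  simp only [(N_D x _).1, (N_D x _).2.2.2.2, s1, s2, s3, (E_N 1 _).1, map_zero]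
  module

theorem nabla1D_opA01 (ω : Comp 0 0 1) : nabla1D (opA01 Y6 ω) = 0 := by
  funext I J B
  have b0 : removeNth 0 B 0 = B 1 := rfl
  have b1 : removeNth 1 B 0 = B 0 := rfl
  simp only [nabla1D]
  refine (Fin.sum_univ_one _).trans ?_
  refine (Fin.sum_univ_two _).trans ?_
  simp only [opA01, b0, b1, map_sum, Pi.zero_apply, ← Finset.sum_add_distrib, Fin.sum_univ_two]
  generalize ω ![] ![] ![0] = f, ω ![] ![] ![1] = g
  generalize J 0 = j, B 0 = a, B 1 = b
  have h1 : D j 0 (E 1 (N 0 f)) = 0 := by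
    rw [← neg_eq_zero, ← E_D, (D_N _ _).1, map_zero]
  have h2 : D j 0 (N 0 (N 3 g)) = 0 := (D_N _ _).1
  have h3 : D j 1 (N 3 (N 0 f)) = 0 := (D_N _ _).2.2.2.2
  have h4 : D j 1 (N 3 (E 0 g)) = 0 := (D_N _ _).2.2.2.2
  have h5 : D j 0 (N 3 (N 0 f)) = -(2 : ℂ) • D j 1 (E 1 (N 0 f)) := by
    have := (N_D_comm j (N 0 f)).1
    rw [(D_N _ _).1, map_zero, E_D] at this
    linear_combination (norm := module) this
  have h6 : D j 1 (N 0 (N 3 g)) = -(2 : ℂ) • D j 0 (N 3 (E 0 g)) := by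
    have := (N_D_comm j (N 3 g)).2
    rw [(D_N _ _).2.2.2.2, map_zero, E_D, (E_N 0 g).2, map_neg] at this
    linear_combination (norm := module) this
  fin_cases a <;> fin_cases b <;>
  simp [epsLow, Dlow_eq, lowerOp_apply, Y6_apply, Fin.sum_univ_two, h1, h2, h3, h4, h5, h6] <;> module

end complexes_higher

/-! ### Operators built from `N`, `E` and `W` as operators with constant coefficients -/

section order

variable {p q r k : ℕ}

theorem IsDComp.congr {g g' : Comp p q r → PSF} (h : IsDComp k g) (e : ∀ ω, g' ω = g ω) :
    IsDComp k g' := by rwa [show g' = g from funext e]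

theorem IsDComp.N {g : Comp p q r → PSF} (h : IsDComp k g) (s : Fin 4) :
    IsDComp (k + 3) fun ω => N s (g ω) := by
  have e : ∀ i j l a b c, IsDComp (k + 3) fun ω => VLE36.D i a (VLE36.D j b (VLE36.D l c (g ω))) :=
    fun i j l a b c => ((h.D l c).D j b).D i a
  fin_cases s
  · exact (e 0 1 2 0 0 0).congr fun ω => N_zero _
  · exact (((e 0 1 2 1 0 0).add (e 0 1 2 0 1 0)).add (e 0 1 2 0 0 1)).congr fun ω => N_one _
  · exact (((e 0 1 2 0 1 1).add (e 0 1 2 1 0 1)).add (e 0 1 2 1 1 0)).congr fun ω => N_two _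
  · exact (e 0 1 2 1 1 1).congr fun ω => N_three _

/-- The derivatives `∂_k` are of order two, being anticommutators of `D^{ia}`. -/
theorem IsDComp.dU {g : Comp p q r → PSF} (h : IsDComp k g) (i : Fin 3) :
    IsDComp (k + 2) fun ω => dU i (g ω) := by
  have e : ∀ i j a b, IsDComp (k + 2) fun ω => (1 / 2 : ℂ) • (VLE36.D i a (VLE36.D j b (g ω)) +
      VLE36.D j b (VLE36.D i a (g ω))) :=
    fun i j a b => (((h.D j b).D i a).add ((h.D i a).D j b)).smul _
  fin_cases i
  · exact (e 1 2 0 1).congr fun ω => by simp only [Fin.zero_eta, normal_order]; module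
  · exact (e 2 0 0 1).congr fun ω => by simp only [Fin.mk_one, normal_order]; module
  · exact (e 0 1 0 1).congr fun ω => by simp only [Fin.reduceFinMk, normal_order]; module

theorem IsDComp.E {g : Comp p q r → PSF} (h : IsDComp k g) (a : Fin 2) :
    IsDComp (k + 3) fun ω => E a (g ω) :=
  IsDComp.congr (IsDComp.sum (s := Finset.univ) fun i => (h.dU i).D i a)
    fun ω => by simp [E_apply, Fin.sum_univ_three]

theorem opA2_dOperator : IsDOperator 4 (opA2 Y42) := by
  have h : ∀ j a b L, IsDComp 4 fun ω : Comp 0 0 2 => Y42 j a b (ω ![] ![] L) := by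
    intro j a b L
    have h := IsDComp.base (![] : Fin 0 → Fin 3) (![] : Fin 0 → Fin 3) L
    fin_cases a <;> fin_cases b
    · exact (((h.N 0).D j 1).smul (-2)).congr fun ω => (Y42_apply _ _).1
    · exact ((h.N 2).D j 0).congr fun ω => (Y42_apply _ _).2.1
    · exact ((h.N 2).D j 0).congr fun ω => (Y42_apply _ _).2.2.1
    · exact (((h.N 3).D j 0).smul 2).congr fun ω => (Y42_apply _ _).2.2.2
  exact isDOperator_of_comp fun _ J _ => IsDComp.sum fun a => IsDComp.sum fun b => h _ a b _

theorem opA1_dOperator : IsDOperator 4 (opA1 Y41) := by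
  have h : ∀ l a b, IsDComp 4 fun ω : Comp 1 0 0 => Y41 l a b (ω ![l] ![] ![]) := by
    intro l a b
    have h := IsDComp.base ![l] (![] : Fin 0 → Fin 3) (![] : Fin 0 → Fin 2)
    fin_cases a <;> fin_cases b
    · exact (((h.D l 1).N 0).smul (-2)).congr fun ω => (Y41_apply _ _).1
    · exact ((h.D l 0).N 2).congr fun ω => (Y41_apply _ _).2.1
    · exact ((h.D l 0).N 2).congr fun ω => (Y41_apply _ _).2.2.1
    · exact (((h.D l 0).N 3).smul 2).congr fun ω => (Y41_apply _ _).2.2.2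
  exact isDOperator_of_comp fun _ _ _ => IsDComp.sum fun l => IsDComp.sum fun a =>
    IsDComp.sum fun b => ((h l a b).add (h l b a)).smul _

theorem opA01_dOperator : IsDOperator 6 (opA01 Y6) := by
  have h : ∀ a d, IsDComp 6 fun ω : Comp 0 0 1 => Y6 a d (ω ![] ![] ![a]) := by
    intro a d
    have h := IsDComp.base (![] : Fin 0 → Fin 3) (![] : Fin 0 → Fin 3) ![a]
    revert h
    fin_cases a <;> fin_cases d <;> intro h
    · exact (((h.N 0).E 1).smul 2).congr fun ω => (Y6_apply _).1
    · exact ((h.N 0).N 3).congr fun ω => (Y6_apply _).2.1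
    · exact ((h.N 3).N 0).congr fun ω => (Y6_apply _).2.2.1
    · exact (((h.E 0).N 3).smul 2).congr fun ω => (Y6_apply _).2.2.2
  exact isDOperator_of_comp fun _ _ _ => IsDComp.sum fun a => IsDComp.sum fun d => (h a d).smul _

theorem nabla4A2_eq : nabla4A2 = opA2 Y4 := by
  funext ω I J B
  rw [Subsingleton.elim I ![]]
  simp only [nabla4A2, opA2, Y4, LinearMap.sum_apply, LinearMap.comp_apply, W, triple_apply, Dlow,
    LinearMap.smul_apply, map_sum, map_smul, Finset.smul_sum, smul_smul,
    Finset.sum_comm (s := (Finset.univ : Finset (Fin 3))) (t := (Finset.univ : Finset (Fin 2)))]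
  simp only [mul_comm]

theorem triple_Dlow_D (x : Fin 2) (b c : Fin 2) (f : PSF) :
    triple (fun i => Dlow i x) (fun i => D i b) (fun i => D i c) f = ∑ a, epsLow x a • W a b c f := by
  simp only [triple_expand, W, Fin.sum_univ_two, Dlow_eq, lowerOp_apply]
  module

theorem triple_Dlow_Dlow_D (x y : Fin 2) (c : Fin 2) (f : PSF) :
    triple (fun i => Dlow i x) (fun i => Dlow i y) (fun i => D i c) f =
      ∑ a, ∑ b, (epsLow x a * epsLow y b) • W a b c f := by
  simp only [triple_expand, W, Fin.sum_univ_two, Dlow_eq, lowerOp_apply, map_add, map_smul]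
  module

theorem sum_comm_four {ι : Type*} [Fintype ι] {M : Type*} [AddCommMonoid M] [Module ℂ M]
    (G : Fin 3 → Fin 3 → Fin 3 → ι → Fin 2 → Fin 2 → M) :
    ∑ i, ∑ j, ∑ k, ∑ l, ∑ c, ∑ d, (eps3 i j k * epsLow c d) • G i j k l c d =
      ∑ l, ∑ c, ∑ d, epsLow c d • ∑ i, ∑ j, ∑ k, eps3 i j k • G i j k l c d := by
  simp only [Finset.smul_sum, smul_smul,
    Finset.sum_comm (s := (Finset.univ : Finset (Fin 3))) (t := (Finset.univ : Finset (Fin 2))),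
    Finset.sum_comm (s := (Finset.univ : Finset ι)) (t := (Finset.univ : Finset (Fin 2))),
    Finset.sum_comm (s := (Finset.univ : Finset (Fin 3))) (t := (Finset.univ : Finset ι))]
  simp only [mul_comm]

theorem sum_comm_six {M : Type*} [AddCommMonoid M] [Module ℂ M]
    (G : Fin 3 → Fin 3 → Fin 3 → Fin 3 → Fin 3 → Fin 3 → Fin 2 → Fin 2 → Fin 2 → Fin 2 → Fin 2 → M) :
    ∑ i, ∑ j, ∑ k, ∑ l, ∑ m, ∑ n, ∑ a, ∑ b, ∑ c, ∑ e, ∑ f,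
        (eps3 i j k * eps3 l m n * epsLow b e * epsLow c f) • G i j k l m n a b c e f =
      ∑ a, ∑ b, ∑ c, ∑ e, ∑ f, (epsLow b e * epsLow c f) •
        ∑ i, ∑ j, ∑ k, eps3 i j k • ∑ l, ∑ m, ∑ n, eps3 l m n • G i j k l m n a b c e f := by
  have h : ∀ H : Fin 3 → Fin 3 → Fin 3 → Fin 3 → Fin 3 → Fin 3 → Fin 2 → Fin 2 → Fin 2 → Fin 2 → Fin 2 → M,
      ∑ i, ∑ j, ∑ k, ∑ l, ∑ m, ∑ n, ∑ a, ∑ b, ∑ c, ∑ e, ∑ f, H i j k l m n a b c e f =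
      ∑ a, ∑ b, ∑ c, ∑ e, ∑ f, ∑ i, ∑ j, ∑ k, ∑ l, ∑ m, ∑ n, H i j k l m n a b c e f := by
    intro H
    simp (maxSteps := 1000000) only [
      Finset.sum_comm (s := (Finset.univ : Finset (Fin 3))) (t := (Finset.univ : Finset (Fin 2)))]
  rw [h]
  refine Finset.sum_congr rfl fun a _ => Finset.sum_congr rfl fun b _ => Finset.sum_congr rfl fun c _ =>
    Finset.sum_congr rfl fun e _ => Finset.sum_congr rfl fun f _ => ?_
  simp only [Finset.smul_sum, smul_smul]
  simp only [mul_comm (epsLow b e * epsLow c f), ← mul_assoc]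

theorem nabla4A1_eq : nabla4A1 = opA1 Y4 := by
  funext ω I J B
  rw [Subsingleton.elim J ![]]
  have h0 : removeNth 0 B 0 = B 1 := rfl
  have h1 : removeNth 1 B 0 = B 0 := rfl
  have e : ∀ x y : Fin 2, ∑ i, ∑ j, ∑ k, ∑ l, ∑ c, ∑ d, (eps3 i j k * epsLow c d) •
      Dlow i x (Dlow j y (D k c (D l d (ω ![l] ![] ![])))) =
      ∑ l, ∑ a, ∑ b, (epsLow x a * epsLow y b) • Y4 l a b (ω ![l] ![] ![]) := by
    intro x y
    rw [sum_comm_four]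
    refine Finset.sum_congr rfl fun l _ => ?_
    have h : ∀ c g, ∑ i, ∑ j, ∑ k, eps3 i j k • Dlow i x (Dlow j y (D k c g)) =
        ∑ a, ∑ b, (epsLow x a * epsLow y b) • W a b c g := fun c g => by
      rw [← triple_Dlow_Dlow_D, triple_apply]
    simp only [h]
    simp only [Y4_apply, Fin.sum_univ_two, Dlow_eq, lowerOp_apply, map_add, map_smul]
    have e0 : epsLow 0 0 = 0 := by simp [epsLow]
    have e1 : epsLow 1 1 = 0 := by simp [epsLow]
    simp only [e0, e1]
    module
  simp only [nabla4A1]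
  refine (Fin.sum_univ_two _).trans ?_
  simp only [opA1, h0, h1, smul_add, Finset.sum_add_distrib]
  rw [Subsingleton.elim (![] : Fin 0 → Fin 2) ![]]
  refine congrArg₂ _ (e _ _) ((e _ _).trans ?_)
  refine Finset.sum_congr rfl fun l _ => Finset.sum_comm.trans ?_
  simp only [mul_comm]

set_option maxHeartbeats 1000000 in
theorem nabla6_eq : nabla6 = opA01 fun a d => K a d + K d a := by
  funext ω I J B
  rw [Subsingleton.elim I ![], Subsingleton.elim J ![]]
  simp only [nabla6, opA01]
  rw [sum_comm_six]
  refine Finset.sum_congr rfl fun a _ => ?_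
  generalize ω ![] ![] ![a] = g
  have e1 : ∀ b c e f, ∑ i, ∑ j, ∑ k, eps3 i j k • ∑ l, ∑ m, ∑ n, eps3 l m n •
      (D i a (D j b (D k c (Dlow l (B 0) (D m e (D n f g))))) +
        Dlow i (B 0) (D j b (D k c (D l a (D m e (D n f g)))))) =
      ∑ d, epsLow (B 0) d • (W a b c (W d e f g) + W d b c (W a e f g)) := by
    intro b c e f
    have h1 : ∑ i, ∑ j, ∑ k, eps3 i j k • ∑ l, ∑ m, ∑ n, eps3 l m n •
        D i a (D j b (D k c (Dlow l (B 0) (D m e (D n f g))))) =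
        ∑ d, epsLow (B 0) d • W a b c (W d e f g) := by
      have h : ∑ i, ∑ j, ∑ k, eps3 i j k • ∑ l, ∑ m, ∑ n, eps3 l m n •
          D i a (D j b (D k c (Dlow l (B 0) (D m e (D n f g))))) =
          W a b c (∑ l, ∑ m, ∑ n, eps3 l m n • Dlow l (B 0) (D m e (D n f g))) := by
        rw [W, triple_apply]
        simp only [map_sum, map_smul]
      rw [h, ← triple_apply (fun i => Dlow i (B 0)) (fun i => D i e) (fun i => D i f), triple_Dlow_D]
      simp only [map_sum, map_smul]
    have h2 : ∑ i, ∑ j, ∑ k, eps3 i j k • ∑ l, ∑ m, ∑ n, eps3 l m n •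
        Dlow i (B 0) (D j b (D k c (D l a (D m e (D n f g))))) =
        ∑ d, epsLow (B 0) d • W d b c (W a e f g) := by
      rw [← triple_Dlow_D, triple_apply]
      simp only [W]
      simp only [triple_apply (fun i => D i a), map_sum, map_smul]
    simp only [smul_add, Finset.sum_add_distrib, h1, h2]
  simp only [smul_add, Finset.sum_add_distrib] at e1
  simp only [e1, smul_add, Finset.sum_add_distrib, K_apply, LinearMap.add_apply, Fin.sum_univ_two]
  generalize epsLow (B 0) = v
  simp only [epsLow]
  simp
  module

end order

/-! ### Nonvanishing of the operators -/

section nonzero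

variable {p q r : ℕ}

/-- The value at `θ = 0`, `u = 0`. -/
def body : PSF →ₐ[ℂ] ℂ :=
  Algebra.TensorProduct.lift (MvPolynomial.aeval 0) ExteriorAlgebra.algebraMapInv
    fun _ _ => Commute.all _ _

instance : Nontrivial PSF := body.toRingHom.domain_nontrivial

/-- The tensor whose only nonzero components, equal to `g`, are those with all the `sl(3)` indices
equal to the first one and all the `sl(2)` indices equal to `b`. -/
def mono (b : Fin 2) (g : PSF) : Comp p q r := fun I J B =>
  if (∀ k, I k = 0) ∧ (∀ k, J k = 0) ∧ ∀ k, B k = b then g else 0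

theorem mono_const (b : Fin 2) (g : PSF) :
    mono (p := p) (q := q) (r := r) b g (fun _ => 0) (fun _ => 0) (fun _ => b) = g := by
  simp [mono]

theorem mono_symm (b : Fin 2) (g : PSF) :
    (∀ J B, IsSymm fun I => mono (p := p) (q := q) (r := r) b g I J B) ∧
    (∀ I B, IsSymm fun J => mono (p := p) (q := q) (r := r) b g I J B) ∧
    ∀ I J, IsSymm (mono (p := p) (q := q) (r := r) b g I J) := by
  refine ⟨fun J B π I => ?_, fun I B π J => ?_, fun I J π B => ?_⟩
  · simp only [mono, Function.comp_apply, π.forall_congr_left (p := fun k => I (π k) = 0), π.apply_symm_apply]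
  · simp only [mono, Function.comp_apply, π.forall_congr_left (p := fun k => J (π k) = 0), π.apply_symm_apply]
  · simp only [mono, Function.comp_apply, π.forall_congr_left (p := fun k => B (π k) = b), π.apply_symm_apply]

theorem mono_mem_lower (b : Fin 2) (g : PSF) (z : ℤ) : mono b g ∈ T ⟨p, 0, r, z⟩ :=
  mem_T_lower (mono_symm b g).1 (mono_symm b g).2.2

theorem mono_mem_upper (b : Fin 2) (g : PSF) (z : ℤ) : mono b g ∈ T ⟨0, q, r, z⟩ :=
  mem_T_upper (mono_symm b g).2.1 (mono_symm b g).2.2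

theorem forall_snoc {α : Type*} {n : ℕ} (I : Fin n → α) (j c : α) :
    (∀ k, (snoc (α := fun _ => α) I j : Fin (n + 1) → α) k = c) ↔ (∀ k, I k = c) ∧ j = c := by
  rw [Fin.forall_fin_succ']; simp

section first_order

variable (T : Fin 3 → Fin 2 → PSF →ₗ[ℂ] PSF) (b : Fin 2) (g : PSF)

theorem opA_mono : opA T (mono (p := p + 1) (q := 0) (r := r + 1) b g) = mono b (T 0 b g) := by
  funext I J B
  simp only [opA, mono, forall_snoc]
  rw [Finset.sum_eq_single 0 (fun j _ hj => by simp [hj]) (by simp),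
    Finset.sum_eq_single b (fun c _ hc => by simp [hc]) (by simp)]
  simp only [and_true, apply_ite (T 0 b), map_zero]

theorem opB_mono : opB T (mono (p := p + 1) (q := 0) (r := r) b g) (fun _ => 0) ![] (fun _ => b) =
    (r + 1 : ℂ) • lowerOp T 0 b g := by
  simp only [opB, mono, forall_snoc]
  rw [Finset.sum_comm, Finset.sum_eq_single 0 (fun j _ hj => by simp [hj]) (by simp)]
  simp [removeNth, ← Nat.cast_smul_eq_nsmul ℂ]

theorem opC_mono : opC T (mono (p := 0) (q := q) (r := r + 1) b g) ![] (fun _ => 0) (fun _ => b) =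
    (q + 1 : ℂ) • T 0 b g := by
  simp only [opC, mono, forall_snoc]
  rw [Finset.sum_comm, Finset.sum_eq_single b (fun j _ hj => by simp [hj]) (by simp)]
  simp [removeNth, ← Nat.cast_smul_eq_nsmul ℂ]

theorem opD_mono : opD T (mono (p := 0) (q := q) (r := r) b g) ![] (fun _ => 0) (fun _ => b) =
    ((q + 1) * (r + 1) : ℂ) • lowerOp T 0 b g := by
  simp only [opD, mono]
  simp [removeNth, ← Nat.cast_smul_eq_nsmul ℂ, mul_smul]

end first_order

theorem nabla2A_mono (g : PSF) : nabla2A (mono (p := p + 2) (q := 0) (r := 0) 0 g) =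
    mono 0 (D 0 1 (D 0 0 g) - D 0 0 (D 0 1 g)) := by
  funext I J B
  simp only [nabla2A, mono, forall_snoc]
  rw [Finset.sum_eq_single 0 (fun j _ hj => by simp [hj]) (by simp),
    Finset.sum_eq_single 0 (fun j _ hj => by simp [hj]) (by simp)]
  simp [Fin.sum_univ_two, epsLow]
  split_ifs
  · abel
  · simp

theorem nabla2C_mono (g : PSF) : nabla2C (mono (p := 0) (q := q) (r := 0) 0 g) ![] (fun _ => 0) ![] =
    ((q + 2) * (q + 1) : ℂ) • (D 0 1 (D 0 0 g) - D 0 0 (D 0 1 g)) := by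
  simp only [nabla2C, mono]
  simp [removeNth, ← Nat.cast_smul_eq_nsmul ℂ, mul_smul, epsLow]
  module

theorem nabla3A_mono (g : PSF) : nabla3A (mono (p := 0) (q := 0) (r := r + 3) 0 g) =
    mono 0 ((6 : ℂ) • N 0 g) := by
  funext I J B
  rw [nabla3A_eq]
  simp only [mono, forall_snoc]
  simp [Fin.sum_univ_two, apply_ite (W 0 0 0), W_symm]

theorem nabla3B_mono (g : PSF) : nabla3B (mono (p := 0) (q := 0) (r := r) 1 g) ![] ![] (fun _ => 1) =
    (6 * ((r + 3) * (r + 2) * (r + 1)) : ℂ) • N 0 g := by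
  have e : Wlow 1 1 1 g = (6 : ℂ) • N 0 g := by
    rw [← (W_symm g).1]
    simp [W, Wlow, triple_expand, Dlow_eq, lowerOp_apply, epsLow, Fin.sum_univ_two]
  rw [nabla3B_eq]
  simp only [mono]
  simp [removeNth, ← Nat.cast_smul_eq_nsmul ℂ, e]
  module

/-- The function `θ_{11} θ_{12}` is not annihilated by the second-order operators. -/
theorem D_theta_theta : D 0 1 (D 0 0 (theta 0 0 * theta 0 1)) - D 0 0 (D 0 1 (theta 0 0 * theta 0 1)) =
    (2 : ℂ) • 1 := by
  simp [D_theta_mul, D_theta, two_smul]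

/-- The function `θ_{11} θ_{21} θ_{31}` is not annihilated by the third-order operators. -/
theorem N_theta : N 0 (theta 0 0 * (theta 1 0 * theta 2 0)) = -1 := by
  simp [N_zero, D_theta_mul, D_theta]

theorem opA2_mono (Y : Fin 3 → Fin 2 → Fin 2 → PSF →ₗ[ℂ] PSF) (g : PSF) :
    opA2 Y (mono 0 g) ![] ![0] ![] = Y 0 0 0 g := by
  simp [opA2, mono, Fin.sum_univ_two, Fin.forall_fin_two]

theorem opA1_mono (Y : Fin 3 → Fin 2 → Fin 2 → PSF →ₗ[ℂ] PSF) (g : PSF) :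
    opA1 Y (mono 0 g) ![] ![] ![1, 1] = (2 : ℂ) • Y 0 0 0 g := by
  simp [opA1, mono, Fin.sum_univ_two, Fin.sum_univ_three, epsLow, two_smul]

theorem opA01_mono (Y : Fin 2 → Fin 2 → PSF →ₗ[ℂ] PSF) (g : PSF) :
    opA01 Y (mono 0 g) ![] ![] ![0] = -Y 0 1 g ∧ opA01 Y (mono 0 g) ![] ![] ![1] = Y 0 0 g := by
  simp [opA01, mono, Fin.sum_univ_two, epsLow]

theorem Y4_theta : Y4 0 0 0 (theta 0 1 * (theta 0 0 * (theta 1 0 * theta 2 0))) = (8 : ℂ) • 1 := by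
  simp [Y4_apply, W, triple_expand, Dlow_eq, lowerOp_apply, Fin.sum_univ_two, epsLow, D_theta_mul, D_theta,
    ← two_smul ℂ]
  module

theorem Y42_theta : Y42 0 0 0 (theta 0 1 * (theta 0 0 * (theta 1 0 * theta 2 0))) = -(2 : ℂ) • 1 := by
  simp [Y42_apply, N_zero, D_theta_mul, D_theta]

theorem Y41_theta : Y41 0 0 0 (theta 0 1 * (theta 0 0 * (theta 1 0 * theta 2 0))) = (2 : ℂ) • 1 := by
  simp [Y41_apply, N_zero, D_theta_mul, D_theta]

theorem Y6_theta : Y6 0 1 (theta 0 1 * (theta 1 1 * (theta 2 1 *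
    (theta 0 0 * (theta 1 0 * theta 2 0))))) = -1 := by
  simp [Y6_apply, N_zero, N_three, D_theta_mul, D_theta]

theorem N_one_N_one (f : PSF) : N 1 (N 1 f) = -(4 : ℂ) • E 1 (N 0 f) := by
  simp only [N_zero, N_one, E_apply, map_add, map_sub, map_neg, map_zero,
    map_smul, normal_order, dU_D, neg_zero]
  module

theorem E_zero_N_one (f : PSF) : E 0 (N 1 f) = -N 1 (E 0 f) := by
  simp only [N_one, map_add, E_D, map_neg]
  module

/-- Single components of `W^{abc}` in terms of `N` and `E`. -/
theorem W_eq (f : PSF) : W 0 0 1 f = (2 : ℂ) • N 1 f + (4 : ℂ) • E 0 f ∧ W 0 1 0 f = (2 : ℂ) • N 1 f ∧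
    W 0 1 1 f = (2 : ℂ) • N 2 f + (4 : ℂ) • E 1 f := by
  refine ⟨?_, ?_, ?_⟩ <;>
  simp only [W, triple_expand, N_one, N_two, E_apply, map_add, map_sub, map_neg, map_zero,
    map_smul, normal_order, dU_D, neg_zero] <;> module

/-- The component of `∇_6` that is used to see that the operator does not vanish. -/
theorem K_zero_zero (f : PSF) : K 0 0 f = (80 : ℂ) • E 1 (N 0 f) := by
  simp only [K_apply, W_symm, W_eq, map_add, map_smul, N_one_N_one, N_N, E_zero_N_one, E_N]
  module

/-- A function that is not annihilated by `∇_6`, in view of `K_zero_zero`. -/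
theorem E_N_theta : E 1 (N 0 (u 0 * (theta 0 1 * (theta 0 0 * (theta 1 0 * theta 2 0))))) = 1 := by
  have h1 : ∀ i, D i 0 (u 0) = ∑ j, eps3 i j 0 • theta j 1 := fun i => by
    rw [D_u]; simp only [thetaUp_zero]
  simp only [N_zero, D_mul (f := u 0), h1, Fin.sum_univ_three, eps3_val, D_theta_mul, D_theta]
  simp [D_mul, E_apply, D_theta_mul, D_theta, dU_theta_mul, dU_u_mul, h1, Fin.sum_univ_three, eps3_val]

end nonzero

/-! ### Invariance of the first-order operators, and their weights -/

namespace VField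

/-- The coefficients `P_{ia}` and `Q̃^i` of an odd element of `vle(3|6)` of degree one. They solve the
equation `D^{ia} Q̃^k = -2 ε^{ijk} ε^{ab} P_{jb}` of `isVLE_of_D_Qt`, with `∂_i Q̃^i = 2 θ_{11}`. -/
def oddPt : (Fin 3 → Fin 2 → PSF) × (Fin 3 → PSF) :=
  (![![0, (2 : ℂ) • (theta 0 0 * theta 0 1)],
     ![-(2 : ℂ) • (theta 0 0 * theta 1 0), -(2 : ℂ) • (theta 0 1 * theta 1 0)],
     ![0, theta 0 0 * theta 2 1 - theta 0 1 * theta 2 0 + u 1]],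
   ![(2 : ℂ) • (theta 0 0 * (theta 1 0 * theta 2 1) - theta 0 1 * (theta 1 0 * theta 2 0) -
      u 1 * theta 1 0),
     (2 : ℂ) • (u 1 * theta 0 0 - theta 0 0 * (theta 0 1 * theta 2 0)),
     (4 : ℂ) • (theta 0 0 * (theta 0 1 * theta 1 0))])

/-- The vector field with the coefficients `oddPt`. Its `Q^i` are recovered from the `Q̃^i`. -/
def odd : VField where
  P := oddPt.1
  Q i := oddPt.2 i + ∑ j, ∑ k, ∑ a, eps3 j k i • (oddPt.1 j a * thetaUp k a)

theorem Qt_odd : odd.Qt = oddPt.2 := by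
  funext i
  simp [Qt, odd]

theorem isHomog_odd : odd.IsHomog (-1) := by
  have hP : ∀ i a, parity (oddPt.1 i a) = oddPt.1 i a := by
    intro i a
    fin_cases i <;> fin_cases a <;> simp [oddPt]
  have hQ : ∀ i, parity (oddPt.2 i) = -oddPt.2 i := by
    intro i
    fin_cases i <;> simp [oddPt] <;> module
  refine ⟨fun i => ?_, fun i a => ?_⟩
  · simp only [odd, map_add, hQ, map_sum, map_smul, parity_mul, hP, parity_thetaUp, mul_neg, smul_neg,
      Finset.sum_neg_distrib, Units.val_neg, Units.val_one, neg_smul, one_smul, neg_add]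
  · simp [odd, hP]

theorem isVLE_odd : odd.IsVLE (-1) := by
  refine isVLE_of_D_Qt isHomog_odd fun i k a => ?_
  have h1 : ∀ i a, D i a (u 1) = ∑ j, eps3 i j 1 • thetaUp j a := fun i a => D_u _ _ _
  have c1 := theta_mul_theta (C := Poly) 2 1 1 0
  have c2 := theta_mul_theta (C := Poly) 2 1 0 0
  have c3 := theta_mul_theta (C := Poly) 2 0 1 0
  have c4 := theta_mul_theta (C := Poly) 2 0 0 0
  have c5 := theta_mul_theta (C := Poly) 0 0 1 0
  rw [Qt_odd]
  fin_cases i <;> fin_cases k <;> fin_cases a <;>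
  simp [oddPt, odd, D_theta_mul, D_mul (f := u 1), h1, D_theta, Fin.sum_univ_three, Fin.sum_univ_two,
    eps3_val, epsUp, thetaUp_zero, thetaUp_one, -zsmul_eq_mul] <;>
  first
    | module
    | linear_combination (norm := module) (2 : ℂ) • c1
    | linear_combination (norm := module) (-1 : ℂ) • c2
    | linear_combination (norm := module) (-2 : ℂ) • c3
    | linear_combination (norm := module) (2 : ℂ) • c4
    | linear_combination (norm := module) (2 : ℂ) • c5
    | exact theta_sq _ _

theorem dv_odd : odd.dv = (2 : ℂ) • theta 0 0 := by
  simp only [dv, Qt_odd, Fin.sum_univ_three]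
  simp [oddPt, dU_theta_mul, dU_u_mul]

/-- Invariance under `vle(3|6)` is stronger than invariance under the Euler field: the derivative
`D^{ia} ∂_j Q̃^j`, which measures the defect of invariance of a first-order operator, need not
vanish. -/
theorem exists_rho_eq_one : ∃ X : VField, X.IsVLE (-1) ∧ X.rho 0 0 = 1 := by
  refine ⟨odd, isVLE_odd, ?_⟩
  rw [rho, dv_odd, map_smul, D_theta, smul_smul]
  simp

end VField

open VField

section weights

variable {p q r : ℕ}

theorem isMorphism_nabla1A (p r : ℕ) :
    IsMorphism IsVLE 1 (OmegaA (p + 1) (r + 1)) (OmegaA p r) nabla1A where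
  dOperator := nabla1A_dOperator
  mapsTo _ hω := nabla1A_mem hω
  ne_zero := ⟨mono 0 (theta 0 0), mono_mem_lower _ _ _, fun h => by
    have h := congrFun (congrFun (congrFun h fun _ => 0) fun _ => 0) fun _ => 0
    have e := congrFun (congrFun (congrFun (opA_mono (p := p) (r := r) D 0 (theta 0 0)) fun _ => 0)
      fun _ => 0) fun _ => 0
    rw [mono_const, D_theta] at e
    simpa using e.symm.trans h⟩
  invariant σ X hX ω hω := by
    rw [pow_one]
    exact lie_nabla1A hX (by push_cast; ring) (Or.inl (by push_cast; ring)) hω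

theorem isMorphism_nabla1B (p r : ℕ) :
    IsMorphism IsVLE 1 (OmegaB (p + 1) r) (OmegaB p (r + 1)) nabla1B where
  dOperator := nabla1B_dOperator
  mapsTo _ hω := nabla1B_mem hω
  ne_zero := ⟨mono 0 (theta 0 1), mono_mem_lower _ _ _, fun h => by
    have h := congrFun (congrFun (congrFun h fun _ => 0) ![]) fun _ => 0
    have e := opB_mono (p := p) (r := r) D 0 (theta 0 1)
    have e' := (e.symm.trans h).symm
    simp [lowerOp_apply, Fin.sum_univ_two, epsLow, D_theta] at e'
    exact absurd e' (by norm_cast)⟩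
  invariant σ X hX ω hω := by
    rw [pow_one]
    exact lie_nabla1B hX (by push_cast; ring) (Or.inl (by push_cast; ring)) hω

theorem isMorphism_nabla1C (q r : ℕ) :
    IsMorphism IsVLE 1 (OmegaC q (r + 1)) (OmegaC (q + 1) r) nabla1C where
  dOperator := nabla1C_dOperator
  mapsTo _ hω := nabla1C_mem hω
  ne_zero := ⟨mono 0 (theta 0 0), mono_mem_upper _ _ _, fun h => by
    have h := congrFun (congrFun (congrFun h ![]) fun _ => 0) fun _ => 0
    have e := opC_mono (q := q) (r := r) D 0 (theta 0 0)
    have e' := (e.symm.trans h).symm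
    simp only [D_theta, and_self, if_true] at e'
    exact smul_ne_zero (Nat.cast_add_one_ne_zero q) one_ne_zero e'.symm⟩
  invariant σ X hX ω hω := by
    rw [pow_one]
    exact lie_nabla1C hX (by push_cast; ring) (Or.inl (by push_cast; ring)) hω

theorem isMorphism_nabla1D (q r : ℕ) :
    IsMorphism IsVLE 1 (OmegaD q r) (OmegaD (q + 1) (r + 1)) nabla1D where
  dOperator := nabla1D_dOperator
  mapsTo _ hω := nabla1D_mem hω
  ne_zero := ⟨mono 0 (theta 0 1), mono_mem_upper _ _ _, fun h => by
    have h := congrFun (congrFun (congrFun h ![]) fun _ => 0) fun _ => 0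
    have e := opD_mono (q := q) (r := r) D 0 (theta 0 1)
    have e' := (e.symm.trans h).symm
    simp [lowerOp_apply, Fin.sum_univ_two, epsLow, D_theta] at e'
    exact absurd e' (by norm_cast)⟩
  invariant σ X hX ω hω := by
    rw [pow_one]
    exact lie_nabla1D hX (by push_cast; ring) (Or.inl (by push_cast; ring)) hω

theorem isG0_euler : euler.IsG0 1 := ⟨isVLE_euler, fun _ => rfl⟩

theorem eq_of_smul_eq {V : Type*} [AddCommGroup V] [Module ℂ V] {σ : ℤˣ} {a b c : V}
    (e : ((σ ^ 1 : ℤˣ) : ℤ) • a = (σ : ℤ) • a + b - c) : b = c := by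
  rw [pow_one, add_sub_assoc, left_eq_add, sub_eq_zero] at e
  exact e

/-- The Euler field, which acts by the degree, determines the difference of the weights. -/
theorem weight_of_euler {p q r : ℕ} {F : Comp p q r} (hF : F ≠ 0) {z z' : ℤ}
    (h : (((z' - z - 1 : ℤ) : ℂ) / 6) • (fun I J B => euler.dv * F I J B) = 0) : z' = z + 1 := by
  have e : (fun I J B => euler.dv * F I J B) = (6 : ℂ) • F := by
    funext I J B
    simp [dv_euler]
  rw [e, smul_smul, div_mul_cancel₀ _ (by norm_num)] at h
  have := (smul_eq_zero.mp h).resolve_right hF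
  rw [Int.cast_eq_zero] at this
  omega

/-- The compatibility of the weights with a field that is not in `𝔤₀`, in the shape in which the
defect of invariance of a first-order operator produces it. -/
theorem weight_of_defect {V : Type*} [AddCommGroup V] [Module ℂ V] {σ : ℤˣ} {z z' z₀ : ℤ}
    {a b F G : V} (hz' : z' = z + 1) (h1 : a = ((σ ^ 1 : ℤˣ) : ℤ) • b)
    (h2 : a = (σ : ℤ) • b + (((z' - z - 1 : ℤ) : ℂ) / 6) • G -
      (σ : ℤ) • (((z - z₀ : ℤ) : ℂ) / 3) • F) (hF : F ≠ 0) : z = z₀ := by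
  have h := eq_of_smul_eq (h1.symm.trans h2)
  rw [hz', show z + 1 - z - 1 = 0 by ring, Int.cast_zero, zero_div, zero_smul] at h
  have h3 : (((z - z₀ : ℤ) : ℂ) / 3) • F = 0 := by
    rcases Int.units_eq_one_or σ with rfl | rfl
    · simpa using h.symm
    · simpa using h.symm
  have := (smul_eq_zero.mp h3).resolve_right hF
  rw [div_eq_zero_iff, Int.cast_eq_zero] at this
  have := this.resolve_right (by norm_num)
  omega

theorem opA_mono_ne_zero {X : VField} (hX : X.rho 0 0 = 1) :
    opA (rhoOp X) (mono (p := p + 1) (q := 0) (r := r + 1) 0 1) ≠ 0 := fun h0 => by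
  have h0 := congrFun (congrFun (congrFun h0 fun _ => 0) fun _ => 0) fun _ => 0
  rw [opA_mono, mono_const, rhoOp_apply, hX, mul_one] at h0
  exact one_ne_zero h0

theorem weights_nabla1A {p r : ℕ} {z z' : ℤ}
    (h : IsMorphism IsVLE 1 ⟨p + 1, 0, r + 1, z⟩ ⟨p, 0, r, z'⟩ nabla1A) :
    z = (OmegaA (p + 1) (r + 1)).z ∧ z' = (OmegaA p r).z := by
  have h1 : z' = z + 1 := by
    obtain ⟨ω, hω, hn⟩ := h.ne_zero
    refine weight_of_euler hn ((eq_of_smul_eq ((h.invariant 1 euler isVLE_euler ω hω).symm.trans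
      (lie_opA isVLE_euler z z' hω))).trans ?_)
    rw [rhoOp_eq_zero isG0_euler, opA_zero, smul_zero, smul_zero]
  have h2 : z = 2 * (p + 1) - 3 * (r + 1) := by
    obtain ⟨X, hX, hρ⟩ := exists_rho_eq_one
    have hω := mono_mem_lower (p := p + 1) (r := r + 1) 0 1 z
    exact weight_of_defect h1 (h.invariant _ X hX _ hω) (lie_opA hX z z' hω)
      (opA_mono_ne_zero hρ)
  refine ⟨?_, ?_⟩ <;> push_cast <;> linarith

theorem lowerOp_rhoOp {X : VField} (hX : X.rho 0 0 = 1) : lowerOp (rhoOp X) 0 1 1 = 1 := by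
  simp [lowerOp_apply, hX, Fin.sum_univ_two, epsLow]

theorem opB_mono_ne_zero {X : VField} (hX : X.rho 0 0 = 1) :
    opB (rhoOp X) (mono (p := p + 1) (q := 0) (r := r) 1 1) ≠ 0 := fun h0 => by
  have h0 := congrFun (congrFun (congrFun h0 fun _ => 0) ![]) fun _ => 1
  rw [opB_mono, lowerOp_rhoOp hX] at h0
  exact smul_ne_zero (Nat.cast_add_one_ne_zero r) one_ne_zero h0

theorem weights_nabla1B {p r : ℕ} {z z' : ℤ}
    (h : IsMorphism IsVLE 1 ⟨p + 1, 0, r, z⟩ ⟨p, 0, r + 1, z'⟩ nabla1B) :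
    z = (OmegaB (p + 1) r).z ∧ z' = (OmegaB p (r + 1)).z := by
  have h1 : z' = z + 1 := by
    obtain ⟨ω, hω, hn⟩ := h.ne_zero
    refine weight_of_euler hn ((eq_of_smul_eq ((h.invariant 1 euler isVLE_euler ω hω).symm.trans
      (lie_opB isVLE_euler z z' hω))).trans ?_)
    rw [rhoOp_eq_zero isG0_euler, opB_zero, smul_zero, smul_zero]
  have h2 : z = 2 * (p + 1) + 3 * r + 6 := by
    obtain ⟨X, hX, hρ⟩ := exists_rho_eq_one
    have hω := mono_mem_lower (p := p + 1) (r := r) 1 1 z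
    exact weight_of_defect h1 (h.invariant _ X hX _ hω) (lie_opB hX z z' hω)
      (opB_mono_ne_zero hρ)
  refine ⟨?_, ?_⟩ <;> push_cast <;> linarith

theorem opC_mono_ne_zero {X : VField} (hX : X.rho 0 0 = 1) :
    opC (rhoOp X) (mono (p := 0) (q := q) (r := r + 1) 0 1) ≠ 0 := fun h0 => by
  have h0 := congrFun (congrFun (congrFun h0 ![]) fun _ => 0) fun _ => 0
  rw [opC_mono, rhoOp_apply, hX, mul_one] at h0
  exact smul_ne_zero (Nat.cast_add_one_ne_zero q) one_ne_zero h0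

theorem weights_nabla1C {q r : ℕ} {z z' : ℤ}
    (h : IsMorphism IsVLE 1 ⟨0, q, r + 1, z⟩ ⟨0, q + 1, r, z'⟩ nabla1C) :
    z = (OmegaC q (r + 1)).z ∧ z' = (OmegaC (q + 1) r).z := by
  have h1 : z' = z + 1 := by
    obtain ⟨ω, hω, hn⟩ := h.ne_zero
    refine weight_of_euler hn ((eq_of_smul_eq ((h.invariant 1 euler isVLE_euler ω hω).symm.trans
      (lie_opC isVLE_euler z z' hω))).trans ?_)
    rw [rhoOp_eq_zero isG0_euler, opC_zero, smul_zero, smul_zero]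
  have h2 : z = -2 * q - 3 * (r + 1) - 6 := by
    obtain ⟨X, hX, hρ⟩ := exists_rho_eq_one
    have hω := mono_mem_upper (q := q) (r := r + 1) 0 1 z
    exact weight_of_defect h1 (h.invariant _ X hX _ hω) (lie_opC hX z z' hω)
      (opC_mono_ne_zero hρ)
  refine ⟨?_, ?_⟩ <;> push_cast <;> linarith

theorem opD_mono_ne_zero {X : VField} (hX : X.rho 0 0 = 1) :
    opD (rhoOp X) (mono (p := 0) (q := q) (r := r) 1 1) ≠ 0 := fun h0 => by
  have h0 := congrFun (congrFun (congrFun h0 ![]) fun _ => 0) fun _ => 1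
  rw [opD_mono, lowerOp_rhoOp hX] at h0
  exact smul_ne_zero (mul_ne_zero (Nat.cast_add_one_ne_zero q) (Nat.cast_add_one_ne_zero r))
    one_ne_zero h0

theorem weights_nabla1D {q r : ℕ} {z z' : ℤ}
    (h : IsMorphism IsVLE 1 ⟨0, q, r, z⟩ ⟨0, q + 1, r + 1, z'⟩ nabla1D) :
    z = (OmegaD q r).z ∧ z' = (OmegaD (q + 1) (r + 1)).z := by
  have h1 : z' = z + 1 := by
    obtain ⟨ω, hω, hn⟩ := h.ne_zero
    refine weight_of_euler hn ((eq_of_smul_eq ((h.invariant 1 euler isVLE_euler ω hω).symm.trans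
      (lie_opD isVLE_euler z z' hω))).trans ?_)
    rw [rhoOp_eq_zero isG0_euler, opD_zero, smul_zero, smul_zero]
  have h2 : z = -2 * q + 3 * r := by
    obtain ⟨X, hX, hρ⟩ := exists_rho_eq_one
    have hω := mono_mem_upper (q := q) (r := r) 1 1 z
    exact weight_of_defect h1 (h.invariant _ X hX _ hω) (lie_opD hX z z' hω)
      (opD_mono_ne_zero hρ)
  refine ⟨?_, ?_⟩ <;> push_cast <;> linarith

end weights

/-! ### Invariance of the operators of higher order under `𝔤₀` -/

theorem comp_ne_zero {p q r : ℕ} {F : Comp p q r} {I : Fin p → Fin 3} {J : Fin q → Fin 3}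
    {B : Fin r → Fin 2} {g : PSF} (h : F I J B = g) (hg : g ≠ 0) : F ≠ 0 := fun h0 =>
  hg (h.symm.trans (by rw [h0]; rfl))

theorem smul_one_ne_zero {c : ℂ} (hc : c ≠ 0) : c • (1 : PSF) ≠ 0 := smul_ne_zero hc one_ne_zero

theorem isMorphism_nabla2A (p : ℕ) :
    IsMorphism IsG0 2 (OmegaA (p + 2) 0) (OmegaB p 0) nabla2A where
  dOperator := nabla2A_dOperator
  mapsTo _ hω := nabla2A_mem hω
  ne_zero := ⟨mono 0 (theta 0 0 * theta 0 1), mono_mem_lower _ _ _, comp_ne_zero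
    (congrFun (congrFun (congrFun (nabla2A_mono _) fun _ => 0) fun _ => 0) fun _ => 0)
    (by rw [mono_const, D_theta_theta]; exact smul_one_ne_zero two_ne_zero)⟩
  invariant _ _ hX _ hω := lie_nabla2A_of_isG0 hX (by push_cast; ring) hω

theorem isMorphism_nabla2C (q : ℕ) :
    IsMorphism IsG0 2 (OmegaC q 0) (OmegaD (q + 2) 0) nabla2C where
  dOperator := nabla2C_dOperator
  mapsTo _ hω := nabla2C_mem hω
  ne_zero := ⟨mono 0 (theta 0 0 * theta 0 1), mono_mem_upper _ _ _, comp_ne_zero (nabla2C_mono _) (by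
    rw [D_theta_theta]
    exact smul_ne_zero (mul_ne_zero (by exact_mod_cast (q + 1).succ_ne_zero)
      (Nat.cast_add_one_ne_zero q)) (smul_one_ne_zero two_ne_zero))⟩
  invariant _ _ hX _ hω := lie_nabla2C_of_isG0 hX (by push_cast; ring) hω

theorem isMorphism_nabla3A (r : ℕ) :
    IsMorphism IsG0 3 (OmegaA 0 (r + 3)) (OmegaC 0 r) nabla3A where
  dOperator := nabla3A_dOperator
  mapsTo _ hω := nabla3A_mem hω
  ne_zero := ⟨mono 0 (theta 0 0 * (theta 1 0 * theta 2 0)), mono_mem_lower _ _ _, comp_ne_zero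
    (congrFun (congrFun (congrFun (nabla3A_mono _) fun _ => 0) fun _ => 0) fun _ => 0)
    (by
      rw [mono_const, N_theta]
      exact smul_ne_zero (by norm_num) (neg_ne_zero.mpr one_ne_zero))⟩
  invariant := invariant_of_even nabla3A_dOperator fun _ _ _ _ h ω _ =>
    lie_nabla3A_even h (by push_cast; ring) ω

theorem isMorphism_nabla3B (r : ℕ) :
    IsMorphism IsG0 3 (OmegaB 0 r) (OmegaD 0 (r + 3)) nabla3B where
  dOperator := nabla3B_dOperator
  mapsTo _ hω := nabla3B_mem hω
  ne_zero := ⟨mono 1 (theta 0 0 * (theta 1 0 * theta 2 0)), mono_mem_lower _ _ _, comp_ne_zero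
    (nabla3B_mono _) (by
      rw [N_theta]
      refine smul_ne_zero (mul_ne_zero (by norm_num) (mul_ne_zero (mul_ne_zero ?_ ?_) ?_))
        (neg_ne_zero.mpr one_ne_zero)
      · exact_mod_cast (r + 2).succ_ne_zero
      · exact_mod_cast (r + 1).succ_ne_zero
      · exact Nat.cast_add_one_ne_zero r)⟩
  invariant := invariant_of_even nabla3B_dOperator fun _ _ _ _ h ω _ =>
    lie_nabla3B_even h (by push_cast; ring) ω

/-- A covariant family of order four defines an invariant operator `Ω_A(0,2) → Ω_D(1,0)`. It is
nonzero if the component `Y^{1|11}` takes a nonzero constant value. -/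
theorem isMorphism_opA2 {Y : Fin 3 → Fin 2 → Fin 2 → PSF →ₗ[ℂ] PSF} (hY : IsCovariant4 Y)
    (hD : IsDOperator 4 (opA2 Y)) {g : PSF} {c : ℂ} (hc : c ≠ 0) (hg : Y 0 0 0 g = c • 1) :
    IsMorphism IsG0 4 (OmegaA 0 2) (OmegaD 1 0) (opA2 Y) where
  dOperator := hD
  mapsTo ω _ := opA2_mem Y _ ω
  ne_zero := ⟨mono 0 g, mono_mem_lower _ _ _, comp_ne_zero (opA2_mono Y g)
    (by rw [hg]; exact smul_one_ne_zero hc)⟩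
  invariant := invariant_of_even hD fun _ _ _ _ h ω _ => lie_opA2_even hY h (by norm_num) ω

/-- A covariant family of order four defines an invariant operator `Ω_A(1,0) → Ω_D(0,2)`. It is
nonzero if the component `Y^{1|11}` takes a nonzero constant value. -/
theorem isMorphism_opA1 {Y : Fin 3 → Fin 2 → Fin 2 → PSF →ₗ[ℂ] PSF} (hY : IsCovariant4 Y)
    (hD : IsDOperator 4 (opA1 Y)) {g : PSF} {c : ℂ} (hc : c ≠ 0) (hg : Y 0 0 0 g = c • 1) :
    IsMorphism IsG0 4 (OmegaA 1 0) (OmegaD 0 2) (opA1 Y) where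
  dOperator := hD
  mapsTo ω _ := opA1_mem Y _ ω
  ne_zero := ⟨mono 0 g, mono_mem_lower _ _ _, comp_ne_zero (opA1_mono Y g)
    (by rw [hg]; exact smul_ne_zero two_ne_zero (smul_one_ne_zero hc))⟩
  invariant := invariant_of_even hD fun _ _ _ _ h ω _ => lie_opA1_even hY h (by norm_num) ω

theorem isMorphism_nabla4A2 : IsMorphism IsG0 4 (OmegaA 0 2) (OmegaD 1 0) nabla4A2 := by
  have h := nabla4A2_dOperator
  rw [nabla4A2_eq] at h ⊢
  exact isMorphism_opA2 isCovariant4_Y4 h (by norm_num) Y4_theta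

theorem isMorphism_nabla4A1 : IsMorphism IsG0 4 (OmegaA 1 0) (OmegaD 0 2) nabla4A1 := by
  have h := nabla4A1_dOperator
  rw [nabla4A1_eq] at h ⊢
  exact isMorphism_opA1 isCovariant4_Y4 h (by norm_num) Y4_theta

theorem IsCovariant6.symm {Y : Fin 2 → Fin 2 → PSF →ₗ[ℂ] PSF} (hY : IsCovariant6 Y) :
    IsCovariant6 fun a d => Y a d + Y d a := by
  intro X A S w h a b f
  simp only [LinearMap.add_apply, map_add, hY X A S w h]
  module

theorem isMorphism_nabla6 : IsMorphism IsG0 6 (OmegaA 0 1) (OmegaD 0 1) nabla6 := by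
  have hD := nabla6_dOperator
  rw [nabla6_eq] at hD ⊢
  refine ⟨hD, fun ω _ => opA01_mem _ _ ω, ?_,
    invariant_of_even hD fun _ _ _ _ h ω _ => lie_opA01_even isCovariant6_K.symm h (by norm_num) ω⟩
  refine ⟨mono 0 (u 0 * (theta 0 1 * (theta 0 0 * (theta 1 0 * theta 2 0)))), mono_mem_lower _ _ _,
    comp_ne_zero (opA01_mono _ _).2 ?_⟩
  rw [LinearMap.add_apply, K_zero_zero, E_N_theta, ← add_smul]
  exact smul_one_ne_zero (by norm_num)

theorem isMorphism_opA01 : IsMorphism IsG0 6 (OmegaA 0 1) (OmegaD 0 1) (opA01 Y6) where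
  dOperator := opA01_dOperator
  mapsTo ω _ := opA01_mem _ _ ω
  ne_zero := ⟨mono 0 (theta 0 1 * (theta 1 1 * (theta 2 1 *
    (theta 0 0 * (theta 1 0 * theta 2 0))))), mono_mem_lower _ _ _, comp_ne_zero (opA01_mono _ _).1 (by
      rw [Y6_theta, neg_neg]; exact one_ne_zero)⟩
  invariant := invariant_of_even opA01_dOperator fun _ _ _ _ h ω _ =>
    lie_opA01_even isCovariant6_Y6 h (by norm_num) ω

/-! ### Reducibility -/

section reducible

variable {k : ℕ} {τ τ' : Label} {f : Comp τ.p τ.q τ.r → Comp τ'.p τ'.q τ'.r}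

theorem lie_zero (τ : Label) (σ : ℤˣ) (X : VField) : lie τ σ X 0 = 0 := by
  funext I J B
  simp [lie]

theorem parity_mem (τ : Label) {ω : Comp τ.p τ.q τ.r} (hω : ω ∈ T τ) :
    (fun I J B => parity (ω I J B)) ∈ T τ := by
  obtain ⟨h1, h2, h3, h4⟩ := hω
  exact ⟨fun π I J B => congrArg parity (h1 π I J B), fun π I J B => congrArg parity (h2 π I J B),
    fun π I J B => congrArg parity (h3 π I J B), fun k k' I J B => by rw [← map_sum, h4, map_zero]⟩

/-- The kernel of an invariant operator is an invariant subspace. -/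
theorem isReducible_of_ker (hf : IsDOperator k f)
    (hinv : ∀ σ X, IsVLE σ X → ∀ ω ∈ T τ, f ω = 0 → f (lie τ σ X ω) = 0)
    (hn : ∃ ω ∈ T τ, f ω ≠ 0) (hz : ∃ ω ∈ T τ, ω ≠ 0 ∧ f ω = 0) : IsReducible τ := by
  obtain ⟨ω₁, h₁, h₁'⟩ := hn
  obtain ⟨ω₀, h₀, h₀', h₀''⟩ := hz
  refine ⟨T τ ⊓ LinearMap.ker hf.toLin, lt_of_le_of_ne inf_le_left fun e => h₁' ?_, fun e => h₀' ?_,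
    fun ω hω => ⟨parity_mem τ hω.1, ?_⟩, fun σ X hX ω hω => ⟨lie_mem τ σ X hω.1, ?_⟩⟩
  · rw [← e] at h₁
    exact h₁.2
  · have h : ω₀ ∈ T τ ⊓ LinearMap.ker hf.toLin := ⟨h₀, h₀''⟩
    rwa [e, Submodule.mem_bot] at h
  · have h := hf.parity ω
    rw [show f ω = 0 from hω.2] at h
    simp only [Pi.zero_apply, map_zero] at h
    have h' := congrArg (fun ω => (((-1) ^ k : ℤˣ) : ℤ) • ω) h
    simp only [smul_smul, Int.units_coe_mul_self, one_smul] at h'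
    exact h'.symm.trans (smul_zero _)
  · exact hinv σ X hX ω hω.1 hω.2

/-- The image of an invariant operator that is followed by a nonzero operator in a complex is an
invariant subspace. -/
theorem isReducible_of_complex {k' : ℕ} {τ'' : Label} {g : Comp τ'.p τ'.q τ'.r → Comp τ''.p τ''.q τ''.r}
    (hf : IsDOperator k f) (hm : ∀ ω ∈ T τ, f ω ∈ T τ') (hn : ∃ ω ∈ T τ, f ω ≠ 0)
    (hinv : ∀ σ X, IsVLE σ X → ∀ ω ∈ T τ, lie τ' σ X (f ω) = ((σ ^ k : ℤˣ) : ℤ) • f (lie τ σ X ω))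
    (hg : IsDOperator k' g) (hgn : ∃ ω ∈ T τ', g ω ≠ 0) (hgf : IsComplex τ τ' τ'' f g) :
    IsReducible τ' := by
  obtain ⟨ω₀, h₀, h₀'⟩ := hn
  obtain ⟨ω₁, h₁, h₁'⟩ := hgn
  have mem : ∀ ω ∈ T τ, f ω ∈ (T τ).map hf.toLin := fun ω hω => ⟨ω, hω, rfl⟩
  refine ⟨(T τ).map hf.toLin, lt_of_le_of_ne ?_ fun e => h₁' ?_, fun e => h₀' ?_, ?_, ?_⟩
  · rintro _ ⟨ω, hω, rfl⟩
    exact hm ω hω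
  · rw [← e] at h₁
    obtain ⟨ω, hω, rfl⟩ := h₁
    exact hgf ω hω
  · have h := mem ω₀ h₀
    rwa [e, Submodule.mem_bot] at h
  · rintro _ ⟨ω, hω, rfl⟩
    rw [show (fun I J B => parity (hf.toLin ω I J B)) = _ from hf.parity ω]
    exact zsmul_mem (mem _ (parity_mem τ hω)) _
  · rintro σ X hX _ ⟨ω, hω, rfl⟩
    rw [show lie τ' σ X (hf.toLin ω) = _ from hinv σ X hX ω hω]
    exact zsmul_mem (mem _ (lie_mem τ σ X hω)) _

/-- The source of an invariant operator with a kernel is reducible. -/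
theorem IsMorphism.isReducible_source (hf : IsMorphism IsVLE k τ τ' f)
    (hz : ∃ ω ∈ T τ, ω ≠ 0 ∧ f ω = 0) : IsReducible τ := by
  refine isReducible_of_ker hf.dOperator (fun σ X hX ω hω h => ?_) hf.ne_zero hz
  have h' := hf.invariant σ X hX ω hω
  rw [h, lie_zero] at h'
  have h'' := congrArg (fun ω => ((σ ^ k : ℤˣ) : ℤ) • ω) h'
  simp only [smul_smul, Int.units_coe_mul_self, one_smul] at h''
  exact h''.symm.trans (smul_zero _)

/-- The target of an invariant operator is reducible if the next operator of a complex is nonzero. The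
latter need not be invariant under all of `vle(3|6)`. -/
theorem IsMorphism.isReducible_target {V : ℤˣ → VField → Prop} {k' : ℕ} {τ'' : Label}
    {g : Comp τ'.p τ'.q τ'.r → Comp τ''.p τ''.q τ''.r}
    (hf : IsMorphism IsVLE k τ τ' f) (hg : IsMorphism V k' τ' τ'' g) (hgf : IsComplex τ τ' τ'' f g) :
    IsReducible τ' :=
  isReducible_of_complex hf.dOperator hf.mapsTo hf.ne_zero hf.invariant hg.dOperator hg.ne_zero hgf

end reducible

theorem mono_one_ne_zero {p q r : ℕ} : (mono 0 1 : Comp p q r) ≠ 0 :=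
  comp_ne_zero (mono_const _ _) one_ne_zero

theorem dWord_one {k : ℕ} (w : Fin (k + 1) → Fin 3 × Fin 2) : dWord w 1 = 0 := by
  induction k with
  | zero => simp [dWord]
  | succ k ih => rw [← Fin.cons_self_tail w, dWord_cons, ih, map_zero]

/-- The operators of positive order annihilate the constants. -/
theorem IsDOperator.map_mono {k p q r p' q' r' : ℕ} {f : Comp p q r → Comp p' q' r'}
    (hf : IsDOperator (k + 1) f) : f (mono 0 1) = 0 := by
  obtain ⟨c, hc⟩ := hf
  funext I J B
  rw [hc]
  refine Finset.sum_eq_zero fun I' _ => Finset.sum_eq_zero fun J' _ => Finset.sum_eq_zero fun B' _ =>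
    Finset.sum_eq_zero fun w _ => ?_
  unfold mono
  split_ifs
  · rw [dWord_one, smul_zero]
  · rw [← dWordHom_apply, map_zero, smul_zero]

/-- The constants lie in the kernel of `∇_1`. -/
theorem isReducible_D (q r : ℕ) : IsReducible (OmegaD q r) :=
  (isMorphism_nabla1D q r).isReducible_source
    ⟨mono 0 1, mono_mem_upper _ _ _, mono_one_ne_zero, nabla1D_dOperator.map_mono⟩

/-- The invariant subspace is the kernel of `∇_1` if `r ≠ 0` and its image if `q ≠ 0`, `r = 0`. On
`Ω_C(0,0)`, where no `∇_1` starts or ends, it is the kernel of `∇_2`, which is invariant there by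
`lie_nabla2C_zero`. -/
theorem isReducible_C : ∀ q r, IsReducible (OmegaC q r)
  | q, r + 1 => (isMorphism_nabla1C q r).isReducible_source
      ⟨mono 0 1, mono_mem_upper _ _ _, mono_one_ne_zero, nabla1C_dOperator.map_mono⟩
  | q + 1, 0 => (isMorphism_nabla1C q 0).isReducible_target (isMorphism_nabla2C (q + 1))
      fun ω _ => nabla2C_nabla1C ω
  | 0, 0 => by
      refine isReducible_of_ker (τ := OmegaC 0 0) (τ' := OmegaD 2 0) (f := nabla2C)
        nabla2C_dOperator (fun σ X hX ω hω h => ?_)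
        (isMorphism_nabla2C 0).ne_zero
        ⟨mono 0 1, mono_mem_upper _ _ _, mono_one_ne_zero, nabla2C_dOperator.map_mono⟩
      have h' := lie_nabla2C_zero hX rfl hω
      rw [h] at h'
      exact h'.symm.trans (lie_zero _ σ X)

/-- The invariant subspace is the kernel of `∇_1` if `p ≠ 0` and its image if `p = 0`, `r ≠ 0`. On
`Ω_B(0,0)`, where no `∇_1` starts or ends, it is the image of `∇_2`, which is invariant there by
`lie_nabla2A_two`. -/
theorem isReducible_B : ∀ p r, IsReducible (OmegaB p r)
  | p + 1, r => (isMorphism_nabla1B p r).isReducible_source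
      ⟨mono 0 1, mono_mem_lower _ _ _, mono_one_ne_zero, nabla1B_dOperator.map_mono⟩
  | 0, r + 1 => (isMorphism_nabla1B 0 r).isReducible_target (isMorphism_nabla3B (r + 1))
      fun ω _ => nabla3B_nabla1B ω
  | 0, 0 => by
      have h := isMorphism_nabla2A 0
      refine isReducible_of_complex h.dOperator h.mapsTo h.ne_zero (fun σ X hX ω hω => ?_)
        (isMorphism_nabla3B 0).dOperator (isMorphism_nabla3B 0).ne_zero fun ω hω => nabla3B_nabla2A hω
      rw [show σ ^ 2 = 1 from Int.units_sq σ]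
      exact (lie_nabla2A_two hX rfl hω).trans (one_zsmul _).symm

/-- The invariant subspace is the kernel of `∇_1` if `p, r ≠ 0` and for `p = r = 0`, where
`Ω_A(0,0) = Ω_D(0,0)`, and the image of `∇_1` otherwise. The image is proper because the operator of
order two, three, four or six that follows in a complex does not vanish. -/
theorem isReducible_A : ∀ p r, IsReducible (OmegaA p r)
  | p + 1, r + 1 => (isMorphism_nabla1A p r).isReducible_source
      ⟨mono 0 1, mono_mem_lower _ _ _, mono_one_ne_zero, nabla1A_dOperator.map_mono⟩
  | 0, 0 => isReducible_D 0 0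
  | 1, 0 => (isMorphism_nabla1A 1 0).isReducible_target
      (isMorphism_opA1 isCovariant4_Y41 opA1_dOperator (by norm_num) Y41_theta) fun ω hω => opA1_nabla1A hω
  | p + 2, 0 => (isMorphism_nabla1A (p + 2) 0).isReducible_target (isMorphism_nabla2A p)
      fun ω hω => nabla2A_nabla1A hω
  | 0, 1 => (isMorphism_nabla1A 0 1).isReducible_target isMorphism_opA01 fun ω hω => opA01_nabla1A hω
  | 0, 2 => (isMorphism_nabla1A 0 2).isReducible_target
      (isMorphism_opA2 isCovariant4_Y42 opA2_dOperator (by norm_num) Y42_theta) fun ω hω => opA2_nabla1A hω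
  | 0, r + 3 => (isMorphism_nabla1A 0 (r + 3)).isReducible_target (isMorphism_nabla3A r)
      fun ω hω => nabla3A_nabla1A hω

/-! ### The Berezin integral -/

open MeasureTheory

theorem smooth_contDiff (f : Smooth) : ContDiff ℝ ((⊤ : ℕ∞) : WithTop ℕ∞) f.1 := f.2

theorem smooth_differentiable (f : Smooth) : Differentiable ℝ f.1 :=
  (smooth_contDiff f).differentiable (by simp)

theorem smoothPd_apply (k : Fin 3) (f : Smooth) (x : Fin 3 → ℝ) :
    (smoothPd k f).1 x = fderiv ℝ f.1 x (Pi.single k 1) := rfl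

theorem smoothPd_mul (k : Fin 3) (f g : Smooth) :
    smoothPd k (f * g) = smoothPd k f * g + f * smoothPd k g := by
  ext x
  change fderiv ℝ (f.1 * g.1) x _ = fderiv ℝ f.1 x _ * g.1 x + f.1 x * fderiv ℝ g.1 x _
  rw [fderiv_mul (smooth_differentiable f x) (smooth_differentiable g x)]
  simp
  ring

theorem smoothPd_one (k : Fin 3) : smoothPd k 1 = 0 := by
  have h := smoothPd_mul k 1 1
  simpa using h

theorem smoothPd_polyToSmooth (k : Fin 3) (f : Poly) :
    smoothPd k (polyToSmooth f) = polyToSmooth (polyPd k f) := by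
  induction f using MvPolynomial.induction_on with
  | C a =>
    have h : (MvPolynomial.C a : Poly) = a • 1 := by rw [MvPolynomial.smul_eq_C_mul, mul_one]
    rw [h, map_smul, map_smul, map_smul, map_smul, map_one, smoothPd_one, polyPd_one, map_zero]
  | add f g hf hg => simp only [map_add, hf, hg]
  | mul_X f i hf =>
    rw [map_mul, smoothPd_mul, hf, polyPd_mul, map_add, map_mul, map_mul, polyPd_X]
    congr 2
    ext x
    rw [smoothPd_apply]
    have e : (polyToSmooth (MvPolynomial.X i)).1 = fun x => Complex.ofRealCLM (ContinuousLinearMap.proj (R := ℝ) (φ := fun _ : Fin 3 => ℝ) i x) := by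
      simp [polyToSmooth]
    rw [e]
    have e2 : fderiv ℝ (fun x => Complex.ofRealCLM (ContinuousLinearMap.proj (R := ℝ) (φ := fun _ : Fin 3 => ℝ) i x)) x = Complex.ofRealCLM.comp (ContinuousLinearMap.proj (R := ℝ) (φ := fun _ : Fin 3 => ℝ) i) :=
      (Complex.ofRealCLM.comp (ContinuousLinearMap.proj (R := ℝ) (φ := fun _ : Fin 3 => ℝ) i)).fderiv
    rw [e2]
    by_cases h : k = i <;> simp [h, Pi.single_apply, eq_comm]

theorem toSSF_tmul (c : Poly) (g : Grass) : toSSF (c ⊗ₜ g) = polyToSmooth c ⊗ₜ g := rfl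

theorem toSSF_dU (k : Fin 3) (f : PSF) : toSSF (dU k f) = onCoeff (smoothPd k) (toSSF f) := by
  induction f using TensorProduct.induction_on with
  | zero => simp
  | add x y hx hy => simp only [map_add, hx, hy]
  | tmul c g => rw [dU, onCoeff_tmul, toSSF_tmul, toSSF_tmul, onCoeff_tmul, smoothPd_polyToSmooth]

theorem toSSF_dTheta (i : Fin 3) (a : Fin 2) (f : PSF) :
    toSSF (dTheta i a f) = dTheta i a (toSSF f) := by
  induction f using TensorProduct.induction_on with
  | zero => simp
  | add x y hx hy => simp only [map_add, hx, hy]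
  | tmul c g => rw [dTheta_tmul, toSSF_tmul, toSSF_tmul, dTheta_tmul]

theorem toSSF_parity (f : PSF) : toSSF (parity f) = parity (toSSF f) := by
  induction f using TensorProduct.induction_on with
  | zero => simp
  | add x y hx hy => simp only [map_add, hx, hy]
  | tmul c g => rw [parity_tmul, toSSF_tmul, toSSF_tmul, parity_tmul]

@[simp] theorem coeff_tmul (φ : Grass →ₗ[ℂ] ℂ) (c : Smooth) (g : Grass) :
    coeff φ (c ⊗ₜ g) = φ g • c := by
  simp [coeff]

theorem coeff_dTheta (φ : Grass →ₗ[ℂ] ℂ) (i : Fin 3) (a : Fin 2) (f : SSF) :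
    coeff φ (dTheta i a f) = coeff (φ ∘ₗ grassD i a) f := by
  induction f using TensorProduct.induction_on with
  | zero => simp
  | add x y hx hy => simp only [map_add, hx, hy]
  | tmul c g => rw [dTheta_tmul, coeff_tmul, coeff_tmul]; rfl

theorem coeff_onCoeff (φ : Grass →ₗ[ℂ] ℂ) (δ : Smooth →ₗ[ℂ] Smooth) (f : SSF) :
    coeff φ (onCoeff δ f) = δ (coeff φ f) := by
  induction f using TensorProduct.induction_on with
  | zero => simp
  | add x y hx hy => simp only [map_add, hx, hy]
  | tmul c g => rw [onCoeff_tmul, coeff_tmul, coeff_tmul, map_smul]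

theorem coeff_tmul_mul (φ : Grass →ₗ[ℂ] ℂ) (c : Smooth) (g : Grass) (f : SSF) :
    coeff φ ((c ⊗ₜ g) * f) = c * coeff (φ ∘ₗ LinearMap.mulLeft ℂ g) f := by
  induction f using TensorProduct.induction_on with
  | zero => simp
  | add x y hx hy => simp only [mul_add, map_add, hx, hy]
  | tmul c' g' =>
    rw [Algebra.TensorProduct.tmul_mul_tmul, coeff_tmul, coeff_tmul, mul_smul_comm]
    rfl

theorem dTheta_mem_CSF {f : SSF} (hf : f ∈ CSF) (i : Fin 3) (a : Fin 2) : dTheta i a f ∈ CSF :=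
  fun φ => by
    rw [coeff_dTheta]
    exact hf _

theorem onCoeff_mem_CSF {f : SSF} (hf : f ∈ CSF) (k : Fin 3) : onCoeff (smoothPd k) f ∈ CSF :=
  fun φ => by
    rw [coeff_onCoeff]
    exact HasCompactSupport.fderiv_apply ℝ (hf φ) _

theorem mul_mem_CSF {f : SSF} (hf : f ∈ CSF) (g : SSF) : g * f ∈ CSF := by
  induction g using TensorProduct.induction_on with
  | zero => simp
  | add x y hx hy => rw [add_mul]; exact add_mem hx hy
  | tmul c g =>
    intro φ
    rw [coeff_tmul_mul]
    exact (hf _).mul_left (f := c.1)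

/-- The integral of a partial derivative vanishes for compactly supported functions. -/
theorem integral_smoothPd (k : Fin 3) {f : Smooth} (hf : HasCompactSupport f.1) :
    ∫ x, (smoothPd k f).1 x = 0 := by
  have hd : Integrable (smoothPd k f).1 := (smooth_contDiff _).continuous.integrable_of_hasCompactSupport
    (HasCompactSupport.fderiv_apply ℝ hf _)
  have hi : Integrable f.1 := (smooth_contDiff _).continuous.integrable_of_hasCompactSupport hf
  have h := integral_smul_fderiv_eq_neg_fderiv_smul_of_integrable (μ := volume) (𝕜 := ℝ)
    (f := fun _ : Fin 3 → ℝ => (1 : ℝ)) (g := f.1) (v := Pi.single k 1)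
    (by simp) (by simp only [one_smul]; exact hd) (by simpa only [one_smul] using hi)
    (fun _ _ => differentiableAt_const _) (fun x _ => smooth_differentiable f x)
  simp only [one_smul, fderiv_fun_const, Pi.zero_apply, ContinuousLinearMap.zero_apply, zero_smul,
    integral_zero, neg_zero] at h
  exact h

theorem grassD_comm (i j : Fin 3) (a b : Fin 2) (g : Grass) :
    grassD i a (grassD j b g) = -grassD j b (grassD i a g) :=
  CliffordAlgebra.contractLeft_comm _ _ _

theorem grassD_grassD (i : Fin 3) (a : Fin 2) (g : Grass) : grassD i a (grassD i a g) = 0 :=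
  CliffordAlgebra.contractLeft_contractLeft _ _

/-- The integral over the odd coordinates is the product of all odd derivatives, which anticommute and
have vanishing squares. -/
theorem berezinTheta_grassD (i : Fin 3) (a : Fin 2) : berezinTheta ∘ₗ grassD i a = 0 := by
  refine LinearMap.ext fun g => ?_
  have h := fun j b (f : Grass) => grassD_comm i j a b f
  simp only [berezinTheta, LinearMap.comp_apply, LinearMap.zero_apply]
  fin_cases i <;> fin_cases a <;>
  simp only [Fin.zero_eta, Fin.mk_one, Fin.reduceFinMk] at h ⊢
  · simp only [h 2 1, h 2 0, h 1 1, h 1 0, h 0 1, grassD_grassD, map_neg, map_zero, neg_zero]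
  · simp only [h 2 1, h 2 0, h 1 1, h 1 0, grassD_grassD, map_neg, map_zero, neg_zero]
  · simp only [h 2 1, h 2 0, h 1 1, grassD_grassD, map_neg, map_zero, neg_zero]
  · simp only [h 2 1, h 2 0, grassD_grassD, map_neg, map_zero, neg_zero]
  · simp only [h 2 1, grassD_grassD, map_neg, map_zero, neg_zero]
  · simp only [grassD_grassD, map_neg, map_zero, neg_zero]

/-- The compactly supported superfunctions with vanishing integral. -/
def intKer : Submodule ℂ SSF := (LinearMap.ker berezin).map CSF.subtype

theorem mem_intKer {f : SSF} : f ∈ intKer ↔ ∃ h : f ∈ CSF, berezin ⟨f, h⟩ = 0 := by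
  constructor
  · rintro ⟨g, hg, rfl⟩
    exact ⟨g.2, hg⟩
  · rintro ⟨h, h0⟩
    exact ⟨⟨f, h⟩, h0, rfl⟩

theorem berezin_apply (ω : CSF) :
    berezin ω = algebraMap ℂ SSF (∫ x : Fin 3 → ℝ, (coeff berezinTheta ω.1).1 x) := rfl

theorem dTheta_mem_intKer {f : SSF} (hf : f ∈ CSF) (i : Fin 3) (a : Fin 2) : dTheta i a f ∈ intKer := by
  refine mem_intKer.mpr ⟨dTheta_mem_CSF hf i a, ?_⟩
  rw [berezin_apply]
  simp only [coeff_dTheta, berezinTheta_grassD]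
  simp [coeff]

theorem onCoeff_mem_intKer {f : SSF} (hf : f ∈ CSF) (k : Fin 3) : onCoeff (smoothPd k) f ∈ intKer := by
  refine mem_intKer.mpr ⟨onCoeff_mem_CSF hf k, ?_⟩
  rw [berezin_apply]
  simp only [coeff_onCoeff, integral_smoothPd k (hf _), map_zero]

theorem covD_mem_intKer {f : SSF} (hf : f ∈ CSF) (i : Fin 3) (a : Fin 2) :
    covD smoothPd i a f ∈ intKer := by
  rw [covD_apply]
  refine add_mem (dTheta_mem_intKer hf i a) (sum_mem fun j _ => sum_mem fun k _ =>
    Submodule.smul_mem _ _ ?_)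
  rw [← onCoeff_thetaUp_mul]
  exact onCoeff_mem_intKer (mul_mem_CSF hf _) k

/-- The superdivergence of an element of `vle(3|6)` vanishes. -/
theorem divergence_eq_zero {X : VField} {σ : ℤˣ} (h : X.IsVLE σ) :
    ∑ i, dU i (X.Q i) - (σ : ℤ) • ∑ i, ∑ a, dTheta i a (X.P i a) = 0 := by
  have hD : (σ : ℤ) • ∑ i, ∑ a, D i a (X.P i a) = X.dv := by
    have h3 := sl3_trace X
    have h2 := sl2_trace h
    simp only [Finset.smul_sum, D_P h]
    simp only [Fin.sum_univ_three, Fin.sum_univ_two, and_self, if_true] at h2 h3 ⊢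
    linear_combination (norm := module) -(2 : ℂ) • h3 - (3 : ℂ) • h2
  have hP : ∀ i j a k, dU i (X.P j a) * thetaUp k a = -((σ : ℤ) • (thetaUp k a * dU i (X.P j a))) :=
    fun i j a k => by rw [mul_thetaUp, ← dU_parity, h.1.2, map_neg, map_zsmul, mul_neg, mul_smul_comm]
  have hQ : ∀ i, X.Q i = X.Qt i + ∑ j, ∑ k, ∑ a, eps3 j k i • (X.P j a * thetaUp k a) := fun i => by
    rw [Qt, sub_add_cancel]
  have hU : ∀ i j k a, dU i (X.P j a * thetaUp k a) = dU i (X.P j a) * thetaUp k a :=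
    fun i j k a => by simp [dU_mul, thetaUp]
  simp only [D_apply, Finset.sum_add_distrib, smul_add] at hD
  rw [Finset.sum_congr rfl fun i _ => congrArg (dU i) (hQ i)]
  simp only [map_add, map_sum, map_smul, hU, hP, Finset.sum_add_distrib]
  rw [← dv.eq_1, ← hD]
  simp only [Fin.sum_univ_three, eps3_val, Fin.sum_univ_two]
  simp
  module

/-- Up to the superdivergence, which vanishes, `X f` is the total derivative
`∂_i (Q^i f) - (-)^X d^{ia} (P_{ia} f)`. -/
theorem actSmooth_mem_intKer {X : VField} {σ : ℤˣ} (hX : X.IsVLE σ) {f : SSF} (hf : f ∈ CSF) :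
    X.actSmooth f ∈ intKer := by
  have h0 := congrArg toSSF (divergence_eq_zero hX)
  simp only [map_sub, map_sum, map_zsmul, toSSF_dU, toSSF_dTheta, map_zero] at h0
  have hP : ∀ i a, parity (toSSF (X.P i a)) = -((σ : ℤ) • toSSF (X.P i a)) := fun i a => by
    rw [← toSSF_parity, hX.1.2, map_neg, map_zsmul]
  have e : X.actSmooth f = ∑ i, onCoeff (smoothPd i) (toSSF (X.Q i) * f) -
      (σ : ℤ) • ∑ i, ∑ a, dTheta i a (toSSF (X.P i a) * f) := by
    have h1 := congrArg (· * f) h0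
    simp only [onCoeff_mul (smoothPd_mul _), dTheta_mul, hP, sub_mul, Finset.sum_mul, smul_mul_assoc,
      neg_mul, Finset.sum_add_distrib, Finset.sum_neg_distrib, ← Finset.smul_sum, smul_add, smul_neg,
      smul_smul, Int.units_coe_mul_self, one_smul, zero_mul] at h1 ⊢
    rw [sub_eq_zero] at h1
    rw [h1]
    simp [actSmooth, LinearMap.sum_apply]
  rw [e]
  exact sub_mem (sum_mem fun i _ => onCoeff_mem_intKer (mul_mem_CSF hf _) i)
    (zsmul_mem (sum_mem fun i _ => sum_mem fun a _ => dTheta_mem_intKer (mul_mem_CSF hf _) i a) _)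

theorem covD_algebraMap (c : ℂ) (i : Fin 3) (a : Fin 2) :
    covD smoothPd i a (algebraMap ℂ SSF c) = 0 := by
  rw [Algebra.algebraMap_eq_smul_one, map_smul, Algebra.TensorProduct.one_def, covD_apply, dTheta_coe]
  simp [smoothPd_one]

theorem actSmooth_algebraMap (X : VField) (c : ℂ) : X.actSmooth (algebraMap ℂ SSF c) = 0 := by
  rw [Algebra.algebraMap_eq_smul_one, map_smul, Algebra.TensorProduct.one_def]
  simp [actSmooth, LinearMap.sum_apply, smoothPd_one]

/-- The product of all the odd coordinates, in the order in which `∫ d^6θ` differentiates. -/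
def topForm : Grass :=
  let ι (i : Fin 3) (a : Fin 2) : Grass := ExteriorAlgebra.ι ℂ (Pi.single (i, a) 1)
  ι 2 1 * (ι 2 0 * (ι 1 1 * (ι 1 0 * (ι 0 1 * ι 0 0))))

theorem berezinTheta_topForm : berezinTheta topForm = 1 := by
  simp [berezinTheta, topForm, grassD, ExteriorAlgebra.ι, CliffordAlgebra.contractLeft_ι_mul,
    CliffordAlgebra.contractLeft_ι]

/-- A compactly supported superfunction with nonvanishing integral, supported in the ball of
radius two. -/
theorem exists_berezin_ne_zero : ∃ (ω : CSF) (c : ℂ), c ≠ 0 ∧ berezin ω = algebraMap ℂ SSF c ∧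
    VanishesOn (Metric.closedBall 0 2)ᶜ (ω : SSF) := by
  -- The product of a bump function with the top form.
  let b : ContDiffBump (0 : Fin 3 → ℝ) := ⟨1, 2, one_pos, one_lt_two⟩
  let f : Smooth := ⟨fun x => ((b x : ℝ) : ℂ), Complex.ofRealCLM.contDiff.comp b.contDiff⟩
  have hf : HasCompactSupport f.1 := b.hasCompactSupport.comp_left Complex.ofReal_zero
  refine ⟨⟨f ⊗ₜ topForm, fun φ => ?_⟩, ∫ x, f.1 x, ?_, ?_, fun φ x hx => ?_⟩
  · rw [coeff_tmul]
    exact hf.smul_left (f := fun _ => φ topForm)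
  · change ∫ x, ((b x : ℝ) : ℂ) ≠ 0
    rw [integral_complex_ofReal]
    exact_mod_cast b.integral_pos.ne'
  · rw [berezin_apply, coeff_tmul, berezinTheta_topForm, one_smul]
  · rw [coeff_tmul]
    have h : b x = 0 := by
      by_contra h
      have h' : x ∈ Function.support b := h
      rw [b.support_eq] at h'
      exact hx (Metric.ball_subset_closedBall h')
    change φ topForm * ((b x : ℝ) : ℂ) = 0
    rw [h, Complex.ofReal_zero, mul_zero]

/-- The integral of a function supported in a ball is a nonzero constant, also outside of the ball. -/
theorem not_isLocal_berezin : ¬ IsLocal berezin := by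
  intro h
  obtain ⟨ω, c, hc, e, hω⟩ := exists_berezin_ne_zero
  have h' := h ω _ Metric.isClosed_closedBall.isOpen_compl hω ExteriorAlgebra.algebraMapInv.toLinearMap
    (fun _ => 3) (by
      rw [Set.mem_compl_iff, mem_closedBall_zero_iff, pi_norm_const]
      norm_num)
  rw [e, Algebra.algebraMap_eq_smul_one, Algebra.TensorProduct.one_def, map_smul, coeff_tmul] at h'
  apply hc
  simpa using h'

theorem berezin_ne_zero : berezin ≠ 0 := fun h =>
  not_isLocal_berezin fun ω U _ _ φ x _ => by rw [h]; simp

theorem exists_berezin_actSmooth {X : VField} {σ : ℤˣ} (hX : X.IsVLE σ) (ω : CSF) :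
    ∃ h : X.actSmooth ω ∈ CSF, berezin ⟨X.actSmooth ω, h⟩ = X.actSmooth (berezin ω) := by
  obtain ⟨h, h0⟩ := mem_intKer.mp (actSmooth_mem_intKer hX ω.2)
  exact ⟨h, h0.trans (actSmooth_algebraMap X _).symm⟩

theorem exists_berezin_covD (ω : Fin 3 → Fin 2 → CSF) :
    ∃ h : ∑ i, ∑ a, covD smoothPd i a (ω i a : SSF) ∈ CSF,
      berezin ⟨∑ i, ∑ a, covD smoothPd i a (ω i a : SSF), h⟩ = 0 :=
  mem_intKer.mp (sum_mem fun i _ => sum_mem fun a _ => covD_mem_intKer (ω i a).2 i a)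

end VLE36

end

open VLE36 VLE36.VField in
theorem mainTheorem2 :
    -- the Lie derivatives act on the tensor modules `T(p,q;r;z)`
    (∀ τ σ X, IsVLE σ X → ∀ ω ∈ T τ, lie τ σ X ω ∈ T τ) ∧
    -- the form modules of the four sectors are reducible
    ((∀ p r, IsReducible (OmegaA p r)) ∧ (∀ p r, IsReducible (OmegaB p r)) ∧
      (∀ q r, IsReducible (OmegaC q r)) ∧ (∀ q r, IsReducible (OmegaD q r))) ∧
    -- the first-order operators `∇_1` are invariant under `vle(3|6)`
    ((∀ p r, IsMorphism IsVLE 1 (OmegaA (p + 1) (r + 1)) (OmegaA p r) nabla1A) ∧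
      (∀ p r, IsMorphism IsVLE 1 (OmegaB (p + 1) r) (OmegaB p (r + 1)) nabla1B) ∧
      (∀ q r, IsMorphism IsVLE 1 (OmegaC q (r + 1)) (OmegaC (q + 1) r) nabla1C) ∧
      (∀ q r, IsMorphism IsVLE 1 (OmegaD q r) (OmegaD (q + 1) (r + 1)) nabla1D)) ∧
    -- and they are invariant for no other values of the `gl(1)` weights
    ((∀ p r z z', IsMorphism IsVLE 1 ⟨p + 1, 0, r + 1, z⟩ ⟨p, 0, r, z'⟩ nabla1A →
        z = (OmegaA (p + 1) (r + 1)).z ∧ z' = (OmegaA p r).z) ∧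
      (∀ p r z z', IsMorphism IsVLE 1 ⟨p + 1, 0, r, z⟩ ⟨p, 0, r + 1, z'⟩ nabla1B →
        z = (OmegaB (p + 1) r).z ∧ z' = (OmegaB p (r + 1)).z) ∧
      (∀ q r z z', IsMorphism IsVLE 1 ⟨0, q, r + 1, z⟩ ⟨0, q + 1, r, z'⟩ nabla1C →
        z = (OmegaC q (r + 1)).z ∧ z' = (OmegaC (q + 1) r).z) ∧
      (∀ q r z z', IsMorphism IsVLE 1 ⟨0, q, r, z⟩ ⟨0, q + 1, r + 1, z'⟩ nabla1D →
        z = (OmegaD q r).z ∧ z' = (OmegaD (q + 1) (r + 1)).z)) ∧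
    -- the higher-order operators are invariant under `𝔤₀`
    ((∀ p, IsMorphism IsG0 2 (OmegaA (p + 2) 0) (OmegaB p 0) nabla2A) ∧
      (∀ q, IsMorphism IsG0 2 (OmegaC q 0) (OmegaD (q + 2) 0) nabla2C) ∧
      (∀ r, IsMorphism IsG0 3 (OmegaA 0 (r + 3)) (OmegaC 0 r) nabla3A) ∧
      (∀ r, IsMorphism IsG0 3 (OmegaB 0 r) (OmegaD 0 (r + 3)) nabla3B) ∧
      IsMorphism IsG0 4 (OmegaA 0 2) (OmegaD 1 0) nabla4A2 ∧
      IsMorphism IsG0 4 (OmegaA 1 0) (OmegaD 0 2) nabla4A1 ∧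
      IsMorphism IsG0 6 (OmegaA 0 1) (OmegaD 0 1) nabla6) ∧
    -- complexes formed by `∇_1`
    ((∀ p r, IsComplex (OmegaA (p + 2) (r + 2)) (OmegaA (p + 1) (r + 1)) (OmegaA p r)
        nabla1A nabla1A) ∧
      (∀ p r, IsComplex (OmegaB (p + 2) r) (OmegaB (p + 1) (r + 1)) (OmegaB p (r + 2))
        nabla1B nabla1B) ∧
      (∀ q r, IsComplex (OmegaC q (r + 2)) (OmegaC (q + 1) (r + 1)) (OmegaC (q + 2) r)
        nabla1C nabla1C) ∧
      (∀ q r, IsComplex (OmegaD q r) (OmegaD (q + 1) (r + 1)) (OmegaD (q + 2) (r + 2))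
        nabla1D nabla1D)) ∧
    -- complexes through `∇_2`
    ((∀ p, IsComplex (OmegaA (p + 3) 1) (OmegaA (p + 2) 0) (OmegaB p 0) nabla1A nabla2A) ∧
      (∀ p, IsComplex (OmegaA (p + 3) 0) (OmegaB (p + 1) 0) (OmegaB p 1) nabla2A nabla1B) ∧
      (∀ q, IsComplex (OmegaC q 1) (OmegaC (q + 1) 0) (OmegaD (q + 3) 0) nabla1C nabla2C) ∧
      (∀ q, IsComplex (OmegaC q 0) (OmegaD (q + 2) 0) (OmegaD (q + 3) 1) nabla2C nabla1D)) ∧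
    -- complexes through `∇_3`
    ((∀ r, IsComplex (OmegaA 1 (r + 4)) (OmegaA 0 (r + 3)) (OmegaC 0 r) nabla1A nabla3A) ∧
      (∀ r, IsComplex (OmegaA 0 (r + 4)) (OmegaC 0 (r + 1)) (OmegaC 1 r) nabla3A nabla1C) ∧
      (∀ r, IsComplex (OmegaB 1 r) (OmegaB 0 (r + 1)) (OmegaD 0 (r + 4)) nabla1B nabla3B) ∧
      (∀ r, IsComplex (OmegaB 0 r) (OmegaD 0 (r + 3)) (OmegaD 1 (r + 4)) nabla3B nabla1D) ∧
      IsComplex (OmegaA 2 0) (OmegaB 0 0) (OmegaD 0 3) nabla2A nabla3B ∧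
      IsComplex (OmegaA 0 3) (OmegaC 0 0) (OmegaD 2 0) nabla3A nabla2C) ∧
    -- complexes through `𝔤₀`-invariant operators of order 4 and 6
    ((∃ f, IsMorphism IsG0 4 (OmegaA 0 2) (OmegaD 1 0) f ∧
        IsComplex (OmegaA 1 3) (OmegaA 0 2) (OmegaD 1 0) nabla1A f ∧
        IsComplex (OmegaA 0 2) (OmegaD 1 0) (OmegaD 2 1) f nabla1D) ∧
      (∃ f, IsMorphism IsG0 4 (OmegaA 1 0) (OmegaD 0 2) f ∧
        IsComplex (OmegaA 2 1) (OmegaA 1 0) (OmegaD 0 2) nabla1A f ∧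
        IsComplex (OmegaA 1 0) (OmegaD 0 2) (OmegaD 1 3) f nabla1D) ∧
      (∃ f, IsMorphism IsG0 6 (OmegaA 0 1) (OmegaD 0 1) f ∧
        IsComplex (OmegaA 1 2) (OmegaA 0 1) (OmegaD 0 1) nabla1A f ∧
        IsComplex (OmegaA 0 1) (OmegaD 0 1) (OmegaD 1 2) f nabla1D)) ∧
    -- the integral is a nonzero, non-local `vle(3|6)`-invariant map `Ω_A(0,0) → Ω_D(0,0)`
    (OmegaA 0 0 = ⟨0, 0, 0, 0⟩ ∧ OmegaD 0 0 = ⟨0, 0, 0, 0⟩ ∧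
      (∀ σ X, IsVLE σ X → ∀ ω : CSF, ∃ h : X.actSmooth ω ∈ CSF,
        berezin ⟨X.actSmooth ω, h⟩ = X.actSmooth (berezin ω)) ∧
      berezin ≠ 0 ∧ ¬ IsLocal berezin ∧
      -- it continues the complexes formed by `∇_1`
      (∀ ω : Fin 3 → Fin 2 → CSF, ∃ h : ∑ i, ∑ a, covD smoothPd i a (ω i a : SSF) ∈ CSF,
        berezin ⟨∑ i, ∑ a, covD smoothPd i a (ω i a : SSF), h⟩ = 0) ∧
      ∀ (ω : CSF) i a, covD smoothPd i a (berezin ω) = 0) :=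
  ⟨fun τ σ X _ _ hω => lie_mem τ σ X hω,
    ⟨isReducible_A, isReducible_B, isReducible_C, isReducible_D⟩,
    ⟨isMorphism_nabla1A, isMorphism_nabla1B, isMorphism_nabla1C, isMorphism_nabla1D⟩,
    ⟨fun _ _ _ _ => weights_nabla1A, fun _ _ _ _ => weights_nabla1B,
      fun _ _ _ _ => weights_nabla1C, fun _ _ _ _ => weights_nabla1D⟩,
    ⟨isMorphism_nabla2A, isMorphism_nabla2C, isMorphism_nabla3A, isMorphism_nabla3B,
      isMorphism_nabla4A2, isMorphism_nabla4A1, isMorphism_nabla6⟩,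
    ⟨fun _ _ _ => nabla1A_nabla1A, fun _ _ _ => nabla1B_nabla1B, fun _ _ _ => nabla1C_nabla1C,
      fun _ _ ω _ => nabla1D_nabla1D ω⟩,
    ⟨fun _ _ => nabla2A_nabla1A, fun _ _ => nabla1B_nabla2A, fun _ ω _ => nabla2C_nabla1C ω,
      fun _ ω _ => nabla1D_nabla2C ω⟩,
    ⟨fun _ _ => nabla3A_nabla1A, fun _ _ => nabla1C_nabla3A, fun _ ω _ => nabla3B_nabla1B ω,
      fun _ ω _ => nabla1D_nabla3B ω, fun _ => nabla3B_nabla2A, fun _ => nabla2C_nabla3A⟩,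
    ⟨⟨opA2 Y42, isMorphism_opA2 isCovariant4_Y42 opA2_dOperator (by norm_num) Y42_theta,
        fun _ => opA2_nabla1A, fun ω _ => nabla1D_opA2 ω⟩,
      ⟨opA1 Y41, isMorphism_opA1 isCovariant4_Y41 opA1_dOperator (by norm_num) Y41_theta,
        fun _ => opA1_nabla1A, fun ω _ => nabla1D_opA1 ω⟩,
      ⟨opA01 Y6, isMorphism_opA01, fun _ => opA01_nabla1A, fun ω _ => nabla1D_opA01 ω⟩⟩,
    ⟨rfl, rfl, fun _ _ => exists_berezin_actSmooth, berezin_ne_zero, not_isLocal_berezin,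
      exists_berezin_covD, fun _ => covD_algebraMap _⟩⟩
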